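/- **Setting.** Let $\Sigma$ be a compact connected Riemann surface with distinct marked points $x_1,\dots,x_n$, and let $G\subset GL(V)$ be a connected simple complex Lie group in a faithful finite-dimensional representation, with Lie algebra $\mathfrak g$ and Killing form $\langle\,,\rangle$. Let $\kappa\in\mathbb C$, $\kappa\ne0$. Let $\mu^0_1,\dots,\mu^0_l$ be smooth Beltrami differentials (type $(-1,1)$) on $\Sigma$ that vanish at the marked points in such a way that, in a local coordinate $z$, $\mu^0_s/(z-x_a)$ is smooth near $x_a$. For $t\in\mathbb C^l$ put $\mu=\sum_s t_s\mu^0_s$, $\partial_s=\partial/\partial t_s$ and $\partial_{\bar w}=\bar\partial+\mu\partial$. Fix $J_1,\dots,J_n\in\mathfrak g$. A *configuration* $(L,\bar L,p)$ consists of a $\mathfrak g$-valued $(1,0)$-differential $L$, smooth except for (at most) simple poles at the $x_a$ with residues $p_a$, a smooth $\mathfrak g$-valued $(0,1)$-differential $\bar L$, and $p=(p_1,\dots,p_n)$ with $p_a$ in the $G$-orbit of $J_a$. It is *flat* at time $t$ if, in the sense of distributions, $$(\bar\partial+\partial\mu)L-\kappa\partial\bar L+[\bar L,L]=2\pi i\sum_{a}\delta^2(x_a)\,p_a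 ,$$ where $(\partial\mu)L$ means $\partial(\mu L)$ and $\delta^2$ is normalized by $\int\delta^2(x)\,e\;d\bar z\wedge dz=e(x)$. An infinitesimal gauge transformation by a smooth $e:\Sigma\to\mathfrak g$ is $\delta L=-\kappa\partial e+[e,L]$, $\delta\bar L=-\partial_{\bar w}e+[e,\bar L]$, $\delta p_a=[e(x_a),p_a]$. **Gauge fixing and coordinates.** Fix a gauge fixing surface (a set of pairs of a time and a configuration, not necessarily flat) with dynamical variables $x=(v,u,p)\in\mathbb C^d$ on it, and suppose that for $(x,t)$ in an open set $D\subset\mathbb C^d\times\mathbb C^l$ the flatness condition has exactly one solution $(L,\bar L,p)(x,t)$ on the surface with dynamical variables $x$, and that this solution depends smoothly on the point of $\Sigma$ and on $(x,t)$ and holomorphically on $(x,t)$, with $p_a=g_a^{-1}J_ag_a$ for holomorphic $g_a:D\to G$. Suppose that these flat connections are stable (no nonzero infinitesimal gauge transformation fixes $(L,\bar L)$) and that the surface is transversal to the gauge orbits: each holomorphic family over $D$ of vectors tangent to the space of flat configurations at fixed $t$ is the sum of vectors tangent to the solution family at fixed $t$ and of infinitesimal gauge transformations by functions $e$ that depend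 smoothly on the point and on $(x,t)$ and holomorphically on $(x,t)$. On $D$ consider the pulled back two-forms $$\omega_0=\int_\Sigma\langle\delta L,\delta\bar L\rangle+2\pi i\sum_a\delta\langle p_a,g_a^{-1}\delta g_a\rangle,\qquad \omega=\omega_0-\frac1\kappa\sum_s\Big(\int_\Sigma\langle L,\delta L\rangle\,\mu^0_s\Big)\wedge\delta t_s ,$$ the integrals being taken against $d\bar z\wedge dz$. Suppose that $\omega_0$ is non-degenerate on the fibres $t=\mathrm{const}$, and let $\{\,,\}_{\omega_0}$ be the Poisson bracket on the fibres inverse to it (with $\{v,u\}=1$ for $\omega_0=\delta v\wedge\delta u$). Let $T\subset\mathbb C^l$ be open and let $t\mapsto(L,\bar L,p)(t)$, $t\in T$, be a family of configurations on the gauge fixing surface, smooth in the point and $t$ and holomorphic in $t$, whose dynamical variables $x(t)=(v,u,p)(t)$ are holomorphic in $t$, with $(x(t),t)\in D$. **Proposition.** Call the family *linearizable* if there are $\mathfrak g$-valued functions $M_s(t)$ on $\Sigma$ ($s=1,\dots,l$), smooth in the point and $t$ and holomorphic in $t$, which off the marked points solve $$\partial_{\bar w}M_s-[M_s,\bar L]=\kappa\partial_s\bar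 L-L\mu^0_s ,$$ and for which the linear system $$(\kappa\partial+L)\Psi=0,\qquad(\kappa\partial_s+M_s)\Psi=0\ (s=1,\dots,l),\qquad(\bar\partial+\mu\partial+\bar L)\Psi=0$$ is consistent: near every point of $(\Sigma\setminus\{x_1,\dots,x_n\})\times T$ it has a smooth solution $\Psi$ with values in $V$, holomorphic in $t$, with arbitrary prescribed value at that point. Then: 1. The family is linearizable if and only if it is flat at each $t\in T$ and satisfies the hierarchy of isomonodromic deformations defined by $\omega$, that is, the vectors $\partial_s+\partial_sx$ at $(x(t),t)$ lie in the kernel of $\omega$. 2. If $H_1,\dots,H_l$ are holomorphic functions on $D$ with $\omega=\omega_0^{\rm fib}-\frac1\kappa\sum_s\delta H_s\wedge\delta t_s$ up to terms in $\delta t_r\wedge\delta t_s$, where $\omega_0^{\rm fib}$ is the part of $\omega_0$ without $\delta t$, then the family is linearizable if and only if it is flat at each $t\in T$ and $$\kappa\,\partial_s(v,u,p)=\{H_s,(v,u,p)\}_{\omega_0},\qquad s=1,\dots,l .$$ 3. If the two-form $\omega_0$ has no terms mixing $\delta t_s$ with the differentials of the coordinates $(v,u,p)$, then the equivalence in 2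 holds with $H_s=\frac12\int_\Sigma\langle L,L\rangle\,\partial_s\mu$. -/

import Mathlib

open scoped Manifold ContDiff Topology

attribute [local instance 100] LieRing.ofAssociativeRing

noncomputable section

namespace Isomonodromy

/-! ### Calculus on a Riemann surface

A Riemann surface is a space `S` charted on `ℂ` with holomorphic transition maps.  A differential of
type `(a, b)` on `S` with values in `E` is a function `f : S → E`; the value `f q` is its coefficient
at `q` in the preferred coordinate `chartAt ℂ q`, that is, the differential at `q` is
`f q (dζ)^a (dζ̄)^b` with `ζ = chartAt ℂ q`. -/

/-- The Wirtinger derivative `∂f/∂z`. -/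
def wirt {E : Type*} [NormedAddCommGroup E] [NormedSpace ℂ E] (f : ℂ → E) (z : ℂ) : E :=
  (1 / 2 : ℂ) • (fderiv ℝ f z 1 - Complex.I • fderiv ℝ f z Complex.I)

/-- The Wirtinger derivative `∂f/∂z̄`. -/
def wirtBar {E : Type*} [NormedAddCommGroup E] [NormedSpace ℂ E] (f : ℂ → E) (z : ℂ) : E :=
  (1 / 2 : ℂ) • (fderiv ℝ f z 1 + Complex.I • fderiv ℝ f z Complex.I)

section Surface

variable {S : Type*} [TopologicalSpace S] [ChartedSpace ℂ S]
variable {E : Type*} [NormedAddCommGroup E] [NormedSpace ℂ E]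

/-- The coefficient, in the chart `φ` at the point with coordinate `z`, of the differential `f` of
type `(a, b)`. -/
def loc (a b : ℤ) (φ : OpenPartialHomeomorph S ℂ) (f : S → E) (z : ℂ) : E :=
  (deriv (fun ζ => chartAt ℂ (φ.symm z) (φ.symm ζ)) z ^ a *
    (starRingEnd ℂ) (deriv (fun ζ => chartAt ℂ (φ.symm z) (φ.symm ζ)) z) ^ b) • f (φ.symm z)

/-- `∂` of the coefficient of a differential of type `(a, b)`, at `q`, in the coordinate
`chartAt ℂ q`. -/
def del (a b : ℤ) (f : S → E) (q : S) : E :=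
  wirt (loc a b (chartAt ℂ q) f) (chartAt ℂ q q)

/-- `∂̄` of the coefficient of a differential of type `(a, b)`, at `q`, in the coordinate
`chartAt ℂ q`. -/
def delBar (a b : ℤ) (f : S → E) (q : S) : E :=
  wirtBar (loc a b (chartAt ℂ q) f) (chartAt ℂ q q)

variable (S) in
theorem exists_finite_cover [CompactSpace S] :
    ∃ (m : ℕ) (c : Fin m → S), ⋃ i, (chartAt ℂ (c i)).source = Set.univ := by
  obtain ⟨t, ht⟩ := isCompact_univ.elim_finite_subcover
    (fun q : S => (chartAt ℂ q).source) (fun q => (chartAt ℂ q).open_source)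
    (fun q _ => Set.mem_iUnion.2 ⟨q, mem_chart_source ℂ q⟩)
  refine ⟨t.card, fun i => (t.equivFin.symm i : S), Set.eq_univ_of_forall fun q => ?_⟩
  obtain ⟨r, hr, hq⟩ := Set.mem_iUnion₂.1 (ht (Set.mem_univ q))
  refine Set.mem_iUnion.2 ⟨t.equivFin ⟨r, hr⟩, ?_⟩
  simpa using hq

/-- `∫_S f dz̄ ∧ dz` for a differential `f` of type `(1, 1)` on a compact Riemann surface
(`dz̄ ∧ dz = 2i dx dy` in each chart): cut `S` into finitely many measurable pieces, each of them
inside a chart.  The value does not depend on the pieces, by the change of variables formula. -/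
def surfInt [CompactSpace S] (f : S → ℂ) : ℂ :=
  2 * Complex.I * ∑ i : Fin (exists_finite_cover S).choose,
    ∫ z in {z | z ∈ (chartAt ℂ ((exists_finite_cover S).choose_spec.choose i)).target ∧
      ∀ j < i, (chartAt ℂ ((exists_finite_cover S).choose_spec.choose i)).symm z ∉
        (chartAt ℂ ((exists_finite_cover S).choose_spec.choose j)).source},
      loc 1 1 (chartAt ℂ ((exists_finite_cover S).choose_spec.choose i)) f z

/-- `F q`, for `q` in the open set `D` of a complex normed space, is a family of `C^∞` differentials
of type `(a, b)` on `S`, jointly `C^∞` in the point and the parameter and holomorphic in the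
parameter. -/
def SmoothFamily {P : Type*} [NormedAddCommGroup P] [NormedSpace ℂ P] (a b : ℤ) (D : Set P)
    (F : P → S → E) : Prop :=
  (∀ φ ∈ atlas ℂ S, ContDiffOn ℝ ∞ (fun w : P × ℂ => loc a b φ (F w.1) w.2) (D ×ˢ φ.target)) ∧
  ∀ r : S, DifferentiableOn ℂ (fun q => F q r) D

/-- `F q`, for `q ∈ D`, is a family of `(1, 0)`-differentials, `C^∞` off the points `mark c`, with at
most a simple pole with residue `res q c` at `mark c` (difference with `res / (z - z_c)` is `C^∞`),
jointly `C^∞` in the point and the parameter and holomorphic in the parameter. -/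
def PoleFamily {P : Type*} [NormedAddCommGroup P] [NormedSpace ℂ P] {n : ℕ} (mark : Fin n → S)
    (D : Set P) (F : P → S → E) (res : P → Fin n → E) : Prop :=
  (∀ φ ∈ atlas ℂ S, ContDiffOn ℝ ∞ (fun w : P × ℂ => loc 1 0 φ (F w.1) w.2)
      (D ×ˢ (φ.target ∩ φ.symm ⁻¹' (Set.range mark)ᶜ))) ∧
  (∀ φ ∈ atlas ℂ S, ∀ c, mark c ∈ φ.source → ∃ N ∈ 𝓝 (φ (mark c)), ∃ h : P × ℂ → E,
      ContDiffOn ℝ ∞ h (D ×ˢ N) ∧ ∀ q ∈ D, ∀ z ∈ N, z ≠ φ (mark c) →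
        loc 1 0 φ (F q) z = (z - φ (mark c))⁻¹ • res q c + h (q, z)) ∧
  (∀ r : S, DifferentiableOn ℂ (fun q => F q r) D) ∧
  ∀ c, DifferentiableOn ℂ (fun q => res q c) D

end Surface

/-! ### The Lie algebra and the group -/

section Group

variable {V : Type*} [NormedAddCommGroup V] [NormedSpace ℂ V]

/-- The Killing form of the Lie algebra `lie ⊆ End V`, as a function on `End V` (zero outside
`lie`). -/
def kil (lie : LieSubalgebra ℂ (V →L[ℂ] V)) (X Y : V →L[ℂ] V) : ℂ :=
  open Classical in
  if h : X ∈ lie ∧ Y ∈ lie then killingForm ℂ lie ⟨X, h.1⟩ ⟨Y, h.2⟩ else 0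

/-- The connected group `G ⊆ GL(V)` with Lie algebra `lie`: it is generated by `exp lie`. -/
def grp (lie : LieSubalgebra ℂ (V →L[ℂ] V)) : Subgroup (V →L[ℂ] V)ˣ :=
  Subgroup.closure {g | ∃ X ∈ lie, (g : V →L[ℂ] V) = NormedSpace.exp X}

end Group

/-! ### The phase space -/

/-- The fixed data: a simple complex group `G` given by its Lie algebra in a faithful representation
`V`, marked points on the compact Riemann surface `S`, Beltrami differentials `μ⁰_s`, the level `κ`,
and elements `J_c` of the Lie algebra, which fix the orbits at the marked points. -/
structure Setup (S V : Type*) [TopologicalSpace S] [ChartedSpace ℂ S]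
    [NormedAddCommGroup V] [NormedSpace ℂ V] (n l : ℕ) where
  /-- the Lie algebra of `G` -/
  lie : LieSubalgebra ℂ (V →L[ℂ] V)
  simple : LieAlgebra.IsSimple ℂ lie
  /-- the marked points -/
  mark : Fin n → S
  mark_injective : Function.Injective mark
  /-- the Beltrami differentials `μ⁰_s`, smooth of type `(-1, 1)` -/
  mu0 : Fin l → S → ℂ
  mu0_smooth : ∀ s, ∀ φ ∈ atlas ℂ S, ContDiffOn ℝ ∞ (loc (-1) 1 φ (mu0 s)) φ.target
  /-- `μ⁰_s` vanishes at the marked points, in such a way that its product with a differential that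
  has a simple pole there is smooth -/
  mu0_vanish : ∀ s, ∀ φ ∈ atlas ℂ S, ∀ c, mark c ∈ φ.source → ∃ m : ℂ → ℂ,
    ContDiffAt ℝ ∞ m (φ (mark c)) ∧
      ∀ᶠ z in 𝓝 (φ (mark c)), loc (-1) 1 φ (mu0 s) z = (z - φ (mark c)) * m z
  /-- the level -/
  kappa : ℂ
  kappa_ne : kappa ≠ 0
  /-- representatives of the orbits -/
  J : Fin n → V →L[ℂ] V
  J_mem : ∀ c, J c ∈ lie

/-- A connection `(κ∂ + L, ∂̄ + μ∂ + L̄)` on the trivial bundle over `S`, with elements `p_c` at the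
marked points. -/
@[ext] structure FieldConf (S V : Type*) [NormedAddCommGroup V] [NormedSpace ℂ V] (n : ℕ) where
  /-- the coefficient of `dw = dz - μ dz̄`, a differential of type `(1, 0)` -/
  L : S → V →L[ℂ] V
  /-- the coefficient of `dw̄ = dz̄`, a differential of type `(0, 1)` -/
  Lbar : S → V →L[ℂ] V
  /-- the variables at the marked points -/
  p : Fin n → V →L[ℂ] V

section Phase

variable {S V : Type*} [TopologicalSpace S] [ChartedSpace ℂ S] [CompactSpace S]
variable [NormedAddCommGroup V] [NormedSpace ℂ V] {n l : ℕ}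

/-- The Beltrami differential `μ = ∑ t_s μ⁰_s`. -/
def Setup.mu (Q : Setup S V n l) (t : Fin l → ℂ) (q : S) : ℂ := ∑ s, t s * Q.mu0 s q

/-- `∂_w̄ f = (∂̄ + μ∂) f` for a function `f`. -/
def Setup.dw {E : Type*} [NormedAddCommGroup E] [NormedSpace ℂ E] (Q : Setup S V n l)
    (t : Fin l → ℂ) (f : S → E) (q : S) : E :=
  delBar 0 0 f q + Q.mu t q • del 0 0 f q

/-- A holomorphic family of points of the phase space: `L̄` is smooth, `L` has simple poles with
residues `p_c`, and `p_c` lies in the orbit of `J_c`.  (The meaningless value of `L` at a marked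
point is set to zero.) -/
structure Setup.IsFamily (Q : Setup S V n l) {P : Type*} [NormedAddCommGroup P] [NormedSpace ℂ P]
    (D : Set P) (F : P → FieldConf S V n) : Prop where
  L_mem : ∀ q ∈ D, ∀ r, (F q).L r ∈ Q.lie
  L_mark : ∀ q ∈ D, ∀ c, (F q).L (Q.mark c) = 0
  L_pole : PoleFamily Q.mark D (fun q => (F q).L) (fun q => (F q).p)
  Lbar_mem : ∀ q ∈ D, ∀ r, (F q).Lbar r ∈ Q.lie
  Lbar_smooth : SmoothFamily 0 1 D (fun q => (F q).Lbar)
  p_orbit : ∀ q ∈ D, ∀ c, ∃ g ∈ grp Q.lie,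
    (F q).p c = (↑(g⁻¹) : V →L[ℂ] V) * Q.J c * (g : V →L[ℂ] V)

/-- The flatness (moment) condition
`(∂̄ + ∂μ) L - κ ∂L̄ + [L̄, L] = 2πi ∑ δ²(x_c) p_c`, in the sense of distributions: both sides are
paired, by the Killing form, with an arbitrary smooth Lie algebra valued function `e`.  The delta
function is normalized by `∫ δ²(x) e dz̄ ∧ dz = e(x)`. -/
def Setup.Flat (Q : Setup S V n l) (t : Fin l → ℂ) (c : FieldConf S V n) : Prop :=
  ∀ e : S → V →L[ℂ] V, (∀ r, e r ∈ Q.lie) →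
    (∀ φ ∈ atlas ℂ S, ContDiffOn ℝ ∞ (loc 0 0 φ e) φ.target) →
    surfInt (fun r => -kil Q.lie (c.L r) (Q.dw t e r)
        - Q.kappa * kil Q.lie (del 0 1 c.Lbar r) (e r)
        + kil Q.lie ⁅c.Lbar r, c.L r⁆ (e r))
      = 2 * Real.pi * Complex.I * ∑ a, kil Q.lie (c.p a) (e (Q.mark a))

/-- The derivative of the `L`-component of a family of configurations in the direction `v`. -/
def dL {P : Type*} [NormedAddCommGroup P] [NormedSpace ℂ P] (F : P → FieldConf S V n) (q v : P)
    (r : S) : V →L[ℂ] V := fderiv ℂ (fun q' => (F q').L r) q v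

/-- The derivative of the `L̄`-component of a family of configurations in the direction `v`. -/
def dLbar {P : Type*} [NormedAddCommGroup P] [NormedSpace ℂ P] (F : P → FieldConf S V n) (q v : P)
    (r : S) : V →L[ℂ] V := fderiv ℂ (fun q' => (F q').Lbar r) q v

/-- The derivative of the `p`-component of a family of configurations in the direction `v`. -/
def dp {P : Type*} [NormedAddCommGroup P] [NormedSpace ℂ P] (F : P → FieldConf S V n) (q v : P)
    (a : Fin n) : V →L[ℂ] V := fderiv ℂ (fun q' => (F q').p a) q v

/-- A holomorphic family `(δL, δL̄, δp)`, indexed by `q ∈ D`, of vectors tangent at `sol q` to the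
space of configurations that are flat at the (fixed) time `time q`: `δp_c` is tangent to the orbit
and is the residue of `δL`, and the linearized flatness condition
`(∂̄ + ∂μ) δL - κ ∂δL̄ + [δL̄, L] + [L̄, δL] = 0` holds off the marked points. -/
structure Setup.IsTangentFamily (Q : Setup S V n l) {P : Type*} [NormedAddCommGroup P]
    [NormedSpace ℂ P] (D : Set P) (time : P → Fin l → ℂ) (sol Z : P → FieldConf S V n) : Prop where
  L_mem : ∀ q ∈ D, ∀ r, (Z q).L r ∈ Q.lie
  L_pole : PoleFamily Q.mark D (fun q => (Z q).L) (fun q => (Z q).p)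
  Lbar_mem : ∀ q ∈ D, ∀ r, (Z q).Lbar r ∈ Q.lie
  Lbar_smooth : SmoothFamily 0 1 D (fun q => (Z q).Lbar)
  p_tangent : ∀ q ∈ D, ∀ a, ∃ X ∈ Q.lie, (Z q).p a = ⁅(sol q).p a, X⁆
  lin_flat : ∀ q ∈ D, ∀ r ∉ Set.range Q.mark,
    delBar 1 0 (Z q).L r + del 0 1 (fun r' => Q.mu (time q) r' • (Z q).L r') r
      - Q.kappa • del 0 1 (Z q).Lbar r
      + ⁅(Z q).Lbar r, (sol q).L r⁆ + ⁅(sol q).Lbar r, (Z q).L r⁆ = 0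

/-- A gauge fixing, together with local coordinates on the extended phase space (the bundle over the
space of times `t ∈ ℂ^l` whose fibres are the symplectic quotients).  Points of the coordinate domain
are pairs `(x, t)`, where `x ∈ ℂ^d` stands for the coordinates `(v, u, p)` on the fibre. -/
structure GaugeFixing (Q : Setup S V n l) (d : ℕ) where
  /-- the domain of the coordinates `(x, t)` -/
  dom : Set ((Fin d → ℂ) × (Fin l → ℂ))
  dom_open : IsOpen dom
  /-- the gauge fixing surface, over the space of times -/
  surface : Set ((Fin l → ℂ) × FieldConf S V n)
  /-- the dynamical variables `x = (v, u, p)` of a configuration on the gauge fixing surface -/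
  coord : (Fin l → ℂ) → FieldConf S V n → Fin d → ℂ
  /-- the solution `(L, L̄, p)(x, t)` of the moment constraint on the gauge fixing surface -/
  sol : (Fin d → ℂ) × (Fin l → ℂ) → FieldConf S V n
  sol_family : Q.IsFamily dom sol
  sol_surface : ∀ q ∈ dom, (q.2, sol q) ∈ surface
  sol_coord : ∀ q ∈ dom, coord q.2 (sol q) = q.1
  sol_flat : ∀ q ∈ dom, Q.Flat q.2 (sol q)
  /-- on the part of the surface where the coordinates are in the coordinate domain, the moment
  constraint has no other solution -/
  eq_sol : ∀ t c, (t, c) ∈ surface → (coord t c, t) ∈ dom → Q.Flat t c → c = sol (coord t c, t)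
  /-- a holomorphic lift `g_a` of `p_a = g_a⁻¹ J_a g_a` to the group -/
  g : (Fin d → ℂ) × (Fin l → ℂ) → Fin n → (V →L[ℂ] V)ˣ
  g_mem : ∀ q ∈ dom, ∀ a, g q a ∈ grp Q.lie
  g_holo : ∀ a, DifferentiableOn ℂ (fun q => (g q a : V →L[ℂ] V)) dom
  g_maurer_cartan : ∀ q ∈ dom, ∀ a v, (↑(g q a)⁻¹ : V →L[ℂ] V) *
    fderiv ℂ (fun q' => (g q' a : V →L[ℂ] V)) q v ∈ Q.lie
  p_eq : ∀ q ∈ dom, ∀ a, (sol q).p a =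
    (↑(g q a)⁻¹ : V →L[ℂ] V) * Q.J a * (g q a : V →L[ℂ] V)
  /-- the flat connections are stable: they have no infinitesimal automorphisms -/
  stable : ∀ q ∈ dom, ∀ e : S → V →L[ℂ] V, (∀ r, e r ∈ Q.lie) →
    (∀ φ ∈ atlas ℂ S, ContDiffOn ℝ ∞ (loc 0 0 φ e) φ.target) →
    (∀ r ∉ Set.range Q.mark, -(Q.kappa • del 0 0 e r) + ⁅e r, (sol q).L r⁆ = 0 ∧
      -Q.dw q.2 e r + ⁅e r, (sol q).Lbar r⁆ = 0) → ∀ r, e r = 0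
  /-- the surface is transversal to the gauge orbits: a vector tangent to the space of flat
  configurations is the sum of a vector tangent to the surface and of an infinitesimal gauge
  transformation -/
  transversal : ∀ Z, Q.IsTangentFamily dom Prod.snd sol Z →
    ∃ (y : (Fin d → ℂ) × (Fin l → ℂ) → Fin d → ℂ)
      (e : (Fin d → ℂ) × (Fin l → ℂ) → S → V →L[ℂ] V),
      SmoothFamily 0 0 dom e ∧ (∀ q ∈ dom, ∀ r, e q r ∈ Q.lie) ∧
      ∀ q ∈ dom,
        (∀ r ∉ Set.range Q.mark,
          (Z q).L r = dL sol q (y q, 0) r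
            + (-(Q.kappa • del 0 0 (e q) r) + ⁅e q r, (sol q).L r⁆) ∧
          (Z q).Lbar r = dLbar sol q (y q, 0) r
            + (-Q.dw q.2 (e q) r + ⁅e q r, (sol q).Lbar r⁆)) ∧
        ∀ a, (Z q).p a = dp sol q (y q, 0) a + ⁅e q (Q.mark a), (sol q).p a⁆

namespace GaugeFixing

variable {Q : Setup S V n l} {d : ℕ} (Γ : GaugeFixing Q d)

/-- The two-form `ω₀ = ∫ <δL, δL̄> + 2πi ∑ δ<p_a, g_a⁻¹ δg_a>` on the coordinate domain; as
`p_a = g_a⁻¹ J_a g_a`, the value of the summand at two vectors is `<p_a, [g_a⁻¹δ₁g_a, g_a⁻¹δ₂g_a]>`. -/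
def omega0 (q v₁ v₂ : (Fin d → ℂ) × (Fin l → ℂ)) : ℂ :=
  surfInt (fun r => kil Q.lie (dL Γ.sol q v₁ r) (dLbar Γ.sol q v₂ r)
      - kil Q.lie (dL Γ.sol q v₂ r) (dLbar Γ.sol q v₁ r))
  + 2 * Real.pi * Complex.I * ∑ a, kil Q.lie ((Γ.sol q).p a)
      ⁅(↑(Γ.g q a)⁻¹ : V →L[ℂ] V) * fderiv ℂ (fun q' => (Γ.g q' a : V →L[ℂ] V)) q v₁,
        (↑(Γ.g q a)⁻¹ : V →L[ℂ] V) * fderiv ℂ (fun q' => (Γ.g q' a : V →L[ℂ] V)) q v₂⁆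

/-- The two-form `ω = ω₀ - κ⁻¹ ∫ <L, δL> δμ`, with `δμ = ∑ μ⁰_s δt_s`. -/
def omega (q v₁ v₂ : (Fin d → ℂ) × (Fin l → ℂ)) : ℂ :=
  Γ.omega0 q v₁ v₂ - Q.kappa⁻¹ * surfInt (fun r =>
    kil Q.lie ((Γ.sol q).L r) (dL Γ.sol q v₁ r) * Q.mu v₂.2 r
      - kil Q.lie ((Γ.sol q).L r) (dL Γ.sol q v₂ r) * Q.mu v₁.2 r)

/-- The matrix of `ω₀` on the fibre over `t`. -/
def omegaMatrix (q : (Fin d → ℂ) × (Fin l → ℂ)) : Matrix (Fin d) (Fin d) ℂ :=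
  Matrix.of fun i j => Γ.omega0 q (Pi.single i 1, 0) (Pi.single j 1, 0)

/-- `ω₀` is non-degenerate on the fibres, i.e. they are symplectic. -/
def IsSymplectic : Prop := ∀ q ∈ Γ.dom, (Γ.omegaMatrix q).det ≠ 0

/-- The Poisson bracket on the fibres, the inverse tensor to `ω₀`; the sign is such that
`{v, u} = 1` for `ω₀ = δv ∧ δu`. -/
def poisson (f h : (Fin d → ℂ) × (Fin l → ℂ) → ℂ) (q : (Fin d → ℂ) × (Fin l → ℂ)) : ℂ :=
  ∑ i, ∑ j, (Γ.omegaMatrix q)⁻¹ j i * fderiv ℂ f q (Pi.single i 1, 0)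
    * fderiv ℂ h q (Pi.single j 1, 0)

/-- `ω = ω₀ - κ⁻¹ ∑ δH_s ∧ δt_s` with `ω₀` the form on the fibres; this is required after
contraction with vertical vectors, that is, up to terms in `δt_r ∧ δt_s`. -/
def IsHamiltonian (H : Fin l → (Fin d → ℂ) × (Fin l → ℂ) → ℂ) : Prop :=
  ∀ q ∈ Γ.dom, (∀ s, DifferentiableAt ℂ (H s) q) ∧
    ∀ (y : Fin d → ℂ) (v : (Fin d → ℂ) × (Fin l → ℂ)),
      Γ.omega q (y, 0) v = Γ.omega0 q (y, 0) (v.1, 0)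
        - Q.kappa⁻¹ * ∑ s, fderiv ℂ (H s) q (y, 0) * v.2 s

/-- The quadratic Hamiltonians `H_s = ½ ∫ <L, L> ∂_s μ`. -/
def quadH (s : Fin l) (q : (Fin d → ℂ) × (Fin l → ℂ)) : ℂ :=
  (1 / 2) * surfInt (fun r => kil Q.lie ((Γ.sol q).L r) ((Γ.sol q).L r) * Q.mu0 s r)

/-- The pull-back of `∫ <δL, δL̄> + 2πi ∑ δ<p_a, g_a⁻¹ δg_a>` has no mixed terms, linear in the
`δt_s` and in the differentials of the fibre coordinates. -/
def NoMixedTerms : Prop :=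
  ∀ q ∈ Γ.dom, ∀ (y : Fin d → ℂ) (τ : Fin l → ℂ), Γ.omega0 q (y, 0) (0, τ) = 0

/-- The hierarchy of isomonodromic deformations for `t ↦ x(t)`, as the equations of the null leaves:
the vectors `∂_s + ∂_s x` are in the kernel of `ω`. -/
def NullLeaf (T : Set (Fin l → ℂ)) (x : (Fin l → ℂ) → Fin d → ℂ) : Prop :=
  ∀ t ∈ T, ∀ (s : Fin l) (v : (Fin d → ℂ) × (Fin l → ℂ)),
    Γ.omega (x t, t) (fderiv ℂ x t (Pi.single s 1), Pi.single s 1) v = 0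

/-- The hierarchy of isomonodromic deformations `κ ∂_s x = {H_s, x}` for `t ↦ x(t)`. -/
def HID (H : Fin l → (Fin d → ℂ) × (Fin l → ℂ) → ℂ) (T : Set (Fin l → ℂ))
    (x : (Fin l → ℂ) → Fin d → ℂ) : Prop :=
  ∀ t ∈ T, ∀ (s : Fin l) (j : Fin d),
    Q.kappa * fderiv ℂ x t (Pi.single s 1) j = Γ.poisson (H s) (fun q => q.1 j) (x t, t)

end GaugeFixing

/-! ### The linear system -/

/-- The equation `∂_w̄ M_s - [M_s, L̄] = κ ∂_s L̄ - L μ⁰_s`. -/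
def Setup.EqM (Q : Setup S V n l) (T : Set (Fin l → ℂ)) (F : (Fin l → ℂ) → FieldConf S V n)
    (M : Fin l → (Fin l → ℂ) → S → V →L[ℂ] V) : Prop :=
  ∀ t ∈ T, ∀ s, ∀ r ∉ Set.range Q.mark,
    Q.dw t (M s t) r - ⁅M s t r, (F t).Lbar r⁆
      = Q.kappa • dLbar F t (Pi.single s 1) r - Q.mu0 s r • (F t).L r

/-- `Ψ` solves, at the point `r` and the time `t`, the linear system
`(κ∂ + L)Ψ = 0`, `(κ∂_s + M_s)Ψ = 0`, `(∂̄ + μ∂ + L̄)Ψ = 0`. -/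
def Setup.Solves (Q : Setup S V n l) (F : (Fin l → ℂ) → FieldConf S V n)
    (M : Fin l → (Fin l → ℂ) → S → V →L[ℂ] V) (Ψ : (Fin l → ℂ) → S → V) (t : Fin l → ℂ) (r : S) :
    Prop :=
  Q.kappa • del 0 0 (Ψ t) r + (F t).L r (Ψ t r) = 0 ∧
  (∀ s, Q.kappa • fderiv ℂ (fun t' => Ψ t' r) t (Pi.single s 1) + M s t r (Ψ t r) = 0) ∧
  Q.dw t (Ψ t) r + (F t).Lbar r (Ψ t r) = 0

/-- The linear system is consistent: off the marked points it has, near every point and every time,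
a smooth local solution (holomorphic in the times) with an arbitrary value in `V` at that point and
that time. -/
def Setup.Consistent (Q : Setup S V n l) (T : Set (Fin l → ℂ)) (F : (Fin l → ℂ) → FieldConf S V n)
    (M : Fin l → (Fin l → ℂ) → S → V →L[ℂ] V) : Prop :=
  ∀ r₀ ∉ Set.range Q.mark, ∀ t₀ ∈ T, ∀ v : V,
    ∃ T₀ ⊆ T, ∃ N ⊆ (chartAt ℂ r₀).source \ Set.range Q.mark,
      IsOpen T₀ ∧ IsOpen N ∧ t₀ ∈ T₀ ∧ r₀ ∈ N ∧
      ∃ Ψ : (Fin l → ℂ) → S → V, Ψ t₀ r₀ = v ∧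
        ContDiffOn ℝ ∞ (fun w : (Fin l → ℂ) × ℂ => Ψ w.1 ((chartAt ℂ r₀).symm w.2))
          (T₀ ×ˢ (chartAt ℂ r₀ '' N)) ∧
        (∀ r ∈ N, DifferentiableOn ℂ (fun t => Ψ t r) T₀) ∧
        ∀ t ∈ T₀, ∀ r ∈ N, Q.Solves F M Ψ t r

/-- There are `M_s`, smooth Lie algebra valued functions on `S` that depend holomorphically on the
times and solve the equation for `M_s`, with which the linear system is consistent. -/
def Setup.IsLinearizable (Q : Setup S V n l) (T : Set (Fin l → ℂ))
    (F : (Fin l → ℂ) → FieldConf S V n) : Prop :=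
  ∃ M : Fin l → (Fin l → ℂ) → S → V →L[ℂ] V,
    (∀ s, SmoothFamily 0 0 T (M s) ∧ ∀ t ∈ T, ∀ r, M s t r ∈ Q.lie) ∧
    Q.EqM T F M ∧ Q.Consistent T F M

end Phase

end Isomonodromy

end

/-! The linear system is parallel transport for a connection on the product of the surface with the
space of times, with components `κ∂ + L`, `∂̄ + μ∂ + L̄` and `κ∂_s + M_s`. By the Frobenius theorem
it has local solutions with arbitrary initial values exactly when the curvature vanishes. The
curvature has four kinds of components: along the surface it is the flatness condition; in the
directions `z`, `t_s` it is `κ∂_s L - κ∂M_s + [M_s, L] = 0` (`Setup.EqZT`); in the directions `z̄`,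
`t_s` it is, modulo the previous one, the equation that defines `M_s` (`Setup.EqM`); and there is
the curvature in two times (`Setup.EqTT`).

The two middle equations say that `∂_s L` and the corrected deformation `∂_s L̄ - κ⁻¹ μ⁰_s L` are
together an infinitesimal gauge transformation, by `e = -κ⁻¹ M_s`. The same correction absorbs the
Hamiltonian term of `ω`: by `omega_eq`, `ω` is `ω₀` with `δL̄` replaced by the corrected deformation
`zbar`. Differentiating the flatness condition, which is the moment map of the gauge group, shows
that gauge directions are annihilated by `ω` (`moment_derivative`, `omega_gauge`). Hence a
linearizable family follows the null leaves (`nullLeaf_of_linearizable`).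

Conversely, the derivative of the solution in a time direction becomes, after the correction,
tangent to the flat configurations at fixed time (`exists_tangentFamily`), so transversality splits
it into a fibre vector and a gauge transformation. Modulo gauge, `∂_s + ∂_s x` is therefore a fibre
vector. If `ω` pairs it to zero with the fibre, non-degeneracy of `ω₀` makes that vector vanish, the
deformation is pure gauge, and `M_s = -κe` solves the two middle equations. The curvature in two
times is then covariantly constant along the surface, by a Bianchi identity, so it is an
infinitesimal automorphism and vanishes by stability. Frobenius gives consistency
(`linearizable_of_vertical`).

This converse uses only contractions with vertical vectors, and these are Hamilton's equations
(`vertical_null_iff`); terms in `δt_r ∧ δt_s` never matter. Without mixed terms in `ω₀`, the form `∫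
<L, δL> μ⁰_s` is the vertical differential of the quadratic Hamiltonian.

The analysis underneath is the Frobenius theorem, smoothness of holomorphic functions of several
variables, the theorems of Stokes and Cauchy for differentials with simple poles on a compact
surface, and differentiation of their integrals in parameters. -/

section Proof

set_option maxSynthPendingDepth 3
set_option linter.unusedSectionVars false

noncomputable section

namespace Isomonodromy

/-! ### Linear systems of total differential equations -/

section Frobenius

variable {X W : Type*} [NormedAddCommGroup X] [NormedSpace ℝ X]
  [NormedAddCommGroup W] [NormedSpace ℝ W]

/-- Linear ordinary differential equations with a small coefficient are solvable on `[0, 1]`. -/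
theorem exists_linear_ode_solution [CompleteSpace W] (a : ℝ → W →L[ℝ] W)
    (ha : ContinuousOn a (Set.Icc 0 1)) (hb : ∀ s ∈ Set.Icc (0 : ℝ) 1, ‖a s‖ ≤ 1 / 4) (v : W) :
    ∃ y : ℝ → W, y 0 = v ∧
      ∀ s ∈ Set.Icc (0 : ℝ) 1, HasDerivWithinAt y (a s (y s)) (Set.Icc 0 1) s := by
  have h01 : (0 : ℝ) ∈ Set.Icc (0 : ℝ) 1 := by simp
  -- In the ball of radius `‖v‖` about `v` one has `‖y‖ ≤ 2‖v‖`, so the speed is at most `‖v‖ / 2`;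
  -- the solution cannot leave the ball within time 1.
  have hpl : IsPicardLindelof (fun s y => a s y) (⟨0, h01⟩ : Set.Icc (0 : ℝ) 1) v ‖v‖₊ 0 ‖v‖₊ 1 := by
    refine ⟨fun t ht => ?_, fun x _ => ha.clm_apply continuousOn_const, fun t ht x hx => ?_, ?_⟩
    · refine LipschitzWith.lipschitzOnWith ?_
      refine (a t).lipschitz.weaken ?_
      rw [← NNReal.coe_le_coe]
      simpa using (hb t ht).trans (by norm_num)
    · have hx' : ‖x‖ ≤ 2 * ‖v‖ := by
        rw [Metric.mem_closedBall, dist_eq_norm] at hx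
        calc ‖x‖ = ‖(x - v) + v‖ := by simp
          _ ≤ ‖x - v‖ + ‖v‖ := norm_add_le _ _
          _ ≤ 2 * ‖v‖ := by simp at hx; linarith
      calc ‖a t x‖ ≤ ‖a t‖ * ‖x‖ := (a t).le_opNorm x
        _ ≤ 1 / 4 * (2 * ‖v‖) := by gcongr; exact hb t ht
        _ ≤ ‖v‖ := by linarith [norm_nonneg v]
    · simp
  exact hpl.exists_eq_forall_mem_Icc_hasDerivWithinAt₀

/-- Grönwall's inequality with rate 1. It bounds the transported vector uniformly along every ray in
the estimate below. -/
theorem norm_le_of_linear_ode (a : ℝ → W →L[ℝ] W)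
    (hb : ∀ s ∈ Set.Icc (0 : ℝ) 1, ‖a s‖ ≤ 1) {y : ℝ → W}
    (hy : ∀ s ∈ Set.Icc (0 : ℝ) 1, HasDerivWithinAt y (a s (y s)) (Set.Icc 0 1) s) :
    ∀ s ∈ Set.Icc (0 : ℝ) 1, ‖y s‖ ≤ ‖y 0‖ * Real.exp 1 := by
  intro s hs
  have h1 : ∀ s ∈ Set.Ico (0 : ℝ) 1, HasDerivWithinAt y (a s (y s)) (Set.Ici s) s := fun s hs =>
    (hy s ⟨hs.1, hs.2.le⟩).mono_of_mem_nhdsWithin (Icc_mem_nhdsGE_of_mem hs)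
  have h := norm_le_gronwallBound_of_norm_deriv_right_le (f := y) (f' := fun s => a s (y s))
    (δ := ‖y 0‖) (K := 1) (ε := 0) (a := 0) (b := 1) (fun s hs => (hy s hs).continuousWithinAt) h1
    le_rfl (fun s hs => by
      have := (a s).le_opNorm (y s)
      have h2 := hb s ⟨hs.1, hs.2.le⟩
      nlinarith [norm_nonneg (y s)]) s hs
  rw [gronwallBound_ε0] at h
  refine h.trans ?_
  gcongr
  simpa using hs.2

/-- The estimate behind the differentiability of radial parallel transport of a flat connection. -/
theorem flat_transport_estimate {x₀ : X} {r K : ℝ} (hr1 : r ≤ 1) (hK : 0 ≤ K)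
    (hKr : K * r ≤ 1 / 4) (A : X → X →L[ℝ] W →L[ℝ] W) (A' : X → X →L[ℝ] X →L[ℝ] W →L[ℝ] W)
    (hA : ∀ x ∈ Metric.ball x₀ r, HasFDerivAt A (A' x) x)
    (hA0 : ∀ x ∈ Metric.ball x₀ r, ‖A x‖ ≤ K) (hA1 : ∀ x ∈ Metric.ball x₀ r, ‖A' x‖ ≤ K)
    (hA2 : ∀ x ∈ Metric.ball x₀ r, ∀ x' ∈ Metric.ball x₀ r, ‖A' x - A' x'‖ ≤ K * ‖x - x'‖)
    (hflat : ∀ x ∈ Metric.ball x₀ r, ∀ h k, A' x h k - A' x k h + A x k ∘L A x h - A x h ∘L A x k = 0)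
    {v : W} {h k : X} (hh : ‖h‖ < r) (hk : ‖h + k‖ < r) {y z : ℝ → W} (hy0 : y 0 = v) (hz0 : z 0 = v)
    (hy : ∀ s ∈ Set.Icc (0 : ℝ) 1, HasDerivWithinAt y (A (x₀ + s • h) h (y s)) (Set.Icc 0 1) s)
    (hz : ∀ s ∈ Set.Icc (0 : ℝ) 1,
      HasDerivWithinAt z (A (x₀ + s • (h + k)) (h + k) (z s)) (Set.Icc 0 1) s) :
    ‖z 1 - y 1 - A (x₀ + h) k (y 1)‖ ≤
      (2 * K + 2 * K ^ 2) * (‖v‖ * Real.exp 1) * (Real.exp 1 - 1) * ‖k‖ ^ 2 := by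
  have hmem : ∀ {g : X}, ‖g‖ < r → ∀ s ∈ Set.Icc (0 : ℝ) 1, x₀ + s • g ∈ Metric.ball x₀ r := by
    intro g hg s hs
    rw [Metric.mem_ball, dist_eq_norm, add_sub_cancel_left, norm_smul, Real.norm_of_nonneg hs.1]
    nlinarith [hs.1, hs.2, norm_nonneg g]
  have hop : ∀ {g : X}, ‖g‖ < r → ∀ s ∈ Set.Icc (0 : ℝ) 1, ‖A (x₀ + s • g) g‖ ≤ 1 := by
    intro g hg s hs
    calc ‖A (x₀ + s • g) g‖ ≤ ‖A (x₀ + s • g)‖ * ‖g‖ := ContinuousLinearMap.le_opNorm _ _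
      _ ≤ K * r := by gcongr; exact hA0 _ (hmem hg s hs)
      _ ≤ 1 := by linarith
  set Y := ‖v‖ * Real.exp 1 with hY
  have hYn : 0 ≤ Y := by positivity
  have hyb : ∀ s ∈ Set.Icc (0 : ℝ) 1, ‖y s‖ ≤ Y := by
    have := norm_le_of_linear_ode (fun s => A (x₀ + s • h) h) (hop hh) hy
    simpa [hy0] using this
  -- `θ` is an approximate transport along the ray to `h + k`: the transport along the ray to `h`,
  -- corrected to first order in `k`. At `s = 1` the difference `z - θ` is the remainder to be
  -- estimated.
  let θ : ℝ → W := fun s => y s + s • A (x₀ + s • h) k (y s)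
  let θ' : ℝ → W := fun s => A (x₀ + s • h) h (y s) + (A (x₀ + s • h) k (y s)
    + s • (A' (x₀ + s • h) h k (y s) + A (x₀ + s • h) k (A (x₀ + s • h) h (y s))))
  have hθ : ∀ s ∈ Set.Icc (0 : ℝ) 1, HasDerivWithinAt θ (θ' s) (Set.Icc 0 1) s := by
    intro s hs
    have h1 : HasDerivWithinAt (fun s : ℝ => x₀ + s • h) h (Set.Icc 0 1) s := by
      simpa using ((hasDerivWithinAt_id s (Set.Icc (0 : ℝ) 1)).smul_const h).const_add x₀
    have h2 : HasDerivWithinAt (fun s : ℝ => A (x₀ + s • h)) (A' (x₀ + s • h) h) (Set.Icc 0 1) s :=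
      (hA _ (hmem hh s hs)).comp_hasDerivWithinAt s h1
    have h3 : HasDerivWithinAt (fun s : ℝ => A (x₀ + s • h) k) (A' (x₀ + s • h) h k)
        (Set.Icc 0 1) s := by
      simpa using h2.clm_apply (hasDerivWithinAt_const s (Set.Icc (0 : ℝ) 1) k)
    have h4 := h3.clm_apply (hy s hs)
    have h5 := (hasDerivWithinAt_id s (Set.Icc (0 : ℝ) 1)).smul h4
    have h6 := (hy s hs).add h5
    refine h6.congr_deriv ?_
    simp only [θ', id, one_smul]
    abel
  -- `θ` solves the equation along the ray to `h + k` up to `O(‖k‖²)`. Flatness cancels the terms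
  -- that are linear in `k`; what remains is a Taylor remainder of `A` and products of two factors
  -- of order `‖k‖`.
  have herr : ∀ s ∈ Set.Icc (0 : ℝ) 1,
      ‖A (x₀ + s • (h + k)) (h + k) (θ s) - θ' s‖ ≤ (2 * K + 2 * K ^ 2) * Y * ‖k‖ ^ 2 := by
    intro s hs
    have hm := hmem hh s hs
    have hm' := hmem hk s hs
    set p := x₀ + s • h with hp
    set p' := x₀ + s • (h + k) with hp'
    have hpp : p' - p = s • k := by rw [hp, hp', smul_add]; abel
    have hsk : ‖s • k‖ ≤ ‖k‖ := by
      rw [norm_smul, Real.norm_of_nonneg hs.1]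
      nlinarith [hs.2, norm_nonneg k]
    have hR0 : ‖A p' - A p‖ ≤ K * ‖k‖ := by
      have := (convex_ball x₀ r).norm_image_sub_le_of_norm_hasFDerivWithin_le
        (fun x hx => (hA x hx).hasFDerivWithinAt) hA1 hm hm'
      rw [hpp] at this
      exact this.trans (by gcongr)
    have hR : ‖A p' - A p - s • A' p k‖ ≤ K * ‖k‖ ^ 2 := by
      have hseg : segment ℝ p p' ⊆ Metric.ball x₀ r := (convex_ball x₀ r).segment_subset hm hm'
      have := (convex_segment p p').norm_image_sub_le_of_norm_hasFDerivWithin_le'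
        (φ := A' p) (C := K * ‖k‖)
        (fun x hx => (hA x (hseg hx)).hasFDerivWithinAt) (fun x hx => by
          refine (hA2 x (hseg hx) p hm).trans ?_
          gcongr
          have := norm_sub_le_of_mem_segment hx
          rw [hpp] at this
          exact this.trans hsk) (left_mem_segment ℝ p p') (right_mem_segment ℝ p p')
      rw [hpp, map_smul] at this
      refine this.trans ?_
      nlinarith [mul_nonneg hK (norm_nonneg k)]
    have hf : s • (A' p k h (y s) - A' p h k (y s) - A p k (A p h (y s)) + A p h (A p k (y s))) = 0 := by
      have := congrArg (fun T : W →L[ℝ] W => T (y s)) (hflat p hm h k)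
      simp at this
      have h2 : A' p k h (y s) - A' p h k (y s) - A p k (A p h (y s)) + A p h (A p k (y s)) = 0 := by
        rw [← neg_eq_zero, ← this]; abel
      rw [h2, smul_zero]
    have hexp : A p' (h + k) (θ s) - θ' s
        = s • A' p k k (y s) + (A p' - A p - s • A' p k) (h + k) (y s)
          + s • (A p k (A p k (y s)) + (A p' - A p) (h + k) (A p k (y s))) := by
      rw [← sub_eq_zero, ← hf]
      simp only [θ, θ', map_add, map_smul, add_apply,
        sub_apply, smul_apply, ← hp]
      module
    rw [hexp]
    have hyY := hyb s hs
    have hs1 : |s| ≤ 1 := by rw [abs_of_nonneg hs.1]; exact hs.2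
    have hkk : ‖h + k‖ ≤ 1 := hk.le.trans hr1
    have e1 : ‖s • A' p k k (y s)‖ ≤ K * Y * ‖k‖ ^ 2 := by
      have : ‖A' p k k (y s)‖ ≤ ‖A' p‖ * ‖k‖ * ‖k‖ * ‖y s‖ :=
        (ContinuousLinearMap.le_opNorm _ _).trans (by gcongr; exact ContinuousLinearMap.le_opNorm₂ _ _ _)
      rw [norm_smul, Real.norm_eq_abs]
      calc |s| * ‖A' p k k (y s)‖ ≤ 1 * (K * ‖k‖ * ‖k‖ * Y) := by
            gcongr
            exact this.trans (by gcongr; exact hA1 p hm)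
        _ = _ := by ring
    have e2 : ‖(A p' - A p - s • A' p k) (h + k) (y s)‖ ≤ K * Y * ‖k‖ ^ 2 := by
      calc _ ≤ ‖A p' - A p - s • A' p k‖ * ‖h + k‖ * ‖y s‖ := ContinuousLinearMap.le_opNorm₂ _ _ _
        _ ≤ K * ‖k‖ ^ 2 * 1 * Y := by gcongr
        _ = _ := by ring
    have e3 : ‖A p k (y s)‖ ≤ K * ‖k‖ * Y := by
      calc _ ≤ ‖A p‖ * ‖k‖ * ‖y s‖ := ContinuousLinearMap.le_opNorm₂ _ _ _
        _ ≤ _ := by gcongr; exact hA0 p hm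
    have e4 : ‖A p k (A p k (y s))‖ ≤ K ^ 2 * Y * ‖k‖ ^ 2 := by
      calc _ ≤ ‖A p‖ * ‖k‖ * ‖A p k (y s)‖ := ContinuousLinearMap.le_opNorm₂ _ _ _
        _ ≤ K * ‖k‖ * (K * ‖k‖ * Y) := by gcongr; exact hA0 p hm
        _ = _ := by ring
    have e5 : ‖(A p' - A p) (h + k) (A p k (y s))‖ ≤ K ^ 2 * Y * ‖k‖ ^ 2 := by
      calc _ ≤ ‖A p' - A p‖ * ‖h + k‖ * ‖A p k (y s)‖ := ContinuousLinearMap.le_opNorm₂ _ _ _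
        _ ≤ K * ‖k‖ * 1 * (K * ‖k‖ * Y) := by gcongr
        _ = _ := by ring
    have e6 : ‖s • (A p k (A p k (y s)) + (A p' - A p) (h + k) (A p k (y s)))‖
        ≤ 2 * (K ^ 2 * Y * ‖k‖ ^ 2) := by
      rw [norm_smul, Real.norm_eq_abs]
      calc _ ≤ 1 * (K ^ 2 * Y * ‖k‖ ^ 2 + K ^ 2 * Y * ‖k‖ ^ 2) := by
            gcongr
            exact (norm_add_le _ _).trans (add_le_add e4 e5)
        _ = _ := by ring
    calc _ ≤ K * Y * ‖k‖ ^ 2 + K * Y * ‖k‖ ^ 2 + 2 * (K ^ 2 * Y * ‖k‖ ^ 2) :=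
          (norm_add_le _ _).trans (add_le_add ((norm_add_le _ _).trans (add_le_add e1 e2)) e6)
      _ = _ := by ring
  have right : ∀ {f : ℝ → W} {f' : W} {s : ℝ}, s ∈ Set.Ico (0 : ℝ) 1 →
      HasDerivWithinAt f f' (Set.Icc 0 1) s → HasDerivWithinAt f f' (Set.Ici s) s :=
    fun hs h => h.mono_of_mem_nhdsWithin (Icc_mem_nhdsGE_of_mem hs)
  -- Both trajectories start at `v`, so Grönwall turns the defect of `θ` into a bound of the same
  -- order on the distance at time 1.
  have hG := dist_le_of_approx_trajectories_ODE_of_mem (v := fun s w => A (x₀ + s • (h + k)) (h + k) w)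
    (s := fun _ => Set.univ) (K := 1) (f := z) (g := θ)
    (f' := fun s => A (x₀ + s • (h + k)) (h + k) (z s)) (g' := θ') (a := 0) (b := 1) (εf := 0)
    (εg := (2 * K + 2 * K ^ 2) * Y * ‖k‖ ^ 2) (δ := 0)
    (fun s hs => by
      refine LipschitzWith.lipschitzOnWith
        ((A (x₀ + s • (h + k)) (h + k)).lipschitz.weaken ?_)
      rw [← NNReal.coe_le_coe]
      simpa using hop hk s ⟨hs.1, hs.2.le⟩)
    (fun s hs => (hz s hs).continuousWithinAt)
    (fun s hs => right hs (hz s ⟨hs.1, hs.2.le⟩)) (fun s hs => by simp) (fun _ _ => trivial)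
    (fun s hs => (hθ s hs).continuousWithinAt)
    (fun s hs => right hs (hθ s ⟨hs.1, hs.2.le⟩))
    (fun s hs => by
      rw [dist_comm, dist_eq_norm]
      exact herr s ⟨hs.1, hs.2.le⟩) (fun _ _ => trivial)
    (by simp [θ, hy0, hz0]) 1 (by simp)
  rw [gronwallBound_of_K_ne_0 (by simp), dist_eq_norm] at hG
  have : z 1 - y 1 - A (x₀ + h) k (y 1) = z 1 - θ 1 := by
    simp only [θ, one_smul]; abel
  rw [this]
  refine hG.trans (le_of_eq ?_)
  simp
  ring

theorem continuousAt_norm_fderiv {U : Set X} (hU : IsOpen U) {f : X → W} (hf : ContDiffOn ℝ ∞ f U)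
    {x₀ : X} (hx₀ : x₀ ∈ U) : ContinuousAt (fun x => ‖fderiv ℝ f x‖) x₀ :=
  ((hf.fderiv_of_isOpen (m := ∞) hU (by simp)).continuousOn.continuousAt (hU.mem_nhds hx₀)).norm

/-- The Frobenius theorem for linear systems: a flat connection has local parallel sections with
arbitrary initial value. -/
theorem exists_parallel_section [CompleteSpace W] {U : Set X} (hU : IsOpen U)
    (A : X → X →L[ℝ] W →L[ℝ] W) (hA : ContDiffOn ℝ ∞ A U)
    (hflat : ∀ x ∈ U, ∀ h k, fderiv ℝ A x h k - fderiv ℝ A x k h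
      + A x k ∘L A x h - A x h ∘L A x k = 0)
    {x₀ : X} (hx₀ : x₀ ∈ U) :
    ∃ r > 0, Metric.ball x₀ r ⊆ U ∧ ∀ v : W, ∃ Ψ : X → W, Ψ x₀ = v ∧
      ContDiffOn ℝ ∞ Ψ (Metric.ball x₀ r) ∧
      ∀ x ∈ Metric.ball x₀ r, HasFDerivAt Ψ ((A x).flip (Ψ x)) x := by
  have hd0 : ContinuousAt A x₀ := hA.continuousOn.continuousAt (hU.mem_nhds hx₀)
  have hA1 : ContDiffOn ℝ ∞ (fderiv ℝ A) U := hA.fderiv_of_isOpen hU (by simp)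
  have hd1 : ContinuousAt (fderiv ℝ A) x₀ := hA1.continuousOn.continuousAt (hU.mem_nhds hx₀)
  have hd2 : ContinuousAt (fun x => ‖fderiv ℝ (fderiv ℝ A) x‖) x₀ :=
    continuousAt_norm_fderiv hU hA1 hx₀
  obtain ⟨K, hK0, hK1, hK2, hK3⟩ : ∃ K : ℝ, 0 < K ∧ ‖A x₀‖ < K ∧ ‖fderiv ℝ A x₀‖ < K ∧
      ‖fderiv ℝ (fderiv ℝ A) x₀‖ < K :=
    ⟨‖A x₀‖ + ‖fderiv ℝ A x₀‖ + ‖fderiv ℝ (fderiv ℝ A) x₀‖ + 1, by positivity,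
      by linarith [norm_nonneg (fderiv ℝ A x₀), norm_nonneg (fderiv ℝ (fderiv ℝ A) x₀)],
      by linarith [norm_nonneg (A x₀), norm_nonneg (fderiv ℝ (fderiv ℝ A) x₀)],
      by linarith [norm_nonneg (A x₀), norm_nonneg (fderiv ℝ A x₀)]⟩
  have hev := (hd0.norm.eventually_lt_const hK1).and
    ((hd1.norm.eventually_lt_const hK2).and ((hd2.eventually_lt_const hK3).and
      (hU.mem_nhds hx₀)))
  obtain ⟨ε, hε, hball⟩ := Metric.eventually_nhds_iff_ball.1 hev
  -- `K * r ≤ 1 / 4` is the smallness required for solving along rays, and `r ≤ 1` lets `‖h + k‖` be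
  -- dropped from the estimate.
  obtain ⟨r, hr, hrε, hr1, hrK⟩ : ∃ r : ℝ, 0 < r ∧ r ≤ ε ∧ r ≤ 1 ∧ K * r ≤ 1 / 4 := by
    refine ⟨min ε (min 1 (1 / (4 * K))), by positivity, min_le_left _ _,
      (min_le_right _ _).trans (min_le_left _ _), ?_⟩
    calc K * min ε (min 1 (1 / (4 * K))) ≤ K * (1 / (4 * K)) := by
          gcongr; exact (min_le_right _ _).trans (min_le_right _ _)
      _ = 1 / 4 := by field_simp
  have hsub : ∀ x ∈ Metric.ball x₀ r, x ∈ Metric.ball x₀ ε := Metric.ball_subset_ball hrε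
  have hBU : Metric.ball x₀ r ⊆ U := fun x hx => (hball x (hsub x hx)).2.2.2
  refine ⟨r, hr, hBU, fun v => ?_⟩
  have hderiv : ∀ x ∈ Metric.ball x₀ r, HasFDerivAt A (fderiv ℝ A x) x := fun x hx =>
    ((hA.differentiableOn (by simp)).differentiableAt (hU.mem_nhds (hBU hx))).hasFDerivAt
  -- The clause for `h = 0` selects the constant solution on the degenerate ray, so that the section
  -- takes the value `v` at the centre.
  have hex : ∀ h : X, ‖h‖ < r → ∃ y : ℝ → W, (h = 0 → y 1 = v) ∧ y 0 = v ∧ ∀ s ∈ Set.Icc (0 : ℝ) 1,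
      HasDerivWithinAt y (A (x₀ + s • h) h (y s)) (Set.Icc 0 1) s := by
    intro h hh
    by_cases h0 : h = 0
    · subst h0
      exact ⟨fun _ => v, fun _ => rfl, rfl, fun s _ => by
        simpa using hasDerivWithinAt_const s (Set.Icc (0 : ℝ) 1) v⟩
    have hmem : ∀ s ∈ Set.Icc (0 : ℝ) 1, x₀ + s • h ∈ Metric.ball x₀ r := by
      intro s hs
      rw [Metric.mem_ball, dist_eq_norm, add_sub_cancel_left, norm_smul, Real.norm_of_nonneg hs.1]
      nlinarith [hs.1, hs.2, norm_nonneg h]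
    obtain ⟨y, hy⟩ := exists_linear_ode_solution (fun s => A (x₀ + s • h) h)
      (ContinuousOn.clm_apply (hA.continuousOn.comp (by fun_prop) fun s hs => hBU (hmem s hs))
        continuousOn_const)
      (fun s hs => by
        calc ‖A (x₀ + s • h) h‖ ≤ ‖A (x₀ + s • h)‖ * ‖h‖ := ContinuousLinearMap.le_opNorm _ _
          _ ≤ K * r := by gcongr; exact (hball _ (hsub _ (hmem s hs))).1.le
          _ ≤ 1 / 4 := hrK) v
    exact ⟨y, fun h => absurd h h0, hy⟩
  choose! y hy00 hy0 hy using hex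
  have hΨ : ∀ x ∈ Metric.ball x₀ r,
      HasFDerivAt (fun x => y (x - x₀) 1) ((A x).flip (y (x - x₀) 1)) x := by
    intro x hx
    have hxn : ‖x - x₀‖ < r := by rwa [← dist_eq_norm]
    -- The quadratic estimate says that the section, defined by transport along rays, has the
    -- derivative prescribed by the connection in all directions and not only radially.
    have hbig : (fun x' => y (x' - x₀) 1 - y (x - x₀) 1 - (A x).flip (y (x - x₀) 1) (x' - x))
        =O[𝓝 x] fun x' => ‖x' - x‖ ^ 2 := by
      refine Asymptotics.IsBigO.of_bound
        ((2 * K + 2 * K ^ 2) * (‖v‖ * Real.exp 1) * (Real.exp 1 - 1)) ?_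
      filter_upwards [Metric.isOpen_ball.mem_nhds hx] with x' hx'
      have hxn' : ‖x - x₀ + (x' - x)‖ < r := by
        rw [show x - x₀ + (x' - x) = x' - x₀ by abel, ← dist_eq_norm]; exact hx'
      have := flat_transport_estimate hr1 hK0.le hrK A (fderiv ℝ A) hderiv
        (fun x hx => (hball x (hsub x hx)).1.le) (fun x hx => (hball x (hsub x hx)).2.1.le)
        (fun p hp p' hp' => (convex_ball x₀ r).norm_image_sub_le_of_norm_fderiv_le
          (fun q hq => (hA1.differentiableOn (by simp)).differentiableAt (hU.mem_nhds (hBU hq)))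
          (fun q hq => (hball q (hsub q hq)).2.2.1.le) hp' hp)
        (fun x hx => hflat x (hBU hx)) hxn hxn' (hy0 _ hxn) (hy0 _ hxn') (hy _ hxn) (hy _ hxn')
      rw [show x - x₀ + (x' - x) = x' - x₀ by abel, show x₀ + (x - x₀) = x by abel] at this
      rw [ContinuousLinearMap.flip_apply, Real.norm_of_nonneg (by positivity)]
      exact this
    have h1 := Asymptotics.IsBigO.hasFDerivAt (𝕜 := ℝ) hbig (by norm_num : 1 < 2)
    have h2 := (h1.add_const (y (x - x₀) 1)).add
      (((A x).flip (y (x - x₀) 1)).hasFDerivAt.comp x ((hasFDerivAt_id x).sub_const x))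
    refine (h2.congr_fderiv ?_).congr_of_eventuallyEq (Filter.Eventually.of_forall fun x' => ?_)
    · ext; simp
    · simp
      abel
  refine ⟨fun x => y (x - x₀) 1, hy00 _ (by simpa using hr) (sub_self x₀), ?_, hΨ⟩
  rw [contDiffOn_infty]
  intro n
  -- Bootstrapping: the derivative of the section is the smooth `A` applied to the section, so each
  -- degree of smoothness gives the next.
  induction n with
  | zero =>
    rw [Nat.cast_zero, contDiffOn_zero]
    exact fun x hx => (hΨ x hx).continuousAt.continuousWithinAt
  | succ n ih =>
    rw [Nat.cast_succ, contDiffOn_succ_iff_fderiv_of_isOpen Metric.isOpen_ball]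
    refine ⟨fun x hx => (hΨ x hx).differentiableAt.differentiableWithinAt, by simp, ?_⟩
    refine ContDiffOn.congr (f := fun x => (A x).flip (y (x - x₀) 1)) ?_
      (fun x hx => (hΨ x hx).fderiv)
    have hAn : ContDiffOn ℝ n A (Metric.ball x₀ r) := (hA.mono hBU).of_le (mod_cast le_top)
    have : ContDiffOn ℝ n (fun x => (A x).flip) (Metric.ball x₀ r) :=
      (LinearIsometryEquiv.contDiff (𝕜 := ℝ)
        (ContinuousLinearMap.flipₗᵢ (𝕜 := ℝ) (E := X) (Fₗ := W) (Gₗ := W))).comp_contDiffOn hAn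
    exact this.clm_apply ih

end Frobenius

/-! ### Complexified directional derivatives -/

section Calculus

variable {X E E₁ E₂ : Type*} [NormedAddCommGroup X] [NormedSpace ℝ X]
  [NormedAddCommGroup E] [NormedSpace ℂ E] [NormedAddCommGroup E₁] [NormedSpace ℂ E₁]
  [NormedAddCommGroup E₂] [NormedSpace ℂ E₂]

/-- The derivative of `f` in the complexified direction `a + i b`. -/
def cD (a b : X) (f : X → E) (w : X) : E := fderiv ℝ f w a + Complex.I • fderiv ℝ f w b

variable {a b a' b' : X} {f g : X → E} {w : X}

theorem cD_congr (h : f =ᶠ[𝓝 w] g) : cD a b f w = cD a b g w := by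
  simp only [cD, h.fderiv_eq]

theorem cD_congr_on {U : Set X} (hU : IsOpen U) (h : ∀ x ∈ U, f x = g x) (hw : w ∈ U) :
    cD a b f w = cD a b g w :=
  cD_congr (Filter.eventuallyEq_of_mem (hU.mem_nhds hw) h)

theorem cD_add (hf : DifferentiableAt ℝ f w) (hg : DifferentiableAt ℝ g w) :
    cD a b (fun x => f x + g x) w = cD a b f w + cD a b g w := by
  simp only [cD, fderiv_fun_add hf hg, add_apply]
  module

theorem cD_sub (hf : DifferentiableAt ℝ f w) (hg : DifferentiableAt ℝ g w) :
    cD a b (fun x => f x - g x) w = cD a b f w - cD a b g w := by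
  simp only [cD, fderiv_fun_sub hf hg, sub_apply]
  module

theorem cD_const_smul (c : ℂ) (hf : DifferentiableAt ℝ f w) :
    cD a b (fun x => c • f x) w = c • cD a b f w := by
  simp only [cD, fderiv_fun_const_smul hf, smul_apply]
  module

theorem cD_neg : cD a b (fun x => -f x) w = -cD a b f w := by
  simp only [cD, fderiv_fun_neg, neg_apply]
  module

@[simp] theorem cD_const (c : E) : cD a b (fun _ : X => c) w = 0 := by simp [cD]

theorem cD_sum {ι : Type*} (s : Finset ι) {f : ι → X → E}
    (hf : ∀ i ∈ s, DifferentiableAt ℝ (f i) w) :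
    cD a b (fun x => ∑ i ∈ s, f i x) w = ∑ i ∈ s, cD a b (f i) w := by
  simp only [cD, fderiv_fun_sum hf, sum_apply, Finset.smul_sum,
    Finset.sum_add_distrib]

theorem cD_bilin (B : E₁ →L[ℂ] E₂ →L[ℂ] E) {f : X → E₁} {g : X → E₂}
    (hf : DifferentiableAt ℝ f w) (hg : DifferentiableAt ℝ g w) :
    cD a b (fun x => B (f x) (g x)) w = B (cD a b f w) (g w) + B (f w) (cD a b g w) := by
  have h := (B.bilinearRestrictScalars ℝ).hasFDerivAt_of_bilinear hf.hasFDerivAt hg.hasFDerivAt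
  have h' : HasFDerivAt (fun x => B (f x) (g x)) _ w := h
  simp only [cD, h'.fderiv]
  simp
  module

theorem contDiffOn_bilin (B : E₁ →L[ℂ] E₂ →L[ℂ] E) {f : X → E₁} {g : X → E₂} {U : Set X}
    {n : ℕ∞ω} (hf : ContDiffOn ℝ n f U) (hg : ContDiffOn ℝ n g U) :
    ContDiffOn ℝ n (fun x => B (f x) (g x)) U :=
  (B.bilinearRestrictScalars ℝ).isBoundedBilinearMap.contDiff.comp_contDiffOn (hf.prodMk hg)

theorem cD_smul {f : X → ℂ} (hf : DifferentiableAt ℝ f w) (hg : DifferentiableAt ℝ g w) :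
    cD a b (fun x => f x • g x) w = cD a b f w • g w + f w • cD a b g w :=
  cD_bilin (ContinuousLinearMap.lsmul ℂ ℂ) hf hg

theorem cD_apply {A : X → E₁ →L[ℂ] E₂} {f : X → E₁} (hA : DifferentiableAt ℝ A w)
    (hf : DifferentiableAt ℝ f w) :
    cD a b (fun x => A x (f x)) w = cD a b A w (f w) + A w (cD a b f w) :=
  cD_bilin (ContinuousLinearMap.id ℂ (E₁ →L[ℂ] E₂)) hA hf

/-- The commutator as a continuous bilinear map. -/
def lieB (V : Type*) [NormedAddCommGroup V] [NormedSpace ℂ V] :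
    (V →L[ℂ] V) →L[ℂ] (V →L[ℂ] V) →L[ℂ] (V →L[ℂ] V) :=
  ContinuousLinearMap.mul ℂ (V →L[ℂ] V) - (ContinuousLinearMap.mul ℂ (V →L[ℂ] V)).flip

@[simp] theorem lieB_apply {V : Type*} [NormedAddCommGroup V] [NormedSpace ℂ V]
    (A B : V →L[ℂ] V) : lieB V A B = ⁅A, B⁆ := by
  simp [lieB, Ring.lie_def]

theorem cD_lie {V : Type*} [NormedAddCommGroup V] [NormedSpace ℂ V] {A B : X → V →L[ℂ] V}
    (hA : DifferentiableAt ℝ A w) (hB : DifferentiableAt ℝ B w) :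
    cD a b (fun x => ⁅A x, B x⁆) w = ⁅cD a b A w, B w⁆ + ⁅A w, cD a b B w⁆ := by
  simpa only [lieB_apply] using cD_bilin (a := a) (b := b) (lieB V) hA hB

theorem contDiffOn_lie {V : Type*} [NormedAddCommGroup V] [NormedSpace ℂ V] {A B : X → V →L[ℂ] V}
    {U : Set X} {n : ℕ∞ω} (hA : ContDiffOn ℝ n A U) (hB : ContDiffOn ℝ n B U) :
    ContDiffOn ℝ n (fun x => ⁅A x, B x⁆) U := by
  simpa only [lieB_apply] using contDiffOn_bilin (lieB V) hA hB

theorem contDiffOn_cD {U : Set X} (hU : IsOpen U) (hf : ContDiffOn ℝ ∞ f U) :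
    ContDiffOn ℝ ∞ (cD a b f) U := by
  have h : ContDiffOn ℝ ∞ (fderiv ℝ f) U := hf.fderiv_of_isOpen hU (by simp)
  exact (h.clm_apply contDiffOn_const).add ((h.clm_apply contDiffOn_const).const_smul Complex.I)

theorem diffAt {U : Set X} (hU : IsOpen U) {n : ℕ∞ω} (hn : n ≠ 0) (hf : ContDiffOn ℝ n f U)
    (hw : w ∈ U) : DifferentiableAt ℝ f w :=
  (hf.differentiableOn hn).differentiableAt (hU.mem_nhds hw)

/-- The complexified directions have constant coefficients, so their commutation is the symmetry of
the second real derivative. This is the source of all the curvature identities. -/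
theorem cD_comm {U : Set X} (hU : IsOpen U) (hf : ContDiffOn ℝ ∞ f U) (hw : w ∈ U) :
    cD a b (cD a' b' f) w = cD a' b' (cD a b f) w := by
  have h1 : ContDiffOn ℝ ∞ (fderiv ℝ f) U := hf.fderiv_of_isOpen hU (by simp)
  have hd : DifferentiableAt ℝ (fderiv ℝ f) w := diffAt hU (by simp) h1 hw
  have hsymm : IsSymmSndFDerivAt ℝ f w :=
    (hf.contDiffAt (hU.mem_nhds hw)).isSymmSndFDerivAt (by
      rw [minSmoothness_of_isRCLikeNormedField]; exact WithTop.coe_le_coe.2 (le_top : (2 : ℕ∞) ≤ ⊤))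
  have key : ∀ a b v : X, fderiv ℝ (cD a b f) w v
      = fderiv ℝ (fderiv ℝ f) w v a + Complex.I • fderiv ℝ (fderiv ℝ f) w v b := by
    intro a b v
    have h2 : HasFDerivAt (cD a b f) _ w :=
      (hd.hasFDerivAt.clm_apply (hasFDerivAt_const a w)).add
        ((hd.hasFDerivAt.clm_apply (hasFDerivAt_const b w)).const_smul Complex.I)
    rw [h2.fderiv]
    simp
  simp only [cD] at key ⊢
  rw [key, key, key, key, hsymm a a', hsymm a b', hsymm b a', hsymm b b']
  module

end Calculus

/-! ### Wirtinger derivatives of functions of a parameter and a coordinate -/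

section Wirtinger

variable {P E E₁ E₂ : Type*} [NormedAddCommGroup P] [NormedSpace ℂ P]
  [NormedAddCommGroup E] [NormedSpace ℂ E] [NormedAddCommGroup E₁] [NormedSpace ℂ E₁]
  [NormedAddCommGroup E₂] [NormedSpace ℂ E₂]

/-- Here `∂/∂z` is the derivative in the complexified direction `1/2 + i(-i/2)`, whose two parts are
real directions in the plane; the calculus of `cD` then covers `∂`, `∂̄` and the parameter
derivatives alike. -/
theorem wirt_eq_cD (f : ℂ → E) (z : ℂ) : wirt f z = cD (1 / 2) (-(Complex.I / 2)) f z := by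
  have h1 : (1 / 2 : ℂ) = (1 / 2 : ℝ) • (1 : ℂ) := by simp
  have h2 : -(Complex.I / 2) = (-(1 / 2) : ℝ) • Complex.I := by
    simp [div_eq_inv_mul]
  rw [cD, h2, map_smul]
  conv_rhs => rw [h1, map_smul]
  rw [wirt]
  simp only [← Complex.coe_smul]
  push_cast
  module

theorem wirtBar_eq_cD (f : ℂ → E) (z : ℂ) : wirtBar f z = cD (1 / 2) (Complex.I / 2) f z := by
  have h1 : (1 / 2 : ℂ) = (1 / 2 : ℝ) • (1 : ℂ) := by simp
  have h2 : Complex.I / 2 = (1 / 2 : ℝ) • Complex.I := by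
    simp [div_eq_inv_mul]
  rw [cD, h2, map_smul]
  conv_rhs => rw [h1, map_smul]
  rw [wirtBar]
  simp only [← Complex.coe_smul]
  push_cast
  module

/-- `∂/∂z` of a function of a parameter and `z`. -/
abbrev pz (f : P × ℂ → E) (w : P × ℂ) : E := cD ((0 : P), (1 / 2 : ℂ)) (0, -(Complex.I / 2)) f w

/-- `∂/∂z̄` of a function of a parameter and `z`. -/
abbrev pzb (f : P × ℂ → E) (w : P × ℂ) : E := cD ((0 : P), (1 / 2 : ℂ)) (0, Complex.I / 2) f w

/-- The derivative in the direction of the parameter. -/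
abbrev pt (v : P) (f : P × ℂ → E) (w : P × ℂ) : E := cD (v, (0 : ℂ)) 0 f w

theorem cD_slice {f : P × ℂ → E} {w : P × ℂ} (hf : DifferentiableAt ℝ f w) (a b : ℂ) :
    cD a b (fun z => f (w.1, z)) w.2 = cD ((0 : P), a) (0, b) f w := by
  have h : HasFDerivAt (fun z : ℂ => f (w.1, z)) _ w.2 :=
    HasFDerivAt.comp w.2 (g := f) (f := fun z => (w.1, z)) (g' := fderiv ℝ f w) hf.hasFDerivAt
      (hasFDerivAt_prodMk_right w.1 w.2)
  simp only [cD, h.fderiv]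
  simp

theorem wirt_slice {f : P × ℂ → E} {w : P × ℂ} (hf : DifferentiableAt ℝ f w) :
    wirt (fun z => f (w.1, z)) w.2 = pz f w := by
  rw [wirt_eq_cD, cD_slice hf]

theorem wirtBar_slice {f : P × ℂ → E} {w : P × ℂ} (hf : DifferentiableAt ℝ f w) :
    wirtBar (fun z => f (w.1, z)) w.2 = pzb f w := by
  rw [wirtBar_eq_cD, cD_slice hf]

/-- Holomorphy in the parameter makes the complex derivative agree with the real one, so derivatives
in the times commute with `∂` and `∂̄` under the same rules. -/
theorem fderiv_slice {f : P × ℂ → E} {w : P × ℂ} (hf : DifferentiableAt ℝ f w)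
    (hf' : DifferentiableAt ℂ (fun q => f (q, w.2)) w.1) (v : P) :
    fderiv ℂ (fun q => f (q, w.2)) w.1 v = pt v f w := by
  have h : HasFDerivAt (fun q : P => f (q, w.2)) _ w.1 :=
    HasFDerivAt.comp w.1 (g := f) (f := fun q => (q, w.2)) (g' := fderiv ℝ f w) hf.hasFDerivAt
      (hasFDerivAt_prodMk_left w.1 w.2)
  have h' := (hf'.hasFDerivAt.restrictScalars ℝ).unique h
  have h'' := congrArg (fun T : P →L[ℝ] E => T v) h'
  simpa [cD] using h''

/-- The chain rule for `∂/∂z` and a holomorphic change of coordinates. -/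
theorem wirt_comp {f : ℂ → E} {h : ℂ → ℂ} {z : ℂ} (hf : DifferentiableAt ℝ f (h z))
    (hh : DifferentiableAt ℂ h z) : wirt (fun x => f (h x)) z = deriv h z • wirt f (h z) := by
  have h1 : HasFDerivAt h ((ContinuousLinearMap.toSpanSingleton ℂ (deriv h z)).restrictScalars ℝ) z :=
    hh.hasDerivAt.hasFDerivAt.restrictScalars ℝ
  have h2 : HasFDerivAt (fun x => f (h x)) _ z := hf.hasFDerivAt.comp z h1
  have h3 : ∀ c : ℂ, fderiv ℝ f (h z) c = (c.re : ℂ) • fderiv ℝ f (h z) 1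
      + (c.im : ℂ) • fderiv ℝ f (h z) Complex.I := by
    intro c
    conv_lhs => rw [← Complex.re_add_im c]
    rw [map_add, ← Complex.real_smul, Complex.coe_smul, Complex.coe_smul, ← map_smul, ← map_smul]
    simp
  simp only [wirt, h2.fderiv]
  simp only [ContinuousLinearMap.coe_comp, Function.comp_apply,
    ContinuousLinearMap.coe_restrictScalars', ContinuousLinearMap.toSpanSingleton_apply, one_mul,
    smul_eq_mul]
  rw [h3 (deriv h z), h3 (Complex.I * deriv h z)]
  conv_rhs => rw [← Complex.re_add_im (deriv h z)]
  simp only [Complex.mul_re, Complex.mul_im, Complex.I_re, Complex.I_im]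
  push_cast
  match_scalars <;> ring_nf <;> simp <;> ring

/-- The chain rule for `∂/∂z̄` and a holomorphic change of coordinates. -/
theorem wirtBar_comp {f : ℂ → E} {h : ℂ → ℂ} {z : ℂ} (hf : DifferentiableAt ℝ f (h z))
    (hh : DifferentiableAt ℂ h z) :
    wirtBar (fun x => f (h x)) z = (starRingEnd ℂ) (deriv h z) • wirtBar f (h z) := by
  have h1 : HasFDerivAt h ((ContinuousLinearMap.toSpanSingleton ℂ (deriv h z)).restrictScalars ℝ) z :=
    hh.hasDerivAt.hasFDerivAt.restrictScalars ℝ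
  have h2 : HasFDerivAt (fun x => f (h x)) _ z := hf.hasFDerivAt.comp z h1
  have h3 : ∀ c : ℂ, fderiv ℝ f (h z) c = (c.re : ℂ) • fderiv ℝ f (h z) 1
      + (c.im : ℂ) • fderiv ℝ f (h z) Complex.I := by
    intro c
    conv_lhs => rw [← Complex.re_add_im c]
    rw [map_add, ← Complex.real_smul, Complex.coe_smul, Complex.coe_smul, ← map_smul, ← map_smul]
    simp
  simp only [wirtBar, h2.fderiv]
  simp only [ContinuousLinearMap.coe_comp, Function.comp_apply,
    ContinuousLinearMap.coe_restrictScalars', ContinuousLinearMap.toSpanSingleton_apply, one_mul,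
    smul_eq_mul]
  rw [h3 (deriv h z), h3 (Complex.I * deriv h z)]
  have hc : (starRingEnd ℂ) (deriv h z) = (deriv h z).re - (deriv h z).im * Complex.I := by
    apply Complex.ext <;> simp
  rw [hc]
  simp only [Complex.mul_re, Complex.mul_im, Complex.I_re, Complex.I_im]
  push_cast
  match_scalars <;> ring_nf <;> simp <;> ring

theorem wirtBar_of_holo {f : ℂ → ℂ} {z : ℂ} (hf : DifferentiableAt ℂ f z) : wirtBar f z = 0 := by
  have h1 : HasFDerivAt f ((ContinuousLinearMap.toSpanSingleton ℂ (deriv f z)).restrictScalars ℝ) z :=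
    hf.hasDerivAt.hasFDerivAt.restrictScalars ℝ
  simp only [wirtBar, h1.fderiv]
  simp
  rw [← mul_assoc]; simp

theorem wirt_of_antiholo {f : ℂ → ℂ} {z : ℂ} (hf : DifferentiableAt ℂ f z) :
    wirt (fun x => (starRingEnd ℂ) (f x)) z = 0 := by
  have h1 : HasFDerivAt f ((ContinuousLinearMap.toSpanSingleton ℂ (deriv f z)).restrictScalars ℝ) z :=
    hf.hasDerivAt.hasFDerivAt.restrictScalars ℝ
  have h2 : HasFDerivAt (fun x => (starRingEnd ℂ) (f x)) _ z :=
    (Complex.conjCLE.toContinuousLinearMap.hasFDerivAt).comp z h1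
  simp only [wirt, h2.fderiv]
  simp
  rw [← mul_assoc]; simp

end Wirtinger

/-! ### Holomorphic functions of several variables are smooth -/

section Osgood

variable {P E : Type*} [NormedAddCommGroup P] [NormedSpace ℂ P]
  [NormedAddCommGroup E] [NormedSpace ℂ E]

/-- Cauchy's estimate on the complex line through `q` in the direction `w`, with the circle of
radius `ε / ‖w‖`. -/
theorem norm_fderiv_le_of_bounded {f : P → E} {q : P} {ε M : ℝ} (hε : 0 < ε) (hM : 0 ≤ M)
    (hf : DifferentiableOn ℂ f (Metric.ball q (2 * ε))) (hb : ∀ x ∈ Metric.ball q (2 * ε), ‖f x‖ ≤ M) :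
    ‖fderiv ℂ f q‖ ≤ M / ε := by
  refine ContinuousLinearMap.opNorm_le_bound _ (by positivity) fun w => ?_
  by_cases hw : w = 0
  · simp [hw]
  have hw' : 0 < ‖w‖ := norm_pos_iff.2 hw
  have hq : DifferentiableAt ℂ f q := hf.differentiableAt (Metric.ball_mem_nhds q (by positivity))
  have hline : ∀ ζ : ℂ, ‖ζ‖ ≤ ε / ‖w‖ → q + ζ • w ∈ Metric.ball q (2 * ε) := by
    intro ζ hζ
    rw [Metric.mem_ball, dist_eq_norm, add_sub_cancel_left, norm_smul]
    have := mul_le_mul_of_nonneg_right hζ hw'.le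
    rw [div_mul_cancel₀ _ hw'.ne'] at this
    linarith
  have hd : deriv (fun ζ : ℂ => f (q + ζ • w)) 0 = fderiv ℂ f q w := by
    have h1 : HasDerivAt (fun ζ : ℂ => q + ζ • w) w 0 := by
      simpa using ((hasDerivAt_id (0 : ℂ)).smul_const w).const_add q
    have h2 : HasFDerivAt f (fderiv ℂ f q) (q + (0 : ℂ) • w) := by simpa using hq.hasFDerivAt
    exact (h2.comp_hasDerivAt (0 : ℂ) h1).deriv
  have hdc : DiffContOnCl ℂ (fun ζ : ℂ => f (q + ζ • w)) (Metric.ball 0 (ε / ‖w‖)) := by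
    refine DifferentiableOn.diffContOnCl fun ζ hζ => ?_
    rw [closure_ball _ (by positivity), mem_closedBall_zero_iff] at hζ
    refine DifferentiableAt.differentiableWithinAt ?_
    have h2 : DifferentiableAt ℂ f (q + ζ • w) :=
      hf.differentiableAt (Metric.isOpen_ball.mem_nhds (hline ζ hζ))
    exact h2.comp ζ (by fun_prop)
  have := Complex.norm_deriv_le_of_forall_mem_sphere_norm_le (by positivity) hdc (C := M)
    (fun ζ hζ => hb _ (hline ζ (by simpa using hζ.le)))
  rw [hd] at this
  refine this.trans (le_of_eq ?_)
  field_simp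

/-- The directional derivative is a Cauchy integral over a circle in the line of direction `v`, with
values of `f` as integrand. It can be differentiated in `q` under the integral sign, because
Cauchy's estimate bounds the derivative of `f`. -/
theorem differentiableOn_fderiv_apply [FiniteDimensional ℂ P] [FiniteDimensional ℂ E] {f : P → E}
    {D : Set P} (hD : IsOpen D) (hf : DifferentiableOn ℂ f D) (v : P) :
    DifferentiableOn ℂ (fun q => fderiv ℂ f q v) D := by
  intro q₀ hq₀
  refine DifferentiableAt.differentiableWithinAt ?_
  have : CompleteSpace E := FiniteDimensional.complete ℂ E
  obtain ⟨ε, M, hε, hM, hball⟩ : ∃ ε M : ℝ, 0 < ε ∧ 0 ≤ M ∧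
      ∀ x ∈ Metric.ball q₀ (4 * ε), x ∈ D ∧ ‖f x‖ ≤ M := by
    have hc : ContinuousAt f q₀ := (hf.differentiableAt (hD.mem_nhds hq₀)).continuousAt
    obtain ⟨ε, hε, h⟩ := Metric.eventually_nhds_iff_ball.1
      ((hD.eventually_mem hq₀).and (hc.norm.eventually_le_const (lt_add_one ‖f q₀‖)))
    refine ⟨ε / 4, ‖f q₀‖ + 1, by positivity, by positivity, fun x hx => h x ?_⟩
    rwa [mul_div_cancel₀ _ (by norm_num)] at hx
  have hfd : ∀ x ∈ Metric.ball q₀ (4 * ε), DifferentiableAt ℂ f x := fun x hx =>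
    hf.differentiableAt (hD.mem_nhds (hball x hx).1)
  have hder : ∀ x ∈ Metric.ball q₀ (2 * ε), ‖fderiv ℂ f x‖ ≤ M / ε := by
    intro x hx
    have hsub : ∀ y ∈ Metric.ball x (2 * ε), y ∈ Metric.ball q₀ (4 * ε) := by
      intro y hy
      rw [Metric.mem_ball] at hx hy ⊢
      linarith [dist_triangle y x q₀]
    exact norm_fderiv_le_of_bounded hε hM
      (fun y hy => (hfd y (hsub y hy)).differentiableWithinAt) fun y hy => (hball y (hsub y hy)).2
  obtain ⟨ρ, hρ, hρv⟩ : ∃ ρ : ℝ, 0 < ρ ∧ ρ * ‖v‖ ≤ ε := by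
    refine ⟨ε / (‖v‖ + 1), by positivity, ?_⟩
    rw [div_mul_eq_mul_div, div_le_iff₀ (by positivity)]
    nlinarith [norm_nonneg v]
  have hmem : ∀ q ∈ Metric.ball q₀ ε, ∀ ζ : ℂ, ‖ζ‖ ≤ ρ → q + ζ • v ∈ Metric.ball q₀ (2 * ε) := by
    intro q hq ζ hζ
    have h1 : dist (q + ζ • v) q ≤ ε := by
      rw [dist_eq_norm, add_sub_cancel_left, norm_smul]
      exact (mul_le_mul_of_nonneg_right hζ (norm_nonneg v)).trans hρv
    rw [Metric.mem_ball] at hq ⊢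
    linarith [dist_triangle (q + ζ • v) q q₀]
  have h24 : Metric.ball q₀ (2 * ε) ⊆ Metric.ball q₀ (4 * ε) :=
    Metric.ball_subset_ball (by linarith)
  have hcauchy : ∀ q ∈ Metric.ball q₀ ε, fderiv ℂ f q v
      = (2 * Real.pi * Complex.I : ℂ)⁻¹ • ∮ ζ in C(0, ρ), (1 / (ζ - 0) ^ 2) • f (q + ζ • v) := by
    intro q hq
    have hq' : DifferentiableAt ℂ f q :=
      hfd q (Metric.ball_subset_ball (by linarith) hq)
    rw [DifferentiableOn.deriv_eq_smul_circleIntegral hρ, inv_smul_smul₀ Complex.two_pi_I_ne_zero]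
    · have h1 : HasDerivAt (fun ζ : ℂ => q + ζ • v) v 0 := by
        simpa using ((hasDerivAt_id (0 : ℂ)).smul_const v).const_add q
      have h2 : HasFDerivAt f (fderiv ℂ f q) (q + (0 : ℂ) • v) := by simpa using hq'.hasFDerivAt
      exact (h2.comp_hasDerivAt (0 : ℂ) h1).deriv.symm
    · intro ζ hζ
      have h2 := hfd _ (h24 (hmem q hq ζ (by simpa using hζ)))
      exact (h2.comp ζ (by fun_prop)).differentiableWithinAt
  have hmain : DifferentiableAt ℂ
      (fun q => ∮ ζ in C(0, ρ), (1 / (ζ - 0) ^ 2) • f (q + ζ • v)) q₀ := by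
    simp only [circleIntegral]
    have hcm : ∀ θ : ℝ, ‖circleMap 0 ρ θ‖ ≤ ρ := fun θ => by
      simp [abs_of_pos hρ]
    let k : ℝ → ℂ := fun θ => deriv (circleMap 0 ρ) θ * (1 / (circleMap 0 ρ θ - 0) ^ 2)
    have hk : Continuous k := by
      have h0 : ∀ θ, circleMap 0 ρ θ ≠ 0 := fun θ => circleMap_ne_center hρ.ne'
      simp only [k, deriv_circleMap, sub_zero]
      refine Continuous.mul (by fun_prop) ?_
      exact continuous_const.div (by fun_prop) fun θ => pow_ne_zero 2 (h0 θ)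
    have hcont : ∀ q ∈ Metric.ball q₀ ε, Continuous fun θ => k θ • f (q + circleMap 0 ρ θ • v) := by
      intro q hq
      refine hk.smul (continuous_iff_continuousAt.2 fun θ => ?_)
      exact ContinuousAt.comp (f := fun θ => q + circleMap 0 ρ θ • v)
        (hfd _ (h24 (hmem q hq _ (hcm θ)))).continuousAt (by fun_prop)
    have := intervalIntegral.hasFDerivAt_integral_of_dominated_of_fderiv_le (𝕜 := ℂ)
      (μ := MeasureTheory.volume) (s := Metric.ball q₀ ε)
      (F := fun q θ => k θ • f (q + circleMap 0 ρ θ • v)) (a := 0) (b := 2 * Real.pi)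
      (F' := fun q θ => k θ • fderiv ℂ f (q + circleMap 0 ρ θ • v)) (x₀ := q₀)
      (bound := fun θ => ‖k θ‖ * (M / ε)) (Metric.ball_mem_nhds q₀ hε)
      (by
        filter_upwards [Metric.ball_mem_nhds q₀ hε] with q hq
        exact (hcont q hq).aestronglyMeasurable)
      ((hcont q₀ (Metric.mem_ball_self hε)).intervalIntegrable _ _)
      (by
        -- Continuity of the derivative is not yet available. It is measurable, which suffices for
        -- dominated differentiation.
        borelize P
        borelize (P →L[ℂ] E)
        have : FiniteDimensional ℂ (P →L[ℂ] E) := inferInstance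
        have : ProperSpace (P →L[ℂ] E) := FiniteDimensional.proper ℂ _
        have : SecondCountableTopology (P →L[ℂ] E) := inferInstance
        have hm : Measurable fun θ : ℝ => fderiv ℂ f (q₀ + circleMap 0 ρ θ • v) :=
          (measurable_fderiv ℂ f).comp (by
            have : Continuous fun θ : ℝ => q₀ + circleMap 0 ρ θ • v := by fun_prop
            exact this.measurable)
        exact hk.aestronglyMeasurable.smul hm.aestronglyMeasurable)
      (Filter.Eventually.of_forall fun θ _ q hq => by
        rw [norm_smul]
        gcongr
        exact hder _ (hmem q hq _ (hcm θ)))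
      ((hk.norm.mul continuous_const).intervalIntegrable _ _)
      (Filter.Eventually.of_forall fun θ _ q hq => by
        have h1 : HasFDerivAt (fun q : P => q + circleMap 0 ρ θ • v)
            (ContinuousLinearMap.id ℂ P) q := (hasFDerivAt_id q).add_const _
        exact (((hfd _ (h24 (hmem q hq _ (hcm θ)))).hasFDerivAt.comp q h1)).const_smul (k θ))
    have h2 := this.differentiableAt
    simpa only [k, mul_smul] using h2
  refine (hmain.const_smul (2 * Real.pi * Complex.I : ℂ)⁻¹).congr_of_eventuallyEq ?_
  filter_upwards [Metric.ball_mem_nhds q₀ hε] with q hq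
  exact hcauchy q hq

/-- A holomorphic function on an open subset of a finite dimensional space is smooth. -/
theorem contDiffOn_of_differentiableOn [FiniteDimensional ℂ P] [FiniteDimensional ℂ E] {f : P → E}
    {D : Set P} (hD : IsOpen D) (hf : DifferentiableOn ℂ f D) : ContDiffOn ℂ ∞ f D := by
  rw [contDiffOn_infty]
  intro n
  induction n generalizing f with
  | zero => rw [Nat.cast_zero, contDiffOn_zero]; exact hf.continuousOn
  | succ n ih =>
    rw [Nat.cast_succ, contDiffOn_succ_iff_fderiv_apply hD.uniqueDiffOn]
    refine ⟨hf, by simp, fun v => ?_⟩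
    exact (ih (differentiableOn_fderiv_apply hD hf v)).congr
      fun q hq => by rw [fderivWithin_of_isOpen hD hq]

theorem contDiffOn_real_of_differentiableOn [FiniteDimensional ℂ P] [FiniteDimensional ℂ E]
    {f : P → E} {D : Set P} (hD : IsOpen D) (hf : DifferentiableOn ℂ f D) : ContDiffOn ℝ ∞ f D :=
  (contDiffOn_of_differentiableOn hD hf).restrict_scalars ℝ

end Osgood

/-! ### Integrals over the complex plane -/

section Plane

open MeasureTheory

/-- The singularity has order 1, below the real dimension 2. -/
theorem locallyIntegrable_inv : LocallyIntegrable (fun z : ℂ => z⁻¹) := by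
  refine locallyIntegrable_of_norm_le_rpow (C := 1) (α := 1) (by simp) (by simp)
    (Filter.Eventually.of_forall fun z => ?_) (by
      exact measurable_inv.aestronglyMeasurable)
  rw [norm_inv, one_mul, Real.rpow_neg_one]

theorem integrable_inv_mul {u : ℂ → ℂ} (c : ℂ) (hu : Continuous u) (hs : HasCompactSupport u) :
    Integrable fun z => (z - c)⁻¹ * u z := by
  have h : Integrable fun z => z⁻¹ • u (z + c) :=
    locallyIntegrable_inv.integrable_smul_right_of_hasCompactSupport (by fun_prop)
      (hs.comp_homeomorph (Homeomorph.addRight c))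
  simpa using h.comp_sub_right c

theorem continuous_wirtBar {u : ℂ → ℂ} (hu : ContDiff ℝ ∞ u) : Continuous (wirtBar u) := by
  have h : Continuous (fderiv ℝ u) := hu.continuous_fderiv (by simp)
  unfold wirtBar
  fun_prop

theorem hasCompactSupport_wirtBar {u : ℂ → ℂ} (hs : HasCompactSupport u) :
    HasCompactSupport (wirtBar u) := by
  refine (hs.fderiv ℝ).mono fun z hz => ?_
  contrapose! hz
  simp only [Function.mem_support, not_not] at hz ⊢
  simp [wirtBar, hz]

/-- Integration by parts against the constant function 1. -/
theorem integral_fderiv_apply_eq_zero {u : ℂ → ℂ} (hu : ContDiff ℝ ∞ u) (hs : HasCompactSupport u)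
    (v : ℂ) : ∫ z, fderiv ℝ u z v = 0 := by
  have hc : Continuous fun z => fderiv ℝ u z v := by
    have h : Continuous (fderiv ℝ u) := hu.continuous_fderiv (by simp)
    fun_prop
  have hcs : HasCompactSupport fun z => fderiv ℝ u z v := hs.fderiv_apply ℝ v
  have := integral_mul_fderiv_eq_neg_fderiv_mul_of_integrable (μ := volume) (f := fun _ : ℂ => (1 : ℂ))
    (g := u) (v := v) (by simp) (by simpa using hc.integrable_of_hasCompactSupport hcs)
    (by simpa using hu.continuous.integrable_of_hasCompactSupport hs)
    (fun _ _ => differentiableAt_const _) (fun z _ => hu.differentiable (by simp) z)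
  simpa using this

theorem integral_wirt_eq_zero {u : ℂ → ℂ} (hu : ContDiff ℝ ∞ u) (hs : HasCompactSupport u) :
    ∫ z, wirt u z = 0 := by
  have hc : ∀ v, Integrable fun z => fderiv ℝ u z v := fun v => by
    have h : Continuous (fderiv ℝ u) := hu.continuous_fderiv (by simp)
    exact Continuous.integrable_of_hasCompactSupport (by fun_prop) (hs.fderiv_apply ℝ v)
  simp only [wirt]
  have h2 : Integrable fun z => Complex.I • fderiv ℝ u z Complex.I := (hc _).smul Complex.I
  rw [integral_smul, integral_sub (hc 1) h2, integral_smul,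
    integral_fderiv_apply_eq_zero hu hs, integral_fderiv_apply_eq_zero hu hs]
  simp

/-- The operator `∂̄` in polar coordinates: up to the phase it is half the sum of the radial
derivative and `i` times the derivative along the unit tangent of the circle. -/
theorem exp_inv_mul_wirtBar (u : ℂ → ℂ) (w : ℂ) (θ : ℝ) :
    (Complex.exp (θ * Complex.I))⁻¹ * wirtBar u w
      = (1 / 2) * (fderiv ℝ u w (Complex.exp (θ * Complex.I))
        + Complex.I * fderiv ℝ u w (Complex.I * Complex.exp (θ * Complex.I))) := by
  have h3 : ∀ c : ℂ, fderiv ℝ u w c = (c.re : ℂ) * fderiv ℝ u w 1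
      + (c.im : ℂ) * fderiv ℝ u w Complex.I := by
    intro c
    conv_lhs => rw [← Complex.re_add_im c]
    rw [map_add, ← Complex.real_smul, ← Complex.real_smul, ← Complex.real_smul, ← map_smul,
      ← map_smul]
    simp
  rw [← Complex.exp_neg, ← neg_mul, ← Complex.ofReal_neg, Complex.exp_mul_I, Complex.exp_mul_I,
    ← Complex.ofReal_cos, ← Complex.ofReal_sin, ← Complex.ofReal_cos, ← Complex.ofReal_sin,
    Real.cos_neg, Real.sin_neg, h3 (_ + _), h3 (Complex.I * _), wirtBar]
  simp
  ring_nf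
  simp
  ring

/-- The Cauchy–Pompeiu formula for a compactly supported function. -/
theorem integral_inv_mul_wirtBar_zero {u : ℂ → ℂ} (hu : ContDiff ℝ ∞ u) (hs : HasCompactSupport u) :
    ∫ z, z⁻¹ * wirtBar u z = -Real.pi * u 0 := by
  have hdu : Continuous (fderiv ℝ u) := hu.continuous_fderiv (by simp)
  obtain ⟨R, hR⟩ : ∃ R : ℝ, ∀ z : ℂ, R < ‖z‖ → z ∉ tsupport u := by
    obtain ⟨R, hR⟩ := hs.isBounded.exists_norm_le
    exact ⟨R, fun z hz hz' => absurd (hR z hz') (not_le.2 hz)⟩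
  have hR0 : ∀ z : ℂ, R < ‖z‖ → fderiv ℝ u z = 0 := fun z hz =>
    Function.notMem_support.1 fun h => hR z hz (support_fderiv_subset ℝ h)
  let e : ℝ → ℂ := fun θ => Complex.exp (θ * Complex.I)
  have hen : ∀ θ, ‖e θ‖ = 1 := fun θ => Complex.norm_exp_ofReal_mul_I θ
  have he : Continuous e := by fun_prop
  -- In polar coordinates the Jacobian cancels the pole and leaves `(a + i b) / 2`. The radial part
  -- `a` integrates to `-u 0` along each ray, and `b`, the angular derivative divided by the radius,
  -- integrates to zero over each circle.
  let a : ℝ × ℝ → ℂ := fun p => fderiv ℝ u (p.1 * e p.2) (e p.2)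
  let b : ℝ × ℝ → ℂ := fun p => fderiv ℝ u (p.1 * e p.2) (Complex.I * e p.2)
  have ha : Continuous a := (hdu.comp (by fun_prop)).clm_apply (by fun_prop)
  have hb : Continuous b := (hdu.comp (by fun_prop)).clm_apply (by fun_prop)
  have hvan : ∀ p : ℝ × ℝ, R < p.1 → 0 < p.1 → fderiv ℝ u (p.1 * e p.2) = 0 := by
    intro p hp hp0
    refine hR0 _ ?_
    rw [norm_mul, hen, mul_one, Complex.norm_real, Real.norm_of_nonneg hp0.le]
    exact hp
  have hint : ∀ {f : ℝ × ℝ → ℂ}, Continuous f → (∀ p : ℝ × ℝ, R < p.1 → 0 < p.1 → f p = 0) →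
      IntegrableOn f (Set.Ioi 0 ×ˢ Set.Ioo (-Real.pi) Real.pi) (volume.prod volume) := by
    intro f hf hf0
    have h1 : IntegrableOn f (Set.Icc 0 R ×ˢ Set.Icc (-Real.pi) Real.pi) (volume.prod volume) :=
      hf.continuousOn.integrableOn_compact (isCompact_Icc.prod isCompact_Icc)
    have h2 : IntegrableOn f {p : ℝ × ℝ | R < p.1 ∧ 0 < p.1} (volume.prod volume) := by
      refine (integrableOn_zero).congr_fun (f := fun _ => (0 : ℂ))
        (fun p hp => (hf0 p hp.1 hp.2).symm) ?_
      exact (measurableSet_lt measurable_const measurable_fst).inter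
        (measurableSet_lt measurable_const measurable_fst)
    refine (h1.union h2).mono_set fun p hp => ?_
    by_cases h : p.1 ≤ R
    · exact Or.inl ⟨⟨hp.1.le, h⟩, ⟨hp.2.1.le, hp.2.2.le⟩⟩
    · exact Or.inr ⟨not_le.1 h, hp.1⟩
  have haI := hint ha (fun p h h' => by simp [a, hvan p h h'])
  have hbI := hint hb (fun p h h' => by simp [b, hvan p h h'])
  have hπ : -Real.pi ≤ Real.pi := by linarith [Real.pi_pos]
  have inta : ∫ p in Set.Ioi (0 : ℝ) ×ˢ Set.Ioo (-Real.pi) Real.pi, a p ∂(volume.prod volume)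
      = -(2 * Real.pi) * u 0 := by
    rw [← setIntegral_prod_swap, setIntegral_prod (fun z : ℝ × ℝ => a z.swap) haI.swap]
    have hin : ∀ θ : ℝ, ∫ r in Set.Ioi (0 : ℝ), a (r, θ) = -u 0 := by
      intro θ
      have hder : ∀ r : ℝ, HasDerivAt (fun r : ℝ => u (r * e θ)) (a (r, θ)) r := by
        intro r
        have h1 : HasDerivAt (fun r : ℝ => (r : ℂ) * e θ) (e θ) r := by
          simpa using (Complex.ofRealCLM.hasDerivAt (x := r)).mul_const (e θ)
        exact (hu.differentiable (by simp) _).hasFDerivAt.comp_hasDerivAt r h1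
      have h := integral_Ioi_of_hasDerivAt_of_tendsto (a := 0) (m := 0)
        (hder 0).continuousAt.continuousWithinAt (fun r _ => hder r) (by
          have hc : Continuous fun r : ℝ => a (r, θ) := by fun_prop
          have h1 : IntegrableOn (fun r => a (r, θ)) (Set.Icc 0 R) :=
            hc.continuousOn.integrableOn_compact isCompact_Icc
          have h2 : IntegrableOn (fun r => a (r, θ)) {r : ℝ | R < r ∧ 0 < r} := by
            refine (integrableOn_zero).congr_fun (f := fun _ => (0 : ℂ))
              (fun r hr => by simp [a, hvan (r, θ) hr.1 hr.2]) ?_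
            exact measurableSet_Ioi.inter measurableSet_Ioi
          refine (h1.union h2).mono_set fun r hr => ?_
          by_cases h : r ≤ R
          · exact Or.inl ⟨le_of_lt hr, h⟩
          · exact Or.inr ⟨not_le.1 h, hr⟩) (by
          refine tendsto_const_nhds.congr' ?_
          filter_upwards [Filter.eventually_gt_atTop R, Filter.eventually_gt_atTop 0] with r hr hr0
          refine (image_eq_zero_of_notMem_tsupport (hR _ ?_)).symm
          rw [norm_mul, hen, mul_one, Complex.norm_real, Real.norm_of_nonneg hr0.le]
          exact hr)
      simpa using h
    simp only [Prod.swap_prod_mk, hin]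
    simp [Real.pi_pos.le]
    left
    ring_nf
  have intb : ∫ p in Set.Ioi (0 : ℝ) ×ˢ Set.Ioo (-Real.pi) Real.pi, b p ∂(volume.prod volume)
      = 0 := by
    rw [setIntegral_prod _ hbI]
    refine setIntegral_eq_zero_of_forall_eq_zero fun r hr => ?_
    have hr : (0 : ℝ) < r := hr
    have hder : ∀ θ : ℝ, HasDerivAt (fun θ : ℝ => (r : ℂ)⁻¹ * u (r * e θ)) (b (r, θ)) θ := by
      intro θ
      have h0 : HasDerivAt e (Complex.I * e θ) θ := by
        have h1 : HasDerivAt (fun θ : ℝ => (θ : ℂ) * Complex.I) Complex.I θ := by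
          simpa using (Complex.ofRealCLM.hasDerivAt (x := θ)).mul_const Complex.I
        simpa [e, mul_comm] using h1.cexp
      have h1 : HasDerivAt (fun θ : ℝ => (r : ℂ) * e θ) ((r : ℂ) * (Complex.I * e θ)) θ :=
        h0.const_mul _
      have h2 := ((hu.differentiable (by simp) _).hasFDerivAt.comp_hasDerivAt θ h1).const_mul
        (r : ℂ)⁻¹
      refine h2.congr_deriv ?_
      rw [← Complex.real_smul (x := r) (z := Complex.I * e θ), map_smul, Complex.real_smul,
        inv_mul_cancel_left₀]
      exact_mod_cast hr.ne'
    rw [← integral_Ioc_eq_integral_Ioo, ← intervalIntegral.integral_of_le hπ,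
      intervalIntegral.integral_eq_sub_of_hasDerivAt (fun θ _ => hder θ)
        (Continuous.intervalIntegrable (by fun_prop) _ _)]
    have : e Real.pi = e (-Real.pi) := by
      simp [e, Complex.exp_neg, Complex.exp_pi_mul_I]
    rw [this, sub_self]
  rw [← Complex.integral_comp_polarCoord_symm, polarCoord_target]
  have hcongr : ∀ p ∈ Set.Ioi (0 : ℝ) ×ˢ Set.Ioo (-Real.pi) Real.pi,
      p.1 • ((Complex.polarCoord.symm p)⁻¹ * wirtBar u (Complex.polarCoord.symm p))
        = (1 / 2) * (a p + Complex.I * b p) := by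
    intro p hp
    have hp1 : (p.1 : ℂ) ≠ 0 := by exact_mod_cast (ne_of_gt hp.1)
    have hpe : Complex.polarCoord.symm p = p.1 * e p.2 := by
      rw [Complex.polarCoord_symm_apply]
      simp [e, Complex.exp_mul_I]
    rw [hpe, ← exp_inv_mul_wirtBar, Complex.real_smul, mul_inv]
    field_simp
    exact mul_div_cancel_right₀ _ (Complex.exp_ne_zero _)
  rw [setIntegral_congr_fun (measurableSet_Ioi.prod measurableSet_Ioo) hcongr, Measure.volume_eq_prod,
    integral_const_mul, integral_add haI (hbI.const_mul _), integral_const_mul, inta, intb]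
  ring

theorem integral_inv_mul_wirtBar {u : ℂ → ℂ} (c : ℂ) (hu : ContDiff ℝ ∞ u)
    (hs : HasCompactSupport u) : ∫ z, (z - c)⁻¹ * wirtBar u z = -Real.pi * u c := by
  have hu' : ContDiff ℝ ∞ fun z => u (z + c) := hu.comp (contDiff_id.add contDiff_const)
  have h := integral_inv_mul_wirtBar_zero hu' (hs.comp_homeomorph (Homeomorph.addRight c))
  have hw : ∀ z, wirtBar (fun z => u (z + c)) z = wirtBar u (z + c) := fun z => by
    simp only [wirtBar, fderiv_comp_add_right]
  rw [← integral_add_right_eq_self _ c]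
  simpa [hw] using h

end Plane

/-! ### Integrals with a simple pole as holomorphic functions of a parameter -/

section ParamIntegral

open MeasureTheory

variable {P : Type*} [NormedAddCommGroup P] [NormedSpace ℂ P]

/-- Differentiation of an integral with a simple pole with respect to a parameter. -/
theorem hasFDerivAt_integral_inv_mul [FiniteDimensional ℂ P] {D : Set P} (hD : IsOpen D)
    {u : P × ℂ → ℂ} (hu : ContDiffOn ℝ ∞ u (D ×ˢ Set.univ)) {K : Set ℂ} (hK : IsCompact K)
    (hu0 : ∀ q ∈ D, ∀ z ∉ K, u (q, z) = 0) (c : ℂ)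
    (hol : ∀ z ≠ c, DifferentiableOn ℂ (fun q => u (q, z)) D) {q₀ : P} (hq₀ : q₀ ∈ D) :
    ∃ A : P →L[ℂ] ℂ, HasFDerivAt (fun q => ∫ z, (z - c)⁻¹ * u (q, z)) A q₀ ∧
      ∀ v, A v = ∫ z, (z - c)⁻¹ * pt v u (q₀, z) := by
  have hU : IsOpen (D ×ˢ (Set.univ : Set ℂ)) := hD.prod isOpen_univ
  have hdu : ContDiffOn ℝ ∞ (fderiv ℝ u) (D ×ˢ Set.univ) := hu.fderiv_of_isOpen hU (by simp)
  have hdiff : ∀ q ∈ D, ∀ z, DifferentiableAt ℝ u (q, z) := fun q hq z =>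
    diffAt hU (by simp) hu ⟨hq, trivial⟩
  have hdu0 : ∀ q ∈ D, ∀ z ∉ K, fderiv ℝ u (q, z) = 0 := by
    intro q hq z hz
    have h : u =ᶠ[𝓝 (q, z)] fun _ => 0 := by
      filter_upwards [(hD.prod hK.isClosed.isOpen_compl).mem_nhds (⟨hq, hz⟩ : (q, z) ∈ D ×ˢ Kᶜ)]
        with w hw
      exact hu0 w.1 hw.1 w.2 hw.2
    rw [h.fderiv_eq]
    simp
  have hproper : ProperSpace P := FiniteDimensional.proper ℂ P
  obtain ⟨ε, hε, hεD⟩ := Metric.nhds_basis_closedBall.mem_iff.1 (hD.mem_nhds hq₀)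
  obtain ⟨C, hC⟩ := ((isCompact_closedBall q₀ ε).prod hK).exists_bound_of_continuousOn
    (hdu.continuousOn.mono (Set.prod_mono hεD (Set.subset_univ _)))
  have hC0 : ∀ q ∈ Metric.closedBall q₀ ε, ∀ z, ‖fderiv ℝ u (q, z)‖ ≤ K.indicator (fun _ => |C|) z := by
    intro q hq z
    by_cases hz : z ∈ K
    · rw [Set.indicator_of_mem hz]
      exact (hC (q, z) ⟨hq, hz⟩).trans (le_abs_self C)
    · rw [Set.indicator_of_notMem hz, hdu0 q (hεD hq) z hz, norm_zero]
  have hcont : ∀ q ∈ D, Continuous fun z => u (q, z) := fun q hq =>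
    hu.continuousOn.comp_continuous (by fun_prop) fun z => ⟨hq, trivial⟩
  have hcs : ∀ q ∈ D, HasCompactSupport fun z => u (q, z) := fun q hq =>
    HasCompactSupport.intro hK fun z hz => hu0 q hq z hz
  have hdcont : Continuous fun z => fderiv ℝ u (q₀, z) :=
    hdu.continuousOn.comp_continuous (by fun_prop) fun z => ⟨hq₀, trivial⟩
  have hinvm : Measurable fun z : ℂ => (z - c)⁻¹ := by fun_prop
  let ι : P →L[ℝ] P × ℂ := ContinuousLinearMap.inl ℝ P ℂ
  have hF'm : AEStronglyMeasurable (fun z => (z - c)⁻¹ • (fderiv ℝ u (q₀, z)).comp ι) volume := by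
    refine hinvm.aestronglyMeasurable.smul ?_
    have : Continuous fun z => (fderiv ℝ u (q₀, z)).comp ι := by fun_prop
    exact this.aestronglyMeasurable
  have hinvK : IntegrableOn (fun z : ℂ => ‖(z - c)⁻¹‖) K := by
    have h : LocallyIntegrable fun z : ℂ => (z - c)⁻¹ := by
      intro x
      have h1 : IntegrableOn (fun z : ℂ => z⁻¹) (Metric.closedBall (x - c) 1) :=
        locallyIntegrable_inv.integrableOn_isCompact (isCompact_closedBall _ _)
      refine ⟨Metric.closedBall x 1, Metric.closedBall_mem_nhds x one_pos, ?_⟩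
      have h2 := (measurePreserving_sub_right volume c).integrableOn_comp_preimage
        (MeasurableEquiv.subRight c).measurableEmbedding
        (f := fun z : ℂ => z⁻¹) (s := Metric.closedBall (x - c) 1)
      have h3 := h2.2 h1
      refine h3.mono_set fun z hz => ?_
      simpa [dist_sub_right] using hz
    exact (h.integrableOn_isCompact hK).norm
  have hbound : Integrable (K.indicator fun z => ‖(z - c)⁻¹‖ * |C|) := by
    have h : IntegrableOn (fun z => ‖(z - c)⁻¹‖ * |C|) K := Integrable.mul_const hinvK |C|
    exact h.integrable_indicator hK.measurableSet
  have hmain := hasFDerivAt_integral_of_dominated_of_fderiv_le (𝕜 := ℝ) (μ := volume)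
    (s := Metric.closedBall q₀ ε) (F := fun q z => (z - c)⁻¹ * u (q, z))
    (F' := fun q z => (z - c)⁻¹ • (fderiv ℝ u (q, z)).comp ι) (x₀ := q₀)
    (bound := fun z => K.indicator (fun z => ‖(z - c)⁻¹‖ * |C|) z)
    (Metric.closedBall_mem_nhds q₀ hε)
    (by
      filter_upwards [hD.mem_nhds hq₀] with q hq
      exact hinvm.aestronglyMeasurable.mul (hcont q hq).aestronglyMeasurable)
    (integrable_inv_mul c (hcont q₀ hq₀) (hcs q₀ hq₀)) hF'm
    (Filter.Eventually.of_forall fun z q hq => by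
      have h1 : ‖(fderiv ℝ u (q, z)).comp ι‖ ≤ ‖fderiv ℝ u (q, z)‖ :=
        (ContinuousLinearMap.opNorm_comp_le _ _).trans (mul_le_of_le_one_right (norm_nonneg _)
          (ContinuousLinearMap.norm_inl_le_one ℝ P ℂ))
      rw [norm_smul]
      have h2 := h1.trans (hC0 q hq z)
      by_cases hz : z ∈ K
      · rw [Set.indicator_of_mem hz] at h2 ⊢
        gcongr
      · rw [Set.indicator_of_notMem hz] at h2 ⊢
        rw [le_antisymm h2 (norm_nonneg _), mul_zero])
    hbound
    (Filter.Eventually.of_forall fun z q hq => by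
      have h1 : HasFDerivAt (fun q => u (q, z)) ((fderiv ℝ u (q, z)).comp ι) q :=
        HasFDerivAt.comp q (g := u) (hdiff q (hεD hq) z).hasFDerivAt (hasFDerivAt_prodMk_left q z)
      exact h1.const_smul (z - c)⁻¹)
  have hF'i : Integrable (fun z => (z - c)⁻¹ • (fderiv ℝ u (q₀, z)).comp ι) volume := by
    refine hbound.mono' hF'm
      (Filter.Eventually.of_forall fun z => ?_)
    have h1 : ‖(fderiv ℝ u (q₀, z)).comp ι‖ ≤ ‖fderiv ℝ u (q₀, z)‖ :=
      (ContinuousLinearMap.opNorm_comp_le _ _).trans (mul_le_of_le_one_right (norm_nonneg _)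
        (ContinuousLinearMap.norm_inl_le_one ℝ P ℂ))
    rw [norm_smul]
    have h2 := h1.trans (hC0 q₀ (Metric.mem_closedBall_self hε.le) z)
    by_cases hz : z ∈ K
    · rw [Set.indicator_of_mem hz] at h2 ⊢
      gcongr
    · rw [Set.indicator_of_notMem hz] at h2 ⊢
      rw [le_antisymm h2 (norm_nonneg _), mul_zero]
  set L : P →L[ℝ] ℂ := ∫ z, (z - c)⁻¹ • (fderiv ℝ u (q₀, z)).comp ι with hL
  have hLv : ∀ v, L v = ∫ z, (z - c)⁻¹ * pt v u (q₀, z) := by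
    intro v
    rw [hL, ContinuousLinearMap.integral_apply hF'i]
    refine integral_congr_ae (Filter.Eventually.of_forall fun z => ?_)
    simp [cD, ι]
  -- Dominated differentiation was carried out over the reals. The derivative is complex linear
  -- because the integrand is holomorphic in the parameter for every `z` except the single point
  -- `c`.
  have hptlin : ∀ z ≠ c, ∀ (k : ℂ) (v : P), pt (k • v) u (q₀, z) = k * pt v u (q₀, z) := by
    intro z hz k v
    have h1 := (hol z hz).differentiableAt (hD.mem_nhds hq₀)
    have h2 : ∀ v, fderiv ℂ (fun q => u (q, z)) q₀ v = pt v u (q₀, z) := fun v =>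
      fderiv_slice (w := (q₀, z)) (hdiff q₀ hq₀ z) h1 v
    rw [← h2, ← h2, map_smul, smul_eq_mul]
  have hlin : ∀ (k : ℂ) (v : P), L (k • v) = k • L v := by
    intro k v
    rw [hLv, hLv, smul_eq_mul, ← integral_const_mul]
    refine integral_congr_ae ?_
    filter_upwards [(Set.finite_singleton c).countable.ae_notMem volume] with z hz
    rw [hptlin z (by simpa using hz)]
    ring
  let A : P →L[ℂ] ℂ := { toFun := L, map_add' := L.map_add, map_smul' := hlin, cont := L.cont }
  refine ⟨A, hasFDerivAt_of_restrictScalars ℝ (g' := L) hmain (by ext v; rfl), hLv⟩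

end ParamIntegral

/-! ### Coordinate changes on a Riemann surface -/

section Charts

variable {S : Type*} [TopologicalSpace S] [ChartedSpace ℂ S]
variable {E E₁ E₂ : Type*} [NormedAddCommGroup E] [NormedSpace ℂ E]
  [NormedAddCommGroup E₁] [NormedSpace ℂ E₁] [NormedAddCommGroup E₂] [NormedSpace ℂ E₂]

/-- The factor `c^a c̄^b` by which differentials of type `(a, b)` transform. -/
def fac (a b : ℤ) (c : ℂ) : ℂ := c ^ a * (starRingEnd ℂ) c ^ b

theorem fac_mul (a b : ℤ) (c d : ℂ) : fac a b (c * d) = fac a b c * fac a b d := by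
  simp only [fac, map_mul, mul_zpow]; ring

@[simp] theorem fac_one (a b : ℤ) : fac a b 1 = 1 := by simp [fac]

theorem fac_ne_zero (a b : ℤ) {c : ℂ} (hc : c ≠ 0) : fac a b c ≠ 0 :=
  mul_ne_zero (zpow_ne_zero _ hc) (zpow_ne_zero _ (by simpa using hc))

theorem fac_add (a b a' b' : ℤ) {c : ℂ} (hc : c ≠ 0) :
    fac (a + a') (b + b') c = fac a b c * fac a' b' c := by
  have hc' : (starRingEnd ℂ) c ≠ 0 := by simpa using hc
  simp only [fac, zpow_add₀ hc, zpow_add₀ hc']; ring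

/-- The derivative of the coordinate change from `φ` to `ψ`. -/
def jac (φ ψ : OpenPartialHomeomorph S ℂ) (z : ℂ) : ℂ := deriv (fun ζ => ψ (φ.symm ζ)) z

/-- The domain of the coordinate change from `φ` to `ψ`. -/
def overlap (φ ψ : OpenPartialHomeomorph S ℂ) : Set ℂ := φ.target ∩ φ.symm ⁻¹' ψ.source

theorem isOpen_overlap (φ ψ : OpenPartialHomeomorph S ℂ) : IsOpen (overlap φ ψ) :=
  φ.symm.isOpen_inter_preimage ψ.open_source

theorem loc_eq (a b : ℤ) (φ : OpenPartialHomeomorph S ℂ) (f : S → E) (z : ℂ) :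
    loc a b φ f z = fac a b (jac φ (chartAt ℂ (φ.symm z)) z) • f (φ.symm z) := rfl

section Holo

variable [IsManifold 𝓘(ℂ) ω S] {φ ψ χ : OpenPartialHomeomorph S ℂ}

theorem contDiffOn_trans (hφ : φ ∈ atlas ℂ S) (hψ : ψ ∈ atlas ℂ S) :
    ContDiffOn ℂ ω (fun ζ => ψ (φ.symm ζ)) (overlap φ ψ) := by
  have h := (contDiffGroupoid ω 𝓘(ℂ)).compatible hφ hψ
  have h2 := (mem_groupoid_of_pregroupoid.1 h).1
  simpa [contDiffPregroupoid, overlap, Function.comp_def] using h2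

theorem differentiableAt_trans (hφ : φ ∈ atlas ℂ S) (hψ : ψ ∈ atlas ℂ S) {z : ℂ}
    (hz : z ∈ overlap φ ψ) : DifferentiableAt ℂ (fun ζ => ψ (φ.symm ζ)) z :=
  ((contDiffOn_trans hφ hψ).differentiableOn (by simp)).differentiableAt
    ((isOpen_overlap φ ψ).mem_nhds hz)

theorem contDiffOn_jac (hφ : φ ∈ atlas ℂ S) (hψ : ψ ∈ atlas ℂ S) :
    ContDiffOn ℂ ∞ (jac φ ψ) (overlap φ ψ) :=
  ((contDiffOn_trans hφ hψ).of_le (m := ∞) le_top).deriv_of_isOpen (isOpen_overlap φ ψ) (by simp)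

theorem jac_comp (hφ : φ ∈ atlas ℂ S) (hψ : ψ ∈ atlas ℂ S) (hχ : χ ∈ atlas ℂ S) {z : ℂ}
    (hz : z ∈ φ.target) (hz' : φ.symm z ∈ ψ.source) (hz'' : φ.symm z ∈ χ.source) :
    jac φ χ z = jac ψ χ (ψ (φ.symm z)) * jac φ ψ z := by
  have h1 := (differentiableAt_trans hφ hψ ⟨hz, hz'⟩).hasDerivAt
  have hm : ψ (φ.symm z) ∈ overlap ψ χ := ⟨ψ.map_source hz', by
    simpa [ψ.left_inv hz'] using hz''⟩
  have h2 := (differentiableAt_trans hψ hχ hm).hasDerivAt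
  have h3 := h2.comp z h1
  have h4 : (fun ζ => χ (φ.symm ζ)) =ᶠ[𝓝 z]
      (fun ζ => χ (ψ.symm ζ)) ∘ fun ζ => ψ (φ.symm ζ) := by
    filter_upwards [(isOpen_overlap φ ψ).mem_nhds ⟨hz, hz'⟩] with y hy
    simp [ψ.left_inv hy.2]
  exact (h3.congr_of_eventuallyEq h4).deriv

theorem jac_self {z : ℂ} (hz : z ∈ φ.target) : jac φ φ z = 1 := by
  have h : (fun ζ => φ (φ.symm ζ)) =ᶠ[𝓝 z] id := by
    filter_upwards [φ.open_target.mem_nhds hz] with y hy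
    simp [φ.right_inv hy]
  rw [jac, h.deriv_eq, deriv_id]

theorem jac_ne_zero (hφ : φ ∈ atlas ℂ S) (hψ : ψ ∈ atlas ℂ S) {z : ℂ} (hz : z ∈ overlap φ ψ) :
    jac φ ψ z ≠ 0 := by
  have h := jac_comp hφ hψ hφ hz.1 hz.2 (φ.map_target hz.1)
  rw [jac_self hz.1] at h
  exact fun h0 => by simp [h0] at h

theorem jac_chartAt_ne_zero (hφ : φ ∈ atlas ℂ S) {z : ℂ} (hz : z ∈ φ.target) :
    jac φ (chartAt ℂ (φ.symm z)) z ≠ 0 :=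
  jac_ne_zero hφ (chart_mem_atlas ℂ _) ⟨hz, mem_chart_source ℂ _⟩

/-- The coefficient stored at a point refers to its preferred chart, which changes from point to
point. Both sides compare with the same preferred chart, and the chain rule for the coordinate
changes does the rest. -/
theorem loc_change (a b : ℤ) (hφ : φ ∈ atlas ℂ S) (hψ : ψ ∈ atlas ℂ S) (f : S → E) {z : ℂ}
    (hz : z ∈ overlap φ ψ) :
    loc a b φ f z = fac a b (jac φ ψ z) • loc a b ψ f (ψ (φ.symm z)) := by
  have hs : ψ.symm (ψ (φ.symm z)) = φ.symm z := ψ.left_inv hz.2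
  rw [loc_eq, loc_eq, hs, smul_smul, ← fac_mul, mul_comm,
    ← jac_comp hφ hψ (chart_mem_atlas ℂ _) hz.1 hz.2 (mem_chart_source ℂ _)]

theorem loc_chartAt (a b : ℤ) (f : S → E) (r : S) :
    loc a b (chartAt ℂ r) f (chartAt ℂ r r) = f r := by
  have h : (chartAt ℂ r).symm (chartAt ℂ r r) = r := (chartAt ℂ r).left_inv (mem_chart_source ℂ r)
  rw [loc_eq, h, jac_self (mem_chart_target ℂ r), fac_one, one_smul]

theorem loc_eq_zero_iff (a b : ℤ) (hφ : φ ∈ atlas ℂ S) (f : S → E) {z : ℂ} (hz : z ∈ φ.target) :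
    loc a b φ f z = 0 ↔ f (φ.symm z) = 0 := by
  rw [loc_eq, smul_eq_zero, or_iff_right (fac_ne_zero a b (jac_chartAt_ne_zero hφ hz))]

theorem loc_bilin (B : E₁ →L[ℂ] E₂ →L[ℂ] E) {a b a' b' a'' b'' : ℤ} (ha : a + a' = a'')
    (hb : b + b' = b'') (hφ : φ ∈ atlas ℂ S) (f : S → E₁) (g : S → E₂) {z : ℂ} (hz : z ∈ φ.target) :
    loc a'' b'' φ (fun r => B (f r) (g r)) z = B (loc a b φ f z) (loc a' b' φ g z) := by
  subst ha hb
  rw [loc_eq, loc_eq, loc_eq, fac_add _ _ _ _ (jac_chartAt_ne_zero hφ hz)]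
  simp [smul_smul, mul_comm]

theorem contDiffOn_fac_jac (a b : ℤ) (hφ : φ ∈ atlas ℂ S) (hψ : ψ ∈ atlas ℂ S) :
    ContDiffOn ℝ ∞ (fun z => fac a b (jac φ ψ z)) (overlap φ ψ) := by
  have hj : ContDiffOn ℝ ∞ (jac φ ψ) (overlap φ ψ) := (contDiffOn_jac hφ hψ).restrict_scalars ℝ
  have hc : ContDiffOn ℝ ∞ (fun z => (starRingEnd ℂ) (jac φ ψ z)) (overlap φ ψ) :=
    Complex.conjCLE.contDiff.comp_contDiffOn hj
  have hz : ∀ (n : ℤ) {k : ℂ → ℂ}, ContDiffOn ℝ ∞ k (overlap φ ψ) → (∀ z ∈ overlap φ ψ, k z ≠ 0) →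
      ContDiffOn ℝ ∞ (fun z => k z ^ n) (overlap φ ψ) := by
    intro n k hk hk0
    cases n with
    | ofNat m => simpa using hk.pow m
    | negSucc m =>
      simp only [zpow_negSucc]
      exact (hk.pow (m + 1)).inv fun z hz => pow_ne_zero _ (hk0 z hz)
  exact (hz a hj fun z hz => jac_ne_zero hφ hψ hz).mul
    (hz b hc fun z hz => by simpa using jac_ne_zero hφ hψ hz)

end Holo

theorem loc_add (a b : ℤ) (φ : OpenPartialHomeomorph S ℂ) (f g : S → E) (z : ℂ) :
    loc a b φ (fun r => f r + g r) z = loc a b φ f z + loc a b φ g z := by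
  simp [loc_eq]

theorem loc_sub (a b : ℤ) (φ : OpenPartialHomeomorph S ℂ) (f g : S → E) (z : ℂ) :
    loc a b φ (fun r => f r - g r) z = loc a b φ f z - loc a b φ g z := by
  simp [loc_eq, smul_sub]

theorem loc_const_smul (a b : ℤ) (φ : OpenPartialHomeomorph S ℂ) (c : ℂ) (f : S → E) (z : ℂ) :
    loc a b φ (fun r => c • f r) z = c • loc a b φ f z := by
  simp only [loc_eq]; module

theorem loc_map (a b : ℤ) (φ : OpenPartialHomeomorph S ℂ) (T : E →L[ℂ] E₁) (f : S → E) (z : ℂ) :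
    loc a b φ (fun r => T (f r)) z = T (loc a b φ f z) := by
  simp [loc_eq]

theorem loc_congr {a b : ℤ} {φ : OpenPartialHomeomorph S ℂ} {f g : S → E} {z : ℂ}
    (h : f (φ.symm z) = g (φ.symm z)) : loc a b φ f z = loc a b φ g z := by
  simp [loc_eq, h]

theorem loc_zero_zero (φ : OpenPartialHomeomorph S ℂ) (f : S → E) (z : ℂ) :
    loc 0 0 φ f z = f (φ.symm z) := by
  simp [loc_eq, fac]

/-! ### The operators `∂` and `∂̄` in an arbitrary chart -/

variable [IsManifold 𝓘(ℂ) ω S] {φ ψ : OpenPartialHomeomorph S ℂ}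

theorem differentiableAt_loc_change (a b : ℤ) (hφ : φ ∈ atlas ℂ S) (hψ : ψ ∈ atlas ℂ S) {f : S → E}
    {z : ℂ} (hz : z ∈ overlap φ ψ) (hf : DifferentiableAt ℝ (loc a b ψ f) (ψ (φ.symm z))) :
    DifferentiableAt ℝ (loc a b φ f) z := by
  have h1 : DifferentiableAt ℝ (fun z => fac a b (jac φ ψ z)) z :=
    diffAt (isOpen_overlap φ ψ) (by simp) (contDiffOn_fac_jac a b hφ hψ) hz
  have h2 : DifferentiableAt ℝ (fun ζ => ψ (φ.symm ζ)) z :=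
    (differentiableAt_trans hφ hψ hz).restrictScalars ℝ
  have h3 : DifferentiableAt ℝ (fun ζ => loc a b ψ f (ψ (φ.symm ζ))) z :=
    DifferentiableAt.comp z (g := loc a b ψ f) hf h2
  refine (h1.smul h3).congr_of_eventuallyEq ?_
  filter_upwards [(isOpen_overlap φ ψ).mem_nhds hz] with y hy
  exact loc_change a b hφ hψ f hy

/-- For type `(0, b)` the transition factor is antiholomorphic, so `∂` does not differentiate it and
`∂f` transforms as a differential of type `(1, b)`. -/
theorem loc_del (b : ℤ) (hφ : φ ∈ atlas ℂ S) {f : S → E} {z : ℂ} (hz : z ∈ φ.target)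
    (hf : DifferentiableAt ℝ (loc 0 b φ f) z) :
    loc 1 b φ (del 0 b f) z = wirt (loc 0 b φ f) z := by
  set r := φ.symm z with hr
  set ψ := chartAt ℂ r with hψ
  have hψa : ψ ∈ atlas ℂ S := chart_mem_atlas ℂ r
  have hov : z ∈ overlap φ ψ := ⟨hz, mem_chart_source ℂ r⟩
  have hov' : ψ r ∈ overlap ψ φ := ⟨mem_chart_target ℂ r, by
    simpa [ψ, (chartAt ℂ r).left_inv (mem_chart_source ℂ r)] using φ.map_target hz⟩
  have hback : φ (ψ.symm (ψ r)) = z := by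
    rw [ψ.left_inv (mem_chart_source ℂ r), hr, φ.right_inv hz]
  have hd : DifferentiableAt ℝ (loc 0 b ψ f) (ψ r) :=
    differentiableAt_loc_change 0 b hψa hφ hov' (by rwa [hback])
  have h1 : loc 0 b φ f =ᶠ[𝓝 z]
      fun y => fac 0 b (jac φ ψ y) • loc 0 b ψ f (ψ (φ.symm y)) := by
    filter_upwards [(isOpen_overlap φ ψ).mem_nhds hov] with y hy
    exact loc_change 0 b hφ hψa f hy
  have hdf : DifferentiableAt ℝ (fun z => fac 0 b (jac φ ψ z)) z :=
    diffAt (isOpen_overlap φ ψ) (by simp) (contDiffOn_fac_jac 0 b hφ hψa) hov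
  have hdt := differentiableAt_trans hφ hψa hov
  have hdc : DifferentiableAt ℝ (fun y => loc 0 b ψ f (ψ (φ.symm y))) z :=
    DifferentiableAt.comp z (g := loc 0 b ψ f) hd (hdt.restrictScalars ℝ)
  have hfac : wirt (fun y => fac 0 b (jac φ ψ y)) z = 0 := by
    have hj : DifferentiableAt ℂ (fun y => jac φ ψ y ^ b) z :=
      DifferentiableAt.zpow (((contDiffOn_jac hφ hψa).differentiableOn (by simp)).differentiableAt
        ((isOpen_overlap φ ψ).mem_nhds hov)) (Or.inl (jac_ne_zero hφ hψa hov))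
    have := wirt_of_antiholo hj
    simpa [fac] using this
  rw [wirt_eq_cD, cD_congr h1, cD_smul hdf hdc, ← wirt_eq_cD, hfac, zero_smul, zero_add,
    ← wirt_eq_cD, wirt_comp (h := fun y => ψ (φ.symm y)) hd hdt, loc_eq, ← hr, del, smul_smul]
  congr 1
  simp [fac, jac, mul_comm]
  rfl

/-- For type `(a, 0)` the transition factor is holomorphic and invisible to `∂̄`. -/
theorem loc_delBar (a : ℤ) (hφ : φ ∈ atlas ℂ S) {f : S → E} {z : ℂ} (hz : z ∈ φ.target)
    (hf : DifferentiableAt ℝ (loc a 0 φ f) z) :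
    loc a 1 φ (delBar a 0 f) z = wirtBar (loc a 0 φ f) z := by
  set r := φ.symm z with hr
  set ψ := chartAt ℂ r with hψ
  have hψa : ψ ∈ atlas ℂ S := chart_mem_atlas ℂ r
  have hov : z ∈ overlap φ ψ := ⟨hz, mem_chart_source ℂ r⟩
  have hov' : ψ r ∈ overlap ψ φ := ⟨mem_chart_target ℂ r, by
    simpa [ψ, (chartAt ℂ r).left_inv (mem_chart_source ℂ r)] using φ.map_target hz⟩
  have hback : φ (ψ.symm (ψ r)) = z := by
    rw [ψ.left_inv (mem_chart_source ℂ r), hr, φ.right_inv hz]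
  have hd : DifferentiableAt ℝ (loc a 0 ψ f) (ψ r) :=
    differentiableAt_loc_change a 0 hψa hφ hov' (by rwa [hback])
  have h1 : loc a 0 φ f =ᶠ[𝓝 z]
      fun y => fac a 0 (jac φ ψ y) • loc a 0 ψ f (ψ (φ.symm y)) := by
    filter_upwards [(isOpen_overlap φ ψ).mem_nhds hov] with y hy
    exact loc_change a 0 hφ hψa f hy
  have hdf : DifferentiableAt ℝ (fun z => fac a 0 (jac φ ψ z)) z :=
    diffAt (isOpen_overlap φ ψ) (by simp) (contDiffOn_fac_jac a 0 hφ hψa) hov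
  have hdt := differentiableAt_trans hφ hψa hov
  have hdc : DifferentiableAt ℝ (fun y => loc a 0 ψ f (ψ (φ.symm y))) z :=
    DifferentiableAt.comp z (g := loc a 0 ψ f) hd (hdt.restrictScalars ℝ)
  have hfac : wirtBar (fun y => fac a 0 (jac φ ψ y)) z = 0 := by
    have hj : DifferentiableAt ℂ (fun y => jac φ ψ y ^ a) z :=
      DifferentiableAt.zpow (((contDiffOn_jac hφ hψa).differentiableOn (by simp)).differentiableAt
        ((isOpen_overlap φ ψ).mem_nhds hov)) (Or.inl (jac_ne_zero hφ hψa hov))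
    have := wirtBar_of_holo hj
    simpa [fac] using this
  rw [wirtBar_eq_cD, cD_congr h1, cD_smul hdf hdc, ← wirtBar_eq_cD, hfac, zero_smul, zero_add,
    ← wirtBar_eq_cD, wirtBar_comp (h := fun y => ψ (φ.symm y)) hd hdt, loc_eq, ← hr, delBar,
    smul_smul]
  congr 1
  simp [fac, jac]
  rfl

end Charts

/-! ### Families of differentials with poles at the marked points -/

section Families

variable {S : Type*} [TopologicalSpace S] [ChartedSpace ℂ S]
variable {P E E₁ E₂ : Type*} [NormedAddCommGroup P] [NormedSpace ℂ P]
  [NormedAddCommGroup E] [NormedSpace ℂ E]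
  [NormedAddCommGroup E₁] [NormedSpace ℂ E₁] [NormedAddCommGroup E₂] [NormedSpace ℂ E₂] {n : ℕ}

/-- The coefficient of a family of differentials in a chart, as a function of the parameter and the
coordinate. -/
abbrev lf (a b : ℤ) (φ : OpenPartialHomeomorph S ℂ) (F : P → S → E) (w : P × ℂ) : E :=
  loc a b φ (F w.1) w.2

/-- The coordinates of the points of a chart that are not marked. -/
def punct (mark : Fin n → S) (φ : OpenPartialHomeomorph S ℂ) : Set ℂ :=
  φ.target ∩ φ.symm ⁻¹' (Set.range mark)ᶜ

theorem isOpen_punct [T2Space S] (mark : Fin n → S) (φ : OpenPartialHomeomorph S ℂ) :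
    IsOpen (punct mark φ) :=
  φ.symm.isOpen_inter_preimage (Set.finite_range mark).isClosed.isOpen_compl

/-- Around a marked point there is a neighbourhood in the chart without other marked points. -/
theorem exists_isolating [T2Space S] (mark : Fin n → S) (φ : OpenPartialHomeomorph S ℂ) {c : Fin n}
    (hc : mark c ∈ φ.source) :
    ∃ N : Set ℂ, IsOpen N ∧ φ (mark c) ∈ N ∧ N ⊆ φ.target ∧
      ∀ z ∈ N, z ≠ φ (mark c) → z ∈ punct mark φ := by
  have hfin : (Set.range mark \ {mark c}).Finite := (Set.finite_range mark).subset Set.sdiff_subset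
  refine ⟨φ.target ∩ φ.symm ⁻¹' (Set.range mark \ {mark c})ᶜ,
    φ.symm.isOpen_inter_preimage hfin.isClosed.isOpen_compl, ⟨φ.map_source hc, ?_⟩,
    Set.inter_subset_left, fun z hz hne => ⟨hz.1, fun hr => hz.2 ⟨hr, fun h => hne ?_⟩⟩⟩
  · simp [φ.left_inv hc]
  · rw [← Set.mem_singleton_iff.1 h, φ.right_inv hz.1]

/-- Families of differentials of type `(a, b)`, smooth off the marked points, with poles of order at
most `k` (in the sense of a smooth multiple of `(z - z_c)⁻ᵏ`) at the marked points. -/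
def Mero (mark : Fin n → S) (k : ℕ) (a b : ℤ) (D : Set P) (F : P → S → E) : Prop :=
  (∀ φ ∈ atlas ℂ S, ContDiffOn ℝ ∞ (lf a b φ F) (D ×ˢ punct mark φ)) ∧
  ∀ φ ∈ atlas ℂ S, ∀ c, mark c ∈ φ.source → ∃ N : Set ℂ, IsOpen N ∧ φ (mark c) ∈ N ∧
    N ⊆ φ.target ∧ (∀ z ∈ N, z ≠ φ (mark c) → z ∈ punct mark φ) ∧
    ∃ u : P × ℂ → E, ContDiffOn ℝ ∞ u (D ×ˢ N) ∧ ∀ q ∈ D, ∀ z ∈ N, z ≠ φ (mark c) →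
      lf a b φ F (q, z) = ((z - φ (mark c))⁻¹) ^ k • u (q, z)

variable {mark : Fin n → S} {k k' : ℕ} {a b a' b' a'' b'' : ℤ} {D : Set P}

theorem Mero.intro [T2Space S] {F : P → S → E}
    (h1 : ∀ φ ∈ atlas ℂ S, ContDiffOn ℝ ∞ (lf a b φ F) (D ×ˢ punct mark φ))
    (h2 : ∀ φ ∈ atlas ℂ S, ∀ c, mark c ∈ φ.source → ∃ N ∈ 𝓝 (φ (mark c)),
      ∃ u : P × ℂ → E, ContDiffOn ℝ ∞ u (D ×ˢ N) ∧ ∀ q ∈ D, ∀ z ∈ N, z ≠ φ (mark c) →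
        lf a b φ F (q, z) = ((z - φ (mark c))⁻¹) ^ k • u (q, z)) : Mero mark k a b D F := by
  refine ⟨h1, fun φ hφ c hc => ?_⟩
  obtain ⟨N, hN, u, hu, hF⟩ := h2 φ hφ c hc
  obtain ⟨N', hN', hc', ht, hp⟩ := exists_isolating mark φ hc
  obtain ⟨N'', hN'', ho, hc''⟩ := mem_nhds_iff.1 hN
  exact ⟨N' ∩ N'', hN'.inter ho, ⟨hc', hc''⟩, fun z hz => ht hz.1, fun z hz => hp z hz.1, u,
    hu.mono (Set.prod_mono le_rfl fun z hz => hN'' hz.2), fun q hq z hz => hF q hq z (hN'' hz.2)⟩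

theorem Mero.of_smooth [T2Space S] {F : P → S → E}
    (h : ∀ φ ∈ atlas ℂ S, ContDiffOn ℝ ∞ (lf a b φ F) (D ×ˢ φ.target)) : Mero mark 0 a b D F :=
  Mero.intro (fun φ hφ => (h φ hφ).mono (Set.prod_mono le_rfl Set.inter_subset_left))
    fun φ hφ c hc => ⟨φ.target, φ.open_target.mem_nhds (φ.map_source hc), _, h φ hφ, by simp⟩

theorem Mero.of_const [T2Space S] {f : S → E}
    (h : ∀ φ ∈ atlas ℂ S, ContDiffOn ℝ ∞ (loc a b φ f) φ.target) :
    Mero mark 0 a b D fun _ => f :=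
  Mero.of_smooth fun φ hφ => (h φ hφ).comp contDiffOn_snd fun _ hw => hw.2

theorem SmoothFamily.mero [T2Space S] {F : P → S → E} (h : SmoothFamily a b D F) :
    Mero mark 0 a b D F := Mero.of_smooth h.1

theorem contDiffOn_sub_inv_pow {X : Type*} [NormedAddCommGroup X] [NormedSpace ℝ X] {k : ℕ} {c : ℂ}
    {U : Set (X × ℂ)} (h : ∀ w ∈ U, w.2 ≠ c) :
    ContDiffOn ℝ ∞ (fun w : X × ℂ => ((w.2 - c)⁻¹) ^ k) U :=
  ((contDiffOn_snd.sub contDiffOn_const).inv fun w hw => sub_ne_zero.2 (h w hw)).pow k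

/-- The residue is holomorphic in a finite dimensional parameter and hence smooth, so `res + (z -
z_c) h` is a smooth numerator for the simple pole. -/
theorem PoleFamily.mero [T2Space S] [FiniteDimensional ℂ P] [FiniteDimensional ℂ E] (hD : IsOpen D)
    {F : P → S → E} {res : P → Fin n → E} (h : PoleFamily mark D F res) :
    Mero mark 1 1 0 D F := by
  refine Mero.intro h.1 fun φ hφ c hc => ?_
  obtain ⟨N, hN, u, hu, hF⟩ := h.2.1 φ hφ c hc
  have hres : ContDiffOn ℝ ∞ (fun q => res q c) D := contDiffOn_real_of_differentiableOn hD (h.2.2.2 c)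
  refine ⟨N, hN, fun w => res w.1 c + (w.2 - φ (mark c)) • u w, ?_, fun q hq z hz hne => ?_⟩
  · exact (hres.comp contDiffOn_fst fun w hw => hw.1).add
      ((contDiffOn_snd.sub contDiffOn_const).smul hu)
  · have h0 : z - φ (mark c) ≠ 0 := sub_ne_zero.2 hne
    rw [pow_one, smul_add, inv_smul_smul₀ h0]
    exact hF q hq z hz hne

theorem Mero.mono {F : P → S → E} (hF : Mero mark k a b D F) (h : k ≤ k') :
    Mero mark k' a b D F := by
  refine ⟨hF.1, fun φ hφ c hc => ?_⟩
  obtain ⟨N, hN, hc', ht, hp, u, hu, hFu⟩ := hF.2 φ hφ c hc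
  refine ⟨N, hN, hc', ht, hp, fun w => (w.2 - φ (mark c)) ^ (k' - k) • u w,
    ((contDiffOn_snd.sub contDiffOn_const).pow _).smul hu, fun q hq z hz hne => ?_⟩
  have h0 : z - φ (mark c) ≠ 0 := sub_ne_zero.2 hne
  rw [hFu q hq z hz hne, smul_smul]
  congr 1
  obtain ⟨m, rfl⟩ := Nat.exists_eq_add_of_le h
  rw [Nat.add_sub_cancel_left, pow_add, mul_assoc, ← mul_pow, inv_mul_cancel₀ h0, one_pow, mul_one]

theorem Mero.add {F G : P → S → E} (hF : Mero mark k a b D F) (hG : Mero mark k a b D G) :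
    Mero mark k a b D fun q r => F q r + G q r := by
  refine ⟨fun φ hφ => ((hF.1 φ hφ).add (hG.1 φ hφ)).congr fun w _ => loc_add _ _ _ _ _ _,
    fun φ hφ c hc => ?_⟩
  obtain ⟨N, hN, hc', ht, hp, u, hu, hFu⟩ := hF.2 φ hφ c hc
  obtain ⟨N₁, hN₁, hc₁, -, -, u₁, hu₁, hGu⟩ := hG.2 φ hφ c hc
  refine ⟨N ∩ N₁, hN.inter hN₁, ⟨hc', hc₁⟩, fun z hz => ht hz.1, fun z hz => hp z hz.1,
    fun w => u w + u₁ w, (hu.mono (Set.prod_mono le_rfl Set.inter_subset_left)).add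
      (hu₁.mono (Set.prod_mono le_rfl Set.inter_subset_right)), fun q hq z hz hne => ?_⟩
  rw [smul_add, ← hFu q hq z hz.1 hne, ← hGu q hq z hz.2 hne]
  exact loc_add _ _ _ _ _ _

theorem Mero.map (T : E →L[ℂ] E₁) {F : P → S → E} (hF : Mero mark k a b D F) :
    Mero mark k a b D fun q r => T (F q r) := by
  have hT : ContDiff ℝ ∞ (fun x => T x) := (T.restrictScalars ℝ).contDiff
  refine ⟨fun φ hφ => (hT.comp_contDiffOn (hF.1 φ hφ)).congr fun w _ => loc_map _ _ _ _ _ _,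
    fun φ hφ c hc => ?_⟩
  obtain ⟨N, hN, hc', ht, hp, u, hu, hFu⟩ := hF.2 φ hφ c hc
  refine ⟨N, hN, hc', ht, hp, fun w => T (u w), hT.comp_contDiffOn hu, fun q hq z hz hne => ?_⟩
  rw [← map_smul, ← hFu q hq z hz hne]
  exact loc_map _ _ _ _ _ _

theorem Mero.const_smul (s : ℂ) {F : P → S → E} (hF : Mero mark k a b D F) :
    Mero mark k a b D fun q r => s • F q r := by
  simpa using hF.map (s • ContinuousLinearMap.id ℂ E)

theorem Mero.neg {F : P → S → E} (hF : Mero mark k a b D F) :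
    Mero mark k a b D fun q r => -F q r := by
  simpa using hF.map (-ContinuousLinearMap.id ℂ E)

theorem Mero.sub {F G : P → S → E} (hF : Mero mark k a b D F) (hG : Mero mark k a b D G) :
    Mero mark k a b D fun q r => F q r - G q r := by
  simpa [sub_eq_add_neg] using hF.add hG.neg

/-- For the zero family only the existence of chart neighbourhoods without other marked points has
content. It is the empty sum in `Mero.sum`. -/
theorem Mero.zero : (Mero mark k a b D fun _ _ => (0 : E)) ↔
    ∀ φ ∈ atlas ℂ S, ∀ c, mark c ∈ φ.source → ∃ N : Set ℂ, IsOpen N ∧ φ (mark c) ∈ N ∧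
      N ⊆ φ.target ∧ (∀ z ∈ N, z ≠ φ (mark c) → z ∈ punct mark φ) := by
  constructor
  · intro h φ hφ c hc
    obtain ⟨N, hN, hc', ht, hp, -⟩ := h.2 φ hφ c hc
    exact ⟨N, hN, hc', ht, hp⟩
  · intro h
    refine ⟨fun φ hφ => (contDiffOn_const (c := (0 : E))).congr fun w _ => by simp [lf, loc_eq], fun φ hφ c hc => ?_⟩
    obtain ⟨N, hN, hc', ht, hp⟩ := h φ hφ c hc
    exact ⟨N, hN, hc', ht, hp, fun _ => 0, contDiffOn_const, by simp [lf, loc_eq]⟩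

theorem Mero.sum [T2Space S] {ι : Type*} (s : Finset ι) {F : ι → P → S → E}
    (hF : ∀ i ∈ s, Mero mark k a b D (F i)) : Mero mark k a b D fun q r => ∑ i ∈ s, F i q r := by
  classical
  induction s using Finset.induction_on with
  | empty =>
    simp only [Finset.sum_empty]
    exact Mero.zero.2 fun φ _ c hc => exists_isolating mark φ hc
  | insert i s hi ih =>
    simp only [Finset.sum_insert hi]
    exact (hF i (Finset.mem_insert_self i s)).add
      (ih fun j hj => hF j (Finset.mem_insert_of_mem hj))

section Holo

variable [IsManifold 𝓘(ℂ) ω S]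

theorem Mero.bilin (B : E₁ →L[ℂ] E₂ →L[ℂ] E) (ha : a + a' = a'') (hb : b + b' = b'')
    {F : P → S → E₁} {G : P → S → E₂} (hF : Mero mark k a b D F) (hG : Mero mark k' a' b' D G) :
    Mero mark (k + k') a'' b'' D fun q r => B (F q r) (G q r) := by
  refine ⟨fun φ hφ => (contDiffOn_bilin B (hF.1 φ hφ) (hG.1 φ hφ)).congr fun w hw =>
    loc_bilin B ha hb hφ _ _ hw.2.1, fun φ hφ c hc => ?_⟩
  obtain ⟨N, hN, hc', ht, hp, u, hu, hFu⟩ := hF.2 φ hφ c hc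
  obtain ⟨N₁, hN₁, hc₁, -, -, u₁, hu₁, hGu⟩ := hG.2 φ hφ c hc
  refine ⟨N ∩ N₁, hN.inter hN₁, ⟨hc', hc₁⟩, fun z hz => ht hz.1, fun z hz => hp z hz.1,
    fun w => B (u w) (u₁ w), contDiffOn_bilin B
      (hu.mono (Set.prod_mono le_rfl Set.inter_subset_left))
      (hu₁.mono (Set.prod_mono le_rfl Set.inter_subset_right)), fun q hq z hz hne => ?_⟩
  have h1 : lf a'' b'' φ (fun q r => B (F q r) (G q r)) (q, z)
      = B (lf a b φ F (q, z)) (lf a' b' φ G (q, z)) := loc_bilin B ha hb hφ _ _ (ht hz.1)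
  rw [h1, hFu q hq z hz.1 hne, hGu q hq z hz.2 hne, map_smul, map_smul, smul_apply, smul_smul,
    pow_add, mul_comm]

theorem Mero.smul (ha : a + a' = a'') (hb : b + b' = b'')
    {F : P → S → ℂ} {G : P → S → E} (hF : Mero mark k a b D F) (hG : Mero mark k' a' b' D G) :
    Mero mark (k + k') a'' b'' D fun q r => F q r • G q r :=
  hF.bilin (ContinuousLinearMap.lsmul ℂ ℂ) ha hb hG

theorem Mero.lie {V : Type*} [NormedAddCommGroup V] [NormedSpace ℂ V] (ha : a + a' = a'')
    (hb : b + b' = b'') {F G : P → S → V →L[ℂ] V} (hF : Mero mark k a b D F)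
    (hG : Mero mark k' a' b' D G) : Mero mark (k + k') a'' b'' D fun q r => ⁅F q r, G q r⁆ := by
  simpa only [lieB_apply] using hF.bilin (lieB V) ha hb hG

variable [T2Space S]

/-- Multiplication by a Beltrami differential lowers the order of the pole. -/
theorem Mero.smul_vanish {μ : S → ℂ}
    (hμ : ∀ φ ∈ atlas ℂ S, ContDiffOn ℝ ∞ (loc (-1) 1 φ μ) φ.target)
    (hμ0 : ∀ φ ∈ atlas ℂ S, ∀ c, mark c ∈ φ.source → ∃ m : ℂ → ℂ,
      ContDiffAt ℝ ∞ m (φ (mark c)) ∧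
        ∀ᶠ z in 𝓝 (φ (mark c)), loc (-1) 1 φ μ z = (z - φ (mark c)) * m z)
    (ha : -1 + a = a') (hb : 1 + b = b') {F : P → S → E} (hF : Mero mark (k + 1) a b D F) :
    Mero mark k a' b' D fun q r => μ r • F q r := by
  refine ⟨((Mero.of_const (mark := mark) hμ).smul ha hb hF).1, fun φ hφ c hc => ?_⟩
  obtain ⟨N, hN, hc', ht, hp, u, hu, hFu⟩ := hF.2 φ hφ c hc
  obtain ⟨m, hm, hev⟩ := hμ0 φ hφ c hc
  obtain ⟨N₁, hN₁, ho, hc₁⟩ := mem_nhds_iff.1 hev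
  -- The hypothesis gives smoothness of `m` only at the marked point itself. At nearby points `m` is
  -- the quotient of the smooth coefficient of `μ` by `z - z_c`.
  have hms : ContDiffOn ℝ ∞ m (N ∩ N₁) := by
    intro z hz
    by_cases hz0 : z = φ (mark c)
    · rw [hz0]; exact hm.contDiffWithinAt
    · have h1 : ContDiffAt ℝ ∞ (fun z => (z - φ (mark c))⁻¹ * loc (-1) 1 φ μ z) z :=
        ((contDiffAt_id.sub contDiffAt_const).inv (sub_ne_zero.2 hz0)).mul
          ((hμ φ hφ).contDiffAt (φ.open_target.mem_nhds (ht hz.1)))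
      refine (h1.congr_of_eventuallyEq ?_).contDiffWithinAt
      filter_upwards [ho.mem_nhds hz.2, isOpen_ne.mem_nhds hz0] with y hy hy0
      rw [hN₁ hy, inv_mul_cancel_left₀ (sub_ne_zero.2 hy0)]
  refine ⟨N ∩ N₁, hN.inter ho, ⟨hc', hc₁⟩, fun z hz => ht hz.1, fun z hz => hp z hz.1,
    fun w => m w.2 • u w, (hms.comp contDiffOn_snd fun w hw => hw.2).smul
      (hu.mono (Set.prod_mono le_rfl Set.inter_subset_left)), fun q hq z hz hne => ?_⟩
  have h0 : z - φ (mark c) ≠ 0 := sub_ne_zero.2 hne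
  have h1 : lf a' b' φ (fun q r => μ r • F q r) (q, z)
      = loc (-1) 1 φ μ z • lf a b φ F (q, z) :=
    loc_bilin (ContinuousLinearMap.lsmul ℂ ℂ) ha hb hφ _ _ (ht hz.1)
  rw [h1, hFu q hq z hz.1 hne, hN₁ hz.2, smul_smul, smul_smul, pow_succ]
  congr 1
  field_simp

theorem loc_del_family (hD : IsOpen D) {F : P → S → E} {φ : OpenPartialHomeomorph S ℂ}
    (hφ : φ ∈ atlas ℂ S) {U : Set ℂ} (hU : IsOpen U) (hUt : U ⊆ φ.target)
    (hF : ContDiffOn ℝ ∞ (lf 0 b φ F) (D ×ˢ U)) {w : P × ℂ} (hw : w ∈ D ×ˢ U) :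
    lf 1 b φ (fun q => del 0 b (F q)) w = pz (lf 0 b φ F) w := by
  have hd : DifferentiableAt ℝ (lf 0 b φ F) w := diffAt (hD.prod hU) (by simp) hF hw
  have hd' : DifferentiableAt ℝ (loc 0 b φ (F w.1)) w.2 :=
    DifferentiableAt.comp w.2 (g := lf 0 b φ F) (f := fun z => (w.1, z)) hd (by fun_prop)
  rw [lf, loc_del b hφ (hUt hw.2) hd', ← wirt_slice hd]

theorem loc_delBar_family (hD : IsOpen D) {F : P → S → E} {φ : OpenPartialHomeomorph S ℂ}
    (hφ : φ ∈ atlas ℂ S) {U : Set ℂ} (hU : IsOpen U) (hUt : U ⊆ φ.target)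
    (hF : ContDiffOn ℝ ∞ (lf a 0 φ F) (D ×ˢ U)) {w : P × ℂ} (hw : w ∈ D ×ˢ U) :
    lf a 1 φ (fun q => delBar a 0 (F q)) w = pzb (lf a 0 φ F) w := by
  have hd : DifferentiableAt ℝ (lf a 0 φ F) w := diffAt (hD.prod hU) (by simp) hF hw
  have hd' : DifferentiableAt ℝ (loc a 0 φ (F w.1)) w.2 :=
    DifferentiableAt.comp w.2 (g := lf a 0 φ F) (f := fun z => (w.1, z)) hd (by fun_prop)
  rw [lf, loc_delBar a hφ (hUt hw.2) hd', ← wirtBar_slice hd]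

/-- Only families without poles are admitted, since `∂` would raise the order of a pole. -/
theorem Mero.del (hD : IsOpen D) {F : P → S → E} (hF : Mero mark 0 0 b D F) :
    Mero mark 0 1 b D fun q => del 0 b (F q) := by
  have ho : ∀ φ : OpenPartialHomeomorph S ℂ, IsOpen (punct mark φ) := isOpen_punct mark
  have key : ∀ φ ∈ atlas ℂ S, ∀ w ∈ D ×ˢ punct mark φ, lf 1 b φ (fun q => Isomonodromy.del 0 b (F q)) w
      = pz (lf 0 b φ F) w := fun φ hφ w hw =>
    loc_del_family hD hφ (ho φ) Set.inter_subset_left (hF.1 φ hφ) hw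
  refine ⟨fun φ hφ => (contDiffOn_cD (hD.prod (ho φ)) (hF.1 φ hφ)).congr (key φ hφ),
    fun φ hφ c hc => ?_⟩
  obtain ⟨N, hN, hc', ht, hp, u, hu, hFu⟩ := hF.2 φ hφ c hc
  refine ⟨N, hN, hc', ht, hp, pz u, contDiffOn_cD (hD.prod hN) hu, fun q hq z hz hne => ?_⟩
  rw [key φ hφ (q, z) ⟨hq, hp z hz hne⟩, pow_zero, one_smul]
  refine cD_congr_on (hD.prod (hN.inter isOpen_ne)) (fun w hw => ?_)
    (⟨hq, hz, hne⟩ : (q, z) ∈ D ×ˢ (N ∩ {z | z ≠ φ (mark c)}))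
  simpa using hFu w.1 hw.1 w.2 hw.2.1 hw.2.2

theorem pzb_inv_pow {c : ℂ} {w : P × ℂ} (hw : w.2 ≠ c) (k : ℕ) :
    pzb (fun w : P × ℂ => ((w.2 - c)⁻¹) ^ k) w = 0 := by
  have ho : IsOpen {w : P × ℂ | w.2 ≠ c} := isOpen_ne_fun (by fun_prop) (by fun_prop)
  have hd : DifferentiableAt ℝ (fun w : P × ℂ => ((w.2 - c)⁻¹) ^ k) w :=
    diffAt ho (n := ∞) (by simp) (contDiffOn_sub_inv_pow fun w hw => hw) hw
  rw [← wirtBar_slice hd]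
  exact wirtBar_of_holo (((differentiableAt_id.sub_const c).inv (sub_ne_zero.2 hw)).pow k)

/-- The factor `(z - z_c)⁻ᵏ` is holomorphic off the marked point, so `∂̄` falls on the numerator
alone and the order of the pole is unchanged. -/
theorem Mero.delBar (hD : IsOpen D) {F : P → S → E} (hF : Mero mark k a 0 D F) :
    Mero mark k a 1 D fun q => delBar a 0 (F q) := by
  have ho : ∀ φ : OpenPartialHomeomorph S ℂ, IsOpen (punct mark φ) := isOpen_punct mark
  have key : ∀ φ ∈ atlas ℂ S, ∀ w ∈ D ×ˢ punct mark φ,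
      lf a 1 φ (fun q => Isomonodromy.delBar a 0 (F q)) w = pzb (lf a 0 φ F) w := fun φ hφ w hw =>
    loc_delBar_family hD hφ (ho φ) Set.inter_subset_left (hF.1 φ hφ) hw
  refine ⟨fun φ hφ => (contDiffOn_cD (hD.prod (ho φ)) (hF.1 φ hφ)).congr (key φ hφ),
    fun φ hφ c hc => ?_⟩
  obtain ⟨N, hN, hc', ht, hp, u, hu, hFu⟩ := hF.2 φ hφ c hc
  refine ⟨N, hN, hc', ht, hp, pzb u, contDiffOn_cD (hD.prod hN) hu, fun q hq z hz hne => ?_⟩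
  have hO : IsOpen (D ×ˢ (N ∩ {z | z ≠ φ (mark c)})) := hD.prod (hN.inter isOpen_ne)
  have hm : (q, z) ∈ D ×ˢ (N ∩ {z | z ≠ φ (mark c)}) := ⟨hq, hz, hne⟩
  rw [key φ hφ (q, z) ⟨hq, hp z hz hne⟩]
  have h1 : pzb (lf a 0 φ F) (q, z)
      = pzb (fun w : P × ℂ => ((w.2 - φ (mark c))⁻¹) ^ k • u w) (q, z) :=
    cD_congr_on hO (fun w hw => hFu w.1 hw.1 w.2 hw.2.1 hw.2.2) hm
  rw [h1, pzb, cD_smul (diffAt hO (n := ∞) (by simp) (contDiffOn_sub_inv_pow fun w hw => hw.2.2) hm)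
    (diffAt (hD.prod hN) (by simp) hu ⟨hq, hz⟩)]
  have h2 := pzb_inv_pow (P := P) (w := (q, z)) hne k
  rw [pzb] at h2
  rw [h2, zero_smul, zero_add]

/-- The derivative of a holomorphic family with respect to the parameter. -/
theorem lf_fderiv (hD : IsOpen D) {F : P → S → E} {φ : OpenPartialHomeomorph S ℂ} {U : Set ℂ}
    (hU : IsOpen U) (hF : ContDiffOn ℝ ∞ (lf a b φ F) (D ×ˢ U))
    (hol : ∀ z ∈ U, DifferentiableOn ℂ (fun q => F q (φ.symm z)) D) (v : P) {w : P × ℂ}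
    (hw : w ∈ D ×ˢ U) :
    lf a b φ (fun q r => fderiv ℂ (fun q' => F q' r) q v) w = pt v (lf a b φ F) w := by
  have hd : DifferentiableAt ℝ (lf a b φ F) w := diffAt (hD.prod hU) (by simp) hF hw
  have h1 : DifferentiableAt ℂ (fun q => F q (φ.symm w.2)) w.1 :=
    (hol w.2 hw.2).differentiableAt (hD.mem_nhds hw.1)
  have h2 : DifferentiableAt ℂ (fun q => lf a b φ F (q, w.2)) w.1 :=
    DifferentiableAt.fun_const_smul h1 (fac a b (jac φ (chartAt ℂ (φ.symm w.2)) w.2))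
  rw [← fderiv_slice hd h2, lf, loc_eq]
  simp only [lf, loc_eq]
  rw [fderiv_fun_const_smul h1, smul_apply]

/-- The position of the pole does not depend on the parameter, so the derivative acts only on the
numerator. -/
theorem Mero.fderiv (hD : IsOpen D) {F : P → S → E} (hF : Mero mark k a b D F)
    (hol : ∀ r ∉ Set.range mark, DifferentiableOn ℂ (fun q => F q r) D) (v : P) :
    Mero mark k a b D fun q r => fderiv ℂ (fun q' => F q' r) q v := by
  have ho : ∀ φ : OpenPartialHomeomorph S ℂ, IsOpen (punct mark φ) := isOpen_punct mark
  have key : ∀ φ ∈ atlas ℂ S, ∀ w ∈ D ×ˢ punct mark φ,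
      lf a b φ (fun q r => _root_.fderiv ℂ (fun q' => F q' r) q v) w = pt v (lf a b φ F) w :=
    fun φ hφ w hw => lf_fderiv hD (ho φ) (hF.1 φ hφ) (fun z hz => hol _ hz.2) v hw
  refine ⟨fun φ hφ => (contDiffOn_cD (hD.prod (ho φ)) (hF.1 φ hφ)).congr (key φ hφ),
    fun φ hφ c hc => ?_⟩
  obtain ⟨N, hN, hc', ht, hp, u, hu, hFu⟩ := hF.2 φ hφ c hc
  refine ⟨N, hN, hc', ht, hp, pt v u, contDiffOn_cD (hD.prod hN) hu, fun q hq z hz hne => ?_⟩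
  have hO : IsOpen (D ×ˢ (N ∩ {z | z ≠ φ (mark c)})) := hD.prod (hN.inter isOpen_ne)
  have hm : (q, z) ∈ D ×ˢ (N ∩ {z | z ≠ φ (mark c)}) := ⟨hq, hz, hne⟩
  rw [key φ hφ (q, z) ⟨hq, hp z hz hne⟩]
  have h1 : pt v (lf a b φ F) (q, z)
      = pt v (fun w : P × ℂ => ((w.2 - φ (mark c))⁻¹) ^ k • u w) (q, z) :=
    cD_congr_on hO (fun w hw => hFu w.1 hw.1 w.2 hw.2.1 hw.2.2) hm
  have hdi := diffAt hO (n := ∞) (by simp)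
    (contDiffOn_sub_inv_pow (k := k) (c := φ (mark c)) fun w hw => hw.2.2) hm
  rw [h1, pt, cD_smul hdi (diffAt (hD.prod hN) (by simp) hu ⟨hq, hz⟩)]
  have h2 : cD (v, (0 : ℂ)) 0 (fun w : P × ℂ => ((w.2 - φ (mark c))⁻¹) ^ k) (q, z) = 0 := by
    have h3 := fderiv_slice hdi
      (differentiableAt_const (𝕜 := ℂ) (E := P) (x := q) (((z - φ (mark c))⁻¹) ^ k)) v
    rw [pt] at h3
    rw [← h3]
    simp
  rw [h2, zero_smul, zero_add]

end Holo

end Families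

/-! ### Integration over a compact Riemann surface -/

section Integral

open MeasureTheory

variable {S : Type*} [TopologicalSpace S] [ChartedSpace ℂ S] [CompactSpace S]

variable (S) in
/-- The charts of the finite cover that defines `surfInt`. -/
def cutChart (i : Fin (exists_finite_cover S).choose) : OpenPartialHomeomorph S ℂ :=
  chartAt ℂ ((exists_finite_cover S).choose_spec.choose i)

/-- The coordinates, in the chart `φ`, of the points of the `i`-th piece of `S`. -/
def cutPiece (φ : OpenPartialHomeomorph S ℂ) (i : Fin (exists_finite_cover S).choose) : Set ℂ :=
  overlap φ (cutChart S i) \ ⋃ j : {j // j < i}, overlap φ (cutChart S j)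

/-- The differential `f` of type `(1, 1)` is integrable. -/
def SurfIntegrable (f : S → ℂ) : Prop :=
  ∀ i, IntegrableOn (loc 1 1 (cutChart S i) f) (cutPiece (cutChart S i) i)

theorem cutChart_mem (i : Fin (exists_finite_cover S).choose) : cutChart S i ∈ atlas ℂ S :=
  chart_mem_atlas ℂ _

theorem measurableSet_cutPiece (φ : OpenPartialHomeomorph S ℂ)
    (i : Fin (exists_finite_cover S).choose) : MeasurableSet (cutPiece φ i) :=
  (isOpen_overlap _ _).measurableSet.diff
    (MeasurableSet.iUnion fun _ => (isOpen_overlap _ _).measurableSet)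

theorem mem_cutPiece {φ : OpenPartialHomeomorph S ℂ} {i : Fin (exists_finite_cover S).choose}
    {z : ℂ} : z ∈ cutPiece φ i ↔ z ∈ φ.target ∧ φ.symm z ∈ (cutChart S i).source ∧
      ∀ j < i, φ.symm z ∉ (cutChart S j).source := by
  simp only [cutPiece, overlap, Set.mem_sdiff, Set.mem_inter_iff, Set.mem_preimage, Set.mem_iUnion,
    Subtype.exists, exists_prop, not_exists, not_and]
  tauto

theorem surfInt_eq (f : S → ℂ) : surfInt f = 2 * Complex.I * ∑ i,
    ∫ z in cutPiece (cutChart S i) i, loc 1 1 (cutChart S i) f z := by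
  rw [surfInt]
  congr 1
  refine Finset.sum_congr rfl fun i _ => ?_
  have h : cutPiece (cutChart S i) i = {z | z ∈ (cutChart S i).target ∧
      ∀ j < i, (cutChart S i).symm z ∉ (cutChart S j).source} := by
    ext z
    rw [mem_cutPiece]
    exact ⟨fun h => ⟨h.1, h.2.2⟩, fun h => ⟨h.1, (cutChart S i).map_target h.1, h.2⟩⟩
  rw [h]
  rfl

theorem iUnion_cutPiece (φ : OpenPartialHomeomorph S ℂ) : ⋃ i, cutPiece φ i = φ.target := by
  refine Set.Subset.antisymm (Set.iUnion_subset fun i z hz => (mem_cutPiece.1 hz).1) fun z hz => ?_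
  have hne : {i | φ.symm z ∈ (cutChart S i).source}.Nonempty := by
    have h := (exists_finite_cover S).choose_spec.choose_spec.symm.subset (Set.mem_univ (φ.symm z))
    obtain ⟨i, hi⟩ := Set.mem_iUnion.1 h
    exact ⟨i, hi⟩
  obtain ⟨i, hi, hmin⟩ := wellFounded_lt.has_min _ hne
  exact Set.mem_iUnion.2 ⟨i, mem_cutPiece.2 ⟨hz, hi, fun j hj h => hmin j h hj⟩⟩

theorem disjoint_cutPiece (φ : OpenPartialHomeomorph S ℂ) :
    Pairwise fun i j => Disjoint (cutPiece φ i) (cutPiece φ j) := by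
  intro i j hij
  refine Set.disjoint_left.2 fun z hi hj => ?_
  rw [mem_cutPiece] at hi hj
  rcases lt_or_gt_of_ne hij with h | h
  · exact hj.2.2 i h hi.2.1
  · exact hi.2.2 j h hj.2.1

theorem SurfIntegrable.add {f g : S → ℂ} (hf : SurfIntegrable f) (hg : SurfIntegrable g) :
    SurfIntegrable fun r => f r + g r := fun i => by
  have h := (hf i).add (hg i)
  refine h.congr (Filter.Eventually.of_forall fun z => ?_)
  exact (loc_add _ _ _ _ _ _).symm

theorem SurfIntegrable.const_mul {f : S → ℂ} (hf : SurfIntegrable f) (c : ℂ) :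
    SurfIntegrable fun r => c * f r := fun i => by
  have h := (hf i).const_mul c
  refine h.congr (Filter.Eventually.of_forall fun z => ?_)
  exact (loc_const_smul _ _ _ c _ _).symm

theorem SurfIntegrable.neg {f : S → ℂ} (hf : SurfIntegrable f) : SurfIntegrable fun r => -f r := by
  simpa using hf.const_mul (-1)

theorem SurfIntegrable.sub {f g : S → ℂ} (hf : SurfIntegrable f) (hg : SurfIntegrable g) :
    SurfIntegrable fun r => f r - g r := by
  simpa [sub_eq_add_neg] using hf.add hg.neg

theorem SurfIntegrable.zero : SurfIntegrable fun _ : S => (0 : ℂ) := fun i => by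
  have h : loc 1 1 (cutChart S i) (fun _ : S => (0 : ℂ)) = fun _ => 0 := by
    ext z; simp [loc_eq]
  rw [h]
  exact integrableOn_zero

theorem SurfIntegrable.sum {ι : Type*} (s : Finset ι) {f : ι → S → ℂ}
    (hf : ∀ i ∈ s, SurfIntegrable (f i)) : SurfIntegrable fun r => ∑ i ∈ s, f i r := by
  classical
  induction s using Finset.induction_on with
  | empty => simpa using SurfIntegrable.zero
  | insert i s hi ih =>
    simp only [Finset.sum_insert hi]
    exact (hf i (Finset.mem_insert_self i s)).add (ih fun j hj => hf j (Finset.mem_insert_of_mem hj))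

theorem surfInt_add {f g : S → ℂ} (hf : SurfIntegrable f) (hg : SurfIntegrable g) :
    surfInt (fun r => f r + g r) = surfInt f + surfInt g := by
  simp only [surfInt_eq, loc_add]
  rw [← mul_add, ← Finset.sum_add_distrib]
  congr 1
  exact Finset.sum_congr rfl fun i _ => integral_add (hf i) (hg i)

theorem surfInt_const_mul (c : ℂ) (f : S → ℂ) : surfInt (fun r => c * f r) = c * surfInt f := by
  have h : ∀ i z, loc 1 1 (cutChart S i) (fun r => c * f r) z = c * loc 1 1 (cutChart S i) f z :=
    fun i z => loc_const_smul _ _ _ c _ _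
  simp only [surfInt_eq, h, integral_const_mul, ← Finset.mul_sum]
  ring

theorem surfInt_neg (f : S → ℂ) : surfInt (fun r => -f r) = -surfInt f := by
  simpa using surfInt_const_mul (-1) f

theorem surfInt_sub {f g : S → ℂ} (hf : SurfIntegrable f) (hg : SurfIntegrable g) :
    surfInt (fun r => f r - g r) = surfInt f - surfInt g := by
  have h := surfInt_add hf hg.neg
  rw [surfInt_neg] at h
  simpa [sub_eq_add_neg] using h

theorem surfInt_zero : surfInt (fun _ : S => (0 : ℂ)) = 0 := by
  simpa using surfInt_const_mul (S := S) 0 fun _ => 0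

theorem surfInt_sum {ι : Type*} (s : Finset ι) {f : ι → S → ℂ}
    (hf : ∀ i ∈ s, SurfIntegrable (f i)) :
    surfInt (fun r => ∑ i ∈ s, f i r) = ∑ i ∈ s, surfInt (f i) := by
  classical
  induction s using Finset.induction_on with
  | empty => simpa using surfInt_zero
  | insert i s hi ih =>
    simp only [Finset.sum_insert hi]
    rw [surfInt_add (hf i (Finset.mem_insert_self i s))
      (SurfIntegrable.sum s fun j hj => hf j (Finset.mem_insert_of_mem hj)),
      ih fun j hj => hf j (Finset.mem_insert_of_mem hj)]

/-- A finite set has measure zero in every chart, so the values of a differential at the marked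
points never influence an integral. -/
theorem loc_ae_eq {f g : S → ℂ} {A : Set S} (hA : A.Finite) (h : ∀ r ∉ A, f r = g r)
    (φ : OpenPartialHomeomorph S ℂ) {B : Set ℂ} (hB : MeasurableSet B) (hBt : B ⊆ φ.target) :
    loc 1 1 φ f =ᵐ[volume.restrict B] loc 1 1 φ g := by
  have hnull : volume (φ '' A) = 0 := (hA.image φ).measure_zero _
  filter_upwards [ae_restrict_mem hB, ae_restrict_of_ae (measure_eq_zero_iff_ae_notMem.1 hnull)]
    with z hz hzA
  refine loc_congr (h _ fun hr => hzA ⟨_, hr, φ.right_inv (hBt hz)⟩)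

theorem surfInt_congr {f g : S → ℂ} {A : Set S} (hA : A.Finite) (h : ∀ r ∉ A, f r = g r) :
    surfInt f = surfInt g := by
  simp only [surfInt_eq]
  congr 1
  exact Finset.sum_congr rfl fun i _ => integral_congr_ae
    (loc_ae_eq hA h _ (measurableSet_cutPiece _ _) fun z hz => (mem_cutPiece.1 hz).1)

theorem SurfIntegrable.congr {f g : S → ℂ} (hf : SurfIntegrable f) {A : Set S} (hA : A.Finite)
    (h : ∀ r ∉ A, f r = g r) : SurfIntegrable g := fun i =>
  (hf i).congr (loc_ae_eq hA h _ (measurableSet_cutPiece _ _) fun _ hz => (mem_cutPiece.1 hz).1)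

variable [IsManifold 𝓘(ℂ) ω S] {φ ψ : OpenPartialHomeomorph S ℂ}

theorem abs_det_toSpanSingleton (c : ℂ) :
    |((ContinuousLinearMap.toSpanSingleton ℂ c).restrictScalars ℝ).det| = ‖c‖ ^ 2 := by
  have h : ((ContinuousLinearMap.toSpanSingleton ℂ c).restrictScalars ℝ).det
      = Algebra.norm ℝ c := by
    rw [Algebra.norm_apply, ContinuousLinearMap.det]
    congr 1
    ext
    simp [mul_comm]
  rw [h, Algebra.norm_complex_apply, abs_of_nonneg (Complex.normSq_nonneg c),
    Complex.normSq_eq_norm_sq]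

theorem fac_one_one (c : ℂ) : fac 1 1 c = ((‖c‖ ^ 2 : ℝ) : ℂ) := by
  rw [fac, zpow_one, zpow_one, Complex.mul_conj, Complex.normSq_eq_norm_sq]

theorem hasFDerivWithinAt_trans (hφ : φ ∈ atlas ℂ S) (hψ : ψ ∈ atlas ℂ S) {B : Set ℂ}
    (hB : B ⊆ overlap φ ψ) : ∀ z ∈ B, HasFDerivWithinAt (fun ζ => ψ (φ.symm ζ))
      ((ContinuousLinearMap.toSpanSingleton ℂ (jac φ ψ z)).restrictScalars ℝ) B z := fun _ hz =>
  ((differentiableAt_trans hφ hψ (hB hz)).hasDerivAt.hasFDerivAt.restrictScalars ℝ).hasFDerivWithinAt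

theorem injOn_trans {B : Set ℂ} (hB : B ⊆ overlap φ ψ) :
    Set.InjOn (fun ζ => ψ (φ.symm ζ)) B := fun z hz w hw h => by
  have h1 : φ.symm z = φ.symm w := ψ.injOn (hB hz).2 (hB hw).2 h
  exact φ.symm.injOn (hB hz).1 (hB hw).1 h1

/-- The transition factor `c c̄` of a `(1, 1)`-differential equals the Jacobian determinant of the
holomorphic coordinate change. This makes the surface integral independent of the charts. -/
theorem abs_det_smul_loc (hφ : φ ∈ atlas ℂ S) (hψ : ψ ∈ atlas ℂ S) (f : S → ℂ) {z : ℂ}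
    (hz : z ∈ overlap φ ψ) :
    |((ContinuousLinearMap.toSpanSingleton ℂ (jac φ ψ z)).restrictScalars ℝ).det| •
      loc 1 1 ψ f (ψ (φ.symm z)) = loc 1 1 φ f z := by
  rw [loc_change 1 1 hφ hψ f hz, abs_det_toSpanSingleton, fac_one_one]
  simp

theorem setIntegral_loc_image (hφ : φ ∈ atlas ℂ S) (hψ : ψ ∈ atlas ℂ S) (f : S → ℂ) {B : Set ℂ}
    (hBm : MeasurableSet B) (hB : B ⊆ overlap φ ψ) :
    ∫ z in (fun ζ => ψ (φ.symm ζ)) '' B, loc 1 1 ψ f z = ∫ z in B, loc 1 1 φ f z := by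
  rw [integral_image_eq_integral_abs_det_fderiv_smul volume hBm (hasFDerivWithinAt_trans hφ hψ hB)
    (injOn_trans hB)]
  exact setIntegral_congr_fun hBm fun z hz => abs_det_smul_loc hφ hψ f (hB hz)

theorem integrableOn_loc_image (hφ : φ ∈ atlas ℂ S) (hψ : ψ ∈ atlas ℂ S) (f : S → ℂ) {B : Set ℂ}
    (hBm : MeasurableSet B) (hB : B ⊆ overlap φ ψ) :
    IntegrableOn (loc 1 1 ψ f) ((fun ζ => ψ (φ.symm ζ)) '' B) ↔ IntegrableOn (loc 1 1 φ f) B := by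
  rw [integrableOn_image_iff_integrableOn_abs_det_fderiv_smul volume hBm
    (hasFDerivWithinAt_trans hφ hψ hB) (injOn_trans hB)]
  exact integrableOn_congr_fun (fun z hz => abs_det_smul_loc hφ hψ f (hB hz)) hBm

theorem cutPiece_subset (i : Fin (exists_finite_cover S).choose) :
    cutPiece φ i ⊆ overlap φ (cutChart S i) := Set.sdiff_subset

theorem image_cutPiece_subset (i : Fin (exists_finite_cover S).choose) :
    (fun ζ => cutChart S i (φ.symm ζ)) '' cutPiece φ i ⊆ cutPiece (cutChart S i) i := by
  rintro _ ⟨z, hz, rfl⟩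
  rw [mem_cutPiece] at hz ⊢
  have h := (cutChart S i).left_inv hz.2.1
  exact ⟨(cutChart S i).map_source hz.2.1, by simpa [h] using hz.2.1, by simpa [h] using hz.2.2⟩

theorem loc_eq_zero_of_notMem_image {f : S → ℂ} (hf : ∀ r ∉ φ.source, f r = 0)
    (i : Fin (exists_finite_cover S).choose) : ∀ z ∈ cutPiece (cutChart S i) i \
      ((fun ζ => cutChart S i (φ.symm ζ)) '' cutPiece φ i), loc 1 1 (cutChart S i) f z = 0 := by
  rintro z ⟨hz, hn⟩
  rw [mem_cutPiece] at hz
  rw [loc_eq, hf, smul_zero]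
  intro hs
  have h := φ.left_inv hs
  refine hn ⟨φ ((cutChart S i).symm z), mem_cutPiece.2 ⟨φ.map_source hs, ?_, ?_⟩, ?_⟩
  · rw [h]; exact hz.2.1
  · rw [h]; exact hz.2.2
  · simp only [h]; exact (cutChart S i).right_inv hz.1

/-- A differential that is supported and integrable in a chart is integrable. -/
theorem surfIntegrable_of_chart (hφ : φ ∈ atlas ℂ S) {f : S → ℂ} (hf : ∀ r ∉ φ.source, f r = 0)
    (hi : IntegrableOn (loc 1 1 φ f) φ.target) : SurfIntegrable f := fun i => by
  have h1 : IntegrableOn (loc 1 1 φ f) (cutPiece φ i) :=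
    hi.mono_set fun z hz => (mem_cutPiece.1 hz).1
  rw [← integrableOn_loc_image hφ (cutChart_mem i) f (measurableSet_cutPiece φ i)
    (cutPiece_subset i)] at h1
  exact h1.of_forall_sdiff_eq_zero (measurableSet_cutPiece _ _) (loc_eq_zero_of_notMem_image hf i)

/-- The integral of a differential that is supported in a chart can be computed there. -/
theorem surfInt_of_chart (hφ : φ ∈ atlas ℂ S) {f : S → ℂ} (hf : ∀ r ∉ φ.source, f r = 0)
    (hi : IntegrableOn (loc 1 1 φ f) φ.target) :
    surfInt f = 2 * Complex.I * ∫ z in φ.target, loc 1 1 φ f z := by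
  -- The target of the chart is cut along the pieces that define the integral, and each piece is
  -- carried to its own chart; outside the images the differential vanishes.
  rw [surfInt_eq, ← iUnion_cutPiece φ, integral_iUnion_fintype (measurableSet_cutPiece φ)
    (disjoint_cutPiece φ) fun i => hi.mono_set fun z hz => (mem_cutPiece.1 hz).1]
  congr 1
  refine Finset.sum_congr rfl fun i _ => ?_
  rw [setIntegral_eq_of_subset_of_forall_sdiff_eq_zero (measurableSet_cutPiece _ _)
    (image_cutPiece_subset i) (loc_eq_zero_of_notMem_image hf i),
    setIntegral_loc_image hφ (cutChart_mem i) f (measurableSet_cutPiece φ i) (cutPiece_subset i)]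

end Integral

/-! ### Partitions of unity and the theorems of Stokes and Cauchy -/

section Stokes

open MeasureTheory

variable {S : Type*} [TopologicalSpace S] [T2Space S] [CompactSpace S] [ChartedSpace ℂ S]
  [IsManifold 𝓘(ℂ) ω S]

-- Smooth partitions of unity refer to a real structure; holomorphic transition maps are in
-- particular real smooth.
variable (S) in
theorem isManifold_real : IsManifold 𝓘(ℝ, ℂ) ∞ S := by
  refine isManifold_of_contDiffOn _ _ _ fun φ ψ hφ hψ => ?_
  have h : ContDiffOn ℝ ∞ (fun ζ => ψ (φ.symm ζ)) (overlap φ ψ) :=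
    ((contDiffOn_trans hφ hψ).of_le le_top).restrict_scalars ℝ
  refine h.mono fun z hz => ?_
  simpa [overlap] using hz

/-- A smooth partition of unity, each function of which is supported in a chart and has at most the
centre of the chart as a marked point in its support. -/
theorem exists_partition {n : ℕ} (mark : Fin n → S) :
    ∃ (t : Finset S) (ρ : S → S → ℂ), (∀ c, ∀ φ ∈ atlas ℂ S,
        ContDiffOn ℝ ∞ (loc 0 0 φ (ρ c)) φ.target) ∧
      (∀ c ∈ t, ∃ K ⊆ (chartAt ℂ c).source, IsCompact K ∧ (∀ r ∉ K, ρ c r = 0) ∧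
        ∀ a, mark a ∈ K → mark a = c) ∧ ∀ r, ∑ c ∈ t, ρ c r = 1 := by
  classical
  have := isManifold_real S
  have hfin : ∀ c, (Set.range mark \ {c}).Finite := fun c =>
    (Set.finite_range mark).subset Set.sdiff_subset
  -- All marked points except possibly the centre are removed from each chart, so that a localized
  -- differential has at most one pole, at a known coordinate.
  set U : S → Set S := fun c => (chartAt ℂ c).source ∩ (Set.range mark \ {c})ᶜ with hUdef
  have hUo : ∀ c, IsOpen (U c) := fun c =>
    (chartAt ℂ c).open_source.inter (hfin c).isClosed.isOpen_compl
  have hUc : ∀ c, c ∈ U c := fun c => ⟨mem_chart_source ℂ c, fun h => h.2 rfl⟩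
  obtain ⟨t, ht⟩ := isCompact_univ.elim_finite_subcover U hUo
    fun c _ => Set.mem_iUnion.2 ⟨c, hUc c⟩
  obtain ⟨f, hf⟩ := SmoothPartitionOfUnity.exists_isSubordinate 𝓘(ℝ, ℂ) (isClosed_univ (X := S))
    (fun c : t => U c) (fun c => hUo c) fun r hr => by
      obtain ⟨c, hc, hrc⟩ := Set.mem_iUnion₂.1 (ht hr)
      exact Set.mem_iUnion.2 ⟨⟨c, hc⟩, hrc⟩
  refine ⟨t, fun c r => if h : c ∈ t then (f ⟨c, h⟩ r : ℂ) else 0, fun c φ hφ => ?_, fun c hc => ?_,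
    fun r => ?_⟩
  · have h0 : loc 0 0 φ (fun r => if h : c ∈ t then (f ⟨c, h⟩ r : ℂ) else 0)
        = fun z => if h : c ∈ t then (f ⟨c, h⟩ (φ.symm z) : ℂ) else 0 := by
      ext z; rw [loc_zero_zero]
    rw [h0]
    by_cases h : c ∈ t
    · simp only [h, dite_true]
      have h1 : ContMDiffOn 𝓘(ℝ, ℂ) 𝓘(ℝ, ℂ) ∞ φ.symm φ.target :=
        contMDiffOn_symm_of_mem_maximalAtlas (IsManifold.subset_maximalAtlas hφ)
      have h2 : ContMDiffOn 𝓘(ℝ, ℂ) 𝓘(ℝ, ℝ) ∞ (fun z => f ⟨c, h⟩ (φ.symm z)) φ.target :=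
        (f ⟨c, h⟩).contMDiff.comp_contMDiffOn h1
      exact Complex.ofRealCLM.contDiff.comp_contDiffOn (contMDiffOn_iff_contDiffOn.1 h2)
    · simp only [h, dite_false]
      exact contDiffOn_const
  · refine ⟨tsupport (f ⟨c, hc⟩), fun r hr => (hf ⟨c, hc⟩ hr).1, (isClosed_tsupport _).isCompact,
      fun r hr => ?_, fun a ha => ?_⟩
    · simp only [hc, dite_true]
      exact_mod_cast image_eq_zero_of_notMem_tsupport hr
    · by_contra hne
      exact (hf ⟨c, hc⟩ ha).2 ⟨⟨a, rfl⟩, hne⟩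
  · have h := f.sum_eq_one (Set.mem_univ r)
    rw [finsum_eq_sum_of_fintype] at h
    rw [← Finset.sum_coe_sort t]
    have h1 : ∀ c : t, (if h : (c : S) ∈ t then (f ⟨c, h⟩ r : ℂ) else 0) = (f c r : ℂ) := fun c => by
      simp [c.2]
    rw [Finset.sum_congr rfl fun c _ => h1 c]
    exact_mod_cast h

variable {P : Type*} [NormedAddCommGroup P] [NormedSpace ℂ P] {n : ℕ} {mark : Fin n → S} {k : ℕ}
  {a b : ℤ} {D : Set P}

/-- A localized family with a pole is `(z - z_c)⁻ᵏ` times a smooth compactly supported function. -/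
theorem exists_smooth_extension (hD : IsOpen D) {F : P → S → ℂ} (hF : Mero mark k a b D F)
    {ρ : S → ℂ} {φ : OpenPartialHomeomorph S ℂ}
    (hφ : φ ∈ atlas ℂ S) (hρ : ContDiffOn ℝ ∞ (loc 0 0 φ ρ) φ.target) {K : Set S}
    (hKφ : K ⊆ φ.source) (hK : IsCompact K) (hρK : ∀ r ∉ K, ρ r = 0) {c : S} (hc : c ∈ φ.source)
    (hKc : ∀ j, mark j ∈ K → mark j = c) :
    ∃ u : P × ℂ → ℂ, ContDiffOn ℝ ∞ u (D ×ˢ Set.univ) ∧ (∀ q, ∀ z ∉ φ '' K, u (q, z) = 0) ∧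
      ∀ q ∈ D, ∀ z ∈ φ.target, z ≠ φ c →
        ρ (φ.symm z) * loc a b φ (F q) z = ((z - φ c)⁻¹) ^ k * u (q, z) := by
  classical
  have hKc' : IsClosed (φ '' K) := (hK.image_of_continuousOn (φ.continuousOn.mono hKφ)).isClosed
  have hφK : ∀ z ∈ φ.target, z ∉ φ '' K → φ.symm z ∉ K := fun z hz hn h =>
    hn ⟨_, h, φ.right_inv hz⟩
  replace hρ : ContDiffOn ℝ ∞ (fun z => ρ (φ.symm z)) φ.target :=
    hρ.congr fun z _ => (loc_zero_zero φ ρ z).symm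
  -- An unmarked centre is treated as a pole too: the numerator is then `(z - z_c)ᵏ` times the
  -- smooth coefficient. Later arguments need no case distinction.
  obtain ⟨N, hN, hcN, hNt, v, hv, hFv⟩ : ∃ N : Set ℂ, IsOpen N ∧ φ c ∈ N ∧ N ⊆ φ.target ∧
      ∃ v : P × ℂ → ℂ, ContDiffOn ℝ ∞ v (D ×ˢ N) ∧ ∀ q ∈ D, ∀ z ∈ N, z ≠ φ c →
        lf a b φ F (q, z) = ((z - φ c)⁻¹) ^ k • v (q, z) := by
    by_cases h : ∃ j, mark j = c
    · obtain ⟨j, rfl⟩ := h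
      obtain ⟨N, hN, hcN, hNt, -, v, hv, hFv⟩ := hF.2 φ hφ j hc
      exact ⟨N, hN, hcN, hNt, v, hv, hFv⟩
    · refine ⟨punct mark φ, isOpen_punct mark φ, ⟨φ.map_source hc, fun hr => h ?_⟩,
        Set.inter_subset_left, fun w => (w.2 - φ c) ^ k • lf a b φ F w,
        ((contDiffOn_snd.sub contDiffOn_const).pow k).smul (hF.1 φ hφ), fun q hq z hz hne => ?_⟩
      · rw [φ.left_inv hc] at hr
        exact hr
      · rw [smul_smul, ← mul_pow, inv_mul_cancel₀ (sub_ne_zero.2 hne), one_pow, one_smul]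
  -- Three expressions are glued: the numerator `v` near the centre, `(z - z_c)ᵏ` times the
  -- coefficient on the rest of the support, and zero elsewhere. They agree where their domains
  -- meet, which gives smoothness.
  refine ⟨fun w => if w.2 ∈ N then ρ (φ.symm w.2) * v w else
    if w.2 ∈ φ '' K then ρ (φ.symm w.2) * ((w.2 - φ c) ^ k * lf a b φ F w) else 0, ?_, ?_, ?_⟩
  · rintro ⟨q, z⟩ ⟨hq, -⟩
    refine ContDiffAt.contDiffWithinAt ?_
    have hDq : D ∈ 𝓝 q := hD.mem_nhds hq
    by_cases hzK : z ∈ φ '' K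
    · by_cases hzc : z = φ c
      · have h1 : ContDiffAt ℝ ∞ (fun w : P × ℂ => ρ (φ.symm w.2) * v w) (q, z) := by
          refine ContDiffOn.contDiffAt (s := D ×ˢ N) ?_ (prod_mem_nhds hDq (hN.mem_nhds (hzc ▸ hcN)))
          exact ((hρ.mono hNt).comp contDiffOn_snd fun w hw => hw.2).mul hv
        refine h1.congr_of_eventuallyEq ?_
        filter_upwards [prod_mem_nhds hDq (hN.mem_nhds (hzc ▸ hcN))] with w hw
        rw [if_pos hw.2]
      · have hzp : z ∈ punct mark φ := by
          obtain ⟨r, hr, rfl⟩ := hzK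
          refine ⟨φ.map_source (hKφ hr), ?_⟩
          rintro ⟨j, hj⟩
          rw [φ.left_inv (hKφ hr)] at hj
          exact hzc (by rw [← hj, hKc j (hj ▸ hr)])
        have hO : IsOpen (punct mark φ ∩ {z | z ≠ φ c}) := (isOpen_punct mark φ).inter isOpen_ne
        have h1 : ContDiffAt ℝ ∞ (fun w : P × ℂ => ρ (φ.symm w.2) *
            ((w.2 - φ c) ^ k * lf a b φ F w)) (q, z) := by
          refine ContDiffOn.contDiffAt (s := D ×ˢ punct mark φ) ?_
            (prod_mem_nhds hDq ((isOpen_punct mark φ).mem_nhds hzp))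
          exact ((hρ.mono Set.inter_subset_left).comp contDiffOn_snd fun w hw => hw.2).mul
            (((contDiffOn_snd.sub contDiffOn_const).pow k).mul (hF.1 φ hφ))
        refine h1.congr_of_eventuallyEq ?_
        filter_upwards [prod_mem_nhds hDq (hO.mem_nhds ⟨hzp, hzc⟩)] with w hw
        have h2 : w.2 - φ c ≠ 0 := sub_ne_zero.2 hw.2.2
        split_ifs with h3 h4
        · rw [hFv w.1 hw.1 w.2 h3 hw.2.2, smul_eq_mul, inv_pow, mul_inv_cancel_left₀ (pow_ne_zero k h2)]
        · rfl
        · rw [hρK _ (hφK _ hw.2.1.1 h4), zero_mul]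
    · refine (contDiffAt_const (c := (0 : ℂ))).congr_of_eventuallyEq ?_
      filter_upwards [prod_mem_nhds hDq (hKc'.isOpen_compl.mem_nhds hzK)] with w hw
      split_ifs with h3 h4
      · rw [hρK _ (hφK _ (hNt h3) hw.2), zero_mul]
      · exact absurd h4 hw.2
      · rfl
  · intro q z hz
    dsimp only
    split_ifs with h3
    · rw [hρK _ (hφK _ (hNt h3) hz), zero_mul]
    · rfl
  · intro q hq z hz hne
    have h2 : z - φ c ≠ 0 := sub_ne_zero.2 hne
    dsimp only
    split_ifs with h3 h4
    · have := hFv q hq z h3 hne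
      rw [lf] at this
      rw [this, smul_eq_mul]
      ring
    · rw [lf, inv_pow]
      field_simp
    · rw [hρK _ (hφK _ hz h4), zero_mul, mul_zero]

end Stokes

/-! ### Surface integrals by localization in charts -/

section StokesTheorem

open MeasureTheory

variable {S : Type*} [TopologicalSpace S] [T2Space S] [CompactSpace S] [ChartedSpace ℂ S]
  [IsManifold 𝓘(ℂ) ω S] {φ : OpenPartialHomeomorph S ℂ} {K : Set S}

theorem isCompact_image_chart (hKφ : K ⊆ φ.source) (hK : IsCompact K) : IsCompact (φ '' K) :=
  hK.image_of_continuousOn (φ.continuousOn.mono hKφ)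

/-- The integral of a differential supported in a chart, through an extension of its coefficient to
the plane. -/
theorem surfInt_of_extension (hφ : φ ∈ atlas ℂ S) (hKφ : K ⊆ φ.source) {f : S → ℂ}
    (hf : ∀ r ∉ K, f r = 0) {w : ℂ → ℂ} (hw : Integrable w) (hwK : ∀ z ∉ φ '' K, w z = 0) (z₀ : ℂ)
    (hfw : ∀ z ∈ φ.target, z ≠ z₀ → loc 1 1 φ f z = w z) :
    SurfIntegrable f ∧ surfInt f = 2 * Complex.I * ∫ z, w z := by
  have hae : loc 1 1 φ f =ᵐ[volume.restrict φ.target] w := by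
    filter_upwards [ae_restrict_mem φ.open_target.measurableSet,
      ae_restrict_of_ae (Measure.ae_ne volume z₀)] with z hz hz0 using hfw z hz hz0
  have hi : IntegrableOn (loc 1 1 φ f) φ.target := hw.integrableOn.congr hae.symm
  have hf' : ∀ r ∉ φ.source, f r = 0 := fun r hr => hf r fun h => hr (hKφ h)
  refine ⟨surfIntegrable_of_chart hφ hf' hi, ?_⟩
  rw [surfInt_of_chart hφ hf' hi, integral_congr_ae hae,
    setIntegral_eq_integral_of_forall_compl_eq_zero]
  rintro z hz
  refine hwK z ?_
  rintro ⟨r, hr, rfl⟩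
  exact hz (φ.map_source (hKφ hr))

theorem loc_eventually_zero {a b : ℤ} {f : S → ℂ} (hK : IsClosed K) (hf : ∀ r ∉ K, f r = 0) {r : S}
    (hr : r ∉ K) : loc a b (chartAt ℂ r) f =ᶠ[𝓝 (chartAt ℂ r r)] fun _ => 0 := by
  have h1 : (chartAt ℂ r).target ∩ (chartAt ℂ r).symm ⁻¹' Kᶜ ∈ 𝓝 (chartAt ℂ r r) :=
    ((chartAt ℂ r).symm.isOpen_inter_preimage hK.isOpen_compl).mem_nhds
      ⟨mem_chart_target ℂ r, by simpa using hr⟩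
  filter_upwards [h1] with z hz
  rw [loc_eq, hf _ hz.2, smul_zero]

theorem del_eq_zero {b : ℤ} {f : S → ℂ} (hK : IsClosed K) (hf : ∀ r ∉ K, f r = 0) {r : S}
    (hr : r ∉ K) : del 0 b f r = 0 := by
  rw [del, wirt_eq_cD, cD_congr (loc_eventually_zero hK hf hr), cD_const]

theorem delBar_eq_zero {a : ℤ} {f : S → ℂ} (hK : IsClosed K) (hf : ∀ r ∉ K, f r = 0) {r : S}
    (hr : r ∉ K) : delBar a 0 f r = 0 := by
  rw [delBar, wirtBar_eq_cD, cD_congr (loc_eventually_zero hK hf hr), cD_const]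

variable {P E : Type*} [NormedAddCommGroup P] [NormedSpace ℂ P] [NormedAddCommGroup E]
  [NormedSpace ℂ E] {n : ℕ} {mark : Fin n → S} {k : ℕ} {a b : ℤ} {D : Set P}

theorem Mero.differentiableAt (hD : IsOpen D) {F : P → S → E} (hF : Mero mark k a b D F) {q : P}
    (hq : q ∈ D) (hφ : φ ∈ atlas ℂ S) {z : ℂ} (hz : z ∈ punct mark φ) :
    DifferentiableAt ℝ (loc a b φ (F q)) z := by
  have hd : DifferentiableAt ℝ (lf a b φ F) (q, z) :=
    diffAt (hD.prod (isOpen_punct mark φ)) (by simp) (hF.1 φ hφ) ⟨hq, hz⟩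
  exact DifferentiableAt.comp z (g := lf a b φ F) (f := fun z => (q, z)) hd (by fun_prop)

theorem mem_punct_chartAt {r : S} (hr : r ∉ Set.range mark) :
    chartAt ℂ r r ∈ punct mark (chartAt ℂ r) :=
  ⟨mem_chart_target ℂ r, by simpa using hr⟩

theorem Mero.differentiableAt_chartAt (hD : IsOpen D) {F : P → S → E} (hF : Mero mark k a b D F)
    {q : P} (hq : q ∈ D) {r : S} (hr : r ∉ Set.range mark) :
    DifferentiableAt ℝ (loc a b (chartAt ℂ r) (F q)) (chartAt ℂ r r) :=
  hF.differentiableAt hD hq (chart_mem_atlas ℂ r) (mem_punct_chartAt hr)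

theorem contDiff_slice {u : P × ℂ → E} (hu : ContDiffOn ℝ ∞ u (D ×ˢ Set.univ))
    {q : P} (hq : q ∈ D) : ContDiff ℝ ∞ fun z => u (q, z) := by
  rw [← contDiffOn_univ]
  exact hu.comp (by fun_prop) fun z _ => ⟨hq, Set.mem_univ z⟩

theorem Mero.smul_const {F : P → S → ℂ} (hF : Mero mark k a b D F) {ρ : S → ℂ}
    (hρ : ∀ φ ∈ atlas ℂ S, ContDiffOn ℝ ∞ (loc 0 0 φ ρ) φ.target) :
    Mero mark k a b D fun q r => ρ r * F q r := by
  simpa using (Mero.of_const (mark := mark) hρ).smul (zero_add a) (zero_add b) hF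

theorem loc_mul_const (a b : ℤ) (ρ f : S → ℂ) (z : ℂ) :
    loc a b φ (fun r => ρ r * f r) z = ρ (φ.symm z) * loc a b φ f z := by
  simp only [loc_eq, smul_eq_mul]; ring

/-- Stokes' theorem for `(0, 1)`-differentials. -/
theorem Mero.surfInt_del (hD : IsOpen D) {F : P → S → ℂ} (hF : Mero mark 0 0 1 D F) {q : P}
    (hq : q ∈ D) :
    SurfIntegrable (Isomonodromy.del 0 1 (F q)) ∧ surfInt (Isomonodromy.del 0 1 (F q)) = 0 := by
  obtain ⟨t, ρ, hρ, hK, hsum⟩ := exists_partition mark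
  have key : ∀ c ∈ t, SurfIntegrable (Isomonodromy.del 0 1 fun r => ρ c r * F q r) ∧
      surfInt (Isomonodromy.del 0 1 fun r => ρ c r * F q r) = 0 := by
    intro c hc
    obtain ⟨K, hKc, hKK, hKρ, hKm⟩ := hK c hc
    have hφ : chartAt ℂ c ∈ atlas ℂ S := chart_mem_atlas ℂ c
    obtain ⟨u, hu, hu0, hFu⟩ := exists_smooth_extension hD hF hφ (hρ c _ hφ) hKc hKK hKρ
      (mem_chart_source ℂ c) hKm
    have hKcl : IsClosed (chartAt ℂ c '' K) := (isCompact_image_chart hKc hKK).isClosed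
    have hus : ContDiff ℝ ∞ fun z => u (q, z) := contDiff_slice hu hq
    have hsupp : HasCompactSupport fun z => u (q, z) :=
      HasCompactSupport.intro (isCompact_image_chart hKc hKK) (hu0 q)
    have hw : ∀ z ∉ chartAt ℂ c '' K, wirt (fun z => u (q, z)) z = 0 := fun z hz => by
      rw [wirt_eq_cD, cD_congr_on hKcl.isOpen_compl (g := fun _ => 0) (fun z hz => hu0 q z hz) hz,
        cD_const]
    have hcont : Continuous (wirt fun z => u (q, z)) := by
      have h : Continuous (_root_.fderiv ℝ fun z => u (q, z)) := hus.continuous_fderiv (by simp)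
      unfold wirt
      fun_prop
    have hI : Integrable (wirt fun z => u (q, z)) := hcont.integrable_of_hasCompactSupport
      (HasCompactSupport.intro (isCompact_image_chart hKc hKK) hw)
    have h := surfInt_of_extension hφ hKc (f := Isomonodromy.del 0 1 fun r => ρ c r * F q r)
      (fun r hr => del_eq_zero hKK.isClosed (fun r hr => by rw [hKρ r hr, zero_mul]) hr) hI hw
      (chartAt ℂ c c) fun z hz hne => by
        have hev : loc 0 1 (chartAt ℂ c) (fun r => ρ c r * F q r) =ᶠ[𝓝 z] fun z => u (q, z) := by
          filter_upwards [(chartAt ℂ c).open_target.mem_nhds hz, isOpen_ne.mem_nhds hne] with y hy hy'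
          rw [loc_mul_const, hFu q hq y hy hy', pow_zero, one_mul]
        rw [loc_del 1 hφ hz (((hus.differentiable (by simp)) z).congr_of_eventuallyEq hev),
          wirt_eq_cD, wirt_eq_cD, cD_congr hev]
    rw [integral_wirt_eq_zero hus hsupp, mul_zero] at h
    exact h
  -- The operator is applied to the sum of the pieces `ρ_c F`, which is `F`; no derivative of the
  -- partition functions has to be computed.
  have hdec : ∀ r ∉ Set.range mark, ∑ c ∈ t, Isomonodromy.del 0 1 (fun r => ρ c r * F q r) r
      = Isomonodromy.del 0 1 (F q) r := by
    intro r hr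
    have h1 : loc 0 1 (chartAt ℂ r) (F q)
        = fun z => ∑ c ∈ t, loc 0 1 (chartAt ℂ r) (fun r => ρ c r * F q r) z := by
      ext z
      simp only [loc_mul_const]
      rw [← Finset.sum_mul, hsum, one_mul]
    simp only [Isomonodromy.del]
    rw [h1]
    simp only [wirt_eq_cD]
    rw [cD_sum]
    exact fun c _ => (hF.smul_const (hρ c)).differentiableAt_chartAt hD hq hr
  have hi := SurfIntegrable.sum t fun c hc => (key c hc).1
  refine ⟨hi.congr (Set.finite_range mark) hdec, ?_⟩
  rw [← surfInt_congr (Set.finite_range mark) hdec, surfInt_sum t fun c hc => (key c hc).1]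
  exact Finset.sum_eq_zero fun c hc => (key c hc).2

/-- The residue at a marked point of a `(1, 0)`-differential with a simple pole there. -/
def HasResidue (f : S → E) (r : S) (e : E) : Prop :=
  Filter.Tendsto (fun z => (z - chartAt ℂ r r) • loc 1 0 (chartAt ℂ r) f z)
    (𝓝[≠] (chartAt ℂ r r)) (𝓝 e)

/-- Cauchy's theorem for `(1, 0)`-differentials with simple poles. -/
theorem Mero.surfInt_delBar (hD : IsOpen D) {F : P → S → ℂ} (hF : Mero mark 1 1 0 D F)
    (hmark : Function.Injective mark) {q : P} (hq : q ∈ D) {res : Fin n → ℂ}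
    (hres : ∀ c, HasResidue (F q) (mark c) (res c)) :
    SurfIntegrable (Isomonodromy.delBar 1 0 (F q)) ∧
      surfInt (Isomonodromy.delBar 1 0 (F q)) = -(2 * Real.pi * Complex.I * ∑ c, res c) := by
  classical
  obtain ⟨t, ρ, hρ, hK, hsum⟩ := exists_partition mark
  have key : ∀ c ∈ t, SurfIntegrable (Isomonodromy.delBar 1 0 fun r => ρ c r * F q r) ∧
      surfInt (Isomonodromy.delBar 1 0 fun r => ρ c r * F q r)
        = -(2 * Real.pi * Complex.I * ∑ j, ρ c (mark j) * res j) := by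
    intro c hc
    obtain ⟨K, hKc, hKK, hKρ, hKm⟩ := hK c hc
    have hφ : chartAt ℂ c ∈ atlas ℂ S := chart_mem_atlas ℂ c
    obtain ⟨u, hu, hu0, hFu⟩ := exists_smooth_extension hD hF hφ (hρ c _ hφ) hKc hKK hKρ
      (mem_chart_source ℂ c) hKm
    have hKcl : IsClosed (chartAt ℂ c '' K) := (isCompact_image_chart hKc hKK).isClosed
    have hus : ContDiff ℝ ∞ fun z => u (q, z) := contDiff_slice hu hq
    have hsupp : HasCompactSupport fun z => u (q, z) :=
      HasCompactSupport.intro (isCompact_image_chart hKc hKK) (hu0 q)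
    have hw : ∀ z ∉ chartAt ℂ c '' K,
        (z - chartAt ℂ c c)⁻¹ * wirtBar (fun z => u (q, z)) z = 0 := fun z hz => by
      rw [wirtBar_eq_cD, cD_congr_on hKcl.isOpen_compl (g := fun _ => 0) (fun z hz => hu0 q z hz) hz,
        cD_const, mul_zero]
    have hI : Integrable fun z => (z - chartAt ℂ c c)⁻¹ * wirtBar (fun z => u (q, z)) z :=
      integrable_inv_mul _ (continuous_wirtBar hus) (hasCompactSupport_wirtBar hsupp)
    have h := surfInt_of_extension hφ hKc (f := Isomonodromy.delBar 1 0 fun r => ρ c r * F q r)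
      (fun r hr => delBar_eq_zero hKK.isClosed (fun r hr => by rw [hKρ r hr, zero_mul]) hr) hI hw
      (chartAt ℂ c c) fun z hz hne => by
        have hev : loc 1 0 (chartAt ℂ c) (fun r => ρ c r * F q r)
            =ᶠ[𝓝 z] fun z => (z - chartAt ℂ c c)⁻¹ • u (q, z) := by
          filter_upwards [(chartAt ℂ c).open_target.mem_nhds hz, isOpen_ne.mem_nhds hne] with y hy hy'
          rw [loc_mul_const, hFu q hq y hy hy', pow_one, smul_eq_mul]
        have hinv : DifferentiableAt ℂ (fun z => (z - chartAt ℂ c c)⁻¹) z :=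
          (differentiableAt_id.sub_const _).inv (sub_ne_zero.2 hne)
        have hud : DifferentiableAt ℝ (fun z => u (q, z)) z := (hus.differentiable (by simp)) z
        rw [loc_delBar 1 hφ hz (((hinv.restrictScalars ℝ).smul hud).congr_of_eventuallyEq hev),
          wirtBar_eq_cD, cD_congr hev, cD_smul (hinv.restrictScalars ℝ) hud, ← wirtBar_eq_cD,
          wirtBar_of_holo hinv, ← wirtBar_eq_cD, zero_smul, zero_add, smul_eq_mul]
    rw [integral_inv_mul_wirtBar _ hus hsupp] at h
    -- The Cauchy–Pompeiu formula returns the numerator at the centre. It is the residue weighted by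
    -- the partition function, or zero when the centre is not marked, because the coefficient is
    -- then continuous there.
    have huc : u (q, chartAt ℂ c c) = ∑ j, ρ c (mark j) * res j := by
      by_cases hcm : ∃ j, mark j = c
      · obtain ⟨j, rfl⟩ := hcm
        rw [Finset.sum_eq_single j]
        · have h1 : Filter.Tendsto (fun z => u (q, z)) (𝓝[≠] (chartAt ℂ (mark j) (mark j)))
              (𝓝 (u (q, chartAt ℂ (mark j) (mark j)))) :=
            (hus.continuous.tendsto _).mono_left nhdsWithin_le_nhds
          have h2 : Filter.Tendsto (fun z => ρ (mark j) ((chartAt ℂ (mark j)).symm z))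
              (𝓝[≠] (chartAt ℂ (mark j) (mark j))) (𝓝 (ρ (mark j) (mark j))) := by
            have h3 := (hρ (mark j) _ hφ).continuousOn.continuousAt
              ((chartAt ℂ (mark j)).open_target.mem_nhds (mem_chart_target ℂ (mark j)))
            have h4 := h3.tendsto.mono_left
              (nhdsWithin_le_nhds (s := {chartAt ℂ (mark j) (mark j)}ᶜ))
            rw [loc_zero_zero, (chartAt ℂ (mark j)).left_inv (mem_chart_source ℂ (mark j))] at h4
            exact h4.congr fun z => loc_zero_zero _ _ _
          refine tendsto_nhds_unique h1 (((h2.mul (hres j))).congr' ?_)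
          filter_upwards [nhdsWithin_le_nhds ((chartAt ℂ (mark j)).open_target.mem_nhds
            (mem_chart_target ℂ (mark j))), self_mem_nhdsWithin] with z hz hne
          have h5 := hFu q hq z hz hne
          rw [pow_one] at h5
          rw [smul_eq_mul, mul_left_comm, h5, mul_inv_cancel_left₀ (sub_ne_zero.2 hne)]
        · intro i _ hij
          rw [hKρ, zero_mul]
          exact fun hi => hij (hmark (hKm i hi))
        · simp
      · have h2 : ∀ j, ρ c (mark j) = 0 := fun j => hKρ _ fun hj => hcm ⟨j, hKm j hj⟩
        simp only [h2, zero_mul, Finset.sum_const_zero]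
        have h3 : Filter.Tendsto (fun z => u (q, z)) (𝓝[≠] (chartAt ℂ c c))
            (𝓝 (u (q, chartAt ℂ c c))) :=
          (hus.continuous.tendsto _).mono_left nhdsWithin_le_nhds
        have hcp : chartAt ℂ c c ∈ punct mark (chartAt ℂ c) :=
          mem_punct_chartAt fun ⟨j, hj⟩ => hcm ⟨j, hj⟩
        have h4 : ContinuousAt (loc 1 0 (chartAt ℂ c) fun r => ρ c r * F q r) (chartAt ℂ c c) :=
          ((hF.smul_const (hρ c)).differentiableAt hD hq hφ hcp).continuousAt
        have h5 : Filter.Tendsto (fun z => (z - chartAt ℂ c c) *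
            loc 1 0 (chartAt ℂ c) (fun r => ρ c r * F q r) z) (𝓝[≠] (chartAt ℂ c c)) (𝓝 0) := by
          have h6 : ContinuousAt (fun z => (z - chartAt ℂ c c) *
            loc 1 0 (chartAt ℂ c) (fun r => ρ c r * F q r) z) (chartAt ℂ c c) :=
            ((continuous_id.sub continuous_const).continuousAt).mul h4
          have h7 := h6.tendsto.mono_left (nhdsWithin_le_nhds (s := {chartAt ℂ c c}ᶜ))
          simpa using h7
        refine tendsto_nhds_unique h3 (h5.congr' ?_)
        filter_upwards [nhdsWithin_le_nhds ((chartAt ℂ c).open_target.mem_nhds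
          (mem_chart_target ℂ c)), self_mem_nhdsWithin] with z hz hne
        rw [loc_mul_const, hFu q hq z hz hne, pow_one, mul_inv_cancel_left₀ (sub_ne_zero.2 hne)]
    refine ⟨h.1, h.2.trans ?_⟩
    rw [huc]
    ring
  have hdec : ∀ r ∉ Set.range mark, ∑ c ∈ t, Isomonodromy.delBar 1 0 (fun r => ρ c r * F q r) r
      = Isomonodromy.delBar 1 0 (F q) r := by
    intro r hr
    have h1 : loc 1 0 (chartAt ℂ r) (F q)
        = fun z => ∑ c ∈ t, loc 1 0 (chartAt ℂ r) (fun r => ρ c r * F q r) z := by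
      ext z
      simp only [loc_mul_const]
      rw [← Finset.sum_mul, hsum, one_mul]
    simp only [Isomonodromy.delBar]
    rw [h1]
    simp only [wirtBar_eq_cD]
    rw [cD_sum]
    exact fun c _ => (hF.smul_const (hρ c)).differentiableAt_chartAt hD hq hr
  have hi := SurfIntegrable.sum t fun c hc => (key c hc).1
  refine ⟨hi.congr (Set.finite_range mark) hdec, ?_⟩
  rw [← surfInt_congr (Set.finite_range mark) hdec, surfInt_sum t fun c hc => (key c hc).1,
    Finset.sum_congr rfl fun c hc => (key c hc).2, Finset.sum_neg_distrib, ← Finset.mul_sum,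
    Finset.sum_comm]
  simp only [← Finset.sum_mul, hsum, one_mul]

/-- Differentials of type `(1, 1)` with simple poles are integrable, and the integral of a
holomorphic family of them can be differentiated under the integral sign. -/
theorem Mero.hasFDerivAt_surfInt [FiniteDimensional ℂ P] (hD : IsOpen D) {F : P → S → ℂ}
    (hF : Mero mark 1 1 1 D F) (hol : ∀ r ∉ Set.range mark, DifferentiableOn ℂ (fun q => F q r) D)
    {q₀ : P} (hq₀ : q₀ ∈ D) :
    ∃ A : P →L[ℂ] ℂ, HasFDerivAt (fun q => surfInt (F q)) A q₀ ∧
      ∀ v, A v = surfInt fun r => _root_.fderiv ℂ (fun q => F q r) q₀ v := by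
  obtain ⟨t, ρ, hρ, hK, hsum⟩ := exists_partition mark
  have key : ∀ c ∈ t, ∃ A : P →L[ℂ] ℂ,
      HasFDerivAt (fun q => surfInt fun r => ρ c r * F q r) A q₀ ∧
      (∀ q ∈ D, SurfIntegrable fun r => ρ c r * F q r) ∧
      ∀ v, (SurfIntegrable fun r => ρ c r * _root_.fderiv ℂ (fun q => F q r) q₀ v) ∧
        A v = surfInt fun r => ρ c r * _root_.fderiv ℂ (fun q => F q r) q₀ v := by
    intro c hc
    obtain ⟨K, hKc, hKK, hKρ, hKm⟩ := hK c hc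
    have hφ : chartAt ℂ c ∈ atlas ℂ S := chart_mem_atlas ℂ c
    set φ := chartAt ℂ c
    obtain ⟨u, hu, hu0, hFu⟩ := exists_smooth_extension hD hF hφ (hρ c _ hφ) hKc hKK hKρ
      (mem_chart_source ℂ c) hKm
    have hKcpt : IsCompact (φ '' K) := isCompact_image_chart hKc hKK
    have hO : IsOpen (Set.univ ×ˢ (φ '' K)ᶜ : Set (P × ℂ)) := isOpen_univ.prod hKcpt.isClosed.isOpen_compl
    have hInt : ∀ {w : P × ℂ → ℂ} {q}, ContDiffOn ℝ ∞ w (D ×ˢ Set.univ) → q ∈ D →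
        (∀ z ∉ φ '' K, w (q, z) = 0) → Integrable fun z => (z - φ c)⁻¹ * w (q, z) :=
      fun hw hq hw0 => integrable_inv_mul _ (contDiff_slice hw hq).continuous
        (HasCompactSupport.intro hKcpt hw0)
    have hrep : ∀ q ∈ D, (SurfIntegrable fun r => ρ c r * F q r) ∧
        (surfInt fun r => ρ c r * F q r) = 2 * Complex.I * ∫ z, (z - φ c)⁻¹ * u (q, z) :=
      fun q hq => surfInt_of_extension hφ hKc (fun r hr => by rw [hKρ r hr, zero_mul])
        (hInt hu hq (hu0 q)) (fun z hz => by rw [hu0 q z hz, mul_zero]) (φ c) fun z hz hne => by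
          rw [loc_mul_const, hFu q hq z hz hne, pow_one]
    have hmem : ∀ z ∈ φ '' K, z ≠ φ c → φ.symm z ∉ Set.range mark ∧ z ∈ φ.target := by
      rintro z ⟨r, hr, rfl⟩ hne
      refine ⟨?_, φ.map_source (hKc hr)⟩
      rw [φ.left_inv (hKc hr)]
      rintro ⟨j, rfl⟩
      exact hne (by rw [hKm j hr])
    -- Off the centre, `u (q, z)` is a multiple of `F q` at the corresponding point by a factor
    -- independent of `q`. It therefore inherits holomorphy in the parameter.
    have hueq : ∀ z ∈ φ '' K, z ≠ φ c → ∃ α : ℂ, (z - φ c) * (ρ c (φ.symm z) *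
        fac 1 1 (jac φ (chartAt ℂ (φ.symm z)) z)) = α ∧
        ∀ q ∈ D, u (q, z) = α * F q (φ.symm z) := fun z hz hne => ⟨_, rfl, fun q hq => by
      have h := hFu q hq z (hmem z hz hne).2 hne
      rw [pow_one, loc_eq, smul_eq_mul] at h
      rw [mul_assoc, mul_assoc, h, mul_inv_cancel_left₀ (sub_ne_zero.2 hne)]⟩
    have hhol : ∀ z ≠ φ c, DifferentiableOn ℂ (fun q => u (q, z)) D := by
      intro z hne
      by_cases hz : z ∈ φ '' K
      · obtain ⟨α, -, hα⟩ := hueq z hz hne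
        exact ((hol _ (hmem z hz hne).1).const_mul α).congr hα
      · exact (differentiableOn_const (0 : ℂ)).congr fun q _ => hu0 q z hz
    obtain ⟨A, hA, hAv⟩ := hasFDerivAt_integral_inv_mul hD hu hKcpt (fun q _ => hu0 q) (φ c) hhol hq₀
    have hpt0 : ∀ v, ∀ z ∉ φ '' K, pt v u (q₀, z) = 0 := fun v z hz => by
      have hm : (q₀, z) ∈ (Set.univ ×ˢ (φ '' K)ᶜ : Set (P × ℂ)) := ⟨Set.mem_univ q₀, hz⟩
      rw [pt, cD_congr_on hO (g := fun _ => 0) (fun w hw => hu0 w.1 w.2 hw.2) hm, cD_const]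
    have hder := fun v => surfInt_of_extension hφ hKc
      (f := fun r => ρ c r * _root_.fderiv ℂ (fun q => F q r) q₀ v)
      (fun r hr => by rw [hKρ r hr, zero_mul])
      (hInt (w := pt v u) (contDiffOn_cD (hD.prod isOpen_univ) hu) hq₀ (hpt0 v))
      (fun z hz => by rw [hpt0 v z hz, mul_zero]) (φ c) fun z hz hne => by
        by_cases hzK : z ∈ φ '' K
        · obtain ⟨α, hα0, hα⟩ := hueq z hzK hne
          have hd : DifferentiableAt ℂ (fun q => F q (φ.symm z)) q₀ :=
            (hol _ (hmem z hzK hne).1).differentiableAt (hD.mem_nhds hq₀)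
          have h1 := fderiv_slice (w := (q₀, z))
            (diffAt (hD.prod isOpen_univ) (by simp) hu ⟨hq₀, Set.mem_univ z⟩)
            ((hhol z hne).differentiableAt (hD.mem_nhds hq₀)) v
          have h2 : (fun q => u (q, z)) =ᶠ[𝓝 q₀] fun q => α * F q (φ.symm z) := by
            filter_upwards [hD.mem_nhds hq₀] with q hq using hα q hq
          dsimp only at h1
          rw [← h1, h2.fderiv_eq, fderiv_const_mul hd, smul_apply, ← hα0, loc_mul_const, loc_eq,
            smul_eq_mul, smul_eq_mul]
          have h3 : z - φ c ≠ 0 := sub_ne_zero.2 hne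
          field_simp
        · rw [hpt0 v z hzK, mul_zero, loc_mul_const, hKρ, zero_mul]
          exact fun h => hzK ⟨_, h, φ.right_inv hz⟩
    refine ⟨(2 * Complex.I) • A, ?_, fun q hq => (hrep q hq).1, fun v => ⟨(hder v).1, ?_⟩⟩
    · refine (hA.const_smul (2 * Complex.I)).congr_of_eventuallyEq ?_
      filter_upwards [hD.mem_nhds hq₀] with q hq
      rw [(hrep q hq).2]
      rfl
    · rw [(hder v).2, smul_apply, hAv, smul_eq_mul]
  choose! A hA hi hAv using key
  have hone : ∀ f : S → ℂ, (fun r => ∑ c ∈ t, ρ c r * f r) = f := fun f => by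
    ext r; rw [← Finset.sum_mul, hsum, one_mul]
  refine ⟨∑ c ∈ t, A c, ?_, fun v => ?_⟩
  · refine (HasFDerivAt.fun_sum hA).congr_of_eventuallyEq ?_
    filter_upwards [hD.mem_nhds hq₀] with q hq
    rw [← surfInt_sum t fun c hc => hi c hc q hq, hone]
  · rw [sum_apply, Finset.sum_congr rfl fun c hc => (hAv c hc v).2,
      ← surfInt_sum t fun c hc => (hAv c hc v).1, hone]

/-- A simple pole is integrable in real dimension two; the partition of unity reduces to one pole in
one chart. Unlike for differentiation, no holomorphy in the parameter is used. -/
theorem Mero.surfIntegrable (hD : IsOpen D) {F : P → S → ℂ} (hF : Mero mark 1 1 1 D F) {q : P}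
    (hq : q ∈ D) : SurfIntegrable (F q) := by
  obtain ⟨t, ρ, hρ, hK, hsum⟩ := exists_partition mark
  have h := SurfIntegrable.sum t (f := fun c r => ρ c r * F q r) fun c hc => by
    obtain ⟨K, hKc, hKK, hKρ, hKm⟩ := hK c hc
    have hφ : chartAt ℂ c ∈ atlas ℂ S := chart_mem_atlas ℂ c
    obtain ⟨u, hu, hu0, hFu⟩ := exists_smooth_extension hD hF hφ (hρ c _ hφ) hKc hKK hKρ
      (mem_chart_source ℂ c) hKm
    exact (surfInt_of_extension hφ hKc (fun r hr => by rw [hKρ r hr, zero_mul])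
      (integrable_inv_mul _ (contDiff_slice hu hq).continuous
        (HasCompactSupport.intro (isCompact_image_chart hKc hKK) (hu0 q)))
      (fun z hz => by rw [hu0 q z hz, mul_zero]) (chartAt ℂ c c) fun z hz hne => by
        rw [loc_mul_const, hFu q hq z hz hne, pow_one]).1
  simp only [← Finset.sum_mul, hsum, one_mul] at h
  exact h

end StokesTheorem

/-! ### The Lie algebra and its invariant form -/

section LieForm

variable {V : Type*} [NormedAddCommGroup V] [NormedSpace ℂ V] [FiniteDimensional ℂ V]
  (lie : LieSubalgebra ℂ (V →L[ℂ] V))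

/-- A linear projection of `End V` to the Lie algebra. -/
def lieProj : (V →L[ℂ] V) →ₗ[ℂ] lie :=
  (LinearMap.exists_leftInverse_of_injective (lie.toSubmodule.subtype)
    (Submodule.ker_subtype _)).choose

theorem lieProj_apply {X : V →L[ℂ] V} (hX : X ∈ lie) : lieProj lie X = ⟨X, hX⟩ :=
  DFunLike.congr_fun (LinearMap.exists_leftInverse_of_injective (lie.toSubmodule.subtype)
    (Submodule.ker_subtype _)).choose_spec (⟨X, hX⟩ : lie)

/-- The Killing form of the Lie algebra, extended to a continuous bilinear form on `End V`. -/
def form : (V →L[ℂ] V) →L[ℂ] (V →L[ℂ] V) →L[ℂ] ℂ :=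
  ((killingForm ℂ lie).compl₁₂ (lieProj lie) (lieProj lie)).toContinuousBilinearMap

variable {lie}

theorem form_apply {X Y : V →L[ℂ] V} (hX : X ∈ lie) (hY : Y ∈ lie) :
    form lie X Y = killingForm ℂ lie ⟨X, hX⟩ ⟨Y, hY⟩ := by
  rw [form, LinearMap.toContinuousBilinearMap_apply, LinearMap.compl₁₂_apply, lieProj_apply lie hX,
    lieProj_apply lie hY]

theorem kil_eq {X Y : V →L[ℂ] V} (hX : X ∈ lie) (hY : Y ∈ lie) : kil lie X Y = form lie X Y := by
  rw [kil, dif_pos ⟨hX, hY⟩, form_apply hX hY]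

variable (lie) in
theorem form_comm (X Y : V →L[ℂ] V) : form lie X Y = form lie Y X := by
  simp only [form, LinearMap.toContinuousBilinearMap_apply, LinearMap.compl₁₂_apply]
  exact LieModule.traceForm_comm ℂ lie lie _ _

theorem form_lie {X Y Z : V →L[ℂ] V} (hX : X ∈ lie) (hY : Y ∈ lie) (hZ : Z ∈ lie) :
    form lie ⁅X, Y⁆ Z = form lie X ⁅Y, Z⁆ := by
  rw [form_apply (lie.lie_mem hX hY) hZ, form_apply hX (lie.lie_mem hY hZ)]
  exact LieModule.traceForm_apply_lie_apply ℂ lie lie ⟨X, hX⟩ ⟨Y, hY⟩ ⟨Z, hZ⟩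

/-- The Killing form of a simple Lie algebra in characteristic zero is non-degenerate. -/
theorem eq_zero_of_form_eq_zero (hs : LieAlgebra.IsSimple ℂ lie) {X : V →L[ℂ] V} (hX : X ∈ lie)
    (h : ∀ Y ∈ lie, form lie X Y = 0) : X = 0 := by
  have h1 : (⟨X, hX⟩ : lie) = 0 := by
    have hnd := LieAlgebra.IsKilling.killingForm_nondegenerate ℂ lie
    refine hnd.1 _ fun Y => ?_
    rw [← form_apply hX Y.2]
    exact h Y Y.2
  exact congrArg Subtype.val h1

theorem isClosed_lie : IsClosed (lie : Set (V →L[ℂ] V)) :=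
  lie.toSubmodule.closed_of_finiteDimensional

variable (lie) in
/-- The Lie algebra is the kernel of a continuous linear map. -/
theorem exists_kernel : ∃ N : (V →L[ℂ] V) →L[ℂ] (V →L[ℂ] V), ∀ X, X ∈ lie ↔ N X = 0 := by
  refine ⟨LinearMap.toContinuousLinearMap
    (LinearMap.id - lie.toSubmodule.subtype ∘ₗ lieProj lie), fun X => ?_⟩
  have h : LinearMap.toContinuousLinearMap
      (LinearMap.id - lie.toSubmodule.subtype ∘ₗ lieProj lie) X = X - (lieProj lie X : V →L[ℂ] V) := rfl
  rw [h, sub_eq_zero]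
  constructor
  · intro hX
    rw [lieProj_apply lie hX]
  · intro hX
    rw [hX]
    exact (lieProj lie X).2

/-- The Lie algebra is the kernel of a linear map, which commutes with differentiation. Where `f` is
not differentiable, its derivative is zero by convention and the claim is trivial. -/
theorem cD_mem {X : Type*} [NormedAddCommGroup X] [NormedSpace ℝ X] {a b : X} {f : X → V →L[ℂ] V}
    {w : X} (h : ∀ᶠ x in 𝓝 w, f x ∈ lie) : cD a b f w ∈ lie := by
  by_cases hf : DifferentiableAt ℝ f w
  · obtain ⟨N, hN⟩ := exists_kernel lie
    have h1 : cD a b (fun x => N (f x)) w = 0 := by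
      rw [cD_congr (g := fun _ => 0) (by filter_upwards [h] with x hx using (hN _).1 hx), cD_const]
    have h2 : HasFDerivAt (fun x => N (f x)) ((N.restrictScalars ℝ).comp (fderiv ℝ f w)) w :=
      (N.restrictScalars ℝ).hasFDerivAt.comp w hf.hasFDerivAt
    rw [hN, cD, map_add, map_smul, ← h1, cD, h2.fderiv]
    rfl
  · rw [cD, fderiv_zero_of_not_differentiableAt hf]
    simp [lie.zero_mem]

theorem fderiv_mem {P : Type*} [NormedAddCommGroup P] [NormedSpace ℂ P] {D : Set P} (hD : IsOpen D)
    {f : P → V →L[ℂ] V} (h : ∀ q ∈ D, f q ∈ lie) {q : P} (hq : q ∈ D) (v : P) :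
    fderiv ℂ f q v ∈ lie := by
  by_cases hf : DifferentiableAt ℂ f q
  · obtain ⟨N, hN⟩ := exists_kernel lie
    have h1 : HasFDerivAt (fun x => N (f x)) (N.comp (fderiv ℂ f q)) q :=
      N.hasFDerivAt.comp q hf.hasFDerivAt
    have h2 : (fun x => N (f x)) =ᶠ[𝓝 q] fun _ => 0 := by
      filter_upwards [hD.mem_nhds hq] with x hx using (hN _).1 (h x hx)
    have h3 : N.comp (fderiv ℂ f q) = 0 := by
      rw [← h1.fderiv, h2.fderiv_eq, fderiv_const_apply]
    exact (hN _).2 (DFunLike.congr_fun h3 v)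
  · rw [fderiv_zero_of_not_differentiableAt hf]
    simp [lie.zero_mem]

variable {S : Type*} [TopologicalSpace S] [ChartedSpace ℂ S]

theorem loc_mem {a b : ℤ} {φ : OpenPartialHomeomorph S ℂ} {f : S → V →L[ℂ] V} (h : ∀ r, f r ∈ lie)
    (z : ℂ) : loc a b φ f z ∈ lie := lie.smul_mem _ (h _)

theorem del_mem {a b : ℤ} {f : S → V →L[ℂ] V} (h : ∀ r, f r ∈ lie) (r : S) : del a b f r ∈ lie := by
  rw [del, wirt_eq_cD]
  exact cD_mem (Filter.Eventually.of_forall (loc_mem h))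

theorem delBar_mem {a b : ℤ} {f : S → V →L[ℂ] V} (h : ∀ r, f r ∈ lie) (r : S) :
    delBar a b f r ∈ lie := by
  rw [delBar, wirtBar_eq_cD]
  exact cD_mem (Filter.Eventually.of_forall (loc_mem h))

theorem dw_mem {n l : ℕ} (Q : Setup S V n l) {t : Fin l → ℂ} {f : S → V →L[ℂ] V}
    (h : ∀ r, f r ∈ Q.lie) (r : S) : Q.dw t f r ∈ Q.lie :=
  Q.lie.add_mem (delBar_mem h r) (Q.lie.smul_mem _ (del_mem h r))

theorem HasResidue.mem {f : S → V →L[ℂ] V} (h : ∀ r, f r ∈ lie) {r : S} {e : V →L[ℂ] V}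
    (he : HasResidue f r e) : e ∈ lie :=
  isClosed_lie.mem_of_tendsto he (Filter.Eventually.of_forall fun z => lie.smul_mem _ (loc_mem h z))

end LieForm

/-! ### Residues -/

section Residues

variable {S : Type*} [TopologicalSpace S] [ChartedSpace ℂ S]
variable {P E E₁ E₂ : Type*} [NormedAddCommGroup P] [NormedSpace ℂ P]
  [NormedAddCommGroup E] [NormedSpace ℂ E]
  [NormedAddCommGroup E₁] [NormedSpace ℂ E₁] [NormedAddCommGroup E₂] [NormedSpace ℂ E₂] {n : ℕ}
  {mark : Fin n → S} {D : Set P}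

theorem PoleFamily.hasResidue {F : P → S → E} {res : P → Fin n → E} (h : PoleFamily mark D F res)
    {q : P} (hq : q ∈ D) (c : Fin n) : HasResidue (F q) (mark c) (res q c) := by
  obtain ⟨N, hN, u, hu, hF⟩ := h.2.1 _ (chart_mem_atlas ℂ (mark c)) c (mem_chart_source ℂ _)
  have hc : ContinuousAt (fun z => u (q, z)) (chartAt ℂ (mark c) (mark c)) := by
    have h1 : ContinuousOn (fun z => u (q, z)) N :=
      hu.continuousOn.comp (by fun_prop) fun z hz => ⟨hq, hz⟩
    exact h1.continuousAt hN
  have h2 : ContinuousAt (fun z => res q c + (z - chartAt ℂ (mark c) (mark c)) • u (q, z))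
      (chartAt ℂ (mark c) (mark c)) :=
    continuousAt_const.add ((continuousAt_id.sub continuousAt_const).smul hc)
  have h3 := h2.tendsto.mono_left
    (nhdsWithin_le_nhds (s := {chartAt ℂ (mark c) (mark c)}ᶜ))
  rw [sub_self, zero_smul, add_zero] at h3
  refine h3.congr' ?_
  filter_upwards [nhdsWithin_le_nhds hN, self_mem_nhdsWithin] with z hz hne
  rw [hF q hq z hz hne, smul_add, smul_inv_smul₀ (sub_ne_zero.2 hne)]

theorem HasResidue.unique {f : S → E} {r : S} {e e' : E} (h : HasResidue f r e)
    (h' : HasResidue f r e') : e = e' :=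
  tendsto_nhds_unique h h'

theorem eventually_notMem_range [T2Space S] (mark : Fin n → S) (c : Fin n) :
    ∀ᶠ z in 𝓝[≠] (chartAt ℂ (mark c) (mark c)),
      z ∈ (chartAt ℂ (mark c)).target ∧ (chartAt ℂ (mark c)).symm z ∉ Set.range mark := by
  obtain ⟨N, hN, hcN, hNt, hp⟩ := exists_isolating mark (chartAt ℂ (mark c)) (mem_chart_source ℂ _)
  filter_upwards [nhdsWithin_le_nhds (hN.mem_nhds hcN), self_mem_nhdsWithin] with z hz hne
    using hp z hz hne

theorem HasResidue.congr [T2Space S] {f g : S → E} {c : Fin n} {e : E}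
    (h : HasResidue f (mark c) e) (hfg : ∀ r ∉ Set.range mark, f r = g r) :
    HasResidue g (mark c) e := by
  refine Filter.Tendsto.congr' ?_ h
  filter_upwards [eventually_notMem_range mark c] with z hz
  rw [loc_congr (hfg _ hz.2)]

theorem HasResidue.add {f g : S → E} {r : S} {e e' : E} (h : HasResidue f r e)
    (h' : HasResidue g r e') : HasResidue (fun r => f r + g r) r (e + e') := by
  refine (Filter.Tendsto.add h h').congr fun z => ?_
  rw [loc_add, smul_add]

theorem HasResidue.const_smul {f : S → E} {r : S} {e : E} (h : HasResidue f r e) (s : ℂ) :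
    HasResidue (fun r => s • f r) r (s • e) := by
  refine (Filter.Tendsto.const_smul h s).congr fun z => ?_
  rw [loc_const_smul, smul_comm]

variable [IsManifold 𝓘(ℂ) ω S]

theorem HasResidue.bilin (B : E₁ →L[ℂ] E₂ →L[ℂ] E) {f : S → E₁} {g : S → E₂} {r : S} {e : E₂}
    (hf : ContinuousAt (loc 0 0 (chartAt ℂ r) f) (chartAt ℂ r r)) (hg : HasResidue g r e) :
    HasResidue (fun r => B (f r) (g r)) r (B (f r) e) := by
  have h1 := hf.tendsto.mono_left (nhdsWithin_le_nhds (s := {chartAt ℂ r r}ᶜ))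
  rw [loc_chartAt] at h1
  have h2 : Filter.Tendsto (fun z => B (loc 0 0 (chartAt ℂ r) f z)
      ((z - chartAt ℂ r r) • loc 1 0 (chartAt ℂ r) g z)) (𝓝[≠] (chartAt ℂ r r)) (𝓝 (B (f r) e)) :=
    (B.isBoundedBilinearMap.continuous.tendsto (f r, e)).comp (h1.prodMk_nhds hg)
  refine h2.congr' ?_
  filter_upwards [nhdsWithin_le_nhds
    ((chartAt ℂ r).open_target.mem_nhds (mem_chart_target ℂ r))] with z hz
  rw [loc_bilin B (zero_add 1) (zero_add 0) (chart_mem_atlas ℂ r) _ _ hz, map_smul]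

theorem hasResidue_zero {f : S → E} {r : S}
    (hf : ContinuousAt (loc 1 0 (chartAt ℂ r) f) (chartAt ℂ r r)) : HasResidue f r 0 := by
  have h1 : ContinuousAt (fun z => (z - chartAt ℂ r r) • loc 1 0 (chartAt ℂ r) f z)
      (chartAt ℂ r r) := (continuousAt_id.sub continuousAt_const).smul hf
  have h2 := h1.tendsto.mono_left (nhdsWithin_le_nhds (s := {chartAt ℂ r r}ᶜ))
  rwa [sub_self, zero_smul] at h2

theorem continuousAt_loc {a b : ℤ} {f : S → E} (r : S)
    (hf : ∀ φ ∈ atlas ℂ S, ContDiffOn ℝ ∞ (loc a b φ f) φ.target) :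
    ContinuousAt (loc a b (chartAt ℂ r) f) (chartAt ℂ r r) :=
  (hf _ (chart_mem_atlas ℂ r)).continuousOn.continuousAt
    ((chartAt ℂ r).open_target.mem_nhds (mem_chart_target ℂ r))

end Residues

/-! ### The curvature of a configuration -/

section Leibniz

variable {S : Type*} [TopologicalSpace S] [ChartedSpace ℂ S] [IsManifold 𝓘(ℂ) ω S]
variable {E E₁ E₂ : Type*} [NormedAddCommGroup E] [NormedSpace ℂ E]
  [NormedAddCommGroup E₁] [NormedSpace ℂ E₁] [NormedAddCommGroup E₂] [NormedSpace ℂ E₂]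

theorem eventually_loc_bilin (B : E₁ →L[ℂ] E₂ →L[ℂ] E) {a b a' b' a'' b'' : ℤ} (ha : a + a' = a'')
    (hb : b + b' = b'') (f : S → E₁) (g : S → E₂) (r : S) :
    loc a'' b'' (chartAt ℂ r) (fun r => B (f r) (g r)) =ᶠ[𝓝 (chartAt ℂ r r)]
      fun z => B (loc a b (chartAt ℂ r) f z) (loc a' b' (chartAt ℂ r) g z) := by
  filter_upwards [(chartAt ℂ r).open_target.mem_nhds (mem_chart_target ℂ r)] with z hz
    using loc_bilin B ha hb (chart_mem_atlas ℂ r) f g hz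

theorem delBar_bilin (B : E₁ →L[ℂ] E₂ →L[ℂ] E) {a : ℤ} {f : S → E₁} {g : S → E₂} {r : S}
    (hf : DifferentiableAt ℝ (loc a 0 (chartAt ℂ r) f) (chartAt ℂ r r))
    (hg : DifferentiableAt ℝ (loc 0 0 (chartAt ℂ r) g) (chartAt ℂ r r)) :
    delBar a 0 (fun r => B (f r) (g r)) r = B (delBar a 0 f r) (g r) + B (f r) (delBar 0 0 g r) := by
  simp only [delBar, wirtBar_eq_cD]
  rw [cD_congr (eventually_loc_bilin B (add_zero a) (add_zero 0) f g r), cD_bilin B hf hg,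
    loc_chartAt, loc_chartAt]

theorem del_bilin (B : E₁ →L[ℂ] E₂ →L[ℂ] E) {b : ℤ} {f : S → E₁} {g : S → E₂} {r : S}
    (hf : DifferentiableAt ℝ (loc 0 b (chartAt ℂ r) f) (chartAt ℂ r r))
    (hg : DifferentiableAt ℝ (loc 0 0 (chartAt ℂ r) g) (chartAt ℂ r r)) :
    del 0 b (fun r => B (f r) (g r)) r = B (del 0 b f r) (g r) + B (f r) (del 0 0 g r) := by
  simp only [del, wirt_eq_cD]
  rw [cD_congr (eventually_loc_bilin B (add_zero 0) (add_zero b) f g r), cD_bilin B hf hg,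
    loc_chartAt, loc_chartAt]

end Leibniz

/-! ### Differentials orthogonal to all smooth functions -/

section DuBoisReymond

open MeasureTheory

variable {S : Type*} [TopologicalSpace S] [T2Space S] [CompactSpace S] [ChartedSpace ℂ S]
  [IsManifold 𝓘(ℂ) ω S]

/-- A compactly supported smooth function in a chart extends to the surface. -/
theorem exists_extension {φ : OpenPartialHomeomorph S ℂ} (hφ : φ ∈ atlas ℂ S) {g₀ : ℂ → ℂ}
    (hg : ContDiff ℝ ∞ g₀) (hs : HasCompactSupport g₀) (ht : tsupport g₀ ⊆ φ.target) :
    ∃ (g : S → ℂ) (K : Set S), K ⊆ φ.source ∧ φ '' K = tsupport g₀ ∧ (∀ r ∉ K, g r = 0) ∧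
      (∀ z ∈ φ.target, g (φ.symm z) = g₀ z) ∧
      ∀ ψ ∈ atlas ℂ S, ContDiffOn ℝ ∞ (loc 0 0 ψ g) ψ.target := by
  classical
  set K : Set S := φ.symm '' tsupport g₀ with hKdef
  have hKs : K ⊆ φ.source := by
    rintro _ ⟨z, hz, rfl⟩
    exact φ.map_target (ht hz)
  have hKc : IsClosed K := ((hs.isCompact).image_of_continuousOn
    (φ.continuousOn_symm.mono ht)).isClosed
  have hg0 : ∀ r ∉ K, (if r ∈ φ.source then g₀ (φ r) else 0) = 0 := by
    intro r hr
    split_ifs with h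
    · refine image_eq_zero_of_notMem_tsupport fun h' => hr ⟨_, h', φ.left_inv h⟩
    · rfl
  refine ⟨fun r => if r ∈ φ.source then g₀ (φ r) else 0, K, hKs, ?_, hg0, fun z hz => ?_,
    fun ψ hψ z hz => ContDiffAt.contDiffWithinAt ?_⟩
  · rw [hKdef, Set.image_image]
    ext z
    constructor
    · rintro ⟨y, hy, rfl⟩
      simpa [φ.right_inv (ht hy)] using hy
    · intro hz
      exact ⟨z, hz, φ.right_inv (ht hz)⟩
  · dsimp only
    rw [if_pos (φ.map_target hz), φ.right_inv hz]
  · by_cases h : ψ.symm z ∈ φ.source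
    · have hov : z ∈ overlap ψ φ := ⟨hz, h⟩
      have h1 : ContDiffOn ℝ ∞ (fun z => g₀ (φ (ψ.symm z))) (overlap ψ φ) :=
        hg.comp_contDiffOn (((contDiffOn_trans hψ hφ).of_le le_top).restrict_scalars ℝ)
      refine (h1.contDiffAt ((isOpen_overlap ψ φ).mem_nhds hov)).congr_of_eventuallyEq ?_
      filter_upwards [(isOpen_overlap ψ φ).mem_nhds hov] with y hy
      rw [loc_zero_zero]
      exact if_pos hy.2
    · refine (contDiffAt_const (c := (0 : ℂ))).congr_of_eventuallyEq ?_
      filter_upwards [(ψ.symm.isOpen_inter_preimage hKc.isOpen_compl).mem_nhds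
        ⟨hz, fun h' => h (hKs h')⟩] with y hy
      rw [loc_zero_zero]
      exact hg0 _ hy.2

variable {P : Type*} [NormedAddCommGroup P] [NormedSpace ℂ P] {n : ℕ} {mark : Fin n → S} {D : Set P}

/-- A differential of type `(1, 1)` that is orthogonal to all smooth functions vanishes. -/
theorem Mero.eq_zero_of_surfInt {h : P → S → ℂ} (hh : Mero mark 1 1 1 D h) {q : P} (hq : q ∈ D)
    (h0 : ∀ g : S → ℂ, (∀ ψ ∈ atlas ℂ S, ContDiffOn ℝ ∞ (loc 0 0 ψ g) ψ.target) →
      surfInt (fun r => g r * h q r) = 0) : ∀ r ∉ Set.range mark, h q r = 0 := by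
  intro r hr
  have hφ : chartAt ℂ r ∈ atlas ℂ S := chart_mem_atlas ℂ r
  set φ := chartAt ℂ r
  have hU := isOpen_punct mark φ
  have hf : ContinuousOn (loc 1 1 φ (h q)) (punct mark φ) :=
    (hh.1 φ hφ).continuousOn.comp (f := fun z => (q, z)) (by fun_prop) fun z hz => ⟨hq, hz⟩
  -- Real test functions supported in the punctured chart extend by zero to the surface, where the
  -- pairing vanishes by hypothesis. The coefficient is thus zero almost everywhere, hence
  -- everywhere by continuity.
  have hae := hU.ae_eq_zero_of_integral_contDiff_smul_eq_zero (μ := volume)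
    (hf.locallyIntegrableOn hU.measurableSet) fun g₀ hg hs ht => by
      have hgC : ContDiff ℝ ∞ fun z => (g₀ z : ℂ) := Complex.ofRealCLM.contDiff.comp hg
      have hts : tsupport (fun z => (g₀ z : ℂ)) = tsupport g₀ := by
        have h1 : Function.support (fun z => (g₀ z : ℂ)) = Function.support g₀ := by
          ext z; simp
        rw [tsupport, h1, tsupport]
      have hsC : HasCompactSupport fun z => (g₀ z : ℂ) := by
        rw [HasCompactSupport, hts]; exact hs.isCompact
      obtain ⟨g, K, hKs, hKi, hgK, hgg, hgs⟩ := exists_extension hφ hgC hsC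
        (hts ▸ ht.trans Set.inter_subset_left)
      rw [hts] at hKi
      have hcont : Continuous fun z => g₀ z • loc 1 1 φ (h q) z := by
        rw [continuous_iff_continuousAt]
        intro z
        by_cases hz : z ∈ tsupport g₀
        · exact hg.continuous.continuousAt.smul (hf.continuousAt (hU.mem_nhds (ht hz)))
        · refine (continuousAt_const (y := (0 : ℂ))).congr ?_
          filter_upwards [(isClosed_tsupport g₀).isOpen_compl.mem_nhds hz] with y hy
          rw [image_eq_zero_of_notMem_tsupport hy, zero_smul]
      have hw0 : ∀ z ∉ tsupport g₀, g₀ z • loc 1 1 φ (h q) z = 0 := fun z hz => by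
        rw [image_eq_zero_of_notMem_tsupport hz, zero_smul]
      have h1 := (surfInt_of_extension hφ hKs (f := fun r => g r * h q r)
        (fun r hr => by rw [hgK r hr, zero_mul])
        (hcont.integrable_of_hasCompactSupport (HasCompactSupport.intro hs.isCompact hw0))
        (fun z hz => hw0 z (hKi ▸ hz)) 0 fun z hz _ => by rw [loc_mul_const, hgg z hz]; rfl).2
      rw [h0 g hgs] at h1
      have h2 : (2 * Complex.I : ℂ) ≠ 0 := by simp
      exact (mul_eq_zero.1 h1.symm).resolve_left h2
  have h2 : loc 1 1 φ (h q) =ᵐ[volume.restrict (punct mark φ)] fun _ => 0 := by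
    filter_upwards [ae_restrict_mem hU.measurableSet, ae_restrict_of_ae hae] with z hz hz' using hz' hz
  have h3 := Measure.eqOn_open_of_ae_eq h2 hU hf continuousOn_const (mem_punct_chartAt hr)
  rwa [loc_chartAt] at h3

end DuBoisReymond

/-! ### Flatness -/

section Flatness

variable {S V : Type*} [TopologicalSpace S] [T2Space S] [CompactSpace S] [ChartedSpace ℂ S]
  [IsManifold 𝓘(ℂ) ω S] [NormedAddCommGroup V] [NormedSpace ℂ V] [FiniteDimensional ℂ V] {n l : ℕ}
  {Q : Setup S V n l} {P : Type*} [NormedAddCommGroup P] [NormedSpace ℂ P] [FiniteDimensional ℂ P]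
  {D : Set P} {F : P → FieldConf S V n} {time : P →L[ℂ] (Fin l → ℂ)}

/-- The curvature of a configuration, off the marked points. -/
def Setup.curv (Q : Setup S V n l) (t : Fin l → ℂ) (c : FieldConf S V n) (r : S) : V →L[ℂ] V :=
  delBar 1 0 c.L r + del 0 1 (fun r' => Q.mu t r' • c.L r') r - Q.kappa • del 0 1 c.Lbar r
    + ⁅c.Lbar r, c.L r⁆

theorem Setup.IsFamily.mero_L (hF : Q.IsFamily D F) (hD : IsOpen D) :
    Mero Q.mark 1 1 0 D fun q => (F q).L := hF.L_pole.mero hD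

theorem Setup.IsFamily.mero_Lbar (hF : Q.IsFamily D F) :
    Mero Q.mark 0 0 1 D fun q => (F q).Lbar := hF.Lbar_smooth.mero

theorem mero_of_param {mark : Fin n → S} {f : P → ℂ} (hf : ContDiffOn ℝ ∞ f D) :
    Mero mark 0 0 0 D fun q (_ : S) => f q := by
  refine Mero.of_smooth fun φ _ => ?_
  refine (hf.comp contDiffOn_fst fun w hw => hw.1).congr fun w _ => ?_
  rw [lf, loc_zero_zero]
  rfl

/-- Time enters as a linear function of a general parameter: a projection on the coordinate domain
of a gauge fixing, the identity on the space of times. The same lemmas then serve the solution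
family and the given family. -/
theorem contDiffOn_time (time : P →L[ℂ] (Fin l → ℂ)) (s : Fin l) :
    ContDiffOn ℝ ∞ (fun q => time q s) D :=
  (((ContinuousLinearMap.proj s).comp time).restrictScalars ℝ).contDiff.contDiffOn

theorem Setup.mero_mu0 (Q : Setup S V n l) (s : Fin l) :
    Mero Q.mark 0 (-1) 1 D fun _ => Q.mu0 s := Mero.of_const (Q.mu0_smooth s)

theorem Setup.mero_mu (Q : Setup S V n l) (time : P →L[ℂ] (Fin l → ℂ)) :
    Mero Q.mark 0 (-1) 1 D fun q => Q.mu (time q) :=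
  Mero.sum Finset.univ fun s _ => by
    simpa using (mero_of_param (contDiffOn_time time s)).smul (zero_add (-1)) (zero_add 1)
      (Q.mero_mu0 s)

variable {E : Type*} [NormedAddCommGroup E] [NormedSpace ℂ E]

theorem Setup.mero_mu0_smul (Q : Setup S V n l) (s : Fin l) {k : ℕ} {a b a' b' : ℤ}
    (ha : -1 + a = a') (hb : 1 + b = b') {G : P → S → E} (hG : Mero Q.mark (k + 1) a b D G) :
    Mero Q.mark k a' b' D fun q r => Q.mu0 s r • G q r :=
  Mero.smul_vanish (Q.mu0_smooth s) (Q.mu0_vanish s) ha hb hG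

theorem Setup.mero_mu_smul (Q : Setup S V n l) (time : P →L[ℂ] (Fin l → ℂ)) {k : ℕ} {a b a' b' : ℤ}
    (ha : -1 + a = a') (hb : 1 + b = b') {G : P → S → E} (hG : Mero Q.mark (k + 1) a b D G) :
    Mero Q.mark k a' b' D fun q r => Q.mu (time q) r • G q r := by
  simp only [Setup.mu, Finset.sum_smul, mul_smul]
  refine Mero.sum Finset.univ fun s _ => ?_
  simpa using (mero_of_param (contDiffOn_time time s)).smul (zero_add a') (zero_add b')
    (Q.mero_mu0_smul s ha hb hG)

theorem Setup.IsFamily.mero_curv (hF : Q.IsFamily D F) (hD : IsOpen D)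
    (time : P →L[ℂ] (Fin l → ℂ)) : Mero Q.mark 1 1 1 D fun q => Q.curv (time q) (F q) := by
  have h1 := (hF.mero_L hD).delBar hD
  have h2 := ((Q.mero_mu_smul time (a' := 0) (b' := 1) rfl rfl (hF.mero_L hD)).del hD).mono zero_le_one
  have h3 := ((hF.mero_Lbar.del hD).const_smul Q.kappa).mono zero_le_one
  have h4 := hF.mero_Lbar.lie (zero_add 1) (add_zero 1) (hF.mero_L hD)
  exact ((h1.add h2).sub h3).add h4

theorem Setup.IsFamily.curv_mem (hF : Q.IsFamily D F) {q : P} (hq : q ∈ D) (t : Fin l → ℂ) (r : S) :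
    Q.curv t (F q) r ∈ Q.lie := by
  refine Q.lie.add_mem (Q.lie.sub_mem (Q.lie.add_mem (delBar_mem (hF.L_mem q hq) r)
    (del_mem (fun r => Q.lie.smul_mem _ (hF.L_mem q hq r)) r))
    (Q.lie.smul_mem _ (del_mem (hF.Lbar_mem q hq) r)))
    (Q.lie.lie_mem (hF.Lbar_mem q hq r) (hF.L_mem q hq r))

theorem Setup.IsFamily.p_mem (hF : Q.IsFamily D F) {q : P} (hq : q ∈ D) (a : Fin n) :
    (F q).p a ∈ Q.lie := (hF.L_pole.hasResidue hq a).mem (hF.L_mem q hq)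

/-- The test functions for flatness. -/
structure Setup.IsTest (Q : Setup S V n l) (e : S → V →L[ℂ] V) : Prop where
  mem : ∀ r, e r ∈ Q.lie
  smooth : ∀ φ ∈ atlas ℂ S, ContDiffOn ℝ ∞ (loc 0 0 φ e) φ.target

theorem Setup.IsTest.mero {e : S → V →L[ℂ] V} (he : Q.IsTest e) :
    Mero Q.mark 0 0 0 D fun (_ : P) => e := Mero.of_const he.smooth

theorem Setup.IsTest.diff {e : S → V →L[ℂ] V} (he : Q.IsTest e) (r : S) :
    DifferentiableAt ℝ (loc 0 0 (chartAt ℂ r) e) (chartAt ℂ r r) :=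
  diffAt (chartAt ℂ r).open_target (by simp) (he.smooth _ (chart_mem_atlas ℂ r))
    (mem_chart_target ℂ r)

theorem Setup.IsTest.mero_dw {e : S → V →L[ℂ] V} (he : Q.IsTest e) (hD : IsOpen D)
    (time : P →L[ℂ] (Fin l → ℂ)) : Mero Q.mark 0 0 1 D fun q => Q.dw (time q) e :=
  (he.mero.delBar hD).add
    ((Q.mero_mu time).smul (a'' := 0) (b'' := 1) rfl rfl (he.mero.del hD))

/-- The flatness condition, paired with a test function, through the curvature. -/
theorem Setup.IsFamily.surfInt_eq_curv (hF : Q.IsFamily D F) (hD : IsOpen D)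
    (time : P →L[ℂ] (Fin l → ℂ)) {q : P} (hq : q ∈ D) {e : S → V →L[ℂ] V} (he : Q.IsTest e) :
    surfInt (fun r => -kil Q.lie ((F q).L r) (Q.dw (time q) e r)
        - Q.kappa * kil Q.lie (del 0 1 (F q).Lbar r) (e r)
        + kil Q.lie ⁅(F q).Lbar r, (F q).L r⁆ (e r))
      = 2 * Real.pi * Complex.I * ∑ a, kil Q.lie ((F q).p a) (e (Q.mark a))
        + surfInt fun r => form Q.lie (Q.curv (time q) (F q) r) (e r) := by
  set B := form Q.lie
  have hLm := hF.mero_L hD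
  have hμL := Q.mero_mu_smul time (a' := 0) (b' := 1) rfl rfl hLm
  -- Integration by parts against `e`. Cauchy's theorem for `<L, e>` produces the delta functions at
  -- the marked points, while Stokes' theorem for `<μL, e>` contributes nothing, since `μ` cancels
  -- the pole.
  have hs1 := Mero.surfInt_delBar hD (hLm.bilin B (add_zero 1) (add_zero 0) he.mero) Q.mark_injective
    hq (res := fun a => B ((F q).p a) (e (Q.mark a))) fun a => by
      have h := HasResidue.bilin B.flip (continuousAt_loc (Q.mark a) he.smooth)
        (hF.L_pole.hasResidue hq a)
      exact h
  have hs2 := Mero.surfInt_del hD (hμL.bilin B (add_zero 0) (add_zero 1) he.mero) hq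
  have hs3 := ((hF.mero_curv hD time).bilin B (add_zero 1) (add_zero 1) he.mero).surfIntegrable hD hq
  have hint : SurfIntegrable (fun r => B (Q.curv (time q) (F q) r) (e r)
      - (delBar 1 0 (fun r => B ((F q).L r) (e r)) r
        + del 0 1 (fun r => B (Q.mu (time q) r • (F q).L r) (e r)) r)) :=
    hs3.sub (hs1.1.add hs2.1)
  have heq : surfInt (fun r => -kil Q.lie ((F q).L r) (Q.dw (time q) e r)
        - Q.kappa * kil Q.lie (del 0 1 (F q).Lbar r) (e r)
        + kil Q.lie ⁅(F q).Lbar r, (F q).L r⁆ (e r))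
      = surfInt (fun r => B (Q.curv (time q) (F q) r) (e r)
      - (delBar 1 0 (fun r => B ((F q).L r) (e r)) r
        + del 0 1 (fun r => B (Q.mu (time q) r • (F q).L r) (e r)) r)) := by
    refine surfInt_congr (Set.finite_range Q.mark) fun r hr => ?_
    rw [delBar_bilin B (hLm.differentiableAt_chartAt hD hq hr) (he.diff r),
      del_bilin B (hμL.differentiableAt_chartAt hD hq hr) (he.diff r),
      kil_eq (hF.L_mem q hq r) (dw_mem Q he.mem r), kil_eq (del_mem (hF.Lbar_mem q hq) r) (he.mem r),
      kil_eq (Q.lie.lie_mem (hF.Lbar_mem q hq r) (hF.L_mem q hq r)) (he.mem r), Setup.curv, Setup.dw]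
    simp only [map_add, map_sub, map_smul, add_apply, sub_apply, smul_apply, smul_eq_mul]
    ring
  rw [heq, surfInt_sub hs3 (hs1.1.add hs2.1), surfInt_add hs1.1 hs2.1, hs1.2, hs2.2]
  rw [Finset.sum_congr rfl fun a _ => kil_eq (hF.p_mem hq a) (he.mem (Q.mark a))]
  ring

theorem Setup.IsTest.smul {g : S → ℂ} (hg : ∀ φ ∈ atlas ℂ S, ContDiffOn ℝ ∞ (loc 0 0 φ g) φ.target)
    {Y : V →L[ℂ] V} (hY : Y ∈ Q.lie) : Q.IsTest fun r => g r • Y := by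
  refine ⟨fun r => Q.lie.smul_mem _ hY, fun φ hφ => ?_⟩
  refine ((hg φ hφ).smul contDiffOn_const (g := fun _ => Y)).congr fun z _ => ?_
  change _ = loc 0 0 φ g z • Y
  rw [loc_zero_zero, loc_zero_zero]

/-- A family is flat if and only if its curvature vanishes off the marked points. -/
theorem Setup.IsFamily.flat_iff (hF : Q.IsFamily D F) (hD : IsOpen D)
    (time : P →L[ℂ] (Fin l → ℂ)) {q : P} (hq : q ∈ D) :
    Q.Flat (time q) (F q) ↔ ∀ r ∉ Set.range Q.mark, Q.curv (time q) (F q) r = 0 := by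
  constructor
  · intro h r hr
    -- Test functions `g Y`, with `g` scalar and `Y` a fixed element of the Lie algebra, isolate the
    -- scalar components of the curvature; non-degeneracy of the Killing form recovers the curvature
    -- itself.
    refine eq_zero_of_form_eq_zero Q.simple (hF.curv_mem hq _ r) fun Y hY => ?_
    have hm : Mero Q.mark 1 1 1 D fun q r => form Q.lie (Q.curv (time q) (F q) r) Y :=
      (hF.mero_curv hD time).map ((form Q.lie).flip Y)
    refine hm.eq_zero_of_surfInt hq (fun g hg => ?_) r hr
    have he := Setup.IsTest.smul (Q := Q) hg hY
    have h1 := hF.surfInt_eq_curv hD time hq he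
    rw [h _ he.mem he.smooth, left_eq_add] at h1
    rw [← h1]
    simp only [map_smul, smul_eq_mul]
  · intro h e he hes
    rw [hF.surfInt_eq_curv hD time hq ⟨he, hes⟩, add_eq_left,
      surfInt_congr (Set.finite_range Q.mark) (g := fun _ => 0) fun r hr => by
        rw [h r hr, map_zero, zero_apply], surfInt_zero]

/-! ### The derivative of the flatness condition -/

theorem hasDerivAt_bilin {E₁ E₂ : Type*} [NormedAddCommGroup E₁] [NormedSpace ℂ E₁]
    [NormedAddCommGroup E₂] [NormedSpace ℂ E₂] (B : E₁ →L[ℂ] E₂ →L[ℂ] E) {f : ℂ → E₁} {g : ℂ → E₂}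
    {f' : E₁} {g' : E₂} {s : ℂ} (hf : HasDerivAt f f' s) (hg : HasDerivAt g g' s) :
    HasDerivAt (fun s => B (f s) (g s)) (B f' (g s) + B (f s) g') s :=
  (B.hasFDerivAt.comp_hasDerivAt s hf).clm_apply hg

theorem differentiableAt_complex_bilin {E₁ E₂ : Type*} [NormedAddCommGroup E₁] [NormedSpace ℂ E₁]
    [NormedAddCommGroup E₂] [NormedSpace ℂ E₂] (B : E₁ →L[ℂ] E₂ →L[ℂ] E) {f : P → E₁} {g : P → E₂}
    {q : P} (hf : DifferentiableAt ℂ f q) (hg : DifferentiableAt ℂ g q) :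
    DifferentiableAt ℂ (fun q => B (f q) (g q)) q :=
  (B.hasFDerivAt.comp q hf.hasFDerivAt).differentiableAt.clm_apply hg

theorem Setup.IsFamily.line_L (hF : Q.IsFamily D F) (hD : IsOpen D) {q : P} (hq : q ∈ D) (v : P)
    (r : S) : HasDerivAt (fun s : ℂ => (F (q + s • v)).L r) (dL F q v r) 0 :=
  (((hF.L_pole.2.2.1 r).differentiableAt (hD.mem_nhds hq)).hasFDerivAt.hasLineDerivAt v)

theorem Setup.IsFamily.line_Lbar (hF : Q.IsFamily D F) (hD : IsOpen D) {q : P} (hq : q ∈ D) (v : P)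
    (r : S) : HasDerivAt (fun s : ℂ => (F (q + s • v)).Lbar r) (dLbar F q v r) 0 :=
  (((hF.Lbar_smooth.2 r).differentiableAt (hD.mem_nhds hq)).hasFDerivAt.hasLineDerivAt v)

theorem Setup.line_mu (Q : Setup S V n l) (time : P →L[ℂ] (Fin l → ℂ)) (q v : P) (r : S) :
    HasDerivAt (fun s : ℂ => Q.mu (time (q + s • v)) r) (Q.mu (time v) r) 0 := by
  simp only [Setup.mu]
  refine HasDerivAt.fun_sum fun i _ => ?_
  refine HasDerivAt.mul_const ?_ _
  have h : HasDerivAt (fun s : ℂ => time q i + s * time v i) (1 * time v i) 0 :=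
    ((hasDerivAt_id 0).mul_const _).const_add _
  simpa using h

theorem differentiable_mu (Q : Setup S V n l) (time : P →L[ℂ] (Fin l → ℂ)) (r : S) :
    Differentiable ℂ fun q => Q.mu (time q) r := by
  simp only [Setup.mu]
  have h : ∀ s, Differentiable ℂ fun q => time q s := fun s =>
    ((ContinuousLinearMap.proj s).comp time).differentiable
  fun_prop

theorem fderiv_eq_of_line {f : P → E} {q v : P} {e : E} (hf : DifferentiableAt ℂ f q)
    (h : HasDerivAt (fun s : ℂ => f (q + s • v)) e 0) : fderiv ℂ f q v = e :=
  (hf.hasFDerivAt.hasLineDerivAt v).unique h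

theorem Setup.IsFamily.dL_mem (hF : Q.IsFamily D F) (hD : IsOpen D) {q : P} (hq : q ∈ D) (v : P)
    (r : S) : dL F q v r ∈ Q.lie := fderiv_mem hD (fun q hq => hF.L_mem q hq r) hq v

theorem Setup.IsFamily.dLbar_mem (hF : Q.IsFamily D F) (hD : IsOpen D) {q : P} (hq : q ∈ D) (v : P)
    (r : S) : dLbar F q v r ∈ Q.lie := fderiv_mem hD (fun q hq => hF.Lbar_mem q hq r) hq v

theorem Setup.IsFamily.mero_dL (hF : Q.IsFamily D F) (hD : IsOpen D) (v : P) :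
    Mero Q.mark 1 1 0 D fun q => dL F q v :=
  (hF.mero_L hD).fderiv hD (fun r _ => hF.L_pole.2.2.1 r) v

theorem Setup.IsFamily.mero_dLbar (hF : Q.IsFamily D F) (hD : IsOpen D) (v : P) :
    Mero Q.mark 0 0 1 D fun q => dLbar F q v :=
  hF.mero_Lbar.fderiv hD (fun r _ => hF.Lbar_smooth.2 r) v

/-- Vectors tangent to a flat family are orthogonal to the infinitesimal gauge transformations. -/
theorem Setup.IsFamily.moment_derivative (hF : Q.IsFamily D F) (hD : IsOpen D)
    (time : P →L[ℂ] (Fin l → ℂ)) (hflat : ∀ q ∈ D, Q.Flat (time q) (F q)) {q : P} (hq : q ∈ D)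
    (v : P) {e : S → V →L[ℂ] V} (he : Q.IsTest e) :
    surfInt (fun r => form Q.lie (dL F q v r) (-Q.dw (time q) e r + ⁅e r, (F q).Lbar r⁆)
      - form Q.lie (-(Q.kappa • del 0 0 e r) + ⁅e r, (F q).L r⁆)
        (dLbar F q v r - Q.kappa⁻¹ • Q.mu (time v) r • (F q).L r))
      = 2 * Real.pi * Complex.I * ∑ a, form Q.lie (dp F q v a) (e (Q.mark a)) := by
  set B := form Q.lie
  have hLm := hF.mero_L hD
  have hLb := hF.mero_Lbar
  -- The derivative on `L̄` has been moved to `e`. No surface derivative of the fields remains, so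
  -- the integrand is pointwise holomorphic in the parameter and can be differentiated directly.
  set H : P → S → ℂ := fun q r => -B ((F q).L r) (Q.dw (time q) e r)
    + Q.kappa * B ((F q).Lbar r) (del 0 0 e r) + B ⁅(F q).Lbar r, (F q).L r⁆ (e r) with hH
  have hHm : Mero Q.mark 1 1 1 D H := by
    have h1 := (hLm.bilin B (add_zero 1) (zero_add 1) (he.mero_dw hD time)).neg
    have h2 := ((hLb.bilin B (zero_add 1) (add_zero 1) (he.mero.del hD)).const_smul Q.kappa).mono
      (zero_le_one' ℕ)
    have h3 := ((hLb.lie (zero_add 1) (add_zero 1) hLm)).bilin B (add_zero 1) (add_zero 1) he.mero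
    exact (h1.add h2).add h3
  have hHd : ∀ r, ∀ q ∈ D, DifferentiableAt ℂ (fun q => H q r) q := by
    intro r q hq
    have h1 := (hF.L_pole.2.2.1 r).differentiableAt (hD.mem_nhds hq)
    have h2 := (hF.Lbar_smooth.2 r).differentiableAt (hD.mem_nhds hq)
    have h3 : DifferentiableAt ℂ (fun q => Q.dw (time q) e r) q := by
      simp only [Setup.dw]
      exact (differentiableAt_const _).add
        ((differentiable_mu Q time r).differentiableAt.smul (differentiableAt_const _))
    have h4 : DifferentiableAt ℂ (fun q => ⁅(F q).Lbar r, (F q).L r⁆) q := by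
      simpa only [lieB_apply] using differentiableAt_complex_bilin (lieB V) h2 h1
    exact ((differentiableAt_complex_bilin B h1 h3).neg.add ((differentiableAt_complex_bilin B h2 (differentiableAt_const _)).const_mul _)).add
      (differentiableAt_complex_bilin B h4 (differentiableAt_const _))
  have hHi : ∀ q ∈ D, surfInt (H q)
      = 2 * Real.pi * Complex.I * ∑ a, B ((F q).p a) (e (Q.mark a)) := by
    intro q hq
    have h1 := hflat q hq e he.mem he.smooth
    rw [Finset.sum_congr rfl fun a _ => kil_eq (hF.p_mem hq a) (he.mem (Q.mark a))] at h1
    rw [← h1]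
    have h2 := Mero.surfInt_del hD ((hLb.bilin B (add_zero 0) (add_zero 1) he.mero).const_smul Q.kappa) hq
    have h3 := surfInt_sub (hHm.surfIntegrable hD hq) h2.1
    rw [h2.2, sub_zero] at h3
    rw [← h3]
    refine surfInt_congr (Set.finite_range Q.mark) fun r hr => ?_
    have h4 := del_bilin (Q.kappa • B) (hLb.differentiableAt_chartAt hD hq hr) (he.diff r)
    simp only [smul_apply] at h4
    rw [h4, kil_eq (hF.L_mem q hq r) (dw_mem Q he.mem r), kil_eq (del_mem (hF.Lbar_mem q hq) r)
      (he.mem r), kil_eq (Q.lie.lie_mem (hF.Lbar_mem q hq r) (hF.L_mem q hq r)) (he.mem r)]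
    simp only [hH, smul_eq_mul]
    ring
  obtain ⟨A, hA, hAv⟩ := hHm.hasFDerivAt_surfInt hD
    (fun r _ q hq => (hHd r q hq).differentiableWithinAt) hq
  have hline := hA.hasLineDerivAt v
  have hp : HasDerivAt (fun s : ℂ => 2 * Real.pi * Complex.I *
      ∑ a, B ((F (q + s • v)).p a) (e (Q.mark a)))
      (2 * Real.pi * Complex.I * ∑ a, B (dp F q v a) (e (Q.mark a))) 0 := by
    refine HasDerivAt.const_mul _ (HasDerivAt.fun_sum fun a _ => ?_)
    have h1 := (((hF.L_pole.2.2.2 a).differentiableAt (hD.mem_nhds hq)).hasFDerivAt.hasLineDerivAt v)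
    have h2 := hasDerivAt_bilin B h1 (hasDerivAt_const (0 : ℂ) (e (Q.mark a)))
    simpa using! h2
  have hev : (fun s : ℂ => surfInt (H (q + s • v))) =ᶠ[𝓝 0] fun s : ℂ =>
      2 * Real.pi * Complex.I * ∑ a, B ((F (q + s • v)).p a) (e (Q.mark a)) := by
    have hc : ContinuousAt (fun s : ℂ => q + s • v) 0 := by fun_prop
    have hm : D ∈ 𝓝 (q + (0 : ℂ) • v) := by simpa using hD.mem_nhds hq
    filter_upwards [hc hm] with s hs using hHi _ hs
  have h5 := HasDerivAt.unique hline (hp.congr_of_eventuallyEq hev)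
  rw [← h5, hAv]
  congr 1
  ext r
  symm
  refine fderiv_eq_of_line (hHd r q hq) ?_
  have hL := hF.line_L hD hq v r
  have hLbar := hF.line_Lbar hD hq v r
  have hdw : HasDerivAt (fun s : ℂ => Q.dw (time (q + s • v)) e r)
      (Q.mu (time v) r • del 0 0 e r) 0 := by
    simp only [Setup.dw]
    exact ((Q.line_mu time q v r).smul_const _).const_add _
  have hlie : HasDerivAt (fun s : ℂ => ⁅(F (q + s • v)).Lbar r, (F (q + s • v)).L r⁆)
      (⁅dLbar F q v r, (F q).L r⁆ + ⁅(F q).Lbar r, dL F q v r⁆) 0 := by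
    simpa using hasDerivAt_bilin (lieB V) hLbar hL
  have h6 := ((hasDerivAt_bilin B hL hdw).neg.add
    ((hasDerivAt_bilin B hLbar (hasDerivAt_const (0 : ℂ) (del 0 0 e r))).const_mul Q.kappa)).add
    (hasDerivAt_bilin B hlie (hasDerivAt_const (0 : ℂ) (e r)))
  refine h6.congr_deriv ?_
  have hLr := hF.L_mem q hq r
  have hbr := hF.Lbar_mem q hq r
  have hdLr := hF.dL_mem hD hq v r
  have hdbr := hF.dLbar_mem hD hq v r
  have her := he.mem r
  have e1 : B ⁅(F q).Lbar r, dL F q v r⁆ (e r) = B (dL F q v r) ⁅e r, (F q).Lbar r⁆ := by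
    rw [form_lie hbr hdLr her, form_comm, form_lie hdLr her hbr]
  have e2 : B ⁅dLbar F q v r, (F q).L r⁆ (e r) = -B ⁅e r, (F q).L r⁆ (dLbar F q v r) := by
    rw [form_lie her hLr hdbr, form_comm Q.lie (e r), ← lie_skew, map_neg, neg_apply]
  -- Because of this identity the correction `-κ⁻¹ μ L` is seen only by `∂e`, and what it
  -- contributes is exactly the time derivative of `∂_w̄ e`.
  have e3 : B ⁅e r, (F q).L r⁆ ((F q).L r) = 0 := by
    rw [form_lie her hLr hLr, lie_self, map_zero]
  have e4 : B (del 0 0 e r) ((F q).L r) = B ((F q).L r) (del 0 0 e r) := form_comm _ _ _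
  have e5 : B (del 0 0 e r) (dLbar F q v r) = B (dLbar F q v r) (del 0 0 e r) := form_comm _ _ _
  have hk := Q.kappa_ne
  simp only [zero_smul, add_zero, map_add, map_neg, map_sub, map_smul, add_apply, neg_apply,
    smul_apply, smul_eq_mul, map_zero, e1, e2, e3, e4, e5]
  field_simp
  ring

end Flatness

/-! ### The two-forms -/

section TwoForms

variable {S V : Type*} [TopologicalSpace S] [T2Space S] [CompactSpace S] [ChartedSpace ℂ S]
  [IsManifold 𝓘(ℂ) ω S] [NormedAddCommGroup V] [NormedSpace ℂ V] [FiniteDimensional ℂ V] {n l d : ℕ}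
  {Q : Setup S V n l} (Γ : GaugeFixing Q d)

namespace GaugeFixing

/-- The pull-back of the Maurer–Cartan form of the group by `g_a`. -/
def theta (q v : (Fin d → ℂ) × (Fin l → ℂ)) (a : Fin n) : V →L[ℂ] V :=
  (↑(Γ.g q a)⁻¹ : V →L[ℂ] V) * fderiv ℂ (fun q' => (Γ.g q' a : V →L[ℂ] V)) q v

/-- Differentiating `g_a p_a = J_a g_a` gives the tangent vector of the orbit without
differentiating an inverse. -/
theorem dp_eq {q : (Fin d → ℂ) × (Fin l → ℂ)} (hq : q ∈ Γ.dom) (v : (Fin d → ℂ) × (Fin l → ℂ))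
    (a : Fin n) : dp Γ.sol q v a = ⁅(Γ.sol q).p a, Γ.theta q v a⁆ := by
  have hp : DifferentiableAt ℂ (fun q => (Γ.sol q).p a) q :=
    (Γ.sol_family.L_pole.2.2.2 a).differentiableAt (Γ.dom_open.mem_nhds hq)
  have hg : DifferentiableAt ℂ (fun q => (Γ.g q a : V →L[ℂ] V)) q :=
    (Γ.g_holo a).differentiableAt (Γ.dom_open.mem_nhds hq)
  have h1 := hasDerivAt_bilin (ContinuousLinearMap.mul ℂ (V →L[ℂ] V))
    (hg.hasFDerivAt.hasLineDerivAt v) (hp.hasFDerivAt.hasLineDerivAt v)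
  have h2 : HasDerivAt (fun s : ℂ => Q.J a * (Γ.g (q + s • v) a : V →L[ℂ] V))
      (Q.J a * fderiv ℂ (fun q => (Γ.g q a : V →L[ℂ] V)) q v) 0 :=
    HasDerivAt.const_mul _ (hg.hasFDerivAt.hasLineDerivAt v)
  have hev : (fun s : ℂ => ContinuousLinearMap.mul ℂ (V →L[ℂ] V) (Γ.g (q + s • v) a : V →L[ℂ] V)
      ((Γ.sol (q + s • v)).p a)) =ᶠ[𝓝 0] fun s : ℂ => Q.J a * (Γ.g (q + s • v) a : V →L[ℂ] V) := by
    have hc : ContinuousAt (fun s : ℂ => q + s • v) 0 := by fun_prop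
    have hm : Γ.dom ∈ 𝓝 (q + (0 : ℂ) • v) := by simpa using Γ.dom_open.mem_nhds hq
    filter_upwards [hc hm] with s hs
    rw [Γ.p_eq _ hs a]
    simp [← mul_assoc]
  have h3 := h1.unique (h2.congr_of_eventuallyEq hev)
  simp only [zero_smul, add_zero, ContinuousLinearMap.mul_apply'] at h3
  have h4 : (Γ.g q a : V →L[ℂ] V) * dp Γ.sol q v a
      = Q.J a * fderiv ℂ (fun q => (Γ.g q a : V →L[ℂ] V)) q v
        - fderiv ℂ (fun q => (Γ.g q a : V →L[ℂ] V)) q v * (Γ.sol q).p a := by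
    rw [← h3, dp]
    abel
  have h5 : dp Γ.sol q v a = (↑(Γ.g q a)⁻¹ : V →L[ℂ] V) *
      ((Γ.g q a : V →L[ℂ] V) * dp Γ.sol q v a) := by
    rw [← mul_assoc, Units.inv_mul, one_mul]
  rw [h5, h4, Ring.lie_def, theta, mul_sub, Γ.p_eq q hq a]
  simp only [mul_assoc, Units.mul_inv_cancel_left]

theorem theta_mem {q : (Fin d → ℂ) × (Fin l → ℂ)} (hq : q ∈ Γ.dom)
    (v : (Fin d → ℂ) × (Fin l → ℂ)) (a : Fin n) : Γ.theta q v a ∈ Q.lie :=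
  Γ.g_maurer_cartan q hq a v

theorem flat_dom : ∀ q ∈ Γ.dom,
    Q.Flat (ContinuousLinearMap.snd ℂ (Fin d → ℂ) (Fin l → ℂ) q) (Γ.sol q) := Γ.sol_flat

/-- The deformation of `L̄`, corrected by the change of the complex structure. -/
def zbar (q v : (Fin d → ℂ) × (Fin l → ℂ)) (r : S) : V →L[ℂ] V :=
  dLbar Γ.sol q v r - Q.kappa⁻¹ • Q.mu v.2 r • (Γ.sol q).L r

end GaugeFixing

theorem Setup.mero_mu_const_smul (Q : Setup S V n l) {P E : Type*} [NormedAddCommGroup P]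
    [NormedSpace ℂ P] [FiniteDimensional ℂ P] [NormedAddCommGroup E] [NormedSpace ℂ E] {D : Set P}
    (t : Fin l → ℂ) {k : ℕ}
    {a b a' b' : ℤ} (ha : -1 + a = a') (hb : 1 + b = b') {G : P → S → E}
    (hG : Mero Q.mark (k + 1) a b D G) : Mero Q.mark k a' b' D fun q r => Q.mu t r • G q r := by
  simp only [Setup.mu, Finset.sum_smul, mul_smul]
  exact Mero.sum Finset.univ fun s _ => (Q.mero_mu0_smul s ha hb hG).const_smul _

@[simp] theorem Setup.mu_zero (Q : Setup S V n l) (r : S) : Q.mu 0 r = 0 := by simp [Setup.mu]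

@[simp] theorem Setup.mu_single (Q : Setup S V n l) (s : Fin l) (r : S) :
    Q.mu (Pi.single s 1) r = Q.mu0 s r := by
  rw [Setup.mu, Finset.sum_eq_single s] <;> simp +contextual

namespace GaugeFixing

theorem mero_zbar (v : (Fin d → ℂ) × (Fin l → ℂ)) : Mero Q.mark 0 0 1 Γ.dom fun q => Γ.zbar q v :=
  (Γ.sol_family.mero_dLbar Γ.dom_open v).sub ((Q.mero_mu_const_smul v.2 rfl rfl
    (Γ.sol_family.mero_L Γ.dom_open)).const_smul _)

theorem zbar_mem {q : (Fin d → ℂ) × (Fin l → ℂ)} (hq : q ∈ Γ.dom) (v : (Fin d → ℂ) × (Fin l → ℂ))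
    (r : S) : Γ.zbar q v r ∈ Q.lie :=
  Q.lie.sub_mem (Γ.sol_family.dLbar_mem Γ.dom_open hq v r)
    (Q.lie.smul_mem _ (Q.lie.smul_mem _ (Γ.sol_family.L_mem q hq r)))

theorem integrable_dL_zbar {q : (Fin d → ℂ) × (Fin l → ℂ)} (hq : q ∈ Γ.dom)
    (v₁ v₂ : (Fin d → ℂ) × (Fin l → ℂ)) :
    SurfIntegrable fun r => form Q.lie (dL Γ.sol q v₁ r) (Γ.zbar q v₂ r) :=
  ((Γ.sol_family.mero_dL Γ.dom_open v₁).bilin (form Q.lie) (add_zero 1) (zero_add 1)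
    (Γ.mero_zbar v₂)).surfIntegrable Γ.dom_open hq

theorem integrable_dL_dLbar {q : (Fin d → ℂ) × (Fin l → ℂ)} (hq : q ∈ Γ.dom)
    (v₁ v₂ : (Fin d → ℂ) × (Fin l → ℂ)) :
    SurfIntegrable fun r => form Q.lie (dL Γ.sol q v₁ r) (dLbar Γ.sol q v₂ r) :=
  ((Γ.sol_family.mero_dL Γ.dom_open v₁).bilin (form Q.lie) (add_zero 1) (zero_add 1)
    (Γ.sol_family.mero_dLbar Γ.dom_open v₂)).surfIntegrable Γ.dom_open hq

/-- The product of two differentials with simple poles has a double pole; the zero of `μ⁰_s` at the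
marked points lowers it to an integrable simple one. -/
theorem integrable_L_dL_mu {q : (Fin d → ℂ) × (Fin l → ℂ)} (hq : q ∈ Γ.dom)
    (v : (Fin d → ℂ) × (Fin l → ℂ)) (t : Fin l → ℂ) :
    SurfIntegrable fun r => form Q.lie ((Γ.sol q).L r) (dL Γ.sol q v r) * Q.mu t r := by
  have h := ((Γ.sol_family.mero_L Γ.dom_open).bilin (form Q.lie) (a'' := 2) (b'' := 0) rfl rfl
    (Γ.sol_family.mero_dL Γ.dom_open v))
  have h1 := (Q.mero_mu_const_smul t (k := 1) (a' := 1) (b' := 1) rfl rfl h).surfIntegrable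
    Γ.dom_open hq
  simpa only [smul_eq_mul, mul_comm] using h1

/-- The contribution of the marked points to the two-forms. -/
def orbitTerm (q v₁ v₂ : (Fin d → ℂ) × (Fin l → ℂ)) : ℂ :=
  2 * Real.pi * Complex.I * ∑ a, form Q.lie ((Γ.sol q).p a) ⁅Γ.theta q v₁ a, Γ.theta q v₂ a⁆

theorem omega0_eq {q : (Fin d → ℂ) × (Fin l → ℂ)} (hq : q ∈ Γ.dom)
    (v₁ v₂ : (Fin d → ℂ) × (Fin l → ℂ)) :
    Γ.omega0 q v₁ v₂ = surfInt (fun r => form Q.lie (dL Γ.sol q v₁ r) (dLbar Γ.sol q v₂ r))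
      - surfInt (fun r => form Q.lie (dL Γ.sol q v₂ r) (dLbar Γ.sol q v₁ r))
      + Γ.orbitTerm q v₁ v₂ := by
  have hd := Γ.sol_family.dL_mem Γ.dom_open hq
  have hb := Γ.sol_family.dLbar_mem Γ.dom_open hq
  rw [omega0, ← surfInt_sub (Γ.integrable_dL_dLbar hq v₁ v₂) (Γ.integrable_dL_dLbar hq v₂ v₁),
    orbitTerm]
  congr 1
  · congr 1
    ext r
    rw [kil_eq (hd v₁ r) (hb v₂ r), kil_eq (hd v₂ r) (hb v₁ r)]
  · congr 1
    refine Finset.sum_congr rfl fun a _ => ?_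
    exact kil_eq (Γ.sol_family.p_mem hq a)
      (Q.lie.lie_mem (Γ.theta_mem hq v₁ a) (Γ.theta_mem hq v₂ a))

theorem omega_eq_sub {q : (Fin d → ℂ) × (Fin l → ℂ)} (hq : q ∈ Γ.dom)
    (v₁ v₂ : (Fin d → ℂ) × (Fin l → ℂ)) :
    Γ.omega q v₁ v₂ = Γ.omega0 q v₁ v₂ - Q.kappa⁻¹ * (
      surfInt (fun r => form Q.lie ((Γ.sol q).L r) (dL Γ.sol q v₁ r) * Q.mu v₂.2 r)
      - surfInt (fun r => form Q.lie ((Γ.sol q).L r) (dL Γ.sol q v₂ r) * Q.mu v₁.2 r)) := by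
  have hd := Γ.sol_family.dL_mem Γ.dom_open hq
  have hL := Γ.sol_family.L_mem q hq
  rw [omega, ← surfInt_sub (Γ.integrable_L_dL_mu hq v₁ v₂.2) (Γ.integrable_L_dL_mu hq v₂ v₁.2)]
  congr 3
  ext r
  rw [kil_eq (hL r) (hd v₁ r), kil_eq (hL r) (hd v₂ r)]

/-- The terms `<L, δL> δμ` are what the correction in `zbar` contributes to the pairing. In terms of
`δL` and the corrected deformation, `ω` therefore looks like `ω₀`. -/
theorem omega_eq {q : (Fin d → ℂ) × (Fin l → ℂ)} (hq : q ∈ Γ.dom)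
    (v₁ v₂ : (Fin d → ℂ) × (Fin l → ℂ)) :
    Γ.omega q v₁ v₂ = surfInt (fun r => form Q.lie (dL Γ.sol q v₁ r) (Γ.zbar q v₂ r))
      - surfInt (fun r => form Q.lie (dL Γ.sol q v₂ r) (Γ.zbar q v₁ r))
      + Γ.orbitTerm q v₁ v₂ := by
  have key : ∀ v₁ v₂, surfInt (fun r => form Q.lie (dL Γ.sol q v₁ r) (Γ.zbar q v₂ r))
      = surfInt (fun r => form Q.lie (dL Γ.sol q v₁ r) (dLbar Γ.sol q v₂ r))
        - Q.kappa⁻¹ *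
          surfInt (fun r => form Q.lie ((Γ.sol q).L r) (dL Γ.sol q v₁ r) * Q.mu v₂.2 r) := by
    intro v₁ v₂
    rw [← surfInt_const_mul, ← surfInt_sub (Γ.integrable_dL_dLbar hq v₁ v₂)
      ((Γ.integrable_L_dL_mu hq v₁ v₂.2).const_mul _)]
    congr 1
    ext r
    rw [zbar, map_sub, map_smul, map_smul, smul_eq_mul, smul_eq_mul, form_comm Q.lie (dL Γ.sol q v₁ r)
      ((Γ.sol q).L r)]
    ring
  rw [Γ.omega_eq_sub hq, Γ.omega0_eq hq, key, key]
  ring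

theorem orbitTerm_swap (q v₁ v₂ : (Fin d → ℂ) × (Fin l → ℂ)) :
    Γ.orbitTerm q v₁ v₂ = -Γ.orbitTerm q v₂ v₁ := by
  rw [orbitTerm, orbitTerm, ← mul_neg, ← Finset.sum_neg_distrib]
  congr 1
  refine Finset.sum_congr rfl fun a _ => ?_
  rw [← lie_skew, map_neg]

theorem omega_swap {q : (Fin d → ℂ) × (Fin l → ℂ)} (hq : q ∈ Γ.dom)
    (v₁ v₂ : (Fin d → ℂ) × (Fin l → ℂ)) : Γ.omega q v₁ v₂ = -Γ.omega q v₂ v₁ := by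
  rw [Γ.omega_eq hq, Γ.omega_eq hq, Γ.orbitTerm_swap]
  ring

/-- Infinitesimal gauge transformations are in the kernel of the two-form on the flat
configurations. -/
theorem omega_gauge {q : (Fin d → ℂ) × (Fin l → ℂ)} (hq : q ∈ Γ.dom) {e : S → V →L[ℂ] V}
    (he : Q.IsTest e) {v₁ : (Fin d → ℂ) × (Fin l → ℂ)} {w : Fin d → ℂ}
    (hL : ∀ r ∉ Set.range Q.mark, dL Γ.sol q v₁ r
      = dL Γ.sol q (w, 0) r + (-(Q.kappa • del 0 0 e r) + ⁅e r, (Γ.sol q).L r⁆))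
    (hLbar : ∀ r ∉ Set.range Q.mark, Γ.zbar q v₁ r
      = dLbar Γ.sol q (w, 0) r + (-Q.dw q.2 e r + ⁅e r, (Γ.sol q).Lbar r⁆))
    (hp : ∀ a, dp Γ.sol q v₁ a = dp Γ.sol q (w, 0) a + ⁅e (Q.mark a), (Γ.sol q).p a⁆)
    (v : (Fin d → ℂ) × (Fin l → ℂ)) : Γ.omega q v₁ v = Γ.omega q (w, 0) v := by
  have hmom := Γ.sol_family.moment_derivative Γ.dom_open
    (ContinuousLinearMap.snd ℂ (Fin d → ℂ) (Fin l → ℂ)) Γ.flat_dom hq v he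
  have hz : ∀ r, Γ.zbar q (w, 0) r = dLbar Γ.sol q (w, 0) r := fun r => by simp [zbar]
  -- By invariance `<p, [θ₁, θ₂]> = <[p, θ₁], θ₂>`, and `[p, θ₁] = δ₁p`. The orbit term thus sees
  -- the first vector only through `δp`, where the gauge transformation is known.
  have horb : Γ.orbitTerm q v₁ v - Γ.orbitTerm q (w, 0) v
      = 2 * Real.pi * Complex.I * ∑ a, form Q.lie (dp Γ.sol q v a) (e (Q.mark a)) := by
    rw [orbitTerm, orbitTerm, ← mul_sub, ← Finset.sum_sub_distrib]
    congr 1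
    refine Finset.sum_congr rfl fun a _ => ?_
    have hpm := Γ.sol_family.p_mem hq a
    have hth := fun v => Γ.theta_mem hq v a
    rw [← form_lie hpm (hth _) (hth _), ← form_lie hpm (hth _) (hth _), ← Γ.dp_eq hq, ← Γ.dp_eq hq,
      ← sub_apply, ← map_sub, hp a, add_sub_cancel_left, form_lie (he.mem _) hpm (hth _),
      ← Γ.dp_eq hq, form_comm]
  -- The derivative of the moment condition evaluates the surface pairing with a gauge direction as
  -- a sum over the marked points, opposite to the change of the orbit term.
  have hint : surfInt (fun r => form Q.lie (dL Γ.sol q v₁ r) (Γ.zbar q v r)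
        - form Q.lie (dL Γ.sol q v r) (Γ.zbar q v₁ r))
      = surfInt (fun r => form Q.lie (dL Γ.sol q (w, 0) r) (Γ.zbar q v r)
        - form Q.lie (dL Γ.sol q v r) (Γ.zbar q (w, 0) r))
      - 2 * Real.pi * Complex.I * ∑ a, form Q.lie (dp Γ.sol q v a) (e (Q.mark a)) := by
    have hi : ∀ v₁, SurfIntegrable fun r => form Q.lie (dL Γ.sol q v₁ r) (Γ.zbar q v r)
        - form Q.lie (dL Γ.sol q v r) (Γ.zbar q v₁ r) := fun v₁ =>
      (Γ.integrable_dL_zbar hq v₁ v).sub (Γ.integrable_dL_zbar hq v v₁)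
    have hsub := surfInt_sub (hi (w, 0)) (hi v₁)
    have hcongr : (surfInt fun r => form Q.lie (dL Γ.sol q (w, 0) r) (Γ.zbar q v r)
          - form Q.lie (dL Γ.sol q v r) (Γ.zbar q (w, 0) r)
          - (form Q.lie (dL Γ.sol q v₁ r) (Γ.zbar q v r)
            - form Q.lie (dL Γ.sol q v r) (Γ.zbar q v₁ r))) =
        surfInt fun r => form Q.lie (dL Γ.sol q v r) (-Q.dw q.2 e r + ⁅e r, (Γ.sol q).Lbar r⁆)
          - form Q.lie (-(Q.kappa • del 0 0 e r) + ⁅e r, (Γ.sol q).L r⁆)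
            (dLbar Γ.sol q v r - Q.kappa⁻¹ • Q.mu v.2 r • (Γ.sol q).L r) := by
      refine surfInt_congr (Set.finite_range Q.mark) fun r hr => ?_
      rw [hL r hr, hLbar r hr, hz, ← zbar]
      simp only [map_add, add_apply]
      ring
    simp only [ContinuousLinearMap.coe_snd'] at hmom
    linear_combination hsub - hcongr - hmom
  rw [Γ.omega_eq hq, Γ.omega_eq hq,
    ← surfInt_sub (Γ.integrable_dL_zbar hq v₁ v) (Γ.integrable_dL_zbar hq v v₁),
    ← surfInt_sub (Γ.integrable_dL_zbar hq (w, 0) v) (Γ.integrable_dL_zbar hq v (w, 0)), hint,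
    sub_eq_iff_eq_add.1 horb]
  ring

theorem omega_vertical (q : (Fin d → ℂ) × (Fin l → ℂ)) (w y : Fin d → ℂ) :
    Γ.omega q (w, 0) (y, 0) = Γ.omega0 q (w, 0) (y, 0) := by
  have h : (fun r => kil Q.lie ((Γ.sol q).L r) (dL Γ.sol q (w, 0) r) * Q.mu (0 : Fin l → ℂ) r
      - kil Q.lie ((Γ.sol q).L r) (dL Γ.sol q (y, 0) r) * Q.mu (0 : Fin l → ℂ) r) = fun _ => 0 := by
    ext r; simp
  rw [omega, h, surfInt_zero, mul_zero, sub_zero]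

theorem omega0_add {q : (Fin d → ℂ) × (Fin l → ℂ)} (hq : q ∈ Γ.dom)
    (v v₁ v₂ : (Fin d → ℂ) × (Fin l → ℂ)) :
    Γ.omega0 q v (v₁ + v₂) = Γ.omega0 q v v₁ + Γ.omega0 q v v₂ := by
  have h1 : ∀ r, dL Γ.sol q (v₁ + v₂) r = dL Γ.sol q v₁ r + dL Γ.sol q v₂ r := fun r => map_add _ _ _
  have h2 : ∀ r, dLbar Γ.sol q (v₁ + v₂) r = dLbar Γ.sol q v₁ r + dLbar Γ.sol q v₂ r :=
    fun r => map_add _ _ _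
  have h3 : Γ.orbitTerm q v (v₁ + v₂) = Γ.orbitTerm q v v₁ + Γ.orbitTerm q v v₂ := by
    simp only [orbitTerm, theta, map_add, mul_add, lie_add, Finset.sum_add_distrib]
  simp only [Γ.omega0_eq hq, h1, h2, h3, map_add, add_apply]
  rw [surfInt_add (Γ.integrable_dL_dLbar hq v v₁) (Γ.integrable_dL_dLbar hq v v₂),
    surfInt_add (Γ.integrable_dL_dLbar hq v₁ v) (Γ.integrable_dL_dLbar hq v₂ v)]
  ring

theorem omega0_smul {q : (Fin d → ℂ) × (Fin l → ℂ)} (hq : q ∈ Γ.dom) (c : ℂ)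
    (v v₁ : (Fin d → ℂ) × (Fin l → ℂ)) : Γ.omega0 q v (c • v₁) = c * Γ.omega0 q v v₁ := by
  have h1 : ∀ r, dL Γ.sol q (c • v₁) r = c • dL Γ.sol q v₁ r := fun r => map_smul _ _ _
  have h2 : ∀ r, dLbar Γ.sol q (c • v₁) r = c • dLbar Γ.sol q v₁ r := fun r => map_smul _ _ _
  have h3 : Γ.orbitTerm q v (c • v₁) = c * Γ.orbitTerm q v v₁ := by
    simp only [orbitTerm, theta, map_smul, mul_smul_comm, lie_smul, smul_eq_mul, ← Finset.mul_sum]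
    ring
  simp only [Γ.omega0_eq hq, h1, h2, h3, map_smul, smul_apply, smul_eq_mul, surfInt_const_mul]
  ring

theorem omega0_swap {q : (Fin d → ℂ) × (Fin l → ℂ)} (hq : q ∈ Γ.dom)
    (v₁ v₂ : (Fin d → ℂ) × (Fin l → ℂ)) : Γ.omega0 q v₁ v₂ = -Γ.omega0 q v₂ v₁ := by
  rw [Γ.omega0_eq hq, Γ.omega0_eq hq, Γ.orbitTerm_swap]
  ring

/-- The contraction of `ω₀` with a vector, on the fibre. -/
def omega0Lin {q : (Fin d → ℂ) × (Fin l → ℂ)} (hq : q ∈ Γ.dom) (v : (Fin d → ℂ) × (Fin l → ℂ)) :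
    (Fin d → ℂ) →ₗ[ℂ] ℂ where
  toFun y := Γ.omega0 q v (y, 0)
  map_add' y₁ y₂ := by rw [← Γ.omega0_add hq]; simp
  map_smul' c y := by
    rw [RingHom.id_apply, smul_eq_mul, ← Γ.omega0_smul hq]
    simp

theorem omega0_basis {q : (Fin d → ℂ) × (Fin l → ℂ)} (hq : q ∈ Γ.dom) (i : Fin d) (ξ : Fin d → ℂ) :
    Γ.omega0 q (Pi.single i 1, 0) (ξ, 0) = (Γ.omegaMatrix q).mulVec ξ i := by
  have h := LinearMap.pi_apply_eq_sum_univ (Γ.omega0Lin hq (Pi.single i 1, 0)) ξ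
  refine h.trans ?_
  rw [Matrix.mulVec, dotProduct]
  refine Finset.sum_congr rfl fun j _ => ?_
  rw [smul_eq_mul, mul_comm, omegaMatrix, Matrix.of_apply]
  congr 1
  change Γ.omega0 q _ (_, 0) = _
  congr 2
  ext k
  simp [Pi.single_apply, eq_comm]

theorem omega0_eq_zero_of_basis {q : (Fin d → ℂ) × (Fin l → ℂ)} (hq : q ∈ Γ.dom)
    (hΓ : Γ.IsSymplectic) {w : Fin d → ℂ} (h : ∀ y, Γ.omega0 q (w, 0) (y, 0) = 0) : w = 0 := by
  refine Matrix.eq_zero_of_mulVec_eq_zero (hΓ q hq) ?_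
  ext i
  rw [← Γ.omega0_basis hq, Γ.omega0_swap hq, h, neg_zero]
  rfl

/-- The equations of the null leaves, contracted with vertical vectors, are Hamilton's equations. -/
theorem vertical_null_iff {H : Fin l → (Fin d → ℂ) × (Fin l → ℂ) → ℂ} (hH : Γ.IsHamiltonian H)
    (hΓ : Γ.IsSymplectic) {q : (Fin d → ℂ) × (Fin l → ℂ)} (hq : q ∈ Γ.dom) (s : Fin l)
    (ξ : Fin d → ℂ) : (∀ y, Γ.omega q (ξ, Pi.single s 1) (y, 0) = 0) ↔
      ∀ j, Q.kappa * ξ j = Γ.poisson (H s) (fun q => q.1 j) q := by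
  have h1 : ∀ y, Γ.omega q (ξ, Pi.single s 1) (y, 0) = 0 ↔
      Q.kappa * Γ.omega0 q (y, 0) (ξ, 0) = fderiv ℂ (H s) q (y, 0) := by
    intro y
    rw [Γ.omega_swap hq, (hH q hq).2, neg_eq_zero, sub_eq_zero, Finset.sum_eq_single s]
    · dsimp only
      rw [Pi.single_eq_same, mul_one, eq_inv_mul_iff_mul_eq₀ Q.kappa_ne]
    · intro b _ hb
      simp [hb]
    · simp
  -- Both sides are linear in `y`, so testing on the coordinate basis turns the condition into a
  -- linear system for `κξ` with the matrix of `ω₀`. Inverting that matrix gives the Poisson bracket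
  -- with a coordinate.
  have h2 : (∀ y, Γ.omega q (ξ, Pi.single s 1) (y, 0) = 0) ↔
      (Γ.omegaMatrix q).mulVec (Q.kappa • ξ)
        = fun i => fderiv ℂ (H s) q (Pi.single i 1, 0) := by
    simp only [h1]
    constructor
    · intro h
      ext i
      rw [← h, Matrix.mulVec_smul, Pi.smul_apply, smul_eq_mul, Γ.omega0_basis hq]
    · intro h y
      have h3 : -(Q.kappa • Γ.omega0Lin hq (ξ, 0))
          = (fderiv ℂ (H s) q : _ →ₗ[ℂ] ℂ) ∘ₗ LinearMap.inl ℂ (Fin d → ℂ) (Fin l → ℂ) := by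
        refine LinearMap.pi_ext' fun i => LinearMap.ext_ring ?_
        have h4 := congrFun h i
        rw [Matrix.mulVec_smul, Pi.smul_apply, smul_eq_mul, ← Γ.omega0_basis hq,
          Γ.omega0_swap hq] at h4
        simpa [omega0Lin] using h4
      have h4 := DFunLike.congr_fun h3 y
      rw [Γ.omega0_swap hq]
      simpa [omega0Lin] using h4
  have h3 : ∀ j, Γ.poisson (H s) (fun q => q.1 j) q
      = ((Γ.omegaMatrix q)⁻¹.mulVec fun i => fderiv ℂ (H s) q (Pi.single i 1, 0)) j := by
    intro j
    have h4 : fderiv ℂ (fun q : (Fin d → ℂ) × (Fin l → ℂ) => q.1 j) q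
        = (ContinuousLinearMap.proj j).comp (ContinuousLinearMap.fst ℂ (Fin d → ℂ) (Fin l → ℂ)) :=
      ((ContinuousLinearMap.proj (R := ℂ) (φ := fun _ : Fin d => ℂ) j).comp
        (ContinuousLinearMap.fst ℂ (Fin d → ℂ) (Fin l → ℂ))).fderiv
    rw [poisson, Matrix.mulVec, dotProduct]
    refine Finset.sum_congr rfl fun i _ => ?_
    rw [h4, Finset.sum_eq_single j]
    · simp
    · intro b _ hb
      simp [hb.symm]
    · simp
  have hu : IsUnit (Γ.omegaMatrix q).det := (hΓ q hq).isUnit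
  rw [h2]
  simp only [h3]
  constructor
  · intro h j
    rw [← h, Matrix.mulVec_mulVec, Matrix.nonsing_inv_mul _ hu, Matrix.one_mulVec]
    rfl
  · intro h
    have h4 : Q.kappa • ξ = (Γ.omegaMatrix q)⁻¹.mulVec
        fun i => fderiv ℂ (H s) q (Pi.single i 1, 0) := funext h
    rw [h4, Matrix.mulVec_mulVec, Matrix.mul_nonsing_inv _ hu, Matrix.one_mulVec]

/-- Without mixed terms in `ω₀` the quadratic functions are Hamiltonians. -/
theorem isHamiltonian_quadH (hm : Γ.NoMixedTerms) : Γ.IsHamiltonian Γ.quadH := by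
  intro q hq
  have hL := Γ.sol_family.L_mem
  -- The factor `½` cancels against the two equal terms in the derivative of the symmetric form `<L,
  -- L>`.
  have key : ∀ s, ∃ A : (Fin d → ℂ) × (Fin l → ℂ) →L[ℂ] ℂ, HasFDerivAt (Γ.quadH s) A q ∧
      ∀ v, A v = surfInt fun r => form Q.lie ((Γ.sol q).L r) (dL Γ.sol q v r) * Q.mu0 s r := by
    intro s
    have h := (Γ.sol_family.mero_L Γ.dom_open).bilin (form Q.lie) (a'' := 2) (b'' := 0) rfl rfl
      (Γ.sol_family.mero_L Γ.dom_open)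
    have h1 := Q.mero_mu0_smul s (k := 1) (a' := 1) (b' := 1) rfl rfl h
    have hd : ∀ r, ∀ q ∈ Γ.dom, DifferentiableAt ℂ (fun q => (Γ.sol q).L r) q := fun r q hq =>
      (Γ.sol_family.L_pole.2.2.1 r).differentiableAt (Γ.dom_open.mem_nhds hq)
    obtain ⟨A, hA, hAv⟩ := h1.hasFDerivAt_surfInt Γ.dom_open (fun r _ q hq =>
      ((differentiableAt_complex_bilin (form Q.lie) (hd r q hq) (hd r q hq)).const_smul
        (Q.mu0 s r)).differentiableWithinAt) hq
    refine ⟨(1 / 2 : ℂ) • A, ?_, fun v => ?_⟩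
    · refine (hA.const_smul (1 / 2 : ℂ)).congr_of_eventuallyEq ?_
      filter_upwards [Γ.dom_open.mem_nhds hq] with q' hq'
      rw [quadH]
      simp only [smul_eq_mul, kil_eq (hL q' hq' _) (hL q' hq' _), mul_comm (Q.mu0 s _), Pi.smul_apply]
    · rw [smul_apply, hAv, smul_eq_mul, ← surfInt_const_mul]
      congr 1
      ext r
      have h2 : fderiv ℂ (fun q => Q.mu0 s r • form Q.lie ((Γ.sol q).L r) ((Γ.sol q).L r)) q v
          = Q.mu0 s r • (form Q.lie (dL Γ.sol q v r) ((Γ.sol q).L r)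
            + form Q.lie ((Γ.sol q).L r) (dL Γ.sol q v r)) := by
        refine fderiv_eq_of_line ((differentiableAt_complex_bilin (form Q.lie) (hd r q hq)
          (hd r q hq)).const_smul (Q.mu0 s r)) ?_
        have hline := Γ.sol_family.line_L Γ.dom_open hq v r
        have h3 := (hasDerivAt_bilin (form Q.lie) hline hline).const_smul (Q.mu0 s r)
        simpa using! h3
      rw [h2, form_comm Q.lie (dL Γ.sol q v r), smul_eq_mul]
      ring
  choose A hA hAv using key
  refine ⟨fun s => (hA s).differentiableAt, fun y v => ?_⟩
  have h0 : Γ.omega0 q (y, 0) v = Γ.omega0 q (y, 0) (v.1, 0) := by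
    have h1 : v = (v.1, 0) + (0, v.2) := by simp
    conv_lhs => rw [h1, Γ.omega0_add hq, hm q hq, add_zero]
  have h1 : ∀ s, fderiv ℂ (Γ.quadH s) q (y, 0)
      = surfInt fun r => form Q.lie ((Γ.sol q).L r) (dL Γ.sol q (y, 0) r) * Q.mu0 s r := fun s => by
    rw [(hA s).fderiv, hAv]
  have hi : ∀ s, SurfIntegrable fun r =>
      form Q.lie ((Γ.sol q).L r) (dL Γ.sol q (y, 0) r) * Q.mu0 s r := fun s => by
    simpa using Γ.integrable_L_dL_mu hq (y, 0) (Pi.single s 1)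
  have h2 : surfInt (fun r => form Q.lie ((Γ.sol q).L r) (dL Γ.sol q v r)
      * Q.mu (0 : Fin l → ℂ) r) = 0 := by
    simp only [Setup.mu_zero, mul_zero]
    exact surfInt_zero
  rw [Γ.omega_eq_sub hq, h0, h2, sub_zero]
  simp only [h1]
  congr 2
  have h3 : ∀ s, (surfInt fun r => form Q.lie ((Γ.sol q).L r) (dL Γ.sol q (y, 0) r) * Q.mu0 s r) * v.2 s
      = surfInt fun r => v.2 s * (form Q.lie ((Γ.sol q).L r) (dL Γ.sol q (y, 0) r) * Q.mu0 s r) :=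
    fun s => by rw [surfInt_const_mul, mul_comm]
  simp only [h3]
  rw [← surfInt_sum Finset.univ fun s _ => (hi s).const_mul (v.2 s)]
  congr 1
  ext r
  rw [Setup.mu, Finset.mul_sum]
  refine Finset.sum_congr rfl fun s _ => ?_
  ring

end GaugeFixing

end TwoForms

/-! ### Identities between the coefficients of the connection -/

section Identities

variable {X V : Type*} [NormedAddCommGroup X] [NormedSpace ℝ X] [NormedAddCommGroup V]
  [NormedSpace ℂ V] {U : Set X} {z z' zb zb' s s' t t' : X} {L Lb Ms Mt : X → V →L[ℂ] V}
  {m ms mt : X → ℂ} {κ : ℂ}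

/-- The derivative of the flatness equation. -/
theorem linearized_flatness (hU : IsOpen U) (hL : ContDiffOn ℝ ∞ L U) (hLb : ContDiffOn ℝ ∞ Lb U)
    (hm : ContDiffOn ℝ ∞ m U) (hms : ContDiffOn ℝ ∞ ms U) (hκ : κ ≠ 0)
    (hmt : ∀ w ∈ U, cD s s' m w = ms w)
    (hflat : ∀ w ∈ U, cD zb zb' L w + cD z z' (fun w => m w • L w) w - κ • cD z z' Lb w
      + ⁅Lb w, L w⁆ = 0) {w : X} (hw : w ∈ U) :
    cD zb zb' (cD s s' L) w + cD z z' (fun w => m w • cD s s' L w) w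
      - κ • cD z z' (fun w => cD s s' Lb w - κ⁻¹ • ms w • L w) w
      + ⁅cD s s' Lb w - κ⁻¹ • ms w • L w, L w⁆ + ⁅Lb w, cD s s' L w⁆ = 0 := by
  have hmL : ContDiffOn ℝ ∞ (fun w => m w • L w) U := hm.smul hL
  have hmsL : ContDiffOn ℝ ∞ (fun w => ms w • L w) U := hms.smul hL
  have d := fun {f : X → V →L[ℂ] V} (hf : ContDiffOn ℝ ∞ f U) =>
    (diffAt hU (by simp) hf hw : DifferentiableAt ℝ f w)
  have c := fun {f : X → V →L[ℂ] V} {a b : X} (hf : ContDiffOn ℝ ∞ f U) =>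
    contDiffOn_cD (a := a) (b := b) hU hf
  have h0 : cD s s' (fun w => cD zb zb' L w + cD z z' (fun w => m w • L w) w - κ • cD z z' Lb w
      + ⁅Lb w, L w⁆) w = 0 := by
    rw [cD_congr_on hU (g := fun _ => 0) hflat hw, cD_const]
  rw [cD_add (((d (c hL)).fun_add (d (c hmL))).fun_sub ((d (c hLb)).fun_const_smul κ))
      (d (contDiffOn_lie hLb hL)),
    cD_sub ((d (c hL)).fun_add (d (c hmL))) ((d (c hLb)).fun_const_smul κ), cD_add (d (c hL)) (d (c hmL)),
    cD_const_smul κ (d (c hLb)), cD_lie (d hLb) (d hL), cD_comm hU hL hw, cD_comm hU hmL hw,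
    cD_comm hU hLb hw] at h0
  -- The coefficient `m` itself depends on the time, which adds a term `ms • L`. It is absorbed in
  -- the corrected deformation of `Lb`, and the bracket is not affected, as the correction commutes
  -- with `L`.
  have h1 : cD z z' (cD s s' fun w => m w • L w) w
      = cD z z' (fun w => ms w • L w) w + cD z z' (fun w => m w • cD s s' L w) w := by
    have i : DifferentiableAt ℝ (fun w => m w • cD s s' L w) w := d (hm.smul (c hL))
    rw [← cD_add (d hmsL) i]
    refine cD_congr_on hU (fun y hy => ?_) hw
    rw [cD_smul (diffAt hU (by simp) hm hy) (diffAt hU (by simp) hL hy), hmt y hy]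
  rw [h1] at h0
  rw [cD_sub (d (c hLb)) ((d hmsL).fun_const_smul κ⁻¹), cD_const_smul κ⁻¹ (d hmsL), sub_lie, smul_lie,
    smul_lie, lie_self, smul_zero, smul_zero, sub_zero, smul_sub, smul_inv_smul₀ hκ, ← h0]
  abel

/-- The integrability condition for two components of a linear system. -/
theorem mixed_derivative (hU : IsOpen U) {Ψ : X → V} (hΨ : ContDiffOn ℝ ∞ Ψ U)
    (hMs : ContDiffOn ℝ ∞ Ms U) (hMt : ContDiffOn ℝ ∞ Mt U) (h1 : ∀ w ∈ U, cD s s' Ψ w = Ms w (Ψ w))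
    (h2 : ∀ w ∈ U, cD t t' Ψ w = Mt w (Ψ w)) {w : X} (hw : w ∈ U) :
    (cD s s' Mt w - cD t t' Ms w + ⁅Mt w, Ms w⁆) (Ψ w) = 0 := by
  have dΨ := diffAt hU (by simp) hΨ hw
  have h3 : cD s s' (cD t t' Ψ) w = cD s s' Mt w (Ψ w) + Mt w (Ms w (Ψ w)) := by
    rw [cD_congr_on hU h2 hw, cD_apply (diffAt hU (by simp) hMt hw) dΨ, h1 w hw]
  have h4 : cD t t' (cD s s' Ψ) w = cD t t' Ms w (Ψ w) + Ms w (Mt w (Ψ w)) := by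
    rw [cD_congr_on hU h1 hw, cD_apply (diffAt hU (by simp) hMs hw) dΨ, h2 w hw]
  rw [cD_comm hU hΨ hw, h4] at h3
  simp only [Ring.lie_def, add_apply, sub_apply, mul_apply_eq_comp]
  linear_combination (norm := module) -h3

/-- Solved for the derivatives of `Ψ`, the system has coefficients `-κ⁻¹L` in `z`, `-κ⁻¹M_s` in
`t_s` and `κ⁻¹μL - L̄` in `z̄`, the last after eliminating `μ∂Ψ`. This identity and the next three
express the curvature of these coefficients through the field equations. -/
theorem integrability_z_t (hU : IsOpen U) (hL : ContDiffOn ℝ ∞ L U) (hM : ContDiffOn ℝ ∞ Ms U)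
    (hκ : κ ≠ 0) {w : X} (hw : w ∈ U) :
    cD z z' (fun w => -(κ⁻¹ • Ms w)) w - cD s s' (fun w => -(κ⁻¹ • L w)) w
      + ⁅-(κ⁻¹ • Ms w), -(κ⁻¹ • L w)⁆
    = (κ⁻¹ * κ⁻¹) • (κ • cD s s' L w - κ • cD z z' Ms w + ⁅Ms w, L w⁆) := by
  rw [cD_neg, cD_neg, cD_const_smul _ (diffAt hU (by simp) hM hw),
    cD_const_smul _ (diffAt hU (by simp) hL hw)]
  simp only [lie_neg, neg_lie, smul_lie, lie_smul, smul_add, smul_sub, smul_smul, mul_assoc,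
    inv_mul_cancel₀ hκ, mul_one]
  module

theorem integrability_z_zb (hU : IsOpen U) (hL : ContDiffOn ℝ ∞ L U) (hLb : ContDiffOn ℝ ∞ Lb U)
    (hm : ContDiffOn ℝ ∞ m U) (hκ : κ ≠ 0) {w : X} (hw : w ∈ U) :
    cD z z' (fun w => κ⁻¹ • m w • L w - Lb w) w - cD zb zb' (fun w => -(κ⁻¹ • L w)) w
      + ⁅κ⁻¹ • m w • L w - Lb w, -(κ⁻¹ • L w)⁆
    = κ⁻¹ • (cD zb zb' L w + cD z z' (fun w => m w • L w) w - κ • cD z z' Lb w + ⁅Lb w, L w⁆) := by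
  have hmL : DifferentiableAt ℝ (fun w => m w • L w) w := diffAt hU (by simp) (hm.smul hL) hw
  rw [cD_neg, cD_const_smul _ (diffAt hU (by simp) hL hw), cD_sub (hmL.fun_const_smul κ⁻¹)
    (diffAt hU (by simp) hLb hw), cD_const_smul _ hmL]
  simp only [lie_neg, sub_lie, smul_lie, lie_smul, lie_self, smul_add, smul_sub, smul_smul,
    inv_mul_cancel₀ hκ, smul_zero]
  module

/-- The coefficient in `z̄` contains `-μ` times the coefficient in `z`, so the compatibility of `z`
and `t_s` enters beside the equation for `M_s`. -/
theorem integrability_zb_t (hU : IsOpen U) (hL : ContDiffOn ℝ ∞ L U) (hLb : ContDiffOn ℝ ∞ Lb U)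
    (hM : ContDiffOn ℝ ∞ Ms U) (hm : ContDiffOn ℝ ∞ m U) (hms : ∀ w ∈ U, cD s s' m w = ms w)
    (hκ : κ ≠ 0) {w : X} (hw : w ∈ U) :
    cD zb zb' (fun w => -(κ⁻¹ • Ms w)) w - cD s s' (fun w => κ⁻¹ • m w • L w - Lb w) w
      + ⁅-(κ⁻¹ • Ms w), κ⁻¹ • m w • L w - Lb w⁆
    = -(κ⁻¹ • (cD zb zb' Ms w + m w • cD z z' Ms w - ⁅Ms w, Lb w⁆
        - (κ • cD s s' Lb w - ms w • L w)))
      - (κ⁻¹ * κ⁻¹ * m w) • (κ • cD s s' L w - κ • cD z z' Ms w + ⁅Ms w, L w⁆) := by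
  have hmL : DifferentiableAt ℝ (fun w => m w • L w) w := diffAt hU (by simp) (hm.smul hL) hw
  rw [cD_neg, cD_const_smul _ (diffAt hU (by simp) hM hw), cD_sub (hmL.fun_const_smul κ⁻¹)
    (diffAt hU (by simp) hLb hw), cD_const_smul _ hmL, cD_smul (diffAt hU (by simp) hm hw)
    (diffAt hU (by simp) hL hw), hms w hw]
  simp only [neg_lie, lie_sub, smul_lie, lie_smul]
  match_scalars <;> field_simp
  ring

theorem integrability_t_t (hU : IsOpen U) (hMs : ContDiffOn ℝ ∞ Ms U) (hMt : ContDiffOn ℝ ∞ Mt U)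
    (hκ : κ ≠ 0) {w : X} (hw : w ∈ U) :
    cD s s' (fun w => -(κ⁻¹ • Mt w)) w - cD t t' (fun w => -(κ⁻¹ • Ms w)) w
      + ⁅-(κ⁻¹ • Mt w), -(κ⁻¹ • Ms w)⁆
    = -((κ⁻¹ * κ⁻¹) • (κ • (cD s s' Mt w - cD t t' Ms w) + ⁅Ms w, Mt w⁆)) := by
  rw [cD_neg, cD_neg, cD_const_smul _ (diffAt hU (by simp) hMs hw),
    cD_const_smul _ (diffAt hU (by simp) hMt hw), ← lie_skew (-(κ⁻¹ • Mt w))]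
  simp only [neg_lie, lie_neg, smul_lie, lie_smul]
  match_scalars <;> field_simp

theorem cD_curvature (hU : IsOpen U) (hMs : ContDiffOn ℝ ∞ Ms U) (hMt : ContDiffOn ℝ ∞ Mt U) {w : X}
    (hw : w ∈ U) :
    cD z z' (fun w => κ • (cD s s' Mt w - cD t t' Ms w) + ⁅Ms w, Mt w⁆) w
      = κ • (cD s s' (cD z z' Mt) w - cD t t' (cD z z' Ms) w)
        + (⁅cD z z' Ms w, Mt w⁆ + ⁅Ms w, cD z z' Mt w⁆) := by
  have h1 : DifferentiableAt ℝ (cD s s' Mt) w := diffAt hU (by simp) (contDiffOn_cD hU hMt) hw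
  have h2 : DifferentiableAt ℝ (cD t t' Ms) w := diffAt hU (by simp) (contDiffOn_cD hU hMs) hw
  rw [cD_add ((h1.fun_sub h2).fun_const_smul κ) (diffAt hU (by simp) (contDiffOn_lie hMs hMt) hw),
    cD_const_smul κ (h1.fun_sub h2), cD_sub h1 h2, cD_comm hU hMt hw, cD_comm hU hMs hw,
    cD_lie (diffAt hU (by simp) hMs hw) (diffAt hU (by simp) hMt hw)]

/-- The curvature in the directions of the times is covariantly constant along the surface. -/
theorem curvature_parallel_z (hU : IsOpen U) (hL : ContDiffOn ℝ ∞ L U) (hMs : ContDiffOn ℝ ∞ Ms U)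
    (hMt : ContDiffOn ℝ ∞ Mt U)
    (hSs : ∀ w ∈ U, κ • cD s s' L w - κ • cD z z' Ms w + ⁅Ms w, L w⁆ = 0)
    (hSt : ∀ w ∈ U, κ • cD t t' L w - κ • cD z z' Mt w + ⁅Mt w, L w⁆ = 0) {w : X} (hw : w ∈ U) :
    κ • cD z z' (fun w => κ • (cD s s' Mt w - cD t t' Ms w) + ⁅Ms w, Mt w⁆) w
      = ⁅κ • (cD s s' Mt w - cD t t' Ms w) + ⁅Ms w, Mt w⁆, L w⁆ := by
  have d := fun {f : X → V →L[ℂ] V} (hf : ContDiffOn ℝ ∞ f U) =>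
    (diffAt hU (by simp) hf hw : DifferentiableAt ℝ f w)
  have c := fun {f : X → V →L[ℂ] V} {a b : X} (hf : ContDiffOn ℝ ∞ f U) =>
    contDiffOn_cD (a := a) (b := b) hU hf
  -- The compatibility equation of one time is differentiated in the other. In the difference of the
  -- two results the second derivatives of `L` cancel, and the Jacobi identity collects the
  -- commutators.
  have key : ∀ {N : X → V →L[ℂ] V} {a a' b b' : X}, ContDiffOn ℝ ∞ N U →
      (∀ w ∈ U, κ • cD a a' L w - κ • cD z z' N w + ⁅N w, L w⁆ = 0) →
      κ • cD b b' (cD z z' N) w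
        = κ • cD b b' (cD a a' L) w + ⁅cD b b' N w, L w⁆ + ⁅N w, cD b b' L w⁆ := by
    intro N a a' b b' hN hS
    have h0 : cD b b' (fun w => κ • cD a a' L w - κ • cD z z' N w + ⁅N w, L w⁆) w = 0 := by
      rw [cD_congr_on hU (g := fun _ => 0) hS hw, cD_const]
    rw [cD_add (((d (c hL)).fun_const_smul κ).fun_sub ((d (c hN)).fun_const_smul κ))
        (d (contDiffOn_lie hN hL)),
      cD_sub ((d (c hL)).fun_const_smul κ) ((d (c hN)).fun_const_smul κ), cD_const_smul _ (d (c hL)),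
      cD_const_smul _ (d (c hN)), cD_lie (d hN) (d hL)] at h0
    linear_combination (norm := module) -h0
  have k1 := key (b := s) (b' := s') hMt hSt
  have k2 := key (b := t) (b' := t') hMs hSs
  rw [cD_comm hU hL hw] at k2
  have e1 : κ • cD z z' Ms w = κ • cD s s' L w + ⁅Ms w, L w⁆ := by
    linear_combination (norm := module) -hSs w hw
  have e2 : κ • cD z z' Mt w = κ • cD t t' L w + ⁅Mt w, L w⁆ := by
    linear_combination (norm := module) -hSt w hw
  rw [cD_curvature hU hMs hMt hw, smul_add, smul_add, ← smul_lie, ← lie_smul, e1, e2, smul_sub, k1, k2]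
  have j : ⁅⁅Ms w, Mt w⁆, L w⁆ = ⁅Ms w, ⁅Mt w, L w⁆⁆ + ⁅⁅Ms w, L w⁆, Mt w⁆ := by
    rw [lie_lie, ← lie_skew ⁅Ms w, L w⁆ (Mt w)]; abel
  simp only [add_lie, sub_lie, smul_lie, lie_add, lie_smul, j, ← lie_skew (cD s s' L w) (Mt w)]
  module

/-- A Bianchi identity: the equation for each `M` is differentiated in the other time and the
results are subtracted, so that second derivatives of `Lb` cancel. The terms from the time
dependence of `m` vanish by `hSs` and `hSt`; `hdst` and `hdts` hold because `μ` is linear in the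
times. -/
theorem curvature_parallel_zb (hU : IsOpen U) (hL : ContDiffOn ℝ ∞ L U) (hLb : ContDiffOn ℝ ∞ Lb U)
    (hMs : ContDiffOn ℝ ∞ Ms U) (hMt : ContDiffOn ℝ ∞ Mt U) (hm : ContDiffOn ℝ ∞ m U)
    (hms : ContDiffOn ℝ ∞ ms U) (hmt : ContDiffOn ℝ ∞ mt U)
    (hdms : ∀ w ∈ U, cD s s' m w = ms w) (hdmt : ∀ w ∈ U, cD t t' m w = mt w)
    (hdst : ∀ w ∈ U, cD s s' mt w = 0) (hdts : ∀ w ∈ U, cD t t' ms w = 0)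
    (hSs : ∀ w ∈ U, κ • cD s s' L w - κ • cD z z' Ms w + ⁅Ms w, L w⁆ = 0)
    (hSt : ∀ w ∈ U, κ • cD t t' L w - κ • cD z z' Mt w + ⁅Mt w, L w⁆ = 0)
    (hEs : ∀ w ∈ U, cD zb zb' Ms w + m w • cD z z' Ms w - ⁅Ms w, Lb w⁆
      - (κ • cD s s' Lb w - ms w • L w) = 0)
    (hEt : ∀ w ∈ U, cD zb zb' Mt w + m w • cD z z' Mt w - ⁅Mt w, Lb w⁆
      - (κ • cD t t' Lb w - mt w • L w) = 0) {w : X} (hw : w ∈ U) :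
    cD zb zb' (fun w => κ • (cD s s' Mt w - cD t t' Ms w) + ⁅Ms w, Mt w⁆) w
      + m w • cD z z' (fun w => κ • (cD s s' Mt w - cD t t' Ms w) + ⁅Ms w, Mt w⁆) w
      = ⁅κ • (cD s s' Mt w - cD t t' Ms w) + ⁅Ms w, Mt w⁆, Lb w⁆ := by
  have d := fun {f : X → V →L[ℂ] V} (hf : ContDiffOn ℝ ∞ f U) =>
    (diffAt hU (by simp) hf hw : DifferentiableAt ℝ f w)
  have c := fun {f : X → V →L[ℂ] V} {a b : X} (hf : ContDiffOn ℝ ∞ f U) =>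
    contDiffOn_cD (a := a) (b := b) hU hf
  have key : ∀ {N : X → V →L[ℂ] V} {a a' b b' : X} {ma mb : X → ℂ}, ContDiffOn ℝ ∞ N U →
      ContDiffOn ℝ ∞ ma U → (∀ w ∈ U, cD b b' m w = mb w) → (∀ w ∈ U, cD b b' ma w = 0) →
      (∀ w ∈ U, cD zb zb' N w + m w • cD z z' N w - ⁅N w, Lb w⁆
        - (κ • cD a a' Lb w - ma w • L w) = 0) →
      cD b b' (cD zb zb' N) w + m w • cD b b' (cD z z' N) w
        = -(mb w • cD z z' N w) + ⁅cD b b' N w, Lb w⁆ + ⁅N w, cD b b' Lb w⁆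
          + κ • cD b b' (cD a a' Lb) w - ma w • cD b b' L w := by
    intro N a a' b b' ma mb hN hma hmb hma0 hE
    have h0 : cD b b' (fun w => cD zb zb' N w + m w • cD z z' N w - ⁅N w, Lb w⁆
        - (κ • cD a a' Lb w - ma w • L w)) w = 0 := by
      rw [cD_congr_on hU (g := fun _ => 0) hE hw, cD_const]
    have i1 : DifferentiableAt ℝ (fun w => m w • cD z z' N w) w := d (hm.smul (c hN))
    have i2 : DifferentiableAt ℝ (fun w => ma w • L w) w := d (hma.smul hL)
    have i3 : DifferentiableAt ℝ (fun w => ⁅N w, Lb w⁆) w := d (contDiffOn_lie hN hLb)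
    have i4 : DifferentiableAt ℝ (fun w => κ • cD a a' Lb w) w := (d (c hLb)).const_smul κ
    rw [cD_sub (((d (c hN)).fun_add i1).fun_sub i3) (i4.fun_sub i2), cD_sub ((d (c hN)).fun_add i1) i3,
      cD_add (d (c hN)) i1, cD_sub i4 i2, cD_const_smul _ (d (c hLb)),
      cD_smul (diffAt hU (by simp) hm hw) (d (c hN)), cD_smul (diffAt hU (by simp) hma hw) (d hL),
      cD_lie (d hN) (d hLb), hmb w hw, hma0 w hw] at h0
    linear_combination (norm := module) h0
  have k1 := key hMt hmt hdms hdst hEt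
  have k2 := key hMs hms hdmt hdts hEs
  rw [cD_comm hU hLb hw] at k2
  have e1 : cD zb zb' Ms w + m w • cD z z' Ms w
      = ⁅Ms w, Lb w⁆ + κ • cD s s' Lb w - ms w • L w := by
    linear_combination (norm := module) hEs w hw
  have e2 : cD zb zb' Mt w + m w • cD z z' Mt w
      = ⁅Mt w, Lb w⁆ + κ • cD t t' Lb w - mt w • L w := by
    linear_combination (norm := module) hEt w hw
  rw [cD_curvature hU hMs hMt hw, cD_curvature hU hMs hMt hw]
  have j : ⁅⁅Ms w, Mt w⁆, Lb w⁆ = ⁅Ms w, ⁅Mt w, Lb w⁆⁆ + ⁅⁅Ms w, Lb w⁆, Mt w⁆ := by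
    rw [lie_lie, ← lie_skew ⁅Ms w, Lb w⁆ (Mt w)]; abel
  have e3 := congrArg (fun x => ⁅x, Mt w⁆) e1
  have e4 := congrArg (fun x => ⁅Ms w, x⁆) e2
  simp only [add_lie, sub_lie, smul_lie, lie_add, lie_sub, lie_smul] at e3 e4
  rw [← lie_skew (L w) (Mt w), ← lie_skew (cD s s' Lb w) (Mt w)] at e3
  simp only [add_lie, sub_lie, smul_lie, j]
  linear_combination (norm := module) κ • k1 - κ • k2 + e3 + e4 - mt w • hSs w hw + ms w • hSt w hw

end Identities

/-! ### Flat linear systems -/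

section LinearSystem

variable {X V : Type*} [NormedAddCommGroup X] [NormedSpace ℝ X] [NormedAddCommGroup V]
  [NormedSpace ℂ V]

/-- The operator valued real one-form `α ⊗ B`. -/
def formOp (α : X →L[ℝ] ℂ) : (V →L[ℂ] V) →L[ℝ] X →L[ℝ] V →L[ℝ] V :=
  (ContinuousLinearMap.compL ℝ X (V →L[ℂ] V) (V →L[ℝ] V)
    (ContinuousLinearMap.restrictScalarsL ℂ V V ℝ ℝ)).comp
    (((ContinuousLinearMap.compL ℝ X ℂ (V →L[ℂ] V)).flip α).comp
      (ContinuousLinearMap.lsmul ℝ ℂ).flip)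

@[simp] theorem formOp_apply (α : X →L[ℝ] ℂ) (B : V →L[ℂ] V) (h : X) (v : V) :
    formOp α B h v = α h • B v := rfl

/-- The one-forms `α_j` are constant, so the curvature of the connection form `∑ α_j ⊗ A_j` on two
vectors `h`, `k` is the sum of `α_i(h) α_j(k)` times its components. The real Frobenius theorem
applies once all components vanish. -/
theorem exists_parallel_of_forms [FiniteDimensional ℝ X] [FiniteDimensional ℂ V] {ι : Type*} [Fintype ι] {U : Set X}
    (hU : IsOpen U) (α : ι → X →L[ℝ] ℂ) (A : ι → X → V →L[ℂ] V) (dA : ι → ι → X → V →L[ℂ] V)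
    (hA : ∀ j, ContDiffOn ℝ ∞ (A j) U)
    (hdA : ∀ j, ∀ w ∈ U, ∀ h, fderiv ℝ (A j) w h = ∑ i, α i h • dA i j w)
    (hflat : ∀ i j, ∀ w ∈ U, dA i j w - dA j i w + ⁅A j w, A i w⁆ = 0) {w₀ : X} (hw₀ : w₀ ∈ U) :
    ∃ r > 0, Metric.ball w₀ r ⊆ U ∧ ∀ v : V, ∃ Ψ : X → V, Ψ w₀ = v ∧
      ContDiffOn ℝ ∞ Ψ (Metric.ball w₀ r) ∧
      ∀ w ∈ Metric.ball w₀ r, DifferentiableAt ℝ Ψ w ∧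
        ∀ h, fderiv ℝ Ψ w h = ∑ j, α j h • A j w (Ψ w) := by
  have : FiniteDimensional ℝ V := FiniteDimensional.complexToReal V
  have hsm : ContDiffOn ℝ ∞ (fun w => ∑ j, formOp (α j) (A j w)) U :=
    ContDiffOn.sum fun j _ => ContDiff.comp_contDiffOn (g := formOp (V := V) (α j))
      (formOp (V := V) (α j)).contDiff (hA j)
  have hder : ∀ w ∈ U, ∀ h k v, fderiv ℝ (fun w => ∑ j, formOp (α j) (A j w)) w h k v
      = ∑ i, ∑ j, (α i h * α j k) • dA i j w v := by
    intro w hw h k v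
    have h1 : HasFDerivAt (fun w => ∑ j, formOp (α j) (A j w))
        (∑ j, (formOp (α j)).comp (fderiv ℝ (A j) w)) w :=
      HasFDerivAt.fun_sum fun j _ =>
        HasFDerivAt.comp w (g := formOp (V := V) (α j)) (formOp (V := V) (α j)).hasFDerivAt
          (diffAt hU (by simp) (hA j) hw).hasFDerivAt
    rw [h1.fderiv, Finset.sum_comm]
    simp only [sum_apply, ContinuousLinearMap.coe_comp, Function.comp_apply, formOp_apply, hdA _ w hw,
      smul_apply, Finset.smul_sum, smul_smul]
    exact Finset.sum_congr rfl fun j _ => Finset.sum_congr rfl fun i _ => by rw [mul_comm]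
  obtain ⟨r, hr, hrU, hΨ⟩ := exists_parallel_section hU _ hsm (fun w hw h k => by
    ext v
    have h2 := hder w hw k h v
    rw [Finset.sum_comm] at h2
    simp only [add_apply, sub_apply, hder w hw h k v, h2, ContinuousLinearMap.coe_comp,
      Function.comp_apply, sum_apply, formOp_apply, map_sum, map_smul, zero_apply]
    conv_lhs => enter [2]; rw [Finset.sum_comm]
    rw [← Finset.sum_sub_distrib, ← Finset.sum_add_distrib, ← Finset.sum_sub_distrib]
    refine Finset.sum_eq_zero fun i _ => ?_
    rw [← Finset.sum_sub_distrib, ← Finset.sum_add_distrib, ← Finset.sum_sub_distrib]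
    refine Finset.sum_eq_zero fun j _ => ?_
    have h3 := congrArg (fun B : V →L[ℂ] V => (α i h * α j k) • B v) (hflat i j w hw)
    simp only [Ring.lie_def, add_apply, sub_apply, mul_apply_eq_comp, zero_apply, smul_zero] at h3
    linear_combination (norm := module) h3) hw₀
  refine ⟨r, hr, hrU, fun v => ?_⟩
  obtain ⟨Ψ, h0, hs, hd⟩ := hΨ v
  refine ⟨Ψ, h0, hs, fun w hw => ⟨(hd w hw).differentiableAt, fun h => ?_⟩⟩
  rw [(hd w hw).fderiv]
  simp

end LinearSystem

/-! ### Linear systems in the times and the two Wirtinger directions -/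

section TimeSpace

variable {l : ℕ} {E V : Type*} [NormedAddCommGroup E] [NormedSpace ℂ E] [NormedAddCommGroup V]
  [NormedSpace ℂ V]

/-- The differential is a combination of `dt_s`, `dz` and `dz̄`; holomorphy in the times excludes
the conjugates of `dt_s`. -/
theorem fderiv_eq_wirtinger {f : (Fin l → ℂ) × ℂ → E} {w : (Fin l → ℂ) × ℂ}
    (hf : DifferentiableAt ℝ f w) (hf' : DifferentiableAt ℂ (fun q => f (q, w.2)) w.1)
    (h : (Fin l → ℂ) × ℂ) :
    fderiv ℝ f w h = ∑ s, h.1 s • pt (Pi.single s 1) f w + h.2 • pz f w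
      + (starRingEnd ℂ) h.2 • pzb f w := by
  have e : h = (h.1, 0) + h.2.re • ((0 : Fin l → ℂ), (1 : ℂ)) + h.2.im • (0, Complex.I) := by
    ext <;> simp
  have e1 : fderiv ℝ f w (h.1, 0) = ∑ s, h.1 s • pt (Pi.single s 1) f w := by
    have h1 : fderiv ℝ f w (h.1, 0) = pt h.1 f w := by simp [cD]
    rw [h1, ← fderiv_slice hf hf']
    conv_lhs => rw [pi_eq_sum_univ' h.1, map_sum]
    refine Finset.sum_congr rfl fun s _ => ?_
    rw [← fderiv_slice hf hf', map_smul]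
  have e2 : ((0 : Fin l → ℂ), (1 / 2 : ℂ)) = (1 / 2 : ℝ) • (0, 1) := by ext <;> simp
  have e3 : ((0 : Fin l → ℂ), Complex.I / 2) = (1 / 2 : ℝ) • (0, Complex.I) := by
    ext <;> simp [div_eq_inv_mul]
  have e4 : ((0 : Fin l → ℂ), -(Complex.I / 2)) = (-(1 / 2) : ℝ) • (0, Complex.I) := by
    ext <;> simp [div_eq_inv_mul]
  have hc : (starRingEnd ℂ) h.2 = h.2.re - h.2.im * Complex.I := by apply Complex.ext <;> simp
  conv_lhs => rw [e, map_add, map_add, map_smul, map_smul, e1]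
  simp only [pz, pzb, cD, e2, e3, e4, map_smul, hc]
  conv_rhs => rw [← Complex.re_add_im h.2]
  simp only [← Complex.coe_smul]
  push_cast
  match_scalars <;> ring_nf <;> simp <;> ring

/-- A flat linear system in the times and in a coordinate on the surface has local solutions with
arbitrary initial value. -/
theorem exists_solution [FiniteDimensional ℂ V] {U : Set ((Fin l → ℂ) × ℂ)} (hU : IsOpen U)
    {At : Fin l → (Fin l → ℂ) × ℂ → V →L[ℂ] V} {Az Azb : (Fin l → ℂ) × ℂ → V →L[ℂ] V}
    (hAt : ∀ s, ContDiffOn ℝ ∞ (At s) U) (hAz : ContDiffOn ℝ ∞ Az U) (hAzb : ContDiffOn ℝ ∞ Azb U)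
    (hAt' : ∀ s, ∀ w ∈ U, DifferentiableAt ℂ (fun q => At s (q, w.2)) w.1)
    (hAz' : ∀ w ∈ U, DifferentiableAt ℂ (fun q => Az (q, w.2)) w.1)
    (hAzb' : ∀ w ∈ U, DifferentiableAt ℂ (fun q => Azb (q, w.2)) w.1)
    (hzzb : ∀ w ∈ U, pz Azb w - pzb Az w + ⁅Azb w, Az w⁆ = 0)
    (hzt : ∀ s, ∀ w ∈ U, pz (At s) w - pt (Pi.single s 1) Az w + ⁅At s w, Az w⁆ = 0)
    (hzbt : ∀ s, ∀ w ∈ U, pzb (At s) w - pt (Pi.single s 1) Azb w + ⁅At s w, Azb w⁆ = 0)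
    (htt : ∀ s r, ∀ w ∈ U, pt (Pi.single s 1) (At r) w - pt (Pi.single r 1) (At s) w
      + ⁅At r w, At s w⁆ = 0) {w₀ : (Fin l → ℂ) × ℂ} (hw₀ : w₀ ∈ U) :
    ∃ r > 0, Metric.ball w₀ r ⊆ U ∧ ∀ v : V, ∃ Ψ : (Fin l → ℂ) × ℂ → V, Ψ w₀ = v ∧
      ContDiffOn ℝ ∞ Ψ (Metric.ball w₀ r) ∧ ∀ w ∈ Metric.ball w₀ r,
        DifferentiableAt ℂ (fun q => Ψ (q, w.2)) w.1 ∧ pz Ψ w = Az w (Ψ w) ∧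
        pzb Ψ w = Azb w (Ψ w) ∧ ∀ s, pt (Pi.single s 1) Ψ w = At s w (Ψ w) := by
  have skew : ∀ {a b c d : V →L[ℂ] V}, a - b + ⁅c, d⁆ = 0 → b - a + ⁅d, c⁆ = 0 := by
    intro a b c d h
    rw [← lie_skew, ← neg_eq_zero, ← h]
    abel
  -- The forms are `dt_s`, then `dz` for `true` and `dz̄` for `false`. As no conjugate of `dt_s` is
  -- among them, a solution of the real system is automatically holomorphic in the times.
  let α : Fin l ⊕ Bool → ((Fin l → ℂ) × ℂ) →L[ℝ] ℂ :=
    Sum.elim (fun s => ((ContinuousLinearMap.proj s).comp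
        (ContinuousLinearMap.fst ℂ (Fin l → ℂ) ℂ)).restrictScalars ℝ)
      (fun b => cond b ((ContinuousLinearMap.snd ℂ (Fin l → ℂ) ℂ).restrictScalars ℝ)
        (Complex.conjCLE.toContinuousLinearMap.comp
          ((ContinuousLinearMap.snd ℂ (Fin l → ℂ) ℂ).restrictScalars ℝ)))
  have hα : ∀ {E' : Type _} [NormedAddCommGroup E'] [NormedSpace ℂ E'] (h : (Fin l → ℂ) × ℂ)
      (f : Fin l ⊕ Bool → E'), ∑ j, α j h • f j
        = ∑ s, h.1 s • f (Sum.inl s) + h.2 • f (Sum.inr true)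
          + (starRingEnd ℂ) h.2 • f (Sum.inr false) := by
    intro E' _ _ h f
    rw [Fintype.sum_sum_type, Fintype.sum_bool, ← add_assoc]
    rfl
  let A : Fin l ⊕ Bool → (Fin l → ℂ) × ℂ → V →L[ℂ] V :=
    Sum.elim At (fun b => cond b Az Azb)
  let dA : Fin l ⊕ Bool → Fin l ⊕ Bool → (Fin l → ℂ) × ℂ → V →L[ℂ] V := fun i j =>
    Sum.elim (fun s => pt (Pi.single s 1) (A j)) (fun b => cond b (pz (A j)) (pzb (A j))) i
  have hA : ∀ j, ContDiffOn ℝ ∞ (A j) U := by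
    rintro (s | _ | _)
    exacts [hAt s, hAzb, hAz]
  have hA' : ∀ j, ∀ w ∈ U, DifferentiableAt ℂ (fun q => A j (q, w.2)) w.1 := by
    rintro (s | _ | _)
    exacts [hAt' s, hAzb', hAz']
  have hflat : ∀ i j, ∀ w ∈ U, dA i j w - dA j i w + ⁅A j w, A i w⁆ = 0 := by
    rintro (s | _ | _) (r | _ | _) w hw
    · exact htt s r w hw
    · exact skew (hzbt s w hw)
    · exact skew (hzt s w hw)
    · exact hzbt r w hw
    · simp
    · exact skew (hzzb w hw)
    · exact hzt r w hw
    · exact hzzb w hw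
    · simp
  obtain ⟨r, hr, hrU, h⟩ := exists_parallel_of_forms hU α A dA hA (fun j w hw h => by
    rw [fderiv_eq_wirtinger (diffAt hU (by simp) (hA j) hw) (hA' j w hw), hα]
    rfl) hflat hw₀
  refine ⟨r, hr, hrU, fun v => ?_⟩
  obtain ⟨Ψ, h0, hs, hd⟩ := h v
  refine ⟨Ψ, h0, hs, fun w hw => ?_⟩
  have hd' : ∀ k, fderiv ℝ Ψ w k = _ := fun k => ((hd w hw).2 k).trans (hα k _)
  have hp : ∀ s, pt (Pi.single s 1) Ψ w = At s w (Ψ w) := by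
    intro s
    simp only [pt, cD, hd', Prod.fst_zero, Prod.snd_zero]
    simp [Pi.single_apply, A]
  have h2 : (starRingEnd ℂ) 2 = 2 := map_ofNat _ 2
  refine ⟨?_, ?_, ?_, hp⟩
  · have h1 : HasFDerivAt (fun q : Fin l → ℂ => Ψ (q, w.2)) _ w.1 :=
      HasFDerivAt.comp w.1 (g := Ψ) (f := fun q => (q, w.2)) (g' := fderiv ℝ Ψ w)
        (hd w hw).1.hasFDerivAt (hasFDerivAt_prodMk_left w.1 w.2)
    refine (hasFDerivAt_of_restrictScalars ℝ (f' := ∑ s,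
      (ContinuousLinearMap.proj s : (Fin l → ℂ) →L[ℂ] ℂ).smulRight (At s w (Ψ w))) h1 ?_).differentiableAt
    ext τ
    simp [hd', A]
  · simp only [pz, cD, hd']
    simp [A, h2]
    match_scalars <;> ring_nf <;> norm_num [Complex.I_sq]
  · simp only [pzb, cD, hd']
    simp [A, h2]
    match_scalars <;> ring_nf <;> norm_num [Complex.I_sq]

end TimeSpace

/-! ### Tangent families -/

section Extension

variable {S E : Type*} [TopologicalSpace S] [T2Space S] [ChartedSpace ℂ S] [IsManifold 𝓘(ℂ) ω S]
  [NormedAddCommGroup E] [NormedSpace ℂ E] [FiniteDimensional ℂ E] {n : ℕ} {P : Type*}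
  [NormedAddCommGroup P] [NormedSpace ℂ P] [FiniteDimensional ℂ P] {mark : Fin n → S} {D : Set P}
  {F : P → S → E} {a b : ℤ}

theorem differentiableAt_lf {φ : OpenPartialHomeomorph S ℂ} {w : P × ℂ}
    (hF : DifferentiableAt ℂ (fun q => F q (φ.symm w.2)) w.1) :
    DifferentiableAt ℂ (fun q => lf a b φ F (q, w.2)) w.1 :=
  DifferentiableAt.fun_const_smul hF (fac a b (jac φ (chartAt ℂ (φ.symm w.2)) w.2))

/-- Off the pole the smooth remainder is a difference of two functions holomorphic in the parameter,
so it is holomorphic too, and the expansion at the pole can be differentiated term by term. -/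
theorem PoleFamily.fderiv (hD : IsOpen D) {res : P → Fin n → E} (h : PoleFamily mark D F res)
    (v : P) : PoleFamily mark D (fun q r => fderiv ℂ (fun q' => F q' r) q v)
      (fun q c => fderiv ℂ (fun q' => res q' c) q v) := by
  refine ⟨((h.mero hD).fderiv hD (fun r _ => h.2.2.1 r) v).1, fun φ hφ c hc => ?_,
    fun r => differentiableOn_fderiv_apply hD (h.2.2.1 r) v,
    fun c => differentiableOn_fderiv_apply hD (h.2.2.2 c) v⟩
  obtain ⟨N, hN, u, hu, hF⟩ := h.2.1 φ hφ c hc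
  obtain ⟨N', hN', ho, hc'⟩ := mem_nhds_iff.1 hN
  have hu' := hu.mono (Set.prod_mono (le_refl D) hN')
  refine ⟨N', ho.mem_nhds hc', pt v u, contDiffOn_cD (hD.prod ho) hu', fun q hq z hz hne => ?_⟩
  have hq' := hD.mem_nhds hq
  have hFd := (h.2.2.1 (φ.symm z)).differentiableAt hq'
  have hrd := ((h.2.2.2 c).differentiableAt hq').fun_const_smul (z - φ (mark c))⁻¹
  have hld := differentiableAt_lf (a := 1) (b := 0) (w := (q, z)) hFd
  have hev : (fun q => lf 1 0 φ F (q, z)) =ᶠ[𝓝 q]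
      fun q => (z - φ (mark c))⁻¹ • res q c + u (q, z) := by
    filter_upwards [hq'] with q hq using hF q hq z (hN' hz) hne
  have hud : DifferentiableAt ℂ (fun q => u (q, z)) q := by
    refine (hld.fun_sub hrd).congr_of_eventuallyEq ?_
    filter_upwards [hev] with q hq
    simp [hq]
  have h1 : _root_.fderiv ℂ (fun q => lf 1 0 φ F (q, z)) q v
      = lf 1 0 φ (fun q r => _root_.fderiv ℂ (fun q' => F q' r) q v) (q, z) := by
    have h2 := fderiv_fun_const_smul hFd (fac 1 0 (jac φ (chartAt ℂ (φ.symm z)) z))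
    exact congrArg (fun T => T v) h2
  change lf 1 0 φ (fun q r => _root_.fderiv ℂ (fun q' => F q' r) q v) (q, z) = _
  rw [← h1, hev.fderiv_eq, fderiv_fun_add hrd hud, fderiv_fun_const_smul ((h.2.2.2 c).differentiableAt hq'),
    ← fderiv_slice (w := (q, z)) (diffAt (hD.prod ho) (by simp) hu' ⟨hq, hz⟩) hud]
  rfl

/-- A function that is smooth up to an isolated point and holomorphic in the parameter off that
point is holomorphic in the parameter. -/
theorem differentiableOn_of_punctured (hD : IsOpen D) {u : P × ℂ → E} {N : Set ℂ} (hN : IsOpen N)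
    (hu : ContDiffOn ℝ ∞ u (D ×ˢ N)) {c : ℂ}
    (hol : ∀ z ∈ N, z ≠ c → DifferentiableOn ℂ (fun q => u (q, z)) D) (hc : c ∈ N) :
    DifferentiableOn ℂ (fun q => u (q, c)) D := by
  intro q hq
  have hd : ∀ z ∈ N, DifferentiableAt ℝ u (q, z) := fun z hz =>
    diffAt (hD.prod hN) (by simp) hu ⟨hq, hz⟩
  have hs : ∀ z ∈ N, HasFDerivAt (fun q => u (q, z))
      ((fderiv ℝ u (q, z)).comp (ContinuousLinearMap.inl ℝ P ℂ)) q := fun z hz =>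
    HasFDerivAt.comp q (g := u) (f := fun q => (q, z)) (hd z hz).hasFDerivAt
      (hasFDerivAt_prodMk_left q z)
  have hcont : ContinuousAt (fun z => fderiv ℝ u (q, z)) c := by
    have h1 : ContinuousOn (fderiv ℝ u) (D ×ˢ N) :=
      (hu.fderiv_of_isOpen (m := ∞) (hD.prod hN) (by simp)).continuousOn
    exact (h1.comp (f := fun z => (q, z)) (by fun_prop) fun z hz => ⟨hq, hz⟩).continuousAt
      (hN.mem_nhds hc)
  -- Complex linearity of the derivative in the parameter is a closed condition and passes to the
  -- limit at the exceptional point.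
  have hI : ∀ (k : ℂ) (v : P), fderiv ℝ u (q, c) (k • v, 0) = k • fderiv ℝ u (q, c) (v, 0) := by
    intro k v
    have h1 : Filter.Tendsto (fun z => fderiv ℝ u (q, z) (k • v, 0) - k • fderiv ℝ u (q, z) (v, 0))
        (𝓝[≠] c) (𝓝 (fderiv ℝ u (q, c) (k • v, 0) - k • fderiv ℝ u (q, c) (v, 0))) := by
      refine Filter.Tendsto.mono_left ?_ nhdsWithin_le_nhds
      exact ((hcont.clm_apply continuousAt_const).sub
        ((hcont.clm_apply continuousAt_const).const_smul k)).tendsto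
    have h2 : (fun z => fderiv ℝ u (q, z) (k • v, 0) - k • fderiv ℝ u (q, z) (v, 0))
        =ᶠ[𝓝[≠] c] fun _ => 0 := by
      filter_upwards [nhdsWithin_le_nhds (hN.mem_nhds hc), self_mem_nhdsWithin] with z hz hne
      have h3 := ((hol z hz hne).differentiableAt (hD.mem_nhds hq)).hasFDerivAt
      have h4 := (h3.restrictScalars ℝ).unique (hs z hz)
      have h5 : ∀ v, fderiv ℝ u (q, z) (v, 0) = fderiv ℂ (fun q => u (q, z)) q v := fun v => by
        simpa using (congrArg (fun T => T v) h4).symm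
      rw [h5, h5, map_smul, sub_self]
    exact sub_eq_zero.1 (tendsto_nhds_unique h1 ((Filter.tendsto_congr' h2).2 tendsto_const_nhds))
  let T : P →ₗ[ℂ] E :=
    { toFun := fun v => fderiv ℝ u (q, c) (v, 0)
      map_add' := fun v v' => by rw [← map_add]; simp
      map_smul' := fun k v => hI k v }
  refine ((hasFDerivAt_of_restrictScalars ℝ (f' := T.toContinuousLinearMap) (hs c hc) ?_)
    |>.differentiableAt).differentiableWithinAt
  ext v
  simp [T]

/-- A family without poles extends smoothly to the marked points. -/
theorem Mero.exists_smoothFamily (hD : IsOpen D) (hmark : Function.Injective mark)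
    (hF : Mero mark 0 a b D F) (hol : ∀ r ∉ Set.range mark, DifferentiableOn ℂ (fun q => F q r) D) :
    ∃ G : P → S → E, SmoothFamily a b D G ∧ ∀ q, ∀ r ∉ Set.range mark, G q r = F q r := by
  classical
  choose N hN hcN hNt hp u hu hFu using fun c =>
    hF.2 _ (chart_mem_atlas ℂ (mark c)) c (mem_chart_source ℂ _)
  simp only [pow_zero, one_smul] at hFu
  -- At a marked point the value is that of the smooth numerator in the preferred chart there, which
  -- is the coefficient by the convention for differentials.
  let G : P → S → E := fun q r => if h : ∃ c, mark c = r then u h.choose (q, chartAt ℂ r r) else F q r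
  have hGF : ∀ q, ∀ r ∉ Set.range mark, G q r = F q r := fun q r hr => dif_neg hr
  have hGm : ∀ q c, G q (mark c) = u c (q, chartAt ℂ (mark c) (mark c)) := by
    intro q c
    have h : ∃ c', mark c' = mark c := ⟨c, rfl⟩
    have h1 : h.choose = c := hmark h.choose_spec
    simp only [G, dif_pos h, h1]
  have hGu : ∀ c, ∀ w ∈ D ×ˢ N c, lf a b (chartAt ℂ (mark c)) G w = u c w := by
    rintro c ⟨q, z⟩ ⟨hq, hz⟩
    by_cases hne : z = chartAt ℂ (mark c) (mark c)
    · subst hne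
      exact (loc_chartAt a b (G q) (mark c)).trans (hGm q c)
    · rw [← hFu c q hq z hz hne]
      exact loc_congr (hGF q _ (hp c z hz hne).2)
  have hsm : ∀ φ ∈ atlas ℂ S, ContDiffOn ℝ ∞ (lf a b φ G) (D ×ˢ punct mark φ) := fun φ hφ =>
    (hF.1 φ hφ).congr fun w hw => loc_congr (hGF _ _ hw.2.2)
  refine ⟨G, ⟨fun φ hφ w hw => ?_, fun r => ?_⟩, hGF⟩
  · refine ContDiffAt.contDiffWithinAt ?_
    by_cases hr : φ.symm w.2 ∈ Set.range mark
    · obtain ⟨c, hc⟩ := hr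
      set ψ := chartAt ℂ (mark c) with hψ
      have hov : w.2 ∈ overlap φ ψ := ⟨hw.2, by rw [Set.mem_preimage, ← hc]; exact mem_chart_source ℂ _⟩
      have hz : ψ (φ.symm w.2) ∈ N c := by rw [← hc]; exact hcN c
      have hcd : ContDiffAt ℝ ∞ (fun ζ => ψ (φ.symm ζ)) w.2 :=
        (((contDiffOn_trans hφ (chart_mem_atlas ℂ (mark c))).of_le (m := ∞) le_top).restrict_scalars
          ℝ).contDiffAt ((isOpen_overlap φ ψ).mem_nhds hov)
      have hfj : ContDiffAt ℝ ∞ (fun z => fac a b (jac φ ψ z)) w.2 :=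
        (contDiffOn_fac_jac a b hφ (chart_mem_atlas ℂ (mark c))).contDiffAt
          ((isOpen_overlap φ ψ).mem_nhds hov)
      have huc : ContDiffAt ℝ ∞ (u c) (w.1, ψ (φ.symm w.2)) :=
        (hu c).contDiffAt ((hD.prod (hN c)).mem_nhds ⟨hw.1, hz⟩)
      have h1 : ContDiffAt ℝ ∞ (fun w : P × ℂ => fac a b (jac φ ψ w.2) • u c (w.1, ψ (φ.symm w.2))) w :=
        (hfj.comp w contDiffAt_snd).smul (ContDiffAt.comp w (g := u c) huc
          (contDiffAt_fst.prodMk (hcd.comp w contDiffAt_snd)))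
      refine h1.congr_of_eventuallyEq ?_
      have hev1 : ∀ᶠ x in 𝓝 w, x.1 ∈ D := continuous_fst.continuousAt (hD.mem_nhds hw.1)
      have hev2 : ∀ᶠ x in 𝓝 w, x.2 ∈ overlap φ ψ :=
        continuous_snd.continuousAt ((isOpen_overlap φ ψ).mem_nhds hov)
      have hev3 : ∀ᶠ x in 𝓝 w, ψ (φ.symm x.2) ∈ N c :=
        (hcd.continuousAt.comp continuousAt_snd) ((hN c).mem_nhds hz)
      filter_upwards [hev1, hev2, hev3] with x h1 h2 h3
      rw [← hGu c (x.1, ψ (φ.symm x.2)) ⟨h1, h3⟩]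
      exact loc_change a b hφ (chart_mem_atlas ℂ (mark c)) (G x.1) h2
    · exact (hsm φ hφ).contDiffAt ((hD.prod (isOpen_punct mark φ)).mem_nhds ⟨hw.1, hw.2, hr⟩)
  · by_cases hr : r ∈ Set.range mark
    · obtain ⟨c, rfl⟩ := hr
      have h1 := differentiableOn_of_punctured hD (hN c) (hu c) (fun z hz hne => ?_) (hcN c)
      · exact h1.congr fun q _ => hGm q c
      · refine DifferentiableOn.congr (f := fun q => lf a b (chartAt ℂ (mark c)) F (q, z))
          (fun q hq => ?_) fun q hq => (hFu c q hq z hz hne).symm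
        exact (differentiableAt_lf (w := (q, z)) ((hol _ (hp c z hz hne).2).differentiableAt
          (hD.mem_nhds hq))).differentiableWithinAt
    · exact (hol r hr).congr fun q _ => hGF q r hr

theorem SmoothFamily.mem {V : Type*} [NormedAddCommGroup V] [NormedSpace ℂ V] [FiniteDimensional ℂ V]
    {lie : LieSubalgebra ℂ (V →L[ℂ] V)} {G : P → S → V →L[ℂ] V} (hG : SmoothFamily a b D G) {q : P}
    (hq : q ∈ D) (h : ∀ r ∉ Set.range mark, G q r ∈ lie) (r : S) : G q r ∈ lie := by
  by_cases hr : r ∈ Set.range mark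
  · obtain ⟨c, rfl⟩ := hr
    have h1 := (continuousAt_loc (a := a) (b := b) (f := G q) (mark c) fun φ hφ =>
      (hG.1 φ hφ).comp (f := fun z => (q, z)) (by fun_prop) fun z hz => ⟨hq, hz⟩).tendsto.mono_left
      (nhdsWithin_le_nhds (s := {chartAt ℂ (mark c) (mark c)}ᶜ))
    rw [loc_chartAt] at h1
    refine isClosed_lie.mem_of_tendsto h1 ?_
    filter_upwards [eventually_notMem_range mark c] with z hz
    exact lie.smul_mem _ (h _ hz.2)
  · exact h r hr

end Extension

/-! ### The equations in a chart -/

section LocalEquations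

variable {S V : Type*} [TopologicalSpace S] [T2Space S] [CompactSpace S] [ChartedSpace ℂ S]
  [IsManifold 𝓘(ℂ) ω S] [NormedAddCommGroup V] [NormedSpace ℂ V] [FiniteDimensional ℂ V] {n l : ℕ}
  {Q : Setup S V n l} {P : Type*} [NormedAddCommGroup P] [NormedSpace ℂ P] [FiniteDimensional ℂ P]
  {D : Set P} {F : P → FieldConf S V n} {time : P →L[ℂ] (Fin l → ℂ)}
  {E : Type*} [NormedAddCommGroup E] [NormedSpace ℂ E] {φ : OpenPartialHomeomorph S ℂ}

theorem lf_lie {a b a' b' a'' b'' : ℤ} (ha : a + a' = a'') (hb : b + b' = b'') (hφ : φ ∈ atlas ℂ S)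
    (A B : P → S → V →L[ℂ] V) {w : P × ℂ} (hw : w.2 ∈ φ.target) :
    lf a'' b'' φ (fun q r => ⁅A q r, B q r⁆) w = ⁅lf a b φ A w, lf a' b' φ B w⁆ := by
  simpa only [lieB_apply] using loc_bilin (lieB V) ha hb hφ (A w.1) (B w.1) hw

theorem lf_smul {a b a' b' a'' b'' : ℤ} (ha : a + a' = a'') (hb : b + b' = b'') (hφ : φ ∈ atlas ℂ S)
    (f : P → S → ℂ) (B : P → S → E) {w : P × ℂ} (hw : w.2 ∈ φ.target) :
    lf a'' b'' φ (fun q r => f q r • B q r) w = lf a b φ f w • lf a' b' φ B w :=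
  loc_bilin (ContinuousLinearMap.lsmul ℂ ℂ) ha hb hφ (f w.1) (B w.1) hw

theorem isOpen_prod_punct (hD : IsOpen D) (mark : Fin n → S) (φ : OpenPartialHomeomorph S ℂ) :
    IsOpen (D ×ˢ punct mark φ) := hD.prod (isOpen_punct mark φ)

theorem Setup.contDiffOn_mu (Q : Setup S V n l) (time : P →L[ℂ] (Fin l → ℂ)) (hφ : φ ∈ atlas ℂ S) :
    ContDiffOn ℝ ∞ (lf (-1) 1 φ fun q => Q.mu (time q)) (D ×ˢ punct Q.mark φ) :=
  (Q.mero_mu time).1 φ hφ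

/-- The linear part of the curvature in a chart. -/
theorem Setup.lf_flat (Q : Setup S V n l) (hD : IsOpen D) (time : P →L[ℂ] (Fin l → ℂ))
    {A B : P → S → V →L[ℂ] V} (hφ : φ ∈ atlas ℂ S)
    (hA : ContDiffOn ℝ ∞ (lf 1 0 φ A) (D ×ˢ punct Q.mark φ))
    (hB : ContDiffOn ℝ ∞ (lf 0 1 φ B) (D ×ˢ punct Q.mark φ)) {w : P × ℂ}
    (hw : w ∈ D ×ˢ punct Q.mark φ) :
    lf 1 1 φ (fun q r => delBar 1 0 (A q) r + del 0 1 (fun r' => Q.mu (time q) r' • A q r') r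
        - Q.kappa • del 0 1 (B q) r) w
      = pzb (lf 1 0 φ A) w + pz (fun w => lf (-1) 1 φ (fun q => Q.mu (time q)) w • lf 1 0 φ A w) w
        - Q.kappa • pz (lf 0 1 φ B) w := by
  have ho := isOpen_punct Q.mark φ
  have hmA : ContDiffOn ℝ ∞ (fun w => lf (-1) 1 φ (fun q => Q.mu (time q)) w • lf 1 0 φ A w)
      (D ×ˢ punct Q.mark φ) := (Q.contDiffOn_mu time hφ).smul hA
  have key : ∀ w ∈ D ×ˢ punct Q.mark φ, lf 0 1 φ (fun q r => Q.mu (time q) r • A q r) w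
      = lf (-1) 1 φ (fun q => Q.mu (time q)) w • lf 1 0 φ A w := fun w hw =>
    lf_smul (by norm_num) (by norm_num) hφ (fun q => Q.mu (time q)) A hw.2.1
  have key' : pz (lf 0 1 φ fun q r => Q.mu (time q) r • A q r) w
      = pz (fun w => lf (-1) 1 φ (fun q => Q.mu (time q)) w • lf 1 0 φ A w) w :=
    cD_congr_on (hD.prod ho) key hw
  rw [← key', ← loc_del_family hD hφ ho Set.inter_subset_left (hmA.congr key) hw,
    ← loc_del_family hD hφ ho Set.inter_subset_left hB hw,
    ← loc_delBar_family hD hφ ho Set.inter_subset_left hA hw]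
  simp only [lf]
  rw [loc_sub, loc_add, loc_const_smul]

theorem Setup.IsFamily.contDiffOn_L (hF : Q.IsFamily D F) (hD : IsOpen D) (hφ : φ ∈ atlas ℂ S) :
    ContDiffOn ℝ ∞ (lf 1 0 φ fun q => (F q).L) (D ×ˢ punct Q.mark φ) := (hF.mero_L hD).1 φ hφ

theorem Setup.IsFamily.contDiffOn_Lbar (hF : Q.IsFamily D F) (hφ : φ ∈ atlas ℂ S) :
    ContDiffOn ℝ ∞ (lf 0 1 φ fun q => (F q).Lbar) (D ×ˢ punct Q.mark φ) := hF.mero_Lbar.1 φ hφ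

theorem Setup.IsFamily.lf_curv (hF : Q.IsFamily D F) (hD : IsOpen D) (time : P →L[ℂ] (Fin l → ℂ))
    (hφ : φ ∈ atlas ℂ S) {w : P × ℂ} (hw : w ∈ D ×ˢ punct Q.mark φ) :
    lf 1 1 φ (fun q => Q.curv (time q) (F q)) w
      = pzb (lf 1 0 φ fun q => (F q).L) w
        + pz (fun w => lf (-1) 1 φ (fun q => Q.mu (time q)) w • lf 1 0 φ (fun q => (F q).L) w) w
        - Q.kappa • pz (lf 0 1 φ fun q => (F q).Lbar) w
        + ⁅lf 0 1 φ (fun q => (F q).Lbar) w, lf 1 0 φ (fun q => (F q).L) w⁆ := by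
  rw [← Q.lf_flat hD time hφ (hF.contDiffOn_L hD hφ) (hF.contDiffOn_Lbar hφ) hw,
    ← lf_lie (zero_add 1) (add_zero 1) hφ _ _ hw.2.1]
  exact loc_add 1 1 φ _ _ _

theorem Setup.IsFamily.lf_dL (hF : Q.IsFamily D F) (hD : IsOpen D) (hφ : φ ∈ atlas ℂ S) (v : P)
    {w : P × ℂ} (hw : w ∈ D ×ˢ punct Q.mark φ) :
    lf 1 0 φ (fun q => dL F q v) w = pt v (lf 1 0 φ fun q => (F q).L) w :=
  lf_fderiv hD (isOpen_punct Q.mark φ) (hF.contDiffOn_L hD hφ) (fun _ _ => hF.L_pole.2.2.1 _) v hw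

theorem Setup.IsFamily.lf_dLbar (hF : Q.IsFamily D F) (hD : IsOpen D) (hφ : φ ∈ atlas ℂ S) (v : P)
    {w : P × ℂ} (hw : w ∈ D ×ˢ punct Q.mark φ) :
    lf 0 1 φ (fun q => dLbar F q v) w = pt v (lf 0 1 φ fun q => (F q).Lbar) w :=
  lf_fderiv hD (isOpen_punct Q.mark φ) (hF.contDiffOn_Lbar hφ) (fun _ _ => hF.Lbar_smooth.2 _) v hw

theorem Setup.pt_mu (Q : Setup S V n l) (hD : IsOpen D) (time : P →L[ℂ] (Fin l → ℂ))
    (hφ : φ ∈ atlas ℂ S) (v : P) {w : P × ℂ} (hw : w ∈ D ×ˢ punct Q.mark φ) :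
    pt v (lf (-1) 1 φ fun q => Q.mu (time q)) w = lf (-1) 1 φ (fun _ : P => Q.mu (time v)) w := by
  rw [← lf_fderiv hD (isOpen_punct Q.mark φ) (Q.contDiffOn_mu time hφ)
    (fun _ _ => (differentiable_mu Q time _).differentiableOn) v hw]
  refine loc_congr ?_
  exact fderiv_eq_of_line (differentiable_mu Q time _).differentiableAt (Q.line_mu time _ v _)

theorem Setup.contDiffOn_mu_const (Q : Setup S V n l) (t : Fin l → ℂ) (hφ : φ ∈ atlas ℂ S) :
    ContDiffOn ℝ ∞ (lf (-1) 1 φ fun _ : P => Q.mu t) (D ×ˢ punct Q.mark φ) := by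
  have h : Mero Q.mark 0 (-1) 1 D fun _ : P => Q.mu t :=
    Mero.sum Finset.univ fun s _ => (Q.mero_mu0 s).const_smul (t s)
  exact h.1 φ hφ

end LocalEquations

/-! ### Deformations of the solution as tangent vectors at a fixed time -/

namespace GaugeFixing

variable {S V : Type*} [TopologicalSpace S] [T2Space S] [CompactSpace S] [ChartedSpace ℂ S]
  [IsManifold 𝓘(ℂ) ω S] [NormedAddCommGroup V] [NormedSpace ℂ V] [FiniteDimensional ℂ V] {n l d : ℕ}
  {Q : Setup S V n l} (Γ : GaugeFixing Q d)

/-- The deformation of the solution in a direction of the extended phase space is tangent to the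
space of configurations that are flat at a fixed time, after the correction of `δL̄`. -/
theorem exists_tangentFamily (v : (Fin d → ℂ) × (Fin l → ℂ)) :
    ∃ Z, Q.IsTangentFamily Γ.dom Prod.snd Γ.sol Z ∧ ∀ q,
      (∀ r ∉ Set.range Q.mark, (Z q).L r = dL Γ.sol q v r ∧ (Z q).Lbar r = Γ.zbar q v r) ∧
      ∀ a, (Z q).p a = dp Γ.sol q v a := by
  have hF := Γ.sol_family
  have hD := Γ.dom_open
  -- The correction has no pole, because `μ` vanishes where `L` is singular. It extends smoothly
  -- over the marked points, as tangent families require.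
  obtain ⟨B, hB, hBz⟩ := (Γ.mero_zbar v).exists_smoothFamily hD Q.mark_injective fun r _ => by
    simp only [zbar]
    exact (differentiableOn_fderiv_apply hD (hF.Lbar_smooth.2 r) v).sub
      (((hF.L_pole.2.2.1 r).fun_const_smul _).fun_const_smul _)
  refine ⟨fun q => ⟨dL Γ.sol q v, B q, dp Γ.sol q v⟩, ⟨fun q hq r => hF.dL_mem hD hq v r,
    hF.L_pole.fderiv hD v, fun q hq r => hB.mem (mark := Q.mark) hq (fun r hr => ?_) r, hB, fun q hq a =>
    ⟨Γ.theta q v a, Γ.theta_mem hq v a, Γ.dp_eq hq v a⟩, fun q hq r hr => ?_⟩,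
    fun q => ⟨fun r hr => ⟨rfl, hBz q r hr⟩, fun a => rfl⟩⟩
  · rw [hBz q r hr]
    exact Γ.zbar_mem hq v r
  · set time := ContinuousLinearMap.snd ℂ (Fin d → ℂ) (Fin l → ℂ) with htime
    set φ := chartAt ℂ r with hφr
    have hφ : φ ∈ atlas ℂ S := chart_mem_atlas ℂ r
    have hsymm : φ.symm (φ r) = r := φ.left_inv (mem_chart_source ℂ r)
    have hw : (q, φ r) ∈ Γ.dom ×ˢ punct Q.mark φ :=
      ⟨hq, mem_chart_target ℂ r, by rw [Set.mem_preimage, hsymm]; exact hr⟩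
    have hU := isOpen_prod_punct hD Q.mark φ
    have key : pzb (pt v (lf 1 0 φ fun q => (Γ.sol q).L)) (q, φ r)
        + pz (fun w => lf (-1) 1 φ (fun q => Q.mu (time q)) w
          • pt v (lf 1 0 φ fun q => (Γ.sol q).L) w) (q, φ r)
        - Q.kappa • pz (fun w => pt v (lf 0 1 φ fun q => (Γ.sol q).Lbar) w
          - Q.kappa⁻¹ • lf (-1) 1 φ (fun _ => Q.mu (time v)) w • lf 1 0 φ (fun q => (Γ.sol q).L) w)
            (q, φ r)
        + ⁅pt v (lf 0 1 φ fun q => (Γ.sol q).Lbar) (q, φ r)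
          - Q.kappa⁻¹ • lf (-1) 1 φ (fun _ => Q.mu (time v)) (q, φ r)
            • lf 1 0 φ (fun q => (Γ.sol q).L) (q, φ r), lf 1 0 φ (fun q => (Γ.sol q).L) (q, φ r)⁆
        + ⁅lf 0 1 φ (fun q => (Γ.sol q).Lbar) (q, φ r),
          pt v (lf 1 0 φ fun q => (Γ.sol q).L) (q, φ r)⁆ = 0 := linearized_flatness (s := (v, (0 : ℂ))) (s' := 0) hU (hF.contDiffOn_L hD hφ)
      (hF.contDiffOn_Lbar hφ) (Q.contDiffOn_mu time hφ) (Q.contDiffOn_mu_const (time v) hφ) Q.kappa_ne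
      (fun w hw => Q.pt_mu hD time hφ v hw) (fun w hw => by
        rw [← hF.lf_curv hD time hφ hw]
        exact (loc_eq_zero_iff 1 1 hφ _ hw.2.1).2
          ((hF.flat_iff hD time hw.1).1 (Γ.flat_dom _ hw.1) _ hw.2.2)) hw
    have hBl : ∀ w ∈ Γ.dom ×ˢ punct Q.mark φ, lf 0 1 φ B w
        = pt v (lf 0 1 φ fun q => (Γ.sol q).Lbar) w - Q.kappa⁻¹ • lf (-1) 1 φ (fun _ => Q.mu (time v)) w
          • lf 1 0 φ (fun q => (Γ.sol q).L) w := by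
      intro w hw
      rw [← hF.lf_dLbar hD hφ v hw, ← lf_smul (a'' := 0) (b'' := 1) (by norm_num) (by norm_num) hφ
        (fun _ => Q.mu (time v)) (fun q => (Γ.sol q).L) hw.2.1]
      simp only [lf]
      rw [← loc_const_smul, ← loc_sub]
      exact loc_congr (hBz _ _ hw.2.2)
    have hBs := (hB.mero (mark := Q.mark)).1 φ hφ
    have hAs := (hF.mero_dL hD v).1 φ hφ
    have hAl := fun w hw => hF.lf_dL (w := w) hD hφ v hw
    have e1 : pz (lf 0 1 φ B) (q, φ r) = pz _ (q, φ r) := cD_congr_on hU hBl hw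
    have e2 : pzb (lf 1 0 φ fun q => dL Γ.sol q v) (q, φ r) = pzb _ (q, φ r) :=
      cD_congr_on hU hAl hw
    have e3 : pz (fun w => lf (-1) 1 φ (fun q => Q.mu (time q)) w
        • lf 1 0 φ (fun q => dL Γ.sol q v) w) (q, φ r) = pz _ (q, φ r) :=
      cD_congr_on hU (fun w hw => by rw [hAl w hw]) hw
    rw [← hAl _ hw, ← hBl _ hw, ← e1, ← e2, ← e3, ← Q.lf_flat hD time hφ hAs hBs hw, ← lf_lie (zero_add 1) (add_zero 1) hφ _ _ hw.2.1,
      ← lf_lie (zero_add 1) (add_zero 1) hφ _ _ hw.2.1] at key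
    simp only [lf] at key
    rw [← loc_add, ← loc_add] at key
    exact (loc_chartAt 1 1 _ r).symm.trans key

/-- The decomposition of a deformation of the solution into a vector tangent to the fibre and an
infinitesimal gauge transformation. -/
theorem exists_decomposition (v : (Fin d → ℂ) × (Fin l → ℂ)) :
    ∃ (y : (Fin d → ℂ) × (Fin l → ℂ) → Fin d → ℂ)
      (e : (Fin d → ℂ) × (Fin l → ℂ) → S → V →L[ℂ] V),
      SmoothFamily 0 0 Γ.dom e ∧ (∀ q ∈ Γ.dom, ∀ r, e q r ∈ Q.lie) ∧
      ∀ q ∈ Γ.dom,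
        (∀ r ∉ Set.range Q.mark,
          dL Γ.sol q v r = dL Γ.sol q (y q, 0) r
            + (-(Q.kappa • del 0 0 (e q) r) + ⁅e q r, (Γ.sol q).L r⁆) ∧
          Γ.zbar q v r = dLbar Γ.sol q (y q, 0) r
            + (-Q.dw q.2 (e q) r + ⁅e q r, (Γ.sol q).Lbar r⁆)) ∧
        ∀ a, dp Γ.sol q v a = dp Γ.sol q (y q, 0) a + ⁅e q (Q.mark a), (Γ.sol q).p a⁆ := by
  obtain ⟨Z, hZ, hZv⟩ := Γ.exists_tangentFamily v
  obtain ⟨y, e, he, hem, h⟩ := Γ.transversal Z hZ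
  refine ⟨y, e, he, hem, fun q hq => ⟨fun r hr => ?_, fun a => ?_⟩⟩
  · rw [← ((hZv q).1 r hr).1, ← ((hZv q).1 r hr).2]
    exact (h q hq).1 r hr
  · rw [← (hZv q).2 a]
    exact (h q hq).2 a

end GaugeFixing

/-! ### The linear system in a chart -/

section Consistency

variable {S V : Type*} [TopologicalSpace S] [T2Space S] [CompactSpace S] [ChartedSpace ℂ S]
  [IsManifold 𝓘(ℂ) ω S] [NormedAddCommGroup V] [NormedSpace ℂ V] [FiniteDimensional ℂ V] {n l : ℕ}
  {Q : Setup S V n l} {T : Set (Fin l → ℂ)} {F : (Fin l → ℂ) → FieldConf S V n}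
  {M : Fin l → (Fin l → ℂ) → S → V →L[ℂ] V} {E : Type*} [NormedAddCommGroup E] [NormedSpace ℂ E]
  {φ : OpenPartialHomeomorph S ℂ}

theorem lf_apply {a b a' b' a'' b'' : ℤ} (ha : a + a' = a'') (hb : b + b' = b'') (hφ : φ ∈ atlas ℂ S)
    {P : Type*} (A : P → S → V →L[ℂ] V) (f : P → S → V) {w : P × ℂ} (hw : w.2 ∈ φ.target) :
    lf a'' b'' φ (fun q r => A q r (f q r)) w = lf a b φ A w (lf a' b' φ f w) :=
  loc_bilin (ContinuousLinearMap.id ℂ (V →L[ℂ] V)) ha hb hφ (A w.1) (f w.1) hw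

theorem Setup.lf_dw (Q : Setup S V n l) (hT : IsOpen T) (hφ : φ ∈ atlas ℂ S) {W : Set ℂ}
    (hW : IsOpen W) (hWt : W ⊆ φ.target) {G : (Fin l → ℂ) → S → E}
    (hG : ContDiffOn ℝ ∞ (lf 0 0 φ G) (T ×ˢ W)) {w : (Fin l → ℂ) × ℂ} (hw : w ∈ T ×ˢ W) :
    lf 0 1 φ (fun t => Q.dw t (G t)) w
      = pzb (lf 0 0 φ G) w + lf (-1) 1 φ Q.mu w • pz (lf 0 0 φ G) w := by
  rw [← loc_del_family hT hφ hW hWt hG hw, ← loc_delBar_family hT hφ hW hWt hG hw,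
    ← lf_smul (a'' := 0) (b'' := 1) (by norm_num) (by norm_num) hφ _ _ (hWt hw.2)]
  exact loc_add 0 1 φ _ _ _

/-- The linear system in a chart. -/
theorem Setup.solves_iff (Q : Setup S V n l) (hT : IsOpen T) (hφ : φ ∈ atlas ℂ S) {W : Set ℂ}
    (hW : IsOpen W) (hWt : W ⊆ φ.target) {Ψ : (Fin l → ℂ) → S → V}
    (hΨ : ContDiffOn ℝ ∞ (lf 0 0 φ Ψ) (T ×ˢ W))
    (hol : ∀ z ∈ W, DifferentiableOn ℂ (fun t => Ψ t (φ.symm z)) T) {w : (Fin l → ℂ) × ℂ}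
    (hw : w ∈ T ×ˢ W) :
    Q.Solves F M Ψ w.1 (φ.symm w.2) ↔
      pz (lf 0 0 φ Ψ) w = (-(Q.kappa⁻¹ • lf 1 0 φ (fun t => (F t).L) w)) (lf 0 0 φ Ψ w) ∧
      (∀ s, pt (Pi.single s 1) (lf 0 0 φ Ψ) w
        = (-(Q.kappa⁻¹ • lf 0 0 φ (M s) w)) (lf 0 0 φ Ψ w)) ∧
      pzb (lf 0 0 φ Ψ) w = (Q.kappa⁻¹ • lf (-1) 1 φ Q.mu w • lf 1 0 φ (fun t => (F t).L) w
        - lf 0 1 φ (fun t => (F t).Lbar) w) (lf 0 0 φ Ψ w) := by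
  have hk := Q.kappa_ne
  have hwt := hWt hw.2
  have solve : ∀ {x y : V}, Q.kappa • x + y = 0 ↔ x = -(Q.kappa⁻¹ • y) := by
    intro x y
    constructor
    · intro h
      rw [← smul_neg, ← eq_neg_of_add_eq_zero_left h, inv_smul_smul₀ hk]
    · rintro rfl
      rw [smul_neg, smul_inv_smul₀ hk, neg_add_cancel]
  have h1 : Q.kappa • del 0 0 (Ψ w.1) (φ.symm w.2) + (F w.1).L (φ.symm w.2) (Ψ w.1 (φ.symm w.2)) = 0
      ↔ pz (lf 0 0 φ Ψ) w = (-(Q.kappa⁻¹ • lf 1 0 φ (fun t => (F t).L) w)) (lf 0 0 φ Ψ w) := by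
    rw [← loc_eq_zero_iff 1 0 hφ
      (fun r => Q.kappa • del 0 0 (Ψ w.1) r + (F w.1).L r (Ψ w.1 r)) hwt, loc_add, loc_const_smul]
    change Q.kappa • lf 1 0 φ (fun t => del 0 0 (Ψ t)) w
      + lf 1 0 φ (fun t r => (F t).L r (Ψ t r)) w = 0 ↔ _
    rw [loc_del_family hT hφ hW hWt hΨ hw,
      lf_apply (add_zero 1) (add_zero 0) hφ (fun t => (F t).L) Ψ hwt, solve]
    simp
  have h2 : ∀ s, Q.kappa • fderiv ℂ (fun t' => Ψ t' (φ.symm w.2)) w.1 (Pi.single s 1)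
      + M s w.1 (φ.symm w.2) (Ψ w.1 (φ.symm w.2)) = 0 ↔
      pt (Pi.single s 1) (lf 0 0 φ Ψ) w = (-(Q.kappa⁻¹ • lf 0 0 φ (M s) w)) (lf 0 0 φ Ψ w) := by
    intro s
    rw [← lf_fderiv hT hW hΨ hol (Pi.single s 1) hw, solve]
    simp only [lf, loc_zero_zero, neg_apply, smul_apply]
  -- Only under the first equation can `μ∂Ψ` be replaced by a multiple of `Ψ`; hence the
  -- implication.
  have h3 : pz (lf 0 0 φ Ψ) w = (-(Q.kappa⁻¹ • lf 1 0 φ (fun t => (F t).L) w)) (lf 0 0 φ Ψ w) →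
      (Q.dw w.1 (Ψ w.1) (φ.symm w.2) + (F w.1).Lbar (φ.symm w.2) (Ψ w.1 (φ.symm w.2)) = 0 ↔
      pzb (lf 0 0 φ Ψ) w = (Q.kappa⁻¹ • lf (-1) 1 φ Q.mu w • lf 1 0 φ (fun t => (F t).L) w
        - lf 0 1 φ (fun t => (F t).Lbar) w) (lf 0 0 φ Ψ w)) := by
    intro h
    rw [← loc_eq_zero_iff 0 1 hφ
      (fun r => Q.dw w.1 (Ψ w.1) r + (F w.1).Lbar r (Ψ w.1 r)) hwt, loc_add]
    change lf 0 1 φ (fun t => Q.dw t (Ψ t)) w + lf 0 1 φ (fun t r => (F t).Lbar r (Ψ t r)) w = 0 ↔ _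
    rw [Q.lf_dw hT hφ hW hWt hΨ hw, lf_apply (add_zero 0) (add_zero 1) hφ (fun t => (F t).Lbar) Ψ hwt, h,
      ← sub_eq_zero (a := pzb (lf 0 0 φ Ψ) w)]
    simp only [neg_apply, smul_apply, sub_apply]
    constructor <;> intro h <;> rw [← h] <;> module
  rw [Setup.Solves, h1]
  simp only [h2]
  exact and_congr_right fun h => and_congr_right fun _ => h3 h

section Equations

variable {N : (Fin l → ℂ) → S → V →L[ℂ] V}

theorem contDiffOn_smoothFamily (hN : SmoothFamily 0 0 T N) (hφ : φ ∈ atlas ℂ S) (mark : Fin n → S) :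
    ContDiffOn ℝ ∞ (lf 0 0 φ N) (T ×ˢ punct mark φ) :=
  (hN.1 φ hφ).mono (Set.prod_mono le_rfl Set.inter_subset_left)

theorem lf_zt (hT : IsOpen T) (hF : Q.IsFamily T F) (hφ : φ ∈ atlas ℂ S) (v : Fin l → ℂ)
    (hN : SmoothFamily 0 0 T N) {w : (Fin l → ℂ) × ℂ} (hw : w ∈ T ×ˢ punct Q.mark φ) :
    lf 1 0 φ (fun t r => Q.kappa • dL F t v r - Q.kappa • del 0 0 (N t) r + ⁅N t r, (F t).L r⁆) w
      = Q.kappa • pt v (lf 1 0 φ fun t => (F t).L) w - Q.kappa • pz (lf 0 0 φ N) w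
        + ⁅lf 0 0 φ N w, lf 1 0 φ (fun t => (F t).L) w⁆ := by
  rw [← hF.lf_dL hT hφ v hw, ← loc_del_family hT hφ (isOpen_punct Q.mark φ) Set.inter_subset_left
    (contDiffOn_smoothFamily hN hφ Q.mark) hw, ← lf_lie (zero_add 1) (add_zero 0) hφ _ _ hw.2.1]
  simp only [lf]
  rw [loc_add, loc_sub, loc_const_smul, loc_const_smul]

theorem lf_zbt (hT : IsOpen T) (hF : Q.IsFamily T F) (hφ : φ ∈ atlas ℂ S) (v : Fin l → ℂ)
    (hN : SmoothFamily 0 0 T N) {w : (Fin l → ℂ) × ℂ} (hw : w ∈ T ×ˢ punct Q.mark φ) :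
    lf 0 1 φ (fun t r => Q.dw t (N t) r - ⁅N t r, (F t).Lbar r⁆
        - (Q.kappa • dLbar F t v r - Q.mu v r • (F t).L r)) w
      = pzb (lf 0 0 φ N) w + lf (-1) 1 φ Q.mu w • pz (lf 0 0 φ N) w
        - ⁅lf 0 0 φ N w, lf 0 1 φ (fun t => (F t).Lbar) w⁆
        - (Q.kappa • pt v (lf 0 1 φ fun t => (F t).Lbar) w
          - lf (-1) 1 φ (fun _ : Fin l → ℂ => Q.mu v) w • lf 1 0 φ (fun t => (F t).L) w) := by
  rw [← hF.lf_dLbar hT hφ v hw, ← Q.lf_dw hT hφ (isOpen_punct Q.mark φ) Set.inter_subset_left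
    (contDiffOn_smoothFamily hN hφ Q.mark) hw,
    ← lf_smul (a'' := 0) (b'' := 1) (by norm_num) (by norm_num) hφ _ _ hw.2.1,
    ← lf_lie (zero_add 0) (zero_add 1) hφ _ _ hw.2.1]
  simp only [lf]
  rw [loc_sub, loc_sub, loc_sub, loc_const_smul]

end Equations

/-- The curvature in two directions of the times. -/
def Setup.curvT (Q : Setup S V n l) (N N' : (Fin l → ℂ) → S → V →L[ℂ] V) (v v' t : Fin l → ℂ)
    (r : S) : V →L[ℂ] V :=
  Q.kappa • (fderiv ℂ (fun t' => N' t' r) t v - fderiv ℂ (fun t' => N t' r) t v') + ⁅N t r, N' t r⁆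

theorem Setup.lf_curvT (Q : Setup S V n l) (hT : IsOpen T) (hφ : φ ∈ atlas ℂ S)
    {N N' : (Fin l → ℂ) → S → V →L[ℂ] V} (hN : SmoothFamily 0 0 T N) (hN' : SmoothFamily 0 0 T N')
    (v v' : Fin l → ℂ) {w : (Fin l → ℂ) × ℂ} (hw : w ∈ T ×ˢ φ.target) :
    lf 0 0 φ (Q.curvT N N' v v') w
      = Q.kappa • (pt v (lf 0 0 φ N') w - pt v' (lf 0 0 φ N) w) + ⁅lf 0 0 φ N w, lf 0 0 φ N' w⁆ := by
  rw [← lf_fderiv hT φ.open_target (hN'.1 φ hφ) (fun z _ => hN'.2 _) v hw,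
    ← lf_fderiv hT φ.open_target (hN.1 φ hφ) (fun z _ => hN.2 _) v' hw,
    ← lf_lie (zero_add 0) (zero_add 0) hφ _ _ hw.2]
  unfold Setup.curvT
  simp only [lf]
  rw [loc_add, loc_const_smul, loc_sub]

/-- The compatibility of the equations along the surface and in the times. -/
def Setup.EqZT (Q : Setup S V n l) (T : Set (Fin l → ℂ)) (F : (Fin l → ℂ) → FieldConf S V n)
    (M : Fin l → (Fin l → ℂ) → S → V →L[ℂ] V) : Prop :=
  ∀ t ∈ T, ∀ s, ∀ r ∉ Set.range Q.mark,
    Q.kappa • dL F t (Pi.single s 1) r - Q.kappa • del 0 0 (M s t) r + ⁅M s t r, (F t).L r⁆ = 0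

/-- The compatibility of the equations in the times. -/
def Setup.EqTT (Q : Setup S V n l) (T : Set (Fin l → ℂ))
    (M : Fin l → (Fin l → ℂ) → S → V →L[ℂ] V) : Prop :=
  ∀ t ∈ T, ∀ s s', ∀ r, Q.curvT (M s) (M s') (Pi.single s 1) (Pi.single s' 1) t r = 0

/-- The flat connection and its compatibility with the times follow from the consistency of the
linear system. -/
theorem Setup.Consistent.curv_eq_zero (hT : IsOpen T) (hF : Q.IsFamily T F)
    (hM : ∀ s, SmoothFamily 0 0 T (M s)) (h : Q.Consistent T F M) :
    (∀ t ∈ T, ∀ r ∉ Set.range Q.mark, Q.curv t (F t) r = 0) ∧ Q.EqZT T F M := by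
  have hk := Q.kappa_ne
  -- The curvature is tested on an arbitrary vector `v`: there is a solution with value `v` at the
  -- point, and commutation of its mixed derivatives makes the curvature annihilate `v`.
  have key : ∀ t ∈ T, ∀ r ∉ Set.range Q.mark, ∀ v : V, Q.curv t (F t) r v = 0 ∧ ∀ s,
      (Q.kappa • dL F t (Pi.single s 1) r - Q.kappa • del 0 0 (M s t) r + ⁅M s t r, (F t).L r⁆) v
        = 0 := by
    intro t₀ ht₀ r₀ hr₀ v
    obtain ⟨T₀, hT₀T, N, hN, hT₀, hNo, ht, hr, Ψ, hv, hΨ, hol, hsol⟩ := h r₀ hr₀ t₀ ht₀ v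
    set φ := chartAt ℂ r₀ with hφr
    have hφ : φ ∈ atlas ℂ S := chart_mem_atlas ℂ r₀
    have hNs : N ⊆ φ.source := fun r hr => (hN hr).1
    have hsymm : ∀ z ∈ φ '' N, φ.symm z ∈ N := by
      rintro _ ⟨r, hr, rfl⟩
      rwa [φ.left_inv (hNs hr)]
    have hW : IsOpen (φ '' N) := φ.isOpen_image_of_subset_source hNo hNs
    have hWp : φ '' N ⊆ punct Q.mark φ := fun z hz => ⟨by
      obtain ⟨r, hr, rfl⟩ := hz
      exact φ.map_source (hNs hr), (hN (hsymm z hz)).2⟩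
    have hWt : φ '' N ⊆ φ.target := fun z hz => (hWp hz).1
    have hU := hT₀.prod hW
    have hUU : T₀ ×ˢ (φ '' N) ⊆ T ×ˢ punct Q.mark φ := Set.prod_mono hT₀T hWp
    have hΨ' : ContDiffOn ℝ ∞ (lf 0 0 φ Ψ) (T₀ ×ˢ (φ '' N)) :=
      hΨ.congr fun w _ => loc_zero_zero φ (Ψ w.1) w.2
    have hs := fun w (hw : w ∈ T₀ ×ˢ (φ '' N)) =>
      (Q.solves_iff hT₀ hφ hW hWt hΨ' (fun z hz => hol _ (hsymm z hz)) hw).1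
        (hsol w.1 hw.1 _ (hsymm _ hw.2))
    have hw : (t₀, φ r₀) ∈ T₀ ×ˢ (φ '' N) := ⟨ht, r₀, hr, rfl⟩
    have hw' := hUU hw
    have hΨw : lf 0 0 φ Ψ (t₀, φ r₀) = v := (loc_chartAt 0 0 (Ψ t₀) r₀).trans hv
    have hL := (hF.contDiffOn_L hT hφ).mono hUU
    have hLb := (hF.contDiffOn_Lbar hφ).mono hUU
    have hm : ContDiffOn ℝ ∞ (lf (-1) 1 φ Q.mu) (T₀ ×ˢ (φ '' N)) :=
      (Q.contDiffOn_mu (ContinuousLinearMap.id ℂ (Fin l → ℂ)) hφ).mono hUU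
    have hAz : ContDiffOn ℝ ∞ (fun w => -(Q.kappa⁻¹ • lf 1 0 φ (fun t => (F t).L) w))
      (T₀ ×ˢ (φ '' N)) := (hL.const_smul _).neg
    have hAzb : ContDiffOn ℝ ∞ (fun w => Q.kappa⁻¹ • lf (-1) 1 φ Q.mu w
        • lf 1 0 φ (fun t => (F t).L) w - lf 0 1 φ (fun t => (F t).Lbar) w) (T₀ ×ˢ (φ '' N)) :=
      ((hm.smul hL).const_smul _).sub hLb
    constructor
    · have h1 := mixed_derivative hU hΨ' hAz hAzb (fun w hw => (hs w hw).1)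
        (fun w hw => (hs w hw).2.2) hw
      rw [integrability_z_zb hU hL hLb hm hk hw, hΨw] at h1
      have h2 := (hF.lf_curv hT (ContinuousLinearMap.id ℂ (Fin l → ℂ)) hφ hw').symm
      have h3 : lf 1 1 φ (fun t => Q.curv t (F t)) (t₀, φ r₀) = Q.curv t₀ (F t₀) r₀ :=
        loc_chartAt 1 1 _ r₀
      have h4 := congrArg (fun B : V →L[ℂ] V => Q.kappa⁻¹ • B v) (h2.trans h3)
      exact (smul_eq_zero_iff_right (inv_ne_zero hk)).1 (h4.symm.trans h1)
    · intro s
      have hMs := (contDiffOn_smoothFamily (hM s) hφ Q.mark).mono hUU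
      have h1 := mixed_derivative hU hΨ' hAz (hMs.const_smul Q.kappa⁻¹).neg (fun w hw => (hs w hw).1)
        (fun w hw => (hs w hw).2.1 s) hw
      have h1' := (congrArg (fun B : V →L[ℂ] V => B (lf 0 0 φ Ψ (t₀, φ r₀)))
        (integrability_z_t hU hL hMs hk hw)).symm.trans h1
      rw [hΨw] at h1'
      have h2 := (lf_zt hT hF hφ (Pi.single s 1) (hM s) hw').symm
      have h3 : lf 1 0 φ (fun t r => Q.kappa • dL F t (Pi.single s 1) r - Q.kappa • del 0 0 (M s t) r
          + ⁅M s t r, (F t).L r⁆) (t₀, φ r₀) = _ := loc_chartAt 1 0 _ r₀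
      have h4 := congrArg (fun B : V →L[ℂ] V => (Q.kappa⁻¹ * Q.kappa⁻¹) • B v) (h2.trans h3)
      exact (smul_eq_zero_iff_right (mul_ne_zero (inv_ne_zero hk) (inv_ne_zero hk))).1
        (h4.symm.trans h1')
  exact ⟨fun t ht r hr => by ext v; exact (key t ht r hr v).1,
    fun t ht s r hr => by ext v; exact (key t ht r hr v).2 s⟩

end Consistency

/-! ### Zero curvature and consistency -/

section ZeroCurvature

variable {S V : Type*} [TopologicalSpace S] [T2Space S] [CompactSpace S] [ChartedSpace ℂ S]
  [IsManifold 𝓘(ℂ) ω S] [NormedAddCommGroup V] [NormedSpace ℂ V] [FiniteDimensional ℂ V] {n l : ℕ}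
  {Q : Setup S V n l} {T : Set (Fin l → ℂ)} {F : (Fin l → ℂ) → FieldConf S V n}
  {M : Fin l → (Fin l → ℂ) → S → V →L[ℂ] V} {φ : OpenPartialHomeomorph S ℂ}

theorem Setup.pt_mu_single (Q : Setup S V n l) (hT : IsOpen T) (hφ : φ ∈ atlas ℂ S) (s : Fin l)
    {w : (Fin l → ℂ) × ℂ} (hw : w ∈ T ×ˢ punct Q.mark φ) :
    pt (Pi.single s 1) (lf (-1) 1 φ Q.mu) w
      = lf (-1) 1 φ (fun _ : Fin l → ℂ => Q.mu (Pi.single s 1)) w :=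
  Q.pt_mu hT (ContinuousLinearMap.id ℂ (Fin l → ℂ)) hφ (Pi.single s 1) hw

/-- The identities for commuting derivatives concern coefficients in one fixed chart. The equations
can be moved there because a coefficient vanishes in one chart exactly when it does in another. -/
theorem Setup.EqZT.local (h : Q.EqZT T F M) (hT : IsOpen T) (hF : Q.IsFamily T F)
    (hM : ∀ s, SmoothFamily 0 0 T (M s)) (hφ : φ ∈ atlas ℂ S) (s : Fin l) :
    ∀ w ∈ T ×ˢ punct Q.mark φ, Q.kappa • pt (Pi.single s 1) (lf 1 0 φ fun t => (F t).L) w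
      - Q.kappa • pz (lf 0 0 φ (M s)) w + ⁅lf 0 0 φ (M s) w, lf 1 0 φ (fun t => (F t).L) w⁆ = 0 := by
  intro w hw
  rw [← lf_zt hT hF hφ (Pi.single s 1) (hM s) hw]
  exact (loc_eq_zero_iff 1 0 hφ _ hw.2.1).2 (h w.1 hw.1 s _ hw.2.2)

theorem Setup.EqM.local (h : Q.EqM T F M) (hT : IsOpen T) (hF : Q.IsFamily T F)
    (hM : ∀ s, SmoothFamily 0 0 T (M s)) (hφ : φ ∈ atlas ℂ S) (s : Fin l) :
    ∀ w ∈ T ×ˢ punct Q.mark φ, pzb (lf 0 0 φ (M s)) w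
        + lf (-1) 1 φ Q.mu w • pz (lf 0 0 φ (M s)) w
        - ⁅lf 0 0 φ (M s) w, lf 0 1 φ (fun t => (F t).Lbar) w⁆
        - (Q.kappa • pt (Pi.single s 1) (lf 0 1 φ fun t => (F t).Lbar) w
          - lf (-1) 1 φ (fun _ : Fin l → ℂ => Q.mu (Pi.single s 1)) w
            • lf 1 0 φ (fun t => (F t).L) w) = 0 := by
  intro w hw
  rw [← lf_zbt hT hF hφ (Pi.single s 1) (hM s) hw]
  refine (loc_eq_zero_iff 0 1 hφ _ hw.2.1).2 ?_
  simp only [Setup.mu_single]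
  exact sub_eq_zero.2 (h w.1 hw.1 s _ hw.2.2)

theorem Setup.EqTT.local (h : Q.EqTT T M) (hT : IsOpen T)
    (hM : ∀ s, SmoothFamily 0 0 T (M s)) (hφ : φ ∈ atlas ℂ S) (s s' : Fin l) :
    ∀ w ∈ T ×ˢ punct Q.mark φ, Q.kappa • (pt (Pi.single s 1) (lf 0 0 φ (M s')) w
      - pt (Pi.single s' 1) (lf 0 0 φ (M s)) w) + ⁅lf 0 0 φ (M s) w, lf 0 0 φ (M s') w⁆ = 0 := by
  intro w hw
  rw [← Q.lf_curvT hT hφ (hM s) (hM s') (Pi.single s 1) (Pi.single s' 1) ⟨hw.1, hw.2.1⟩]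
  exact (loc_eq_zero_iff 0 0 hφ _ hw.2.1).2 (h w.1 hw.1 s s' _)

/-- The linear system of a connection with zero curvature is consistent. -/
theorem Setup.consistent_of_curv_eq_zero (hT : IsOpen T) (hF : Q.IsFamily T F)
    (hM : ∀ s, SmoothFamily 0 0 T (M s))
    (hC : ∀ t ∈ T, ∀ r ∉ Set.range Q.mark, Q.curv t (F t) r = 0) (hZT : Q.EqZT T F M)
    (hE : Q.EqM T F M) (hTT : Q.EqTT T M) : Q.Consistent T F M := by
  intro r₀ hr₀ t₀ ht₀ v
  have hk := Q.kappa_ne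
  set φ := chartAt ℂ r₀ with hφr
  have hφ : φ ∈ atlas ℂ S := chart_mem_atlas ℂ r₀
  have hU := isOpen_prod_punct hT Q.mark φ
  have hL := hF.contDiffOn_L hT hφ
  have hLb := hF.contDiffOn_Lbar hφ
  have hm : ContDiffOn ℝ ∞ (lf (-1) 1 φ Q.mu) (T ×ˢ punct Q.mark φ) :=
    Q.contDiffOn_mu (ContinuousLinearMap.id ℂ (Fin l → ℂ)) hφ
  have hMs := fun s => contDiffOn_smoothFamily (hM s) hφ Q.mark
  have hLd : ∀ w ∈ T ×ˢ punct Q.mark φ,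
      DifferentiableAt ℂ (fun t => lf 1 0 φ (fun t => (F t).L) (t, w.2)) w.1 := fun w hw =>
    differentiableAt_lf ((hF.L_pole.2.2.1 _).differentiableAt (hT.mem_nhds hw.1))
  have hLbd : ∀ w ∈ T ×ˢ punct Q.mark φ,
      DifferentiableAt ℂ (fun t => lf 0 1 φ (fun t => (F t).Lbar) (t, w.2)) w.1 := fun w hw =>
    differentiableAt_lf ((hF.Lbar_smooth.2 _).differentiableAt (hT.mem_nhds hw.1))
  have hmd : ∀ w ∈ T ×ˢ punct Q.mark φ,
      DifferentiableAt ℂ (fun t => lf (-1) 1 φ Q.mu (t, w.2)) w.1 := fun w _ =>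
    differentiableAt_lf (differentiable_mu Q (ContinuousLinearMap.id ℂ (Fin l → ℂ)) _).differentiableAt
  have hMd : ∀ s, ∀ w ∈ T ×ˢ punct Q.mark φ,
      DifferentiableAt ℂ (fun t => lf 0 0 φ (M s) (t, w.2)) w.1 := fun s w hw =>
    differentiableAt_lf (((hM s).2 _).differentiableAt (hT.mem_nhds hw.1))
  have hw₀ : (t₀, φ r₀) ∈ T ×ˢ punct Q.mark φ := ⟨ht₀, mem_chart_target ℂ r₀, by
    rwa [Set.mem_preimage, φ.left_inv (mem_chart_source ℂ r₀)]⟩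
  obtain ⟨ε, hε, hball, hsol⟩ := exists_solution hU
    (At := fun s w => -(Q.kappa⁻¹ • lf 0 0 φ (M s) w))
    (Az := fun w => -(Q.kappa⁻¹ • lf 1 0 φ (fun t => (F t).L) w))
    (Azb := fun w => Q.kappa⁻¹ • lf (-1) 1 φ Q.mu w • lf 1 0 φ (fun t => (F t).L) w
      - lf 0 1 φ (fun t => (F t).Lbar) w)
    (fun s => ((hMs s).const_smul _).neg) (hL.const_smul _).neg (((hm.smul hL).const_smul _).sub hLb)
    (fun s w hw => ((hMd s w hw).fun_const_smul _).fun_neg)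
    (fun w hw => ((hLd w hw).fun_const_smul _).fun_neg)
    (fun w hw => (((hmd w hw).fun_smul (hLd w hw)).fun_const_smul _).fun_sub (hLbd w hw))
    (fun w hw => by
      refine (integrability_z_zb hU hL hLb hm hk hw).trans ?_
      have h1 := (hF.lf_curv hT (ContinuousLinearMap.id ℂ (Fin l → ℂ)) hφ hw).symm.trans
        ((loc_eq_zero_iff 1 1 hφ _ hw.2.1).2 (hC w.1 hw.1 _ hw.2.2))
      exact (congrArg (fun B => Q.kappa⁻¹ • B) h1).trans (smul_zero _))
    (fun s w hw => by
      refine (integrability_z_t hU hL (hMs s) hk hw).trans ?_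
      exact (congrArg (fun B => (Q.kappa⁻¹ * Q.kappa⁻¹) • B) (hZT.local hT hF hM hφ s w hw)).trans
        (smul_zero _))
    (fun s w hw => by
      refine (integrability_zb_t (z := ((0 : Fin l → ℂ), (1 / 2 : ℂ))) (z' := (0, -(Complex.I / 2)))
        hU hL hLb (hMs s) hm (fun w hw => Q.pt_mu_single hT hφ s hw) hk hw).trans ?_
      exact (congrArg₂ (fun A B => -(Q.kappa⁻¹ • A)
        - (Q.kappa⁻¹ * Q.kappa⁻¹ * lf (-1) 1 φ Q.mu w) • B) (hE.local hT hF hM hφ s w hw)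
        (hZT.local hT hF hM hφ s w hw)).trans (by simp))
    (fun s s' w hw => by
      refine (integrability_t_t hU (hMs s) (hMs s') hk hw).trans ?_
      exact (congrArg (fun B => -((Q.kappa⁻¹ * Q.kappa⁻¹) • B))
        (hTT.local hT hM hφ s s' w hw)).trans (by simp)) hw₀
  obtain ⟨Ψ, hv, hΨ, hd⟩ := hsol v
  -- A ball of the product is a product of balls, which separates a neighbourhood of the time from a
  -- coordinate disc.
  rw [← ball_prod_same] at hΨ hd hball
  have hne : (Metric.ball t₀ ε ×ˢ Metric.ball (φ r₀) ε).Nonempty :=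
    ⟨(t₀, φ r₀), Metric.mem_ball_self hε, Metric.mem_ball_self hε⟩
  obtain ⟨hbT, hbp⟩ := (Set.prod_subset_prod_iff.1 hball).resolve_right (by
    rintro (h | h)
    · exact (Set.nonempty_iff_ne_empty.1 hne.fst) h
    · exact (Set.nonempty_iff_ne_empty.1 hne.snd) h)
  have hbt : Metric.ball (φ r₀) ε ⊆ φ.target := fun z hz => (hbp hz).1
  set N : Set S := φ.source ∩ φ ⁻¹' Metric.ball (φ r₀) ε with hN
  have hNi : φ '' N = Metric.ball (φ r₀) ε := by
    rw [hN, φ.image_source_inter_eq']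
    ext z
    constructor
    · rintro ⟨hz, hz'⟩
      rwa [Set.mem_preimage, Set.mem_preimage, φ.right_inv hz] at hz'
    · intro hz
      exact ⟨hbt hz, by rwa [Set.mem_preimage, Set.mem_preimage, φ.right_inv (hbt hz)]⟩
  have hlf : ∀ w ∈ Metric.ball t₀ ε ×ˢ Metric.ball (φ r₀) ε,
      lf 0 0 φ (fun t r => Ψ (t, φ r)) w = Ψ w := fun w hw => by
    rw [lf, loc_zero_zero, φ.right_inv (hbt hw.2)]
  have hbU : IsOpen (Metric.ball t₀ ε ×ˢ Metric.ball (φ r₀) ε) := Metric.isOpen_ball.prod Metric.isOpen_ball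
  have hΨ' : ContDiffOn ℝ ∞ (lf 0 0 φ fun t r => Ψ (t, φ r))
      (Metric.ball t₀ ε ×ˢ Metric.ball (φ r₀) ε) := hΨ.congr hlf
  refine ⟨Metric.ball t₀ ε, hbT, N, fun r hr => ⟨hr.1, ?_⟩, Metric.isOpen_ball,
    φ.isOpen_inter_preimage Metric.isOpen_ball, Metric.mem_ball_self hε,
    ⟨mem_chart_source ℂ r₀, Metric.mem_ball_self hε⟩, fun t r => Ψ (t, φ r), hv, ?_, ?_, ?_⟩
  · have h1 := (hbp hr.2).2
    rwa [Set.mem_preimage, φ.left_inv hr.1] at h1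
  · rw [hNi]
    exact hΨ'.congr fun w _ => (loc_zero_zero φ (fun r => Ψ (w.1, φ r)) w.2).symm
  · exact fun r hr t ht => (hd (t, φ r) ⟨ht, hr.2⟩).1.differentiableWithinAt
  · intro t ht r hr
    have hw : (t, φ r) ∈ Metric.ball t₀ ε ×ˢ Metric.ball (φ r₀) ε := ⟨ht, hr.2⟩
    have h1 := (Q.solves_iff (F := F) (M := M) Metric.isOpen_ball hφ Metric.isOpen_ball hbt hΨ'
      (fun z hz t ht => ?_) hw).2 ?_
    · rwa [φ.left_inv hr.1] at h1
    · simp only [φ.right_inv (hbt hz)]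
      exact (hd (t, z) ⟨ht, hz⟩).1.differentiableWithinAt
    · have hc : ∀ {a b}, cD a b (lf 0 0 φ fun t r => Ψ (t, φ r)) (t, φ r) = cD a b Ψ (t, φ r) :=
        cD_congr_on hbU hlf hw
      obtain ⟨-, h1, h2, h3⟩ := hd _ hw
      rw [hlf _ hw]
      exact ⟨hc.trans h1, fun s => hc.trans (h3 s), hc.trans h2⟩

end ZeroCurvature

/-! ### Linearizable families -/

section Linearizable

variable {S V : Type*} [TopologicalSpace S] [T2Space S] [CompactSpace S] [ChartedSpace ℂ S]
  [IsManifold 𝓘(ℂ) ω S] [NormedAddCommGroup V] [NormedSpace ℂ V] [FiniteDimensional ℂ V] {n l d : ℕ}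
  {Q : Setup S V n l} {T : Set (Fin l → ℂ)} {F : (Fin l → ℂ) → FieldConf S V n}
  {M : Fin l → (Fin l → ℂ) → S → V →L[ℂ] V} {E : Type*} [NormedAddCommGroup E] [NormedSpace ℂ E]

theorem del_const_smul (a b : ℤ) (c : ℂ) {f : S → E} {r : S}
    (hf : DifferentiableAt ℝ (loc a b (chartAt ℂ r) f) (chartAt ℂ r r)) :
    del a b (fun r => c • f r) r = c • del a b f r := by
  have h : loc a b (chartAt ℂ r) (fun r => c • f r) = fun z => c • loc a b (chartAt ℂ r) f z :=
    funext fun z => loc_const_smul a b _ c f z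
  rw [del, del, wirt_eq_cD, wirt_eq_cD, h, cD_const_smul c hf]

theorem delBar_const_smul (a b : ℤ) (c : ℂ) {f : S → E} {r : S}
    (hf : DifferentiableAt ℝ (loc a b (chartAt ℂ r) f) (chartAt ℂ r r)) :
    delBar a b (fun r => c • f r) r = c • delBar a b f r := by
  have h : loc a b (chartAt ℂ r) (fun r => c • f r) = fun z => c • loc a b (chartAt ℂ r) f z :=
    funext fun z => loc_const_smul a b _ c f z
  rw [delBar, delBar, wirtBar_eq_cD, wirtBar_eq_cD, h, cD_const_smul c hf]

theorem Setup.dw_const_smul (Q : Setup S V n l) (t : Fin l → ℂ) (c : ℂ) {f : S → E} {r : S}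
    (hf : DifferentiableAt ℝ (loc 0 0 (chartAt ℂ r) f) (chartAt ℂ r r)) :
    Q.dw t (fun r => c • f r) r = c • Q.dw t f r := by
  rw [Setup.dw, Setup.dw, del_const_smul 0 0 c hf, delBar_const_smul 0 0 c hf]
  module

section Slices

variable {P : Type*} [NormedAddCommGroup P] [NormedSpace ℂ P] {D : Set P}

theorem SmoothFamily.smooth {a b : ℤ} {G : P → S → E} (hG : SmoothFamily a b D G) {q : P}
    (hq : q ∈ D) : ∀ φ ∈ atlas ℂ S, ContDiffOn ℝ ∞ (loc a b φ (G q)) φ.target := fun φ hφ =>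
  (hG.1 φ hφ).comp (f := fun z => (q, z)) (by fun_prop) fun _ hz => ⟨hq, hz⟩

theorem SmoothFamily.diff {a b : ℤ} {G : P → S → E} (hG : SmoothFamily a b D G) {q : P} (hq : q ∈ D)
    (r : S) : DifferentiableAt ℝ (loc a b (chartAt ℂ r) (G q)) (chartAt ℂ r r) :=
  diffAt (chartAt ℂ r).open_target (by simp) (hG.smooth hq _ (chart_mem_atlas ℂ r))
    (mem_chart_target ℂ r)

theorem SmoothFamily.const_smul {a b : ℤ} {G : P → S → E} (hG : SmoothFamily a b D G) (c : ℂ) :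
    SmoothFamily a b D fun q r => c • G q r :=
  ⟨fun φ hφ => ((hG.1 φ hφ).const_smul c).congr fun _ _ => loc_const_smul a b φ c _ _,
    fun r => (hG.2 r).fun_const_smul c⟩

theorem SmoothFamily.comp {a b : ℤ} {G : P → S → E} (hG : SmoothFamily a b D G) {c : (Fin l → ℂ) → P}
    (hT : IsOpen T) [FiniteDimensional ℂ P] (hc : DifferentiableOn ℂ c T) (hcD : Set.MapsTo c T D) :
    SmoothFamily a b T fun t => G (c t) := by
  refine ⟨fun φ hφ => ?_, fun r => (hG.2 r).comp hc hcD⟩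
  have h : ContDiffOn ℝ ∞ (fun w : (Fin l → ℂ) × ℂ => (c w.1, w.2)) (T ×ˢ φ.target) :=
    ((contDiffOn_real_of_differentiableOn hT hc).comp contDiffOn_fst fun w hw => hw.1).prodMk
      contDiffOn_snd
  have h1 : ContDiffOn ℝ ∞ (lf a b φ G ∘ fun w : (Fin l → ℂ) × ℂ => (c w.1, w.2)) (T ×ˢ φ.target) :=
    (hG.1 φ hφ).comp h fun _ hw => ⟨hcD hw.1, hw.2⟩
  exact h1

theorem SmoothFamily.hasResidue_del {G : P → S → E} (hD : IsOpen D) (hG : SmoothFamily 0 0 D G)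
    {q : P} (hq : q ∈ D) (r : S) : HasResidue (del 0 0 (G q)) r 0 := by
  refine hasResidue_zero (continuousAt_loc r fun φ hφ => ?_)
  have h0 : ContDiffOn ℝ ∞ (pz (lf 0 0 φ G)) (D ×ˢ φ.target) :=
    contDiffOn_cD (hD.prod φ.open_target) (hG.1 φ hφ)
  have h : ContDiffOn ℝ ∞ (fun z => pz (lf 0 0 φ G) (q, z)) φ.target :=
    h0.comp (f := fun z => (q, z)) (by fun_prop) fun z hz => ⟨hq, hz⟩
  exact h.congr fun z hz =>
    loc_del_family (w := (q, z)) hD hφ φ.open_target le_rfl (hG.1 φ hφ) ⟨hq, hz⟩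

end Slices

theorem Setup.IsFamily.flat_iff_curv (hF : Q.IsFamily T F) (hT : IsOpen T) {t : Fin l → ℂ}
    (ht : t ∈ T) : Q.Flat t (F t) ↔ ∀ r ∉ Set.range Q.mark, Q.curv t (F t) r = 0 :=
  hF.flat_iff hT (ContinuousLinearMap.id ℂ (Fin l → ℂ)) ht

theorem Setup.pt_mu_const (Q : Setup S V n l) (hT : IsOpen T) {φ : OpenPartialHomeomorph S ℂ}
    (hφ : φ ∈ atlas ℂ S) (v τ : Fin l → ℂ) {w : (Fin l → ℂ) × ℂ} (hw : w ∈ T ×ˢ punct Q.mark φ) :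
    pt v (lf (-1) 1 φ fun _ : Fin l → ℂ => Q.mu τ) w = 0 := by
  rw [← lf_fderiv hT (isOpen_punct Q.mark φ) (Q.contDiffOn_mu_const τ hφ)
    (fun _ _ => differentiableOn_const _) v hw]
  refine (loc_eq_zero_iff (-1) 1 hφ _ hw.2.1).2 ?_
  simp

theorem del_eq_pz (hT : IsOpen T) {R : (Fin l → ℂ) → S → E} {r : S} {W : Set ℂ} (hW : IsOpen W)
    (hWt : W ⊆ (chartAt ℂ r).target) (hR : ContDiffOn ℝ ∞ (lf 0 0 (chartAt ℂ r) R) (T ×ˢ W))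
    {t : Fin l → ℂ} (ht : t ∈ T) (hr : chartAt ℂ r r ∈ W) :
    del 0 0 (R t) r = pz (lf 0 0 (chartAt ℂ r) R) (t, chartAt ℂ r r) := by
  have h := loc_del_family (w := (t, chartAt ℂ r r)) hT (chart_mem_atlas ℂ r) hW hWt hR ⟨ht, hr⟩
  exact (loc_chartAt 1 0 (del 0 0 (R t)) r).symm.trans h

theorem Setup.dw_eq_pzb (Q : Setup S V n l) (hT : IsOpen T) {R : (Fin l → ℂ) → S → E} {r : S}
    {W : Set ℂ} (hW : IsOpen W) (hWt : W ⊆ (chartAt ℂ r).target)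
    (hR : ContDiffOn ℝ ∞ (lf 0 0 (chartAt ℂ r) R) (T ×ˢ W)) {t : Fin l → ℂ} (ht : t ∈ T)
    (hr : chartAt ℂ r r ∈ W) :
    Q.dw t (R t) r = pzb (lf 0 0 (chartAt ℂ r) R) (t, chartAt ℂ r r)
      + lf (-1) 1 (chartAt ℂ r) Q.mu (t, chartAt ℂ r r)
        • pz (lf 0 0 (chartAt ℂ r) R) (t, chartAt ℂ r r) := by
  have h := Q.lf_dw (w := (t, chartAt ℂ r r)) hT (chart_mem_atlas ℂ r) hW hWt hR ⟨ht, hr⟩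
  exact (loc_chartAt 0 1 (Q.dw t (R t)) r).symm.trans h

/-- The curvature in the directions of the times is annihilated by the infinitesimal gauge
transformations. -/
theorem Setup.EqZT.curvature_parallel (hZT : Q.EqZT T F M) (hE : Q.EqM T F M) (hT : IsOpen T)
    (hF : Q.IsFamily T F) (hM : ∀ s, SmoothFamily 0 0 T (M s)) {t : Fin l → ℂ} (ht : t ∈ T)
    (s s' : Fin l) {r : S} (hr : r ∉ Set.range Q.mark) :
    (-(Q.kappa • del 0 0 (Q.curvT (M s) (M s') (Pi.single s 1) (Pi.single s' 1) t) r)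
      + ⁅Q.curvT (M s) (M s') (Pi.single s 1) (Pi.single s' 1) t r, (F t).L r⁆ = 0) ∧
    (-Q.dw t (Q.curvT (M s) (M s') (Pi.single s 1) (Pi.single s' 1) t) r
      + ⁅Q.curvT (M s) (M s') (Pi.single s 1) (Pi.single s' 1) t r, (F t).Lbar r⁆ = 0) := by
  set R := Q.curvT (M s) (M s') (Pi.single s 1) (Pi.single s' 1)
  set φ := chartAt ℂ r with hφr
  have hφ : φ ∈ atlas ℂ S := chart_mem_atlas ℂ r
  have hU := isOpen_prod_punct hT Q.mark φ
  have hw : (t, φ r) ∈ T ×ˢ punct Q.mark φ := ⟨ht, mem_chart_target ℂ r, by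
    rwa [Set.mem_preimage, φ.left_inv (mem_chart_source ℂ r)]⟩
  have hL := hF.contDiffOn_L hT hφ
  have hLb := hF.contDiffOn_Lbar hφ
  have hm : ContDiffOn ℝ ∞ (lf (-1) 1 φ Q.mu) (T ×ˢ punct Q.mark φ) :=
    Q.contDiffOn_mu (ContinuousLinearMap.id ℂ (Fin l → ℂ)) hφ
  have hMs := fun s => contDiffOn_smoothFamily (hM s) hφ Q.mark
  have hRl : ∀ w ∈ T ×ˢ punct Q.mark φ, lf 0 0 φ R w
      = Q.kappa • (pt (Pi.single s 1) (lf 0 0 φ (M s')) w - pt (Pi.single s' 1) (lf 0 0 φ (M s)) w)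
        + ⁅lf 0 0 φ (M s) w, lf 0 0 φ (M s') w⁆ := fun w hw =>
    Q.lf_curvT hT hφ (hM s) (hM s') _ _ ⟨hw.1, hw.2.1⟩
  have hRs : ContDiffOn ℝ ∞ (lf 0 0 φ R) (T ×ˢ punct Q.mark φ) :=
    ((((contDiffOn_cD hU (hMs s')).sub (contDiffOn_cD hU (hMs s))).const_smul Q.kappa).add
      (contDiffOn_lie (hMs s) (hMs s'))).congr hRl
  have hz := curvature_parallel_z (z := ((0 : Fin l → ℂ), (1 / 2 : ℂ))) (z' := (0, -(Complex.I / 2)))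
    hU hL (hMs s) (hMs s') (hZT.local hT hF hM hφ s) (hZT.local hT hF hM hφ s') hw
  have hzb := curvature_parallel_zb (z := ((0 : Fin l → ℂ), (1 / 2 : ℂ)))
    (z' := (0, -(Complex.I / 2))) (zb := ((0 : Fin l → ℂ), (1 / 2 : ℂ))) (zb' := (0, Complex.I / 2))
    hU hL hLb (hMs s) (hMs s') hm (Q.contDiffOn_mu_const (Pi.single s 1) hφ)
    (Q.contDiffOn_mu_const (Pi.single s' 1) hφ) (fun w hw => Q.pt_mu_single hT hφ s hw)
    (fun w hw => Q.pt_mu_single hT hφ s' hw) (fun w hw => Q.pt_mu_const hT hφ _ _ hw)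
    (fun w hw => Q.pt_mu_const hT hφ _ _ hw) (hZT.local hT hF hM hφ s) (hZT.local hT hF hM hφ s')
    (hE.local hT hF hM hφ s) (hE.local hT hF hM hφ s') hw
  have hcz := cD_congr_on (a := ((0 : Fin l → ℂ), (1 / 2 : ℂ))) (b := (0, -(Complex.I / 2))) hU hRl hw
  have hczb := cD_congr_on (a := ((0 : Fin l → ℂ), (1 / 2 : ℂ))) (b := (0, Complex.I / 2)) hU hRl hw
  rw [← hcz] at hz hzb
  rw [← hczb] at hzb
  have hR : lf 0 0 φ R (t, φ r) = R t r := loc_chartAt 0 0 (R t) r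
  have hLw : lf 1 0 φ (fun t => (F t).L) (t, φ r) = (F t).L r := loc_chartAt 1 0 (F t).L r
  have hLbw : lf 0 1 φ (fun t => (F t).Lbar) (t, φ r) = (F t).Lbar r := loc_chartAt 0 1 (F t).Lbar r
  have hdel := del_eq_pz hT (isOpen_punct Q.mark φ) Set.inter_subset_left hRs ht hw.2
  have hdw := Q.dw_eq_pzb hT (isOpen_punct Q.mark φ) Set.inter_subset_left hRs ht hw.2
  rw [← hRl _ hw, hR, hLw] at hz
  rw [← hRl _ hw, hR, hLbw] at hzb
  rw [hdel, hdw]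
  exact ⟨neg_add_eq_zero.2 hz, neg_add_eq_zero.2 hzb⟩

namespace GaugeFixing

variable (Γ : GaugeFixing Q d) {x : (Fin l → ℂ) → Fin d → ℂ}

theorem omega_zero_left {q : (Fin d → ℂ) × (Fin l → ℂ)} (hq : q ∈ Γ.dom)
    (v : (Fin d → ℂ) × (Fin l → ℂ)) : Γ.omega q 0 v = 0 := by
  have h1 : ∀ r, dL Γ.sol q 0 r = 0 := fun r => map_zero _
  have h2 : ∀ r, dLbar Γ.sol q 0 r = 0 := fun r => map_zero _
  have h3 : ∀ a, Γ.theta q 0 a = 0 := fun a => by rw [theta, map_zero, mul_zero]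
  rw [Γ.omega_eq_sub hq, Γ.omega0_eq hq, orbitTerm]
  simp [h1, h2, h3, surfInt_zero]

/-! ### Linearizability and null leaves along a family of solutions -/

section Path

theorem hasFDerivAt_path (hT : IsOpen T) (hdiff : DifferentiableOn ℂ x T) {t : Fin l → ℂ}
    (ht : t ∈ T) : HasFDerivAt (fun t => (x t, t))
      ((fderiv ℂ x t).prod (ContinuousLinearMap.id ℂ (Fin l → ℂ))) t :=
  ((hdiff.differentiableAt (hT.mem_nhds ht)).hasFDerivAt).prodMk (hasFDerivAt_id t)

/-- The chain rule along `t ↦ (x t, t)` turns `∂_s` into the vector `∂_s + ∂_s x` of the extended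
phase space. -/
theorem fderiv_path (hT : IsOpen T) (hdiff : DifferentiableOn ℂ x T) {f : (Fin l → ℂ) → E}
    {g : (Fin d → ℂ) × (Fin l → ℂ) → E} (hfg : ∀ t ∈ T, f t = g (x t, t)) {t : Fin l → ℂ} (ht : t ∈ T)
    (hg : DifferentiableAt ℂ g (x t, t)) (v : Fin l → ℂ) :
    fderiv ℂ f t v = fderiv ℂ g (x t, t) (fderiv ℂ x t v, v) := by
  have h1 : HasFDerivAt (fun t => g (x t, t)) _ t :=
    HasFDerivAt.comp t (g := g) hg.hasFDerivAt (hasFDerivAt_path hT hdiff ht)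
  have h2 : f =ᶠ[𝓝 t] fun t => g (x t, t) := by
    filter_upwards [hT.mem_nhds ht] with t ht using hfg t ht
  rw [h2.fderiv_eq, h1.fderiv]
  rfl

theorem dL_path (hT : IsOpen T) (hdiff : DifferentiableOn ℂ x T)
    (hsol : ∀ t ∈ T, F t = Γ.sol (x t, t)) (hdom : ∀ t ∈ T, (x t, t) ∈ Γ.dom) {t : Fin l → ℂ}
    (ht : t ∈ T) (v : Fin l → ℂ) (r : S) :
    dL F t v r = dL Γ.sol (x t, t) (fderiv ℂ x t v, v) r :=
  fderiv_path hT hdiff (g := fun q => (Γ.sol q).L r) (fun t ht => by rw [hsol t ht]) ht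
    ((Γ.sol_family.L_pole.2.2.1 r).differentiableAt (Γ.dom_open.mem_nhds (hdom t ht))) v

theorem dLbar_path (hT : IsOpen T) (hdiff : DifferentiableOn ℂ x T)
    (hsol : ∀ t ∈ T, F t = Γ.sol (x t, t)) (hdom : ∀ t ∈ T, (x t, t) ∈ Γ.dom) {t : Fin l → ℂ}
    (ht : t ∈ T) (v : Fin l → ℂ) (r : S) :
    dLbar F t v r = dLbar Γ.sol (x t, t) (fderiv ℂ x t v, v) r :=
  fderiv_path hT hdiff (g := fun q => (Γ.sol q).Lbar r) (fun t ht => by rw [hsol t ht]) ht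
    ((Γ.sol_family.Lbar_smooth.2 r).differentiableAt (Γ.dom_open.mem_nhds (hdom t ht))) v

theorem dp_path (hT : IsOpen T) (hdiff : DifferentiableOn ℂ x T)
    (hsol : ∀ t ∈ T, F t = Γ.sol (x t, t)) (hdom : ∀ t ∈ T, (x t, t) ∈ Γ.dom) {t : Fin l → ℂ}
    (ht : t ∈ T) (v : Fin l → ℂ) (a : Fin n) :
    dp F t v a = dp Γ.sol (x t, t) (fderiv ℂ x t v, v) a :=
  fderiv_path hT hdiff (g := fun q => (Γ.sol q).p a) (fun t ht => by rw [hsol t ht]) ht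
    ((Γ.sol_family.L_pole.2.2.2 a).differentiableAt (Γ.dom_open.mem_nhds (hdom t ht))) v

/-- A linearizable family follows the null leaves. -/
theorem nullLeaf_of_linearizable (hT : IsOpen T) (hF : Q.IsFamily T F)
    (hdiff : DifferentiableOn ℂ x T)
    (hsol : ∀ t ∈ T, F t = Γ.sol (x t, t)) (hdom : ∀ t ∈ T, (x t, t) ∈ Γ.dom)
    (hM : ∀ s, SmoothFamily 0 0 T (M s) ∧ ∀ t ∈ T, ∀ r, M s t r ∈ Q.lie) (hE : Q.EqM T F M)
    (hZT : Q.EqZT T F M) : Γ.NullLeaf T x := by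
  intro t ht s v
  have hk := Q.kappa_ne
  have hq := hdom t ht
  have hdM := (hM s).1.diff ht
  have hsm : SmoothFamily 0 0 T fun t r => -Q.kappa⁻¹ • M s t r := (hM s).1.const_smul _
  have he : Q.IsTest fun r => -Q.kappa⁻¹ • M s t r :=
    ⟨fun r => Q.lie.smul_mem _ ((hM s).2 t ht r), hsm.smooth ht⟩
  have h0 : ((0 : Fin d → ℂ), (0 : Fin l → ℂ)) = 0 := rfl
  have hz1 : ∀ r, dL Γ.sol (x t, t) 0 r = 0 := fun r => map_zero _
  have hz2 : ∀ r, dLbar Γ.sol (x t, t) 0 r = 0 := fun r => map_zero _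
  have hz3 : ∀ a, dp Γ.sol (x t, t) 0 a = 0 := fun a => map_zero _
  -- The deformation is pure gauge, by `-κ⁻¹ M_s`, with fibre part `w = 0`.
  rw [Γ.omega_gauge hq he (w := 0) (fun r hr => ?_) (fun r hr => ?_) fun a => ?_, h0,
    Γ.omega_zero_left hq]
  · rw [h0, hz1, ← Γ.dL_path hT hdiff hsol hdom ht, ← hsol t ht, del_const_smul 0 0 _ (hdM r)]
    have h1 := congrArg (fun B => Q.kappa⁻¹ • B) (hZT t ht s r hr)
    simp only [smul_add, smul_sub, smul_smul, inv_mul_cancel₀ hk, one_smul, smul_zero] at h1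
    simp only [smul_lie, neg_smul, smul_neg, neg_neg, smul_inv_smul₀ hk, neg_lie]
    linear_combination (norm := module) h1
  · rw [h0, hz2, zbar, ← Γ.dLbar_path hT hdiff hsol hdom ht, ← hsol t ht, Q.dw_const_smul _ _ (hdM r),
      Setup.mu_single]
    have h1 := congrArg (fun B => Q.kappa⁻¹ • B) (hE t ht s r hr)
    simp only [smul_sub, smul_smul, inv_mul_cancel₀ hk, one_smul] at h1
    simp only [smul_lie, neg_smul, neg_lie, smul_smul]
    linear_combination (norm := module) -h1
  -- The motion of the `p_a` is not among the equations. It follows by taking residues at the marked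
  -- points of the compatibility of `z` and `t_s`, where `∂M_s` has none.
  · rw [h0, hz3, ← Γ.dp_path hT hdiff hsol hdom ht, ← hsol t ht, zero_add]
    have h1 : HasResidue (dL F t (Pi.single s 1)) (Q.mark a) (dp F t (Pi.single s 1) a) :=
      (hF.L_pole.fderiv hT (Pi.single s 1)).hasResidue ht a
    have h2 := ((hM s).1.hasResidue_del hT ht (Q.mark a)).const_smul (-Q.kappa)
    have h3 := HasResidue.bilin (lieB V) (continuousAt_loc (Q.mark a) ((hM s).1.smooth ht))
      (hF.L_pole.hasResidue ht a)
    have h4 := ((h1.const_smul Q.kappa).add h2).add h3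
    have h5 : HasResidue (fun _ : S => (0 : V →L[ℂ] V)) (Q.mark a) 0 :=
      hasResidue_zero (by
        rw [show loc 1 0 (chartAt ℂ (Q.mark a)) (fun _ => (0 : V →L[ℂ] V)) = fun _ => 0 by
          ext z; simp [loc_eq]]
        exact continuousAt_const)
    have h6 := (h4.congr (g := fun _ => 0) fun r hr => by
      rw [← hZT t ht s r hr, lieB_apply]; module).unique h5
    rw [lieB_apply, smul_zero, add_zero] at h6
    have h7 := congrArg (fun B => Q.kappa⁻¹ • B) h6
    simp only [smul_add, smul_smul, inv_mul_cancel₀ hk, one_smul, smul_zero] at h7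
    simp only [smul_lie, neg_smul, neg_lie]
    linear_combination (norm := module) h7

/-- A flat family is linearizable if the vectors `∂_s + ∂_s x` are orthogonal to the fibres. -/
theorem linearizable_of_vertical (hΓ : Γ.IsSymplectic) (hT : IsOpen T) (hF : Q.IsFamily T F)
    (hdiff : DifferentiableOn ℂ x T) (hsol : ∀ t ∈ T, F t = Γ.sol (x t, t))
    (hdom : ∀ t ∈ T, (x t, t) ∈ Γ.dom) (hflat : ∀ t ∈ T, Q.Flat t (F t))
    (hnull : ∀ t ∈ T, ∀ (s : Fin l) (y : Fin d → ℂ),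
      Γ.omega (x t, t) (fderiv ℂ x t (Pi.single s 1), Pi.single s 1) (y, 0) = 0) :
    Q.IsLinearizable T F := by
  have hk := Q.kappa_ne
  -- The decomposition is made for the pure time direction on the whole coordinate domain, so that
  -- `e` depends holomorphically on the point and can be pulled back along the path.
  choose y e he hem hdec using fun s : Fin l => Γ.exists_decomposition (0, Pi.single s 1)
  have hadd : ∀ (w w' : Fin d → ℂ) (τ : Fin l → ℂ), ((w + w', τ) : (Fin d → ℂ) × (Fin l → ℂ))
      = (w, 0) + (w', τ) := fun w w' τ => by simp
  have key : ∀ t ∈ T, ∀ s, ∀ r ∉ Set.range Q.mark,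
      dL F t (Pi.single s 1) r = -(Q.kappa • del 0 0 (e s (x t, t)) r) + ⁅e s (x t, t) r, (F t).L r⁆ ∧
      dLbar F t (Pi.single s 1) r - Q.kappa⁻¹ • Q.mu0 s r • (F t).L r
        = -Q.dw t (e s (x t, t)) r + ⁅e s (x t, t) r, (F t).Lbar r⁆ := by
    intro t ht s
    have hq := hdom t ht
    set ξ := fderiv ℂ x t (Pi.single s 1) with hξ
    have hv : ((ξ, Pi.single s 1) : (Fin d → ℂ) × (Fin l → ℂ)) = (ξ, 0) + (0, Pi.single s 1) := by simp
    have hw : ((ξ + y s (x t, t), 0) : (Fin d → ℂ) × (Fin l → ℂ)) = (ξ, 0) + (y s (x t, t), 0) := by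
      simp
    have hL : ∀ r ∉ Set.range Q.mark, dL Γ.sol (x t, t) (ξ, Pi.single s 1) r
        = dL Γ.sol (x t, t) (ξ + y s (x t, t), 0) r
          + (-(Q.kappa • del 0 0 (e s (x t, t)) r) + ⁅e s (x t, t) r, (Γ.sol (x t, t)).L r⁆) := by
      intro r hr
      have h1 := ((hdec s _ hq).1 r hr).1
      simp only [dL] at h1 ⊢
      rw [hv, hw, map_add, map_add, h1, add_assoc]
    have hLb : ∀ r ∉ Set.range Q.mark, Γ.zbar (x t, t) (ξ, Pi.single s 1) r
        = dLbar Γ.sol (x t, t) (ξ + y s (x t, t), 0) r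
          + (-Q.dw t (e s (x t, t)) r + ⁅e s (x t, t) r, (Γ.sol (x t, t)).Lbar r⁆) := by
      intro r hr
      have h1 := ((hdec s _ hq).1 r hr).2
      simp only [zbar, dLbar] at h1 ⊢
      rw [hv, hw, map_add, map_add, add_assoc, ← h1]
      abel
    have hp : ∀ a, dp Γ.sol (x t, t) (ξ, Pi.single s 1) a
        = dp Γ.sol (x t, t) (ξ + y s (x t, t), 0) a
          + ⁅e s (x t, t) (Q.mark a), (Γ.sol (x t, t)).p a⁆ := by
      intro a
      have h1 := (hdec s _ hq).2 a
      simp only [dp] at h1 ⊢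
      rw [hv, hw, map_add, map_add, h1, add_assoc]
    -- Modulo gauge transformations, `∂_s + ∂_s x` is the fibre vector `ξ + y`. The hypothesis makes
    -- it orthogonal to the fibre, where `ω₀` is non-degenerate.
    have hw0 : ξ + y s (x t, t) = 0 := Γ.omega0_eq_zero_of_basis hq hΓ fun y' => by
      rw [← Γ.omega_vertical, ← Γ.omega_gauge hq ⟨hem s _ hq, (he s).smooth hq⟩ hL hLb hp]
      exact hnull t ht s y'
    intro r hr
    have hL' := hL r hr
    have hLb' := hLb r hr
    have hz1 : dL Γ.sol (x t, t) (0, 0) r = 0 := map_zero _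
    have hz2 : dLbar Γ.sol (x t, t) (0, 0) r = 0 := map_zero _
    rw [hw0, hz1, zero_add, ← Γ.dL_path hT hdiff hsol hdom ht, ← hsol t ht] at hL'
    rw [hw0, hz2, zero_add, zbar, ← Γ.dLbar_path hT hdiff hsol hdom ht, ← hsol t ht,
      Setup.mu_single] at hLb'
    exact ⟨hL', hLb'⟩
  have hc : DifferentiableOn ℂ (fun t => (x t, t)) T := hdiff.prodMk differentiableOn_id
  let M : Fin l → (Fin l → ℂ) → S → V →L[ℂ] V := fun s t r => -Q.kappa • e s (x t, t) r
  have hM : ∀ s, SmoothFamily 0 0 T (M s) := fun s => ((he s).comp hT hc hdom).const_smul _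
  have hMm : ∀ s, ∀ t ∈ T, ∀ r, M s t r ∈ Q.lie := fun s t ht r =>
    Q.lie.smul_mem _ (hem s _ (hdom t ht) r)
  have hed : ∀ s, ∀ t ∈ T, ∀ r, DifferentiableAt ℝ (loc 0 0 (chartAt ℂ r) (e s (x t, t)))
      (chartAt ℂ r r) := fun s t ht r => (he s).diff (hdom t ht) r
  have hE : Q.EqM T F M := by
    intro t ht s r hr
    have h1 := congrArg (fun B => Q.kappa • B) (key t ht s r hr).2
    simp only [smul_sub, smul_smul, mul_inv_cancel_left₀ hk] at h1
    simp only [M]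
    rw [Q.dw_const_smul _ _ (hed s t ht r)]
    simp only [smul_lie]
    linear_combination (norm := module) -h1
  have hZT : Q.EqZT T F M := by
    intro t ht s r hr
    have h1 := congrArg (fun B => Q.kappa • B) (key t ht s r hr).1
    simp only [M]
    rw [del_const_smul 0 0 _ (hed s t ht r)]
    simp only [smul_lie]
    linear_combination (norm := module) h1
  -- The curvature in two times is a smooth covariantly constant function on the surface, that is,
  -- an infinitesimal automorphism, so stability applies.
  have hTT : Q.EqTT T M := by
    intro t ht s s'
    refine Γ.stable (x t, t) (hdom t ht) _ (fun r => ?_) (fun φ hφ => ?_) fun r hr => ?_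
    · exact Q.lie.add_mem (Q.lie.smul_mem _ (Q.lie.sub_mem
        (fderiv_mem hT (fun t ht => hMm s' t ht r) ht _)
        (fderiv_mem hT (fun t ht => hMm s t ht r) ht _)))
        (Q.lie.lie_mem (hMm s t ht r) (hMm s' t ht r))
    · have hU := hT.prod φ.open_target
      have h1 := (((contDiffOn_cD (a := (Pi.single s 1, (0 : ℂ))) (b := 0) hU ((hM s').1 φ hφ)).sub
        (contDiffOn_cD (a := (Pi.single s' 1, (0 : ℂ))) (b := 0) hU ((hM s).1 φ hφ))).const_smul
        Q.kappa).add (contDiffOn_lie ((hM s).1 φ hφ) ((hM s').1 φ hφ))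
      have h2 := h1.congr fun w hw => Q.lf_curvT hT hφ (hM s) (hM s') _ _ hw
      exact h2.comp (f := fun z => (t, z)) (by fun_prop) fun z hz => ⟨ht, hz⟩
    · rw [← hsol t ht]
      exact hZT.curvature_parallel hE hT hF hM ht s s' hr
  exact ⟨M, fun s => ⟨hM s, hMm s⟩, hE, Setup.consistent_of_curv_eq_zero hT hF hM
    (fun t ht => (hF.flat_iff_curv hT ht).1 (hflat t ht)) hZT hE hTT⟩

end Path

end GaugeFixing

end Linearizable

end Isomonodromy

end

end Proof

/-! ### Assembly of the three equivalences -/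

theorem proposition4p1 {S V : Type*} [TopologicalSpace S] [T2Space S] [CompactSpace S]
    [ConnectedSpace S] [ChartedSpace ℂ S] [IsManifold 𝓘(ℂ) ω S]
    [NormedAddCommGroup V] [NormedSpace ℂ V] [FiniteDimensional ℂ V] {n l d : ℕ}
    (Q : Isomonodromy.Setup S V n l) (Γ : Isomonodromy.GaugeFixing Q d) (hΓ : Γ.IsSymplectic)
    (T : Set (Fin l → ℂ)) (hT : IsOpen T)
    (F : (Fin l → ℂ) → Isomonodromy.FieldConf S V n) (hF : Q.IsFamily T F)
    (hsurf : ∀ t ∈ T, (t, F t) ∈ Γ.surface)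
    (x : (Fin l → ℂ) → Fin d → ℂ) (hx : ∀ t ∈ T, x t = Γ.coord t (F t))
    (hdom : ∀ t ∈ T, (x t, t) ∈ Γ.dom) (hdiff : DifferentiableOn ℂ x T) :
    (((∀ t ∈ T, Q.Flat t (F t)) ∧ Γ.NullLeaf T x) ↔ Q.IsLinearizable T F) ∧
    (∀ H, Γ.IsHamiltonian H →
      (((∀ t ∈ T, Q.Flat t (F t)) ∧ Γ.HID H T x) ↔ Q.IsLinearizable T F)) ∧
    (Γ.NoMixedTerms →
      (((∀ t ∈ T, Q.Flat t (F t)) ∧ Γ.HID Γ.quadH T x) ↔ Q.IsLinearizable T F)) := by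
  -- A family is known to run through the solutions only once it is flat, by uniqueness on the gauge
  -- fixing surface. In the direction from linearizability, flatness must therefore be obtained
  -- first.
  have hsol : (∀ t ∈ T, Q.Flat t (F t)) → ∀ t ∈ T, F t = Γ.sol (x t, t) := fun hflat t ht => by
    have h := Γ.eq_sol t (F t) (hsurf t ht) (by rw [← hx t ht]; exact hdom t ht) (hflat t ht)
    rwa [← hx t ht] at h
  have hlin : Q.IsLinearizable T F → (∀ t ∈ T, Q.Flat t (F t)) ∧ Γ.NullLeaf T x := by
    rintro ⟨M, hM, hE, hC⟩
    obtain ⟨hcurv, hZT⟩ := hC.curv_eq_zero hT hF fun s => (hM s).1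
    have hflat : ∀ t ∈ T, Q.Flat t (F t) := fun t ht => (hF.flat_iff_curv hT ht).2 (hcurv t ht)
    exact ⟨hflat, Γ.nullLeaf_of_linearizable hT hF hdiff (hsol hflat) hdom hM hE hZT⟩
  -- Hamilton's equations give only the vertical contractions of `ω`. These already imply
  -- linearizability, from which the contractions with all vectors follow.
  have hham : ∀ H, Γ.IsHamiltonian H →
      (((∀ t ∈ T, Q.Flat t (F t)) ∧ Γ.HID H T x) ↔ Q.IsLinearizable T F) := fun H hH =>
    ⟨fun h => Γ.linearizable_of_vertical hΓ hT hF hdiff (hsol h.1) hdom h.1 fun t ht s =>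
      (Γ.vertical_null_iff hH hΓ (hdom t ht) s _).2 (h.2 t ht s),
    fun h => ⟨(hlin h).1, fun t ht s =>
      (Γ.vertical_null_iff hH hΓ (hdom t ht) s _).1 fun y => (hlin h).2 t ht s (y, 0)⟩⟩
  exact ⟨⟨fun h => Γ.linearizable_of_vertical hΓ hT hF hdiff (hsol h.1) hdom h.1
    fun t ht s y => h.2 t ht s (y, 0), hlin⟩, hham, fun hm => hham _ (Γ.isHamiltonian_quadH hm)⟩
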